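/- Let $n\ge 3$ and let $D_n$ be the quiver with vertices $1,\dots,n$ and arrows $i\to i+1$ ($1\le i\le n-2$) and $n-2\to n$. Let $\mathsf v\in\mathbb N^n$ and $\mathsf w=\delta_n$, and assume that the Nakajima quiver variety $\mathcal M(\mathsf v,\delta_n)=\mu^{-1}(0)^s/G_{\mathsf v}$ over $\mathbb C$ is nonempty, where $\mu$ is the moment map $\big(\sum_{j\to i}X_{ji}Y_{ji}-\sum_{i\to j}Y_{ij}X_{ij}+A_iB_i\big)_i$ on $T^*\mathrm{Rep}(\mathsf v,\delta_n)$ and $(X,Y,A,B)$ is stable if every collection of subspaces $S_i\subseteq V_i$ preserved by $X,Y$ and containing the images of the $A_i$ is all of $(V_i)$. Let $K$ be a field of characteristic $0$ and $q,\hbar\in K$ algebraically independent over $\mathbb Q$ (for instance $K=\mathbb C(q,\hbar)$), and let $L$ be an extension field of $K$. **Macdonald functions.** On $\mathcal F=K[p_1,p_2,\dots]$ (symmetric functions in power sums) let $\langle p_\lambda,p_\mu\rangle=\delta_{\lambda\mu}\prod_{k}k^{m_k(\lambda)}m_k(\lambda)!\prod_i\frac{1-q^{\lambda_i}}{1-\hbar^{\lambda_i}}$,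 where $m_k(\lambda)$ is the multiplicity of $k$ in $\lambda$. Let $(P_\lambda)$ be the Macdonald family: $P_\lambda\in m_\lambda+\sum_{\mu\triangleleft\lambda}K m_\mu$ (dominance order) and $\langle P_\lambda,P_\mu\rangle=0$ for $\lambda\ne\mu$. Let $(Q_\lambda)$ be the dual basis, and define $P_{\lambda/\mu}$, $Q_{\lambda/\mu}$ by $\langle P_{\lambda/\mu},Q_\nu\rangle=\langle P_\lambda,Q_\mu Q_\nu\rangle$ and $\langle Q_{\lambda/\mu},P_\nu\rangle=\langle Q_\lambda,P_\mu P_\nu\rangle$ for all $\nu$. Put $b^{\mathrm{el}}_\lambda=\prod_{s\in\lambda,\ l(s)\text{ even}}\frac{1-q^{a(s)}\hbar^{l(s)+1}}{1-q^{a(s)+1}\hbar^{l(s)}}$ with $a(s),l(s)$ the arm and leg lengths. Write $\lambda\succ\mu$ if $\lambda_1\ge\mu_1\ge\lambda_2\ge\mu_2\ge\cdots$. For $x\in L$, $f(x)$ is the one-variable specialization $p_k\mapsto x^k$ of $f\in\mathcal F$, and $$\mathcal E_\lambda(x)=\Phi(x)^{-1}\sum_{\mu'\text{ even},\ \mu\succ\lambda}b^{\mathrm{el}}_\mu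 P_{\mu/\lambda}(x),\qquad \Phi(x)=\sum_{\nu'\text{ even}}b^{\mathrm{el}}_\nu P_\nu(x),$$ where "$\mu'$ even" means that all columns of $\mu$ have even length. **Interlacing tuples.** Set $l_0=l_n=0$, $l_i=\mathsf v_i$ for $1\le i\le n-2$, $l_{n-1}=\mathsf v_{n-1}+\mathsf v_n$, and $\tau(i)=(-1)^{l_i-l_{i-1}-1}$ for $1\le i\le n$. Let $S_{\mathsf v}$ be the set of tuples of partitions $\boldsymbol\lambda=(\lambda^0=\emptyset,\lambda^1,\dots,\lambda^{n-1})$ such that, for $1\le i\le n-1$, $\lambda^i\succ\lambda^{i-1}$ if $\tau(i)=1$, $\lambda^{i}\prec\lambda^{i-1}$ if $\tau(i)=-1$, and $\lambda^i$ has at most $l_i$ nonzero parts. For $x_1,\dots,x_n\in L^\times$ put $$\mathcal W(\boldsymbol\lambda)=\mathcal E_{\lambda^{n-1}}(x_n)\prod_{\substack{1\le i\le n-1\\ \tau(i)=1}}P_{\lambda^i/\lambda^{i-1}}(x_i)\prod_{\substack{1\le i\le n-1\\ \tau(i)=-1}}Q_{\lambda^{i-1}/\lambda^i}(x_i),$$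 the weight of the half-space Macdonald process. **Vertex terms.** For $d\ge0$ let $(a)_d=\prod_{i=0}^{d-1}(1-aq^i)$ and $(a)_{-d}=\prod_{i=1}^{d}(1-aq^{-i})^{-1}$. Put $l=l_{n-1}$ and $$\alpha_{\lambda^{n-1}}=\prod_{\substack{1\le j\le l\\ l-j\text{ even}}}\frac{(\hbar^{l-j+1})_{\lambda^{n-1}_j}}{(q\hbar^{l-j})_{\lambda^{n-1}_j}},\qquad \beta_{\lambda^i,\lambda^{i+1}}=\prod_{j=1}^{l_i}\prod_{k=1}^{l_{i+1}}\frac{(\hbar^{l_{i+1}-l_i-k+j})_{\lambda^{i+1}_k-\lambda^i_j}}{(q\hbar^{l_{i+1}-l_i-k+j-1})_{\lambda^{i+1}_k-\lambda^i_j}},$$ $$\gamma_{\lambda^i}=\prod_{j,k}\frac{(q\hbar^{j-k})_{\lambda^i_k-\lambda^i_j}}{(\hbar^{j-k+1})_{\lambda^i_k-\lambda^i_j}},$$ the last product being over $1\le j,k\le l_i$, with the restriction $j\equiv k\pmod 2$ if $i=n-1$. Let $b_i=\sum_{j\to i}\mathsf v_j-\sum_{i\to j}\mathsf v_j+\delta_{i,n}$,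 $a_i=\mathsf v_i-\sum_{i\to j}\mathsf v_j$, and for $d\in\mathbb N^n$ let $N(d)=\sum_i b_id_i$. The degree $\deg\boldsymbol\lambda\in\mathbb N^n$ has components $|\lambda^i|$ for $i\le n-2$, $\sum_{l-j\text{ odd}}\lambda^{n-1}_j$ for $i=n-1$ and $\sum_{l-j\text{ even}}\lambda^{n-1}_j$ for $i=n$ (sums over $1\le j\le l$). For $z_1,\dots,z_n\in L$ put $\boldsymbol z^{\boldsymbol\lambda}=(q/\hbar)^{N(\deg\boldsymbol\lambda)}\prod_i z_i^{(\deg\boldsymbol\lambda)_i}$. **Vertex function.** Consider the poset with elements $d_{i,j}$ ($1\le i\le n$, $1\le j\le\mathsf v_i$) whose order is generated by those of the following relations in which both elements are present: $d_{i+1,j}\le d_{i,j}\le d_{i+1,j+1}$ ($1\le i\le n-3$), $d_{n-2,2j-1}\le d_{n-1,j}\le d_{n-2,2j}$, $d_{n-2,2j-2}\le d_{n,j}\le d_{n-2,2j-1}$. Let $\mathrm{wt}(d_{i,j})=\hbar^{n-i+j-2}$ for $i\le n-2$, $\mathrm{wt}(d_{n-1,j})=\hbar^{2j-1}$, $\mathrm{wt}(d_{n,j})=\hbar^{2j-2}$.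 The spin vertex function $\mathsf V(\boldsymbol z)\in K[[z_1,\dots,z_n]]$ is given by the localization formula $$\mathsf V(\boldsymbol z)=\sum_{\pi}(q/\hbar)^{N(\deg\pi)}\boldsymbol z^{\deg\pi}\prod_{x\in C_n}\frac{(\hbar\,\mathrm{wt}(x))_{\pi(x)}}{(q\,\mathrm{wt}(x))_{\pi(x)}}\prod_{i\to i'}\prod_{\substack{x\in C_i\\ y\in C_{i'}}}\frac{(\hbar\frac{\mathrm{wt}(y)}{\mathrm{wt}(x)})_{\pi(y)-\pi(x)}}{(q\frac{\mathrm{wt}(y)}{\mathrm{wt}(x)})_{\pi(y)-\pi(x)}}\prod_{i}\prod_{x,y\in C_i}\frac{(q\frac{\mathrm{wt}(y)}{\mathrm{wt}(x)})_{\pi(y)-\pi(x)}}{(\hbar\frac{\mathrm{wt}(y)}{\mathrm{wt}(x)})_{\pi(y)-\pi(x)}},$$ where $C_i=\{d_{i,j}\}_j$, $\pi$ runs over all order-preserving maps from the poset to $\mathbb N$ ($x\le y\Rightarrow\pi(x)\le\pi(y)$), and $(\deg\pi)_i=\sum_{x\in C_i}\pi(x)$. **Claim.** Suppose that $$(q/\hbar)^{a_i}z_i=x_i^{\tau(i)}x_{i+1}^{-\tau(i+1)}\quad(1\le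 i\le n-1),\qquad (q/\hbar)^{a_n}z_n=x_{n-1}^{\tau(n-1)}x_n^{\tau(n)}.$$ Then for every $\boldsymbol\lambda\in S_{\mathsf v}$ $$\mathcal W(\boldsymbol\lambda)=\alpha_{\lambda^{n-1}}\Big(\prod_{i=1}^{n-2}\beta_{\lambda^i,\lambda^{i+1}}\Big)\Big(\prod_{i=1}^{n-1}\gamma_{\lambda^i}\Big)\boldsymbol z^{\boldsymbol\lambda}.$$ Consequently $\mathsf V(\boldsymbol z)$ is the partition function $\sum_{\boldsymbol\lambda\in S_{\mathsf v}}\mathcal W(\boldsymbol\lambda)$ of the half-space Macdonald process, degree by degree in $\boldsymbol z$: for every $d\in\mathbb N^n$, the sum of $\mathcal W(\boldsymbol\lambda)$ over the finitely many $\boldsymbol\lambda\in S_{\mathsf v}$ with $\deg\boldsymbol\lambda=d$ equals the degree-$d$ term of $\mathsf V(\boldsymbol z)$. -/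

import Mathlib

open Finset

namespace SpinVertex

noncomputable section

/-! ### Partitions

Partitions are Young diagrams; the part `λ_j` (with `j ≥ 1`) is `λ.rowLen (j - 1)`, the number of
nonzero parts is `λ.colLen 0`, and the size is `λ.card`. -/

/-- The `j`-th part `λ_j` (`j ≥ 1`) as an integer; it is `0` beyond the length of `λ`. -/
def part (μ : YoungDiagram) (j : ℕ) : ℤ := μ.rowLen (j - 1)

/-- `λ ≻ μ`: `λ₁ ≥ μ₁ ≥ λ₂ ≥ μ₂ ≥ ⋯`. -/
def Interlaces (lam μ : YoungDiagram) : Prop :=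
  ∀ i, μ.rowLen i ≤ lam.rowLen i ∧ lam.rowLen (i + 1) ≤ μ.rowLen i

/-- Dominance order `μ ⊴ λ` (on partitions of the same integer). -/
def Dominated (μ lam : YoungDiagram) : Prop :=
  μ.card = lam.card ∧
    ∀ k, ∑ i ∈ range k, μ.rowLen i ≤ ∑ i ∈ range k, lam.rowLen i

/-- The conjugate of `μ` is even: every column has even length. -/
def ConjEven (μ : YoungDiagram) : Prop := ∀ j, Even (μ.colLen j)

theorem sum_rowLens (μ : YoungDiagram) : (μ.rowLens : Multiset ℕ).sum = μ.card := by
  have h : μ.cells = (range (μ.colLen 0)).biUnion fun i => μ.row i := by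
    ext ⟨i, j⟩
    simp only [mem_biUnion, mem_range, YoungDiagram.mem_cells, YoungDiagram.mem_row_iff]
    constructor
    · intro hij
      exact ⟨i, YoungDiagram.mem_iff_lt_colLen.1
        (μ.up_left_mem le_rfl (Nat.zero_le j) hij), hij, rfl⟩
    · rintro ⟨_, _, hij, _⟩
      exact hij
  have hc : μ.card = ∑ i ∈ range (μ.colLen 0), μ.rowLen i := by
    rw [YoungDiagram.card, h, card_biUnion]
    · exact sum_congr rfl fun i _ => (μ.rowLen_eq_card).symm
    · intro i _ k _ hik
      refine disjoint_left.2 fun c hc hc' => hik ?_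
      rw [← (YoungDiagram.mem_row_iff.1 hc).2, (YoungDiagram.mem_row_iff.1 hc').2]
  rw [hc, Multiset.sum_coe, YoungDiagram.rowLens]
  rfl

/-- A Young diagram as a `Nat.Partition` of its size. -/
def toPartition (μ : YoungDiagram) : μ.card.Partition where
  parts := (μ.rowLens : Multiset ℕ)
  parts_pos := fun {i} hi => μ.pos_of_mem_rowLens i (by simpa using hi)
  parts_sum := sum_rowLens μ

/-! ### Symmetric functions and Macdonald polynomials -/

variable {K : Type*} [Field K]

/-- The ring of symmetric functions `K[p₁, p₂, …]`; the variable `X k` is the power sum `p_k`. -/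
abbrev SymFun (K : Type*) [Field K] : Type _ := MvPolynomial ℕ+ K

/-- The symmetric polynomial in `N` variables attached to a symmetric function. -/
def toVars (N : ℕ) : SymFun K →ₐ[K] MvPolynomial (Fin N) K :=
  MvPolynomial.aeval fun k : ℕ+ => MvPolynomial.psum (Fin N) K (k : ℕ)

/-- Specialization to the variable set `(x, 0, 0, …)`: `p_k ↦ x ^ k`. -/
def oneVar {L : Type*} [Field L] [Algebra K L] (x : L) : SymFun K →ₐ[K] L :=
  MvPolynomial.aeval fun k : ℕ+ => x ^ (k : ℕ)

/-- The Macdonald inner product, in which the monomials `p_m = ∏ p_k ^ (m k)` are orthogonal with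
`⟨p_m, p_m⟩ = ∏ k ^ (m k) (m k)! ((1 - q ^ k) / (1 - ħ ^ k)) ^ (m k)`. -/
def macInner (q ħ : K) (f g : SymFun K) : K :=
  ∑ m ∈ f.support, f.coeff m * g.coeff m *
    m.prod fun k e => (k : K) ^ e * (e.factorial : K) *
      ((1 - q ^ (k : ℕ)) / (1 - ħ ^ (k : ℕ))) ^ e

/-- The two defining properties of the family of Macdonald polynomials: each `P λ` is
`m_λ` plus a combination of monomial symmetric functions `m_μ` with `μ` strictly below `λ` in
dominance order, and the `P λ` are pairwise orthogonal. An identity of symmetric functions is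
expressed by its restrictions to `N` variables for all `N`. -/
def IsMacdonaldFamily (q ħ : K) (P : YoungDiagram → SymFun K) : Prop :=
  (∀ lam, ∃ u : YoungDiagram →₀ K, u lam = 1 ∧ (∀ μ, u μ ≠ 0 → Dominated μ lam) ∧
    ∀ N, toVars N (P lam) = u.sum fun μ c => c • MvPolynomial.msymm (Fin N) K (toPartition μ)) ∧
  ∀ lam μ, lam ≠ μ → macInner q ħ (P lam) (P μ) = 0

/-- Macdonald's `P_λ(q, ħ)`: the family with the two defining properties (for generic `q`, `ħ`
it exists and is unique). -/
def macP (q ħ : K) : YoungDiagram → SymFun K :=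
  Classical.epsilon (IsMacdonaldFamily q ħ)

/-- `Q_λ`, the basis dual to the orthogonal basis `P_λ`. -/
def macQ (q ħ : K) (lam : YoungDiagram) : SymFun K :=
  (macInner q ħ (macP q ħ lam) (macP q ħ lam))⁻¹ • macP q ħ lam

/-- The skew polynomial `P_{λ/μ}`, with `⟨P_{λ/μ}, Q_ν⟩ = ⟨P_λ, Q_μ Q_ν⟩` for all `ν`. -/
def skewP (q ħ : K) (lam μ : YoungDiagram) : SymFun K :=
  ∑ᶠ ν : YoungDiagram, macInner q ħ (macP q ħ lam) (macQ q ħ μ * macQ q ħ ν) • macP q ħ ν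

/-- The skew polynomial `Q_{λ/μ}`, with `⟨Q_{λ/μ}, P_ν⟩ = ⟨Q_λ, P_μ P_ν⟩` for all `ν`. -/
def skewQ (q ħ : K) (lam μ : YoungDiagram) : SymFun K :=
  ∑ᶠ ν : YoungDiagram, macInner q ħ (macQ q ħ lam) (macP q ħ μ * macP q ħ ν) • macQ q ħ ν

/-- Arm length of the box `s = (i, j)` (rows and columns counted from `0`), for `s ∈ λ`. -/
def arm (lam : YoungDiagram) (s : ℕ × ℕ) : ℕ := lam.rowLen s.1 - (s.2 + 1)

/-- Leg length of the box `s = (i, j)` (rows and columns counted from `0`), for `s ∈ λ`. -/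
def leg (lam : YoungDiagram) (s : ℕ × ℕ) : ℕ := lam.colLen s.2 - (s.1 + 1)

/-- `b_λ^el`, the product over the boxes of `λ` with even leg length of
`(1 - q ^ a ħ ^ (l + 1)) / (1 - q ^ (a + 1) ħ ^ l)`. -/
def bEl (q ħ : K) (lam : YoungDiagram) : K :=
  ∏ s ∈ lam.cells with Even (leg lam s),
    (1 - q ^ arm lam s * ħ ^ (leg lam s + 1)) / (1 - q ^ (arm lam s + 1) * ħ ^ leg lam s)

section OneVariable

variable {L : Type*} [Field L] [Algebra K L]

/-- `Φ = ∑_{ν' even} b_ν^el P_ν` in a single variable `x`. Only finitely many terms are nonzero,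
because `P_ν(x) = 0` when `ν` has more than one row. -/
def evenPhi (q ħ : K) (x : L) : L :=
  ∑ᶠ (ν : YoungDiagram) (_ : ConjEven ν), oneVar x (bEl q ħ ν • macP q ħ ν)

/-- The even part function
`𝓔_λ = Φ⁻¹ ∑_{μ' even, λ ≺ μ} b_μ^el P_{μ/λ}` in a single variable `x`. -/
def evenPart (q ħ : K) (lam : YoungDiagram) (x : L) : L :=
  (evenPhi q ħ x)⁻¹ *
    ∑ᶠ (μ : YoungDiagram) (_ : ConjEven μ ∧ Interlaces μ lam),
      oneVar x (bEl q ħ μ • skewP q ħ μ lam)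

end OneVariable

/-! ### The quiver `D_n` and its quiver varieties

Vertices are the natural numbers `1, …, n`; values of dimension vectors elsewhere are ignored. -/

/-- The arrows `i → i + 1` for `1 ≤ i ≤ n - 2`, and `n - 2 → n`. -/
def arrows (n : ℕ) : Finset (ℕ × ℕ) :=
  insert (n - 2, n) ((Icc 1 (n - 2)).image fun i => (i, i + 1))

/-- The framing vector `δ_n`. -/
def deltaFraming (n : ℕ) : ℕ → ℕ := fun i => if i = n then 1 else 0

/-- A point of `T^* Rep(v, w)`: maps `X i j : V_i → V_j` and `Y i j : V_j → V_i` for the arrows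
`i → j` (only the components at arrows of the quiver matter), `A i : W_i → V_i` and
`B i : V_i → W_i`. -/
structure FramedRep (v w : ℕ → ℕ) where
  X : ∀ i j : ℕ, (Fin (v i) → ℂ) →ₗ[ℂ] (Fin (v j) → ℂ)
  Y : ∀ i j : ℕ, (Fin (v j) → ℂ) →ₗ[ℂ] (Fin (v i) → ℂ)
  A : ∀ i : ℕ, (Fin (w i) → ℂ) →ₗ[ℂ] (Fin (v i) → ℂ)
  B : ∀ i : ℕ, (Fin (v i) → ℂ) →ₗ[ℂ] (Fin (w i) → ℂ)

/-- The moment map vanishes at every vertex. -/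
def FramedRep.MomentZero (n : ℕ) {v w : ℕ → ℕ} (R : FramedRep v w) : Prop :=
  ∀ i ∈ Icc 1 n,
    (∑ j ∈ Icc 1 n with (j, i) ∈ arrows n, R.X j i ∘ₗ R.Y j i) -
      (∑ j ∈ Icc 1 n with (i, j) ∈ arrows n, R.Y i j ∘ₗ R.X i j) + R.A i ∘ₗ R.B i = 0

/-- Stability: the only invariant collection of subspaces containing the image of the framing is
the whole collection `(V_i)`. -/
def FramedRep.Stable (n : ℕ) {v w : ℕ → ℕ} (R : FramedRep v w) : Prop :=
  ∀ S : ∀ i, Submodule ℂ (Fin (v i) → ℂ),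
    (∀ i ∈ Icc 1 n, LinearMap.range (R.A i) ≤ S i) →
    (∀ i j, (i, j) ∈ arrows n → (S i).map (R.X i j) ≤ S j ∧ (S j).map (R.Y i j) ≤ S i) →
    ∀ i ∈ Icc 1 n, S i = ⊤

/-- The quiver variety `𝓜(v, w) = μ⁻¹(0)ˢ / G_v` of type `D_n` is nonempty. -/
def QuiverVarietyNonempty (n : ℕ) (v w : ℕ → ℕ) : Prop :=
  ∃ R : FramedRep v w, R.MomentZero n ∧ R.Stable n

/-- `a_i = (v - A_Q v)_i = v_i - ∑_{i → j} v_j`. -/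
def aExp (n : ℕ) (v : ℕ → ℕ) (i : ℕ) : ℤ :=
  v i - ∑ j ∈ Icc 1 n with (i, j) ∈ arrows n, (v j : ℤ)

/-- `b_i = ∑_{j → i} v_j - ∑_{i → j} v_j + w_i` for `w = δ_n`. -/
def bExp (n : ℕ) (v : ℕ → ℕ) (i : ℕ) : ℤ :=
  ∑ j ∈ Icc 1 n with (j, i) ∈ arrows n, (v j : ℤ) -
    ∑ j ∈ Icc 1 n with (i, j) ∈ arrows n, (v j : ℤ) + (deltaFraming n i : ℤ)

/-- `N(d) = ∑ b_i d_i`, for a degree `d` with components `d_1, …, d_n`. -/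
def nExp (n : ℕ) (v : ℕ → ℕ) (d : ℕ → ℕ) : ℤ := ∑ i ∈ Icc 1 n, bExp n v i * d i

/-! ### The vertex function -/

/-- The `q`-Pochhammer symbol `(a)_d` for `d ∈ ℤ`. -/
def qPoch (q a : K) (d : ℤ) : K :=
  if 0 ≤ d then ∏ i ∈ range d.toNat, (1 - a * q ^ i)
  else ∏ i ∈ range (-d).toNat, (1 - a * q ^ (-((i : ℤ) + 1)))⁻¹

/-- The elements `d_{i,j}` (`1 ≤ i ≤ n`, `1 ≤ j ≤ v_i`) of the poset of type `ω_n` with `v_i`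
elements of color `i`. -/
def InPoset (n : ℕ) (v : ℕ → ℕ) (a : ℕ × ℕ) : Prop :=
  a.1 ∈ Icc 1 n ∧ a.2 ∈ Icc 1 (v a.1)

/-- The relations `d_a ≤ d_b` generating the order of the spin poset. -/
inductive SpinLE (n : ℕ) : ℕ × ℕ → ℕ × ℕ → Prop
  | down (i j : ℕ) (h : i ∈ Icc 1 (n - 3)) : SpinLE n (i + 1, j) (i, j)
  | up (i j : ℕ) (h : i ∈ Icc 1 (n - 3)) : SpinLE n (i, j) (i + 1, j + 1)
  | evenDown (j : ℕ) : SpinLE n (n - 1, j) (n - 2, 2 * j)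
  | evenUp (j : ℕ) : SpinLE n (n - 2, 2 * j - 1) (n - 1, j)
  | oddDown (j : ℕ) : SpinLE n (n, j) (n - 2, 2 * j - 1)
  | oddUp (j : ℕ) : SpinLE n (n - 2, 2 * j - 2) (n, j)

/-- Reverse plane partitions over the poset (extended by zero): `x ≤ y → π x ≤ π y`. -/
def IsRPP (n : ℕ) (v : ℕ → ℕ) (π : ℕ → ℕ → ℕ) : Prop :=
  (∀ i j, ¬ InPoset n v (i, j) → π i j = 0) ∧
  ∀ a b, InPoset n v a → InPoset n v b → SpinLE n a b → π a.1 a.2 ≤ π b.1 b.2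

/-- The weight of `d_{i,j}` is `ħ` to this power. -/
def wtExp (n i j : ℕ) : ℤ :=
  if i = n then 2 * j - 2 else if i = n - 1 then 2 * j - 1 else (n : ℤ) - i + j - 2

/-- The contribution of a reverse plane partition to the localization formula, for `w = δ_n`
(without the power of `q / ħ` and the monomial in `z`). -/
def rppTerm (q ħ : K) (n : ℕ) (v : ℕ → ℕ) (π : ℕ → ℕ → ℕ) : K :=
  (∏ j ∈ Icc 1 (v n),
    qPoch q (ħ * ħ ^ wtExp n n j) (π n j) / qPoch q (q * ħ ^ wtExp n n j) (π n j)) *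
  (∏ e ∈ arrows n, ∏ j ∈ Icc 1 (v e.1), ∏ k ∈ Icc 1 (v e.2),
    qPoch q (ħ * ħ ^ (wtExp n e.2 k - wtExp n e.1 j)) ((π e.2 k : ℤ) - π e.1 j) /
      qPoch q (q * ħ ^ (wtExp n e.2 k - wtExp n e.1 j)) ((π e.2 k : ℤ) - π e.1 j)) *
  (∏ i ∈ Icc 1 n, ∏ j ∈ Icc 1 (v i), ∏ k ∈ Icc 1 (v i),
    qPoch q (q * ħ ^ (wtExp n i k - wtExp n i j)) ((π i k : ℤ) - π i j) /
      qPoch q (ħ * ħ ^ (wtExp n i k - wtExp n i j)) ((π i k : ℤ) - π i j))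

/-- The vertex function `𝖵(z) ∈ K⟦z⟧` for `w = δ_n`, as the sum over reverse plane partitions of
its localization formula. The coefficient of `z ^ D` is the (finite) sum over the reverse plane
partitions of degree `D`. -/
def vertexFunction (q ħ : K) (n : ℕ) (v : ℕ → ℕ) : MvPowerSeries ℕ K := fun D =>
  ∑ᶠ (π : ℕ → ℕ → ℕ) (_ : IsRPP n v π ∧ ∀ i, D i = ∑ j ∈ Icc 1 (v i), π i j),
    (q / ħ) ^ nExp n v D * rppTerm q ħ n v π

/-! ### Interlacing tuples and the terms of the vertex function -/

/-- `l_0 = 0`, `l_i = v_i` for `1 ≤ i ≤ n - 2`, `l_{n-1} = v_{n-1} + v_n`, `l_n = 0`. -/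
def len (n : ℕ) (v : ℕ → ℕ) (i : ℕ) : ℕ :=
  if i = n - 1 then v (n - 1) + v n else if i ∈ Icc 1 (n - 2) then v i else 0

/-- The sign function `τ(i) = (-1) ^ (l_i - l_{i-1} - 1)`, for `1 ≤ i ≤ n`. -/
def sgn (n : ℕ) (v : ℕ → ℕ) (i : ℕ) : ℤ :=
  (((-1 : ℤˣ) ^ ((len n v i : ℤ) - len n v (i - 1) - 1) : ℤˣ) : ℤ)

/-- The set `S_v` of tuples `(λ^0 = ∅, λ^1, …, λ^{n-1})` that interlace according to `v`
(tuples are extended by `λ^i = ∅` for `i ≥ n`). -/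
def interlacingTuples (n : ℕ) (v : ℕ → ℕ) : Set (ℕ → YoungDiagram) :=
  {lam | lam 0 = ⊥ ∧ (∀ i, n ≤ i → lam i = ⊥) ∧
    ∀ i ∈ Icc 1 (n - 1),
      (sgn n v i = 1 → Interlaces (lam i) (lam (i - 1))) ∧
      (sgn n v i = -1 → Interlaces (lam (i - 1)) (lam i)) ∧
      (lam i).colLen 0 ≤ len n v i}

/-- The `z`-degree of a tuple: `|λ^i|` for `1 ≤ i ≤ n - 2`, then
`|λ^{n-1,e}| = λ^{n-1}_{l-1} + λ^{n-1}_{l-3} + ⋯` and `|λ^{n-1,o}| = λ^{n-1}_l + λ^{n-1}_{l-2} + ⋯`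
in degrees `n - 1` and `n`, where `l = l_{n-1}`. -/
def tupleDegree (n : ℕ) (v : ℕ → ℕ) (lam : ℕ → YoungDiagram) (i : ℕ) : ℕ :=
  if i = n then
    ∑ j ∈ Icc 1 (len n v (n - 1)) with Even (len n v (n - 1) - j), (lam (n - 1)).rowLen (j - 1)
  else if i = n - 1 then
    ∑ j ∈ Icc 1 (len n v (n - 1)) with Odd (len n v (n - 1) - j), (lam (n - 1)).rowLen (j - 1)
  else if i ∈ Icc 1 (n - 2) then (lam i).card
  else 0

/-- `α_{λ^{n-1}}`, a product over `1 ≤ j ≤ l_{n-1}` with `l_{n-1} - j` even. -/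
def alphaFactor (q ħ : K) (n : ℕ) (v : ℕ → ℕ) (lam : ℕ → YoungDiagram) : K :=
  ∏ j ∈ Icc 1 (len n v (n - 1)) with Even (len n v (n - 1) - j),
    qPoch q (ħ ^ (len n v (n - 1) - j + 1)) (part (lam (n - 1)) j) /
      qPoch q (q * ħ ^ (len n v (n - 1) - j)) (part (lam (n - 1)) j)

/-- `β_{λ^i, λ^{i+1}}`. -/
def betaFactor (q ħ : K) (n : ℕ) (v : ℕ → ℕ) (lam : ℕ → YoungDiagram) (i : ℕ) : K :=
  ∏ j ∈ Icc 1 (len n v i), ∏ k ∈ Icc 1 (len n v (i + 1)),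
    qPoch q (ħ ^ ((len n v (i + 1) : ℤ) - len n v i - k + j))
        (part (lam (i + 1)) k - part (lam i) j) /
      qPoch q (q * ħ ^ ((len n v (i + 1) : ℤ) - len n v i - k + j - 1))
        (part (lam (i + 1)) k - part (lam i) j)

/-- `γ_{λ^i}`: a product over all `1 ≤ j, k ≤ l_i`, restricted to `j ≡ k mod 2` if `i = n - 1`. -/
def gammaFactor (q ħ : K) (n : ℕ) (v : ℕ → ℕ) (lam : ℕ → YoungDiagram) (i : ℕ) : K :=
  ∏ j ∈ Icc 1 (len n v i), ∏ k ∈ Icc 1 (len n v i) with (i = n - 1 → (Even j ↔ Even k)),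
    qPoch q (q * ħ ^ ((j : ℤ) - k)) (part (lam i) k - part (lam i) j) /
      qPoch q (ħ ^ ((j : ℤ) - k + 1)) (part (lam i) k - part (lam i) j)

section Weights

variable {L : Type*} [Field L] [Algebra K L]

/-- `z^λ = (q / ħ) ^ N(λ) ∏ z_i ^ (deg λ)_i`. -/
def zMonomial (q ħ : K) (n : ℕ) (v : ℕ → ℕ) (z : ℕ → L) (lam : ℕ → YoungDiagram) : L :=
  algebraMap K L ((q / ħ) ^ nExp n v (tupleDegree n v lam)) *
    ∏ i ∈ Icc 1 n, z i ^ tupleDegree n v lam i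

/-- `𝓦(λ; i)` with the single variable `x_i`. -/
def weightAt (q ħ : K) (n : ℕ) (v : ℕ → ℕ) (x : ℕ → L) (lam : ℕ → YoungDiagram) (i : ℕ) : L :=
  if i = n then evenPart q ħ (lam (n - 1)) (x n)
  else if sgn n v i = -1 then oneVar (x i) (skewQ q ħ (lam (i - 1)) (lam i))
  else oneVar (x i) (skewP q ħ (lam i) (lam (i - 1)))

/-- The half-space Macdonald process weight `𝓦(λ) = ∏_{i=1}^n 𝓦(λ; i)`. -/
def weight (q ħ : K) (n : ℕ) (v : ℕ → ℕ) (x : ℕ → L) (lam : ℕ → YoungDiagram) : L :=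
  ∏ i ∈ Icc 1 n, weightAt q ħ n v x lam i

end Weights

end

end SpinVertex

open Finset

namespace SpinVertex

noncomputable section

variable {K : Type*} [Field K]

variable {q t : K}

/-! ### Residue identities with generic parameters, and explicit coefficients for horizontal strips.
-/

section

/-! ### Partial fractions -/

section PartialFractions

open Polynomial

/-! The half-space weights are one-variable specializations, and in one variable Macdonald functions
are explicit: P_{λ/μ}(x) = ψ_{λ/μ} x^{|λ|-|μ|} and Q_{λ/μ}(x) = φ_{λ/μ} x^{|λ|-|μ|}, with
Macdonald's product formulas for horizontal strips. Because P is given only by triangularity and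
orthogonality, these formulas have to be proved. Throughout, t stands for ħ.

They are obtained backwards. On the space with basis the Young diagrams one defines G r (`raiseOp`)
with matrix ψ, H r (`lowerOp`) with matrix φ, and a diagonal operator D (`macOp`) with Macdonald's
eigenvalues. Partial fractions give the relations of G 1, H 1 and D with all G r. Bracketing with G
1 and H 1 and passing to adjoints yields the relations of D and three companion operators with all G
r and H r (`MulIndep.exists_companions`). Since q and t are algebraically independent, D has simple
spectrum (`eig_injective`), so whatever commutes with D is diagonal; by induction on r + s this
gives `MulIndep.raiseOp_comm` and the normal ordering `MulIndep.lowerOp_mul_raiseOp`.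

Hence symmetric functions act with g_r ↦ G r, and applying them to the vacuum gives a map S
(`IsFockMap`). It is an isometry for the Macdonald form and carries the shift p_k ↦ p_k + z^k to the
H r. Monomial coefficients become vacuum entries of products of H r; these count chains of
horizontal strips and are triangular for dominance. So the basis vectors are the images of the Q_λ
(`IsFockMap.macQ`), and `oneVar_skewP` and `oneVar_skewQ` follow.

The sum defining the even part function collapses as well: the only μ ≻ λ with even columns has rows
λ₁, λ₁, λ₃, λ₃, …, and b^el_μ ψ_{μ/λ} = b^el_λ. What remains is a comparison of products of
`arcFactor`s. Each ψ or φ splits into a factor of the smaller index, a factor of the larger index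
and a β; the two one-index factors meeting at λ^i make γ, and at i = n - 1 the head factor together
with b^el makes αγ (`MulIndep.bEl_mul_headPart`). The surplus powers of q / t and the telescoped
monomial in the x_i are what the substitution for z absorbs (`weight_eq`).

The bookkeeping needs l_{i+1} - l_i ∈ {0, 1} and v_n = ⌈l_{n-1} / 2⌉. Both follow from a stable
point: V_{n-2} is spanned by the vectors obtained from the framing by going alternately round the
two end vertices (`finrank_alternating`, `admissible_of_nonempty`). Counting parts from the bottom
then identifies interlacing tuples with reverse plane partitions (`Admissible.bijOn_toRPP`) and
matches the summands (`rppTerm_toRPP`), so the statement on the vertex function follows from the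
weight identity degree by degree. -/

theorem sum_residue {ι : Type*} [DecidableEq ι] (s : Finset ι) (z c : ι → K)
    (hz : Set.InjOn z s) :
    ∑ i ∈ s, (∏ j ∈ s, (z i - c j)) / ∏ j ∈ s.erase i, (z i - z j) = ∑ i ∈ s, (z i - c i) := by
  rcases s.eq_empty_or_nonempty with rfl | hs
  · simp
  -- The difference of two monic polynomials of degree `#s` is interpolated by its values at the `z
  -- i`; comparing coefficients of degree `#s - 1` gives the identity.
  have hdeg : (Lagrange.nodal s c - Lagrange.nodal s z).degree < (#s : WithBot ℕ) := by
    rw [← Lagrange.degree_nodal (s := s) (v := c)]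
    apply degree_sub_lt_left
    · rw [Lagrange.degree_nodal, Lagrange.degree_nodal]
    · exact Lagrange.nodal_ne_zero
    · rw [Lagrange.nodal_monic, Lagrange.nodal_monic]
  have h := Lagrange.coeff_eq_sum hz hdeg
  rw [coeff_sub, Lagrange.nodal_eq, Lagrange.nodal_eq,
    prod_X_sub_C_coeff_card_pred s c hs.card_pos, prod_X_sub_C_coeff_card_pred s z hs.card_pos]
    at h
  rw [sum_sub_distrib]
  have h2 : ∀ i ∈ s, (∏ j ∈ s, (z i - c j)) / ∏ j ∈ s.erase i, (z i - z j) =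
      eval (z i) (∏ i ∈ s, (X - C (c i)) - ∏ i ∈ s, (X - C (z i))) /
        ∏ j ∈ s.erase i, (z i - z j) := by
    intro i hi
    congr 1
    rw [eval_sub, eval_prod, eval_prod, prod_eq_zero hi (f := fun j => eval (z i) (X - C (z j)))
      (by simp)]
    simp
  rw [sum_congr rfl h2, ← h]
  ring

/-- The interpolation behind `sum_residue`, now evaluated at 0 instead of compared in its leading
coefficient. -/
theorem sum_residue_div {ι : Type*} [DecidableEq ι] (s : Finset ι) (z c : ι → K)
    (hz : Set.InjOn z s) (hz0 : ∀ i ∈ s, z i ≠ 0) :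
    ∑ i ∈ s, (∏ j ∈ s, (z i - c j)) / (∏ j ∈ s.erase i, (z i - z j)) / z i =
      1 - ∏ i ∈ s, c i / z i := by
  have hdeg : (Lagrange.nodal s c - Lagrange.nodal s z).degree < (#s : WithBot ℕ) := by
    rw [← Lagrange.degree_nodal (s := s) (v := c)]
    apply degree_sub_lt_left
    · rw [Lagrange.degree_nodal, Lagrange.degree_nodal]
    · exact Lagrange.nodal_ne_zero
    · rw [Lagrange.nodal_monic, Lagrange.nodal_monic]
  have h := congrArg (eval 0) (Lagrange.eq_interpolate hz hdeg)
  rw [Lagrange.eval_interpolate_not_at_node _ (fun i hi => (hz0 i hi).symm), eval_sub,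
    Lagrange.eval_nodal, Lagrange.eval_nodal] at h
  have hne : ∏ i ∈ s, (0 - z i) ≠ 0 := prod_ne_zero_iff.2 fun i hi => by simpa using hz0 i hi
  have h3 : ∏ i ∈ s, c i / z i = (∏ i ∈ s, (0 - c i)) / ∏ i ∈ s, (0 - z i) := by
    rw [← prod_div_distrib]
    exact prod_congr rfl fun i _ => by rw [zero_sub, zero_sub, neg_div_neg_eq]
  have h2 : ∀ i ∈ s, (∏ j ∈ s, (z i - c j)) / (∏ j ∈ s.erase i, (z i - z j)) / z i =
      -(Lagrange.nodalWeight s z i * (0 - z i)⁻¹ *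
        eval (z i) (Lagrange.nodal s c - Lagrange.nodal s z)) := by
    intro i hi
    rw [eval_sub, Lagrange.eval_nodal, Lagrange.eval_nodal_at_node hi, Lagrange.nodalWeight,
      prod_inv_distrib, zero_sub, inv_neg]
    ring
  rw [sum_congr rfl h2, sum_neg_distrib, h3, eq_sub_iff_add_eq, neg_add_eq_sub,
    sub_eq_iff_eq_add, div_eq_iff hne]
  linear_combination h

theorem erase_disjSum_inl (A B : Finset ℕ) (a : ℕ) :
    (A.disjSum B).erase (Sum.inl a) = (A.erase a).disjSum B := by
  ext x; cases x <;> simp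

theorem erase_disjSum_inr (A B : Finset ℕ) (a : ℕ) :
    (A.disjSum B).erase (Sum.inr a) = A.disjSum (B.erase a) := by
  ext x; cases x <;> simp

/-- Partial fractions with the poles split into two families. -/
theorem sum_residue₂ (A B : Finset ℕ) (x y c d : ℕ → K)
    (hx : Set.InjOn x A) (hy : Set.InjOn y B) (hxy : ∀ i ∈ A, ∀ j ∈ B, x i ≠ y j) :
    ∑ i ∈ A, ((∏ j ∈ A, (x i - c j)) * ∏ j ∈ B, (x i - d j)) /
        ((∏ j ∈ A.erase i, (x i - x j)) * ∏ j ∈ B, (x i - y j)) +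
      ∑ i ∈ B, ((∏ j ∈ A, (y i - c j)) * ∏ j ∈ B, (y i - d j)) /
        ((∏ j ∈ A, (y i - x j)) * ∏ j ∈ B.erase i, (y i - y j)) =
      ∑ i ∈ A, (x i - c i) + ∑ i ∈ B, (y i - d i) := by
  have h := sum_residue (A.disjSum B) (Sum.elim x y) (Sum.elim c d) (by
    rintro (i | i) hi (j | j) hj h <;> simp at hi hj h
    · rw [hx hi hj h]
    · exact absurd h (hxy i hi j hj)
    · exact absurd h.symm (hxy j hj i hi)
    · rw [hy hi hj h])
  rw [sum_disjSum, sum_disjSum] at h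
  simpa [erase_disjSum_inl, erase_disjSum_inr, prod_disjSum] using h

theorem sum_residue_div₂ (A B : Finset ℕ) (x y c d : ℕ → K)
    (hx : Set.InjOn x A) (hy : Set.InjOn y B) (hxy : ∀ i ∈ A, ∀ j ∈ B, x i ≠ y j)
    (hx0 : ∀ i ∈ A, x i ≠ 0) (hy0 : ∀ i ∈ B, y i ≠ 0) :
    ∑ i ∈ A, ((∏ j ∈ A, (x i - c j)) * ∏ j ∈ B, (x i - d j)) /
        ((∏ j ∈ A.erase i, (x i - x j)) * ∏ j ∈ B, (x i - y j)) / x i +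
      ∑ i ∈ B, ((∏ j ∈ A, (y i - c j)) * ∏ j ∈ B, (y i - d j)) /
        ((∏ j ∈ A, (y i - x j)) * ∏ j ∈ B.erase i, (y i - y j)) / y i =
      1 - (∏ i ∈ A, c i / x i) * ∏ i ∈ B, d i / y i := by
  have h := sum_residue_div (A.disjSum B) (Sum.elim x y) (Sum.elim c d) (by
    rintro (i | i) hi (j | j) hj h <;> simp at hi hj h
    · rw [hx hi hj h]
    · exact absurd h (hxy i hi j hj)
    · exact absurd h.symm (hxy j hj i hi)
    · rw [hy hi hj h]) (by
    rintro (i | i) hi <;> simp at hi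
    · exact hx0 i hi
    · exact hy0 i hi)
  rw [sum_disjSum, prod_disjSum] at h
  simpa [erase_disjSum_inl, erase_disjSum_inr, prod_disjSum] using h

end PartialFractions

/-! ### Generic parameters -/

/-- `q` and `t` are nonzero and multiplicatively independent. -/
structure MulIndep (q t : K) : Prop where
  q_ne : q ≠ 0
  t_ne : t ≠ 0
  indep : ∀ a b : ℤ, q ^ a * t ^ b = 1 → a = 0 ∧ b = 0

theorem MulIndep.monomial_inj {q t : K} (h : MulIndep q t) {a b c d : ℤ}
    (e : q ^ a * t ^ b = q ^ c * t ^ d) : a = c ∧ b = d := by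
  have := h.indep (a - c) (b - d) (by
    have hc : q ^ c ≠ 0 := zpow_ne_zero _ h.q_ne
    have hd : t ^ d ≠ 0 := zpow_ne_zero _ h.t_ne
    rw [zpow_sub₀ h.q_ne, zpow_sub₀ h.t_ne]
    field_simp
    exact e)
  omega

theorem MulIndep.one_sub_ne {q t : K} (h : MulIndep q t) {a b : ℕ} (hab : a ≠ 0 ∨ b ≠ 0) :
    1 - q ^ a * t ^ b ≠ 0 := by
  intro e
  have := h.indep a b (by simpa using (sub_eq_zero.1 e).symm)
  omega

/-- The factor `(q t ^ b; q)_a / (t ^ (b + 1); q)_a`. -/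
def arcFactor (q t : K) (b a : ℕ) : K :=
  ∏ k ∈ range a, (1 - q ^ (k + 1) * t ^ b) / (1 - q ^ k * t ^ (b + 1))

@[simp] theorem arcFactor_zero (q t : K) (b : ℕ) : arcFactor q t b 0 = 1 := by simp [arcFactor]

theorem MulIndep.arcFactor_ne {q t : K} (h : MulIndep q t) (b a : ℕ) : arcFactor q t b a ≠ 0 :=
  prod_ne_zero_iff.2 fun _ _ =>
    div_ne_zero (h.one_sub_ne (Or.inl (Nat.succ_ne_zero _))) (h.one_sub_ne (Or.inr (Nat.succ_ne_zero _)))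

theorem arcFactor_succ (q t : K) (b a : ℕ) :
    arcFactor q t b (a + 1) =
      arcFactor q t b a * ((1 - q ^ (a + 1) * t ^ b) / (1 - q ^ a * t ^ (b + 1))) := by
  rw [arcFactor, arcFactor, prod_range_succ]

/-- The triangular product `∏_{i ≤ j < N} F_{j - i} (u_i - v_j)`. -/
def triProd (q t : K) (N : ℕ) (u v : ℕ → ℕ) : K :=
  ∏ j ∈ range N, ∏ i ∈ range (j + 1), arcFactor q t (j - i) (u i - v j)

theorem MulIndep.triProd_ne {q t : K} (h : MulIndep q t) (N : ℕ) (u v : ℕ → ℕ) :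
    triProd q t N u v ≠ 0 :=
  prod_ne_zero_iff.2 fun _ _ => prod_ne_zero_iff.2 fun _ _ => h.arcFactor_ne _ _

/-- The monomial `q ^ (u_i) t ^ (-i)` attached to row `i`. -/
def node (q t : K) (u : ℕ → ℕ) (i : ℕ) : K := q ^ u i * (t ^ i)⁻¹

theorem MulIndep.node_ne {q t : K} (h : MulIndep q t) (u : ℕ → ℕ) (i : ℕ) : node q t u i ≠ 0 :=
  mul_ne_zero (pow_ne_zero _ h.q_ne) (inv_ne_zero (pow_ne_zero _ h.t_ne))

/-- The ratio of consecutive values of `arcFactor`. -/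
def arcStep (q t z : K) : K := (1 - q * z) / (1 - t * z)

theorem MulIndep.node_div {q t : K} (h : MulIndep q t) {u v : ℕ → ℕ} {i j : ℕ} (hij : i ≤ j)
    (huv : v j ≤ u i) : node q t u i / node q t v j = q ^ (u i - v j) * t ^ (j - i) := by
  obtain ⟨d, hd⟩ := Nat.exists_eq_add_of_le huv
  obtain ⟨e, rfl⟩ := Nat.exists_eq_add_of_le hij
  have := h.q_ne; have := h.t_ne
  rw [node, node, hd, Nat.add_sub_cancel_left, Nat.add_sub_cancel_left, pow_add, pow_add]
  field_simp

theorem MulIndep.arcFactor_step {q t : K} (h : MulIndep q t) {u v : ℕ → ℕ} {i j : ℕ} (hij : i ≤ j)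
    (huv : v j ≤ u i) :
    arcFactor q t (j - i) (u i + 1 - v j) =
      arcFactor q t (j - i) (u i - v j) * arcStep q t (node q t u i / node q t v j) := by
  rw [Nat.sub_add_comm huv, arcFactor_succ, h.node_div hij huv, arcStep]
  ring_nf

/-- Only the factors with `i = a` change, each by one `arcStep`. The inequalities ensure that the
truncated differences really grow by one. -/
theorem MulIndep.triProd_update_left {q t : K} (h : MulIndep q t) (N : ℕ) (u v : ℕ → ℕ) (a : ℕ)
    (huv : ∀ j, a ≤ j → j < N → v j ≤ u a) :
    triProd q t N (Function.update u a (u a + 1)) v =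
      triProd q t N u v * ∏ j ∈ Ico a N, arcStep q t (node q t u a / node q t v j) := by
  have hI : ∏ j ∈ Ico a N, arcStep q t (node q t u a / node q t v j) =
      ∏ j ∈ range N, if a ≤ j then arcStep q t (node q t u a / node q t v j) else 1 := by
    rw [prod_ite, prod_const_one, mul_one]
    refine prod_congr ?_ fun _ _ => rfl
    ext j; simp [and_comm]
  rw [hI, triProd, triProd, ← prod_mul_distrib]
  refine prod_congr rfl fun j hj => ?_
  rw [mem_range] at hj
  split_ifs with haj
  · have ha : a ∈ range (j + 1) := by simp; omega
    rw [← mul_prod_erase _ _ ha, ← mul_prod_erase _ (fun i => arcFactor q t (j - i) (u i - v j)) ha,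
      Function.update_self, h.arcFactor_step haj (huv j haj hj)]
    rw [prod_congr rfl fun i hi => by rw [Function.update_of_ne (ne_of_mem_erase hi)]]
    ring
  · rw [mul_one]
    refine prod_congr rfl fun i hi => ?_
    rw [mem_range] at hi
    rw [Function.update_of_ne (by omega)]

/-- Raising `v a` shortens the arguments `u i - v a`, so the steps stand next to the new product;
they are taken at the new node, which is `q` times the old one. -/
theorem MulIndep.triProd_update_right {q t : K} (h : MulIndep q t) (N : ℕ) (u v : ℕ → ℕ) (a : ℕ)
    (ha : a < N) (huv : ∀ i, i ≤ a → v a + 1 ≤ u i) :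
    triProd q t N u (Function.update v a (v a + 1)) *
      ∏ i ∈ range (a + 1), arcStep q t (node q t u i / (q * node q t v a)) =
      triProd q t N u v := by
  have hq := h.q_ne
  rw [triProd, triProd, ← mul_prod_erase _ _ (mem_range.2 ha),
    ← mul_prod_erase _ (fun j => ∏ i ∈ range (j + 1), arcFactor q t (j - i) (u i - v j))
      (mem_range.2 ha), Function.update_self, mul_right_comm, ← prod_mul_distrib]
  congr 1
  · refine prod_congr rfl fun i hi => ?_
    rw [mem_range] at hi
    have h1 := h.arcFactor_step (u := u) (v := fun j => v j + 1) (i := i) (j := a) (by omega)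
      (huv i (by omega))
    have h2 : node q t (fun j => v j + 1) a = q * node q t v a := by
      simp only [node, pow_succ]; ring
    rw [h2] at h1
    rw [← h1]
    congr 1
    have := huv i (by omega)
    omega
  · exact prod_congr rfl fun j hj => prod_congr rfl fun i _ => by
      rw [Function.update_of_ne (ne_of_mem_erase hj)]

theorem node_update_self (q t : K) (u : ℕ → ℕ) (a : ℕ) :
    node q t (Function.update u a (u a + 1)) a = q * node q t u a := by
  simp only [node, Function.update_self, pow_succ]; ring

theorem node_update_of_ne (q t : K) (u : ℕ → ℕ) {a i : ℕ} (hi : i ≠ a) (x : ℕ) :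
    node q t (Function.update u a x) i = node q t u i := by
  simp only [node, Function.update_of_ne hi]

theorem MulIndep.node_succ {q t : K} (h : MulIndep q t) (u : ℕ → ℕ) (j : ℕ) :
    node q t (fun i => u (i + 1)) j = t * node q t u (j + 1) := by
  have := h.t_ne
  simp only [node, pow_succ]; field_simp

end

section

/-! ### Branching coefficients of one-box and horizontal strips -/

/-- The coefficient `ψ_{l/m}` computed with `N` rows. -/
def branch (q t : K) (N : ℕ) (l m : ℕ → ℕ) : K :=
  triProd q t N m m * triProd q t N l (fun i => l (i + 1)) /
    (triProd q t N l m * triProd q t N m (fun i => l (i + 1)))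

/-- The norm `b_l` computed with `N` rows. -/
def rowNorm (q t : K) (N : ℕ) (l : ℕ → ℕ) : K :=
  triProd q t N l l / triProd q t N l (fun i => l (i + 1))

/-- `f` with one box added in row `a`. -/
abbrev bump (f : ℕ → ℕ) (a : ℕ) : ℕ → ℕ := Function.update f a (f a + 1)

/-- Interlacing of sequences of row lengths. -/
def RowInterlaces (l m : ℕ → ℕ) : Prop := ∀ i, m i ≤ l i ∧ l (i + 1) ≤ m i

theorem RowInterlaces.anti_left {l m : ℕ → ℕ} (h : RowInterlaces l m) : Antitone l :=
  antitone_nat_of_succ_le fun i => (h i).2.trans (h i).1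

theorem RowInterlaces.anti_right {l m : ℕ → ℕ} (h : RowInterlaces l m) : Antitone m :=
  antitone_nat_of_succ_le fun i => (h (i + 1)).1.trans (h i).2

theorem RowInterlaces.le_of_lt {l m : ℕ → ℕ} (h : RowInterlaces l m) {i j : ℕ} (hij : i < j) :
    l j ≤ m i :=
  (h.anti_left (by omega : i + 1 ≤ j)).trans (h i).2


theorem MulIndep.branch_ne (h : MulIndep q t) (N : ℕ) (l m : ℕ → ℕ) : branch q t N l m ≠ 0 :=
  div_ne_zero (mul_ne_zero (h.triProd_ne _ _ _) (h.triProd_ne _ _ _))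
    (mul_ne_zero (h.triProd_ne _ _ _) (h.triProd_ne _ _ _))

theorem MulIndep.rowNorm_ne (h : MulIndep q t) (N : ℕ) (l : ℕ → ℕ) : rowNorm q t N l ≠ 0 :=
  div_ne_zero (h.triProd_ne _ _ _) (h.triProd_ne _ _ _)

theorem MulIndep.q_ne_t (h : MulIndep q t) : q ≠ t := by
  intro e
  have := h.monomial_inj (a := 1) (b := 0) (c := 0) (d := 1) (by simpa using e)
  omega

theorem MulIndep.one_sub_q (h : MulIndep q t) : 1 - q ≠ 0 := by
  simpa using h.one_sub_ne (a := 1) (b := 0) (by simp)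

theorem MulIndep.one_sub_t (h : MulIndep q t) : 1 - t ≠ 0 := by
  simpa using h.one_sub_ne (a := 0) (b := 1) (by simp)

/-- Comparison of two monomials attached to rows. -/
theorem MulIndep.node_eq (h : MulIndep q t) {u v : ℕ → ℕ} {i j : ℕ} {c d : ℤ}
    (e : node q t u i = q ^ c * t ^ d * node q t v j) :
    (u i : ℤ) = c + v j ∧ (j : ℤ) = d + i := by
  have hq := h.q_ne
  have ht := h.t_ne
  have := h.monomial_inj (a := u i) (b := -i) (c := c + v j) (d := d - j) (by
    simp only [node] at e
    rw [zpow_add₀ hq, zpow_sub₀ ht, zpow_neg]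
    simp only [zpow_natCast]
    rw [e]; field_simp)
  omega

/-- This and the next three lemmas supply the denominators: a difference of two monomials in `q` and
`t` vanishes only if both exponents agree, and the side condition excludes the one case in which
they can. -/
theorem MulIndep.node_ne_node (h : MulIndep q t) {u v : ℕ → ℕ} {i j : ℕ}
    (hne : i = j → u i ≠ v j) : node q t u i - node q t v j ≠ 0 := by
  intro e
  have := h.node_eq (u := u) (v := v) (i := i) (j := j) (c := 0) (d := 0)
    (by simpa using sub_eq_zero.1 e)
  exact hne (by omega) (by omega)

theorem MulIndep.node_ne_s_node (h : MulIndep q t) {u v : ℕ → ℕ} {i j : ℕ}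
    (hne : j = i + 1 → u i + 1 ≠ v j) : node q t u i - t / q * node q t v j ≠ 0 := by
  intro e
  have := h.node_eq (u := u) (v := v) (i := i) (j := j) (c := -1) (d := 1)
    (by rw [sub_eq_zero.1 e, zpow_neg_one, zpow_one]; ring)
  exact hne (by omega) (by omega)

theorem MulIndep.q_node_ne_node (h : MulIndep q t) {u v : ℕ → ℕ} {i j : ℕ}
    (hne : i = j → u i + 1 ≠ v j) : q * node q t u i - node q t v j ≠ 0 := by
  intro e
  have hq := h.q_ne
  have := h.node_eq (u := u) (v := v) (i := i) (j := j) (c := -1) (d := 0)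
    (by rw [← sub_eq_zero.1 e, zpow_neg_one, zpow_zero]; field_simp)
  exact hne (by omega) (by omega)

theorem MulIndep.t_node_ne_node (h : MulIndep q t) {u v : ℕ → ℕ} {i j : ℕ}
    (hne : i = j + 1 → u i ≠ v j) : t * node q t u i - node q t v j ≠ 0 := by
  intro e
  have ht := h.t_ne
  have := h.node_eq (u := u) (v := v) (i := i) (j := j) (c := 0) (d := -1)
    (by rw [← sub_eq_zero.1 e, zpow_neg_one, zpow_zero]; field_simp)
  exact hne (by omega) (by omega)

theorem arcStep_one (q t : K) : arcStep q t 1 = (1 - q) / (1 - t) := by simp [arcStep]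

theorem arcStep_div_q (h : MulIndep q t) {x y : K} (hy : y ≠ 0) :
    arcStep q t (x / (q * y)) = (y - x) / (y - t / q * x) := by
  have hq := h.q_ne
  rw [arcStep, ← mul_div_mul_right _ _ hy]
  congr 1 <;> field_simp

theorem arcStep_div_t (h : MulIndep q t) {x y : K} (hy : y ≠ 0) :
    arcStep q t (x / (t * y)) = (t / q)⁻¹ * ((x - t / q * y) / (x - y)) := by
  have hq := h.q_ne
  have ht := h.t_ne
  have h1 : 1 - q * (x / (t * y)) = (t / q)⁻¹ * -(x - t / q * y) / y := by field_simp; ring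
  have h2 : 1 - t * (x / (t * y)) = -(x - y) / y := by field_simp; ring
  rw [arcStep, h1, h2, div_div_div_cancel_right₀ hy, mul_div_assoc, neg_div_neg_eq]

theorem arcStep_div (q t : K) {x y : K} (hy : y ≠ 0) :
    arcStep q t (x / y) = (q * x - y) / (t * x - y) := by
  rw [arcStep, ← neg_div_neg_eq, ← mul_div_mul_right _ _ hy]
  congr 1 <;> field_simp <;> ring

theorem arcStep_div_qt (h : MulIndep q t) {x y : K} (hy : y ≠ 0) :
    arcStep q t (x / (q * (t * y))) = (t / q)⁻¹ * ((t * y - x) / (q * y - x)) := by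
  have hq := h.q_ne
  have ht := h.t_ne
  rw [arcStep, ← mul_div_mul_right _ _ (mul_ne_zero (mul_ne_zero hq ht) hy),
    ← mul_div_mul_left _ (q * y - x) ht, ← mul_div_assoc]
  field_simp

theorem prod_range_erase {a N : ℕ} (ha : a < N) (f : ℕ → K) :
    ∏ i ∈ (range N).erase a, f i = (∏ i ∈ range a, f i) * ∏ i ∈ Ico (a + 1) N, f i := by
  have : (range N).erase a = range a ∪ Ico (a + 1) N := by ext; simp; omega
  rw [this, prod_union]
  rw [disjoint_left]; intro x; simp; omega

theorem prod_range_split {a N : ℕ} (ha : a ≤ N) (f : ℕ → K) :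
    ∏ i ∈ range N, f i = (∏ i ∈ range a, f i) * ∏ i ∈ Ico a N, f i := by
  rw [prod_range_mul_prod_Ico _ ha]

theorem succ_bump_succ (f : ℕ → ℕ) (a : ℕ) :
    (fun i => bump f (a + 1) (i + 1)) = bump (fun i => f (i + 1)) a := by
  funext i
  by_cases hi : i = a
  · subst hi; simp [bump]
  · simp [bump, Function.update_of_ne hi, Function.update_of_ne (fun h => hi (Nat.succ_injective h))]

/-- Adding a box of `m` in row `a` changes `∏ F(m_i - m_j)` by this factor. -/
theorem MulIndep.triProd_bump_diag (h : MulIndep q t) {N a : ℕ} (ha : a < N) {m : ℕ → ℕ}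
    (hm : ∀ j, a ≤ j → m j ≤ m a) (hm' : ∀ i, i < a → m a + 1 ≤ m i) :
    triProd q t N (bump m a) (bump m a) *
        ∏ i ∈ range a, arcStep q t (node q t m i / (q * node q t m a)) =
      triProd q t N m m *
        ∏ j ∈ Ico (a + 1) N, arcStep q t (node q t m a / node q t m j) := by
  have h1 := h.triProd_update_left N m m a fun j hj _ => hm j hj
  have h2 := h.triProd_update_right N (bump m a) m a ha fun i hi => by
    rcases hi.lt_or_eq with hi | rfl
    · rw [bump, Function.update_of_ne hi.ne]; exact hm' i hi
    · simp [bump]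
  rw [h1, prod_range_succ, prod_eq_prod_Ico_succ_bot ha, node_update_self,
    div_self (mul_ne_zero h.q_ne (h.node_ne _ _)), div_self (h.node_ne _ _)] at h2
  -- The diagonal factor `i = j = a` is raised in `h1` and lowered again in `h2`, so `arcStep q t 1`
  -- stands on both sides and cancels.
  have h1' : arcStep q t 1 ≠ 0 := by
    rw [arcStep_one]; exact div_ne_zero h.one_sub_q h.one_sub_t
  have h3 : ∏ i ∈ range a, arcStep q t (node q t (bump m a) i / (q * node q t m a)) =
      ∏ i ∈ range a, arcStep q t (node q t m i / (q * node q t m a)) :=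
    prod_congr rfl fun i hi => by rw [node_update_of_ne _ _ _ (mem_range.1 hi).ne]
  rw [h3] at h2
  apply mul_right_cancel₀ h1'
  linear_combination h2

theorem MulIndep.triProd_bump_succ_right (h : MulIndep q t) {N a : ℕ} (ha : a ≤ N) {u l : ℕ → ℕ}
    (hu : ∀ i, i < a → l a + 1 ≤ u i) :
    triProd q t N u (fun i => bump l a (i + 1)) *
        ∏ i ∈ range a, arcStep q t (node q t u i / (q * (t * node q t l a))) =
      triProd q t N u (fun i => l (i + 1)) := by
  cases a with
  -- Row 0 does not occur among the shifted rows, so a box added there changes nothing.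
  | zero => simp
  | succ a =>
    rw [succ_bump_succ, ← h.node_succ]
    exact h.triProd_update_right N u (fun i => l (i + 1)) a ha fun i hi => hu i (by omega)

theorem MulIndep.triProd_bump_succ_left (h : MulIndep q t) (N a : ℕ) {u l : ℕ → ℕ}
    (hu : ∀ j, a ≤ j → l (j + 1) ≤ u a) :
    triProd q t N (bump u a) (fun i => l (i + 1)) =
      triProd q t N u (fun i => l (i + 1)) *
        ∏ j ∈ Ico a N, arcStep q t (node q t u a / (t * node q t l (j + 1))) := by
  rw [h.triProd_update_left N u _ a fun j hj _ => hu j hj]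
  simp only [h.node_succ]

end

section

/-! ### Ratios of branching coefficients -/

/-- The ratio `ψ_{m + a / m} ψ_{l / m + a} / ψ_{l / m}`. -/
def upCoef (q t : K) (N : ℕ) (X Y : ℕ → K) (a : ℕ) : K :=
  (1 - t) / (1 - q) * ((∏ i ∈ (range N).erase a, (X a - t / q * X i) / (X a - X i)) *
    ∏ i ∈ range N, (X a - Y i) / (X a - t / q * Y i))

/-- The ratio `φ_{l + a / l} ψ_{l + a / m} / ψ_{l / m}`. -/
def addCoef (q t : K) (N : ℕ) (X Y : ℕ → K) (a : ℕ) : K :=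
  (1 - t) / (1 - q) * ((t / q)⁻¹ ^ N *
    ((∏ i ∈ (range (N + 1)).erase a, (Y a - t / q * Y i) / (Y a - Y i)) *
      ∏ i ∈ range N, (t * Y a - X i) / (q * Y a - X i)))

/-- The ratio `ψ_{l / m - a} φ_{m / m - a} / ψ_{l / m}`. -/
def remCoef (q t : K) (N : ℕ) (X Y : ℕ → K) (a : ℕ) : K :=
  (1 - t) / (1 - q) * ((t / q)⁻¹ ^ N *
    ((∏ i ∈ (range N).erase a, (t / q * X a - X i) / (X a - X i)) *
      ∏ i ∈ range (N + 1), (X a / q - t / q * Y i) / (X a / q - Y i)))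

/-- The ratio `ψ_{l - a / m} ψ_{l / l - a} / ψ_{l / m}`. -/
def downCoef (q t : K) (N : ℕ) (X Y : ℕ → K) (a : ℕ) : K :=
  (1 - t) / (1 - q) * ((∏ i ∈ (range N).erase a, (t / q * Y a - Y i) / (Y a - Y i)) *
    ∏ i ∈ range N, (Y a - X i) / (t / q * Y a - X i))

theorem MulIndep.arcStep_one_ne (h : MulIndep q t) : arcStep q t 1 ≠ 0 := by
  rw [arcStep_one]; exact div_ne_zero h.one_sub_q h.one_sub_t

theorem MulIndep.branch_bump_self (h : MulIndep q t) {N a : ℕ} (ha : a < N) {m : ℕ → ℕ}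
    (hm : Antitone m) :
    branch q t N (bump m a) m = (arcStep q t 1)⁻¹ *
      ((∏ j ∈ Ico a N, arcStep q t (node q t m a / (t * node q t m (j + 1)))) /
        ∏ j ∈ Ico (a + 1) N, arcStep q t (node q t m a / node q t m j)) := by
  have h1 := h.triProd_update_left N m m a fun j hj _ => hm hj
  have h2 := h.triProd_bump_succ_left N a (u := m) (l := bump m a) fun j hj => by
    rw [bump, Function.update_of_ne (by omega)]; exact hm (by omega)
  have h3 : ∀ j ∈ Ico a N, arcStep q t (node q t m a / (t * node q t (bump m a) (j + 1))) =
      arcStep q t (node q t m a / (t * node q t m (j + 1))) := fun j hj => by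
    have := mem_Ico.1 hj
    rw [node_update_of_ne _ _ _ (by omega)]
  rw [prod_congr rfl h3] at h2
  rw [prod_eq_prod_Ico_succ_bot ha, div_self (h.node_ne _ _)] at h1
  rw [branch, h1, h2]
  have e1 := h.triProd_ne N m m
  have e2 := h.triProd_ne N m fun i => bump m a (i + 1)
  field_simp

section Node

variable {l m : ℕ → ℕ}

theorem prod_div_ne_zero (s : Finset ℕ) (f g : ℕ → K)
    (hf : ∀ i ∈ s, f i ≠ 0) (hg : ∀ i ∈ s, g i ≠ 0) : ∏ i ∈ s, f i / g i ≠ 0 :=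
  prod_ne_zero_iff.2 fun i hi => div_ne_zero (hf i hi) (hg i hi)

theorem prod_div_inv (s : Finset ℕ) (f g : ℕ → K) : ∏ i ∈ s, f i / g i = (∏ i ∈ s, g i / f i)⁻¹ := by
  rw [← prod_inv_distrib]; exact prod_congr rfl fun _ _ => (inv_div _ _).symm

theorem MulIndep.prod_arcStep_div_t (h : MulIndep q t) (a N : ℕ) (x : K) (l : ℕ → ℕ) :
    ∏ j ∈ Ico a N, arcStep q t (x / (t * node q t l (j + 1))) =
      (t / q)⁻¹ ^ (N - a) * ∏ j ∈ Ico (a + 1) (N + 1),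
        (x - t / q * node q t l j) / (x - node q t l j) := by
  rw [← prod_Ico_add' _ a N 1, prod_congr rfl fun j _ => arcStep_div_t h (h.node_ne l (j + 1)),
    prod_mul_distrib, prod_const, Nat.card_Ico]

theorem MulIndep.prod_arcStep_div_qt (h : MulIndep q t) (a : ℕ) {y : K} (hy : y ≠ 0) (f : ℕ → K) :
    ∏ i ∈ range a, arcStep q t (f i / (q * (t * y))) =
      (t / q)⁻¹ ^ a * ∏ i ∈ range a, (t * y - f i) / (q * y - f i) := by
  rw [prod_congr rfl fun i _ => arcStep_div_qt h hy, prod_mul_distrib, prod_const, card_range]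

/-- The effect on `ψ_{l / m}` of adding a box of `m` in row `a`. -/
theorem MulIndep.branch_bump_right (h : MulIndep q t) {N a : ℕ} (hlm : RowInterlaces l m)
    (ha : a < N) (hlt : m a < l a) :
    branch q t N l (bump m a) *
        ((∏ i ∈ range a, arcStep q t (node q t m i / (q * node q t m a))) *
          ∏ j ∈ Ico a N, arcStep q t (node q t m a / (t * node q t l (j + 1)))) =
      branch q t N l m *
        ((∏ j ∈ Ico (a + 1) N, arcStep q t (node q t m a / node q t m j)) *
          ∏ i ∈ range (a + 1), arcStep q t (node q t l i / (q * node q t m a))) := by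
  have hm := hlm.anti_right
  have E1 := h.triProd_bump_diag ha (m := m) (fun j hj => hm hj)
    fun i hi => hlt.trans_le (hlm.le_of_lt hi)
  have E2 := h.triProd_update_right N l m a ha fun i hi => hlt.trans_le (hlm.anti_left hi)
  have E3 := h.triProd_bump_succ_left N a (u := m) (l := l) fun j hj => hlm.le_of_lt (by omega)
  have n1 := h.triProd_ne N l (bump m a)
  have n2 := h.triProd_ne N (bump m a) (fun i => l (i + 1))
  have n3 := h.triProd_ne N l m
  have n4 := h.triProd_ne N m (fun i => l (i + 1))
  rw [branch, branch, div_mul_eq_mul_div, div_mul_eq_mul_div, div_eq_div_iff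
    (mul_ne_zero n1 n2) (mul_ne_zero n3 n4), E3, ← E2]
  linear_combination (triProd q t N l (fun i => l (i + 1)) *
    (∏ j ∈ Ico a N, arcStep q t (node q t m a / (t * node q t l (j + 1)))) *
    (∏ i ∈ range (a + 1), arcStep q t (node q t l i / (q * node q t m a))) *
    triProd q t N l (bump m a) * triProd q t N m (fun i => l (i + 1))) * E1

/-- The steps at `node m a / node m j` occur inverted in the one-box coefficient and upright in the
change of ψ_{l/m}; they cancel, and the remaining factors are those of `upCoef`. -/
theorem MulIndep.branch_mul_branch_up (h : MulIndep q t) {N a : ℕ} (hlm : RowInterlaces l m)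
    (ha : a < N) (hlt : m a < l a) (hN : m N = l N) :
    branch q t N (bump m a) m * branch q t N l (bump m a) =
      branch q t N l m * upCoef q t N (node q t m) (node q t l) a := by
  have hm := hlm.anti_right
  have hXX : ∀ i, i ≠ a → node q t m a - node q t m i ≠ 0 := fun i hi =>
    h.node_ne_node fun e => absurd e.symm hi
  have hXsX : ∀ i, node q t m a - t / q * node q t m i ≠ 0 := fun i =>
    h.node_ne_s_node fun e => by have := hm (show a ≤ i by omega); omega
  have hXsY : ∀ i, node q t m a - t / q * node q t l i ≠ 0 := fun i =>
    h.node_ne_s_node fun e => by have := hlm.le_of_lt (show a < i by omega); omega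
  have hXY : ∀ i, node q t m a - node q t l i ≠ 0 := fun i =>
    h.node_ne_node fun e => by subst e; omega
  have E := h.branch_bump_right hlm ha hlt
  -- The shifted products reach index `N`; since rows `N` of `m` and `l` agree, their last factors
  -- coincide and drop out.
  have hX : node q t m N = node q t l N := by simp only [node, hN]
  rw [h.branch_bump_self ha hm]
  simp only [arcStep_div_q h (h.node_ne m a)] at E
  rw [h.prod_arcStep_div_t, prod_Ico_succ_top (by omega)] at E ⊢
  rw [upCoef, prod_range_erase ha, prod_range_split (show a + 1 ≤ N by omega), hX,
    prod_div_inv (range a)]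
  rw [prod_div_inv (Ico (a + 1) N) _ (fun j => node q t m a - node q t l j)] at E
  have n1 : (node q t m a - t / q * node q t l N) / (node q t m a - node q t l N) ≠ 0 :=
    div_ne_zero (hXsY N) (hXY N)
  have nP2 : ∏ j ∈ Ico (a + 1) N, arcStep q t (node q t m a / node q t m j) ≠ 0 := by
    refine prod_ne_zero_iff.2 fun j hj => ?_
    rw [arcStep_div q t (h.node_ne _ _)]
    have := mem_Ico.1 hj
    exact div_ne_zero (h.q_node_ne_node fun e => by omega) (h.t_node_ne_node fun e => by omega)
  have nP3 := prod_div_ne_zero (range a) (fun i => node q t m a - node q t m i)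
    (fun i => node q t m a - t / q * node q t m i) (fun i hi => hXX i (mem_range.1 hi).ne)
    (fun i _ => hXsX i)
  have nP5 := prod_div_ne_zero (Ico (a + 1) N) (fun i => node q t m a - node q t l i)
    (fun i => node q t m a - t / q * node q t l i) (fun i _ => hXY i) (fun i _ => hXsY i)
  have ns : (t / q)⁻¹ ^ (N - a) ≠ 0 := pow_ne_zero _ (inv_ne_zero (div_ne_zero h.t_ne h.q_ne))
  have t4 := h.one_sub_q
  have t5 := h.one_sub_t
  rw [← eq_div_iff (mul_ne_zero nP3 (mul_ne_zero ns (mul_ne_zero (inv_ne_zero nP5) n1)))] at E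
  rw [E, arcStep_one]
  generalize (∏ j ∈ Ico (a + 1) N, arcStep q t (node q t m a / node q t m j)) = P2 at *
  generalize (∏ i ∈ range a, (node q t m a - node q t m i) /
    (node q t m a - t / q * node q t m i)) = P3 at *
  generalize (∏ i ∈ Ico (a + 1) N, (node q t m a - node q t l i) /
    (node q t m a - t / q * node q t l i)) = P5 at *
  generalize (node q t m a - t / q * node q t l N) / (node q t m a - node q t l N) = P6 at *
  generalize (t / q)⁻¹ ^ (N - a) = c at *
  field_simp

/-- The effect on `ψ_{l / m}` of adding a box of `l` in row `a`. -/
theorem MulIndep.branch_bump_left (h : MulIndep q t) {N a : ℕ} (ha : a ≤ N)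
    (hl : Antitone l) (h1 : ∀ j, a ≤ j → m j ≤ l a) (h2 : ∀ i, i < a → l a + 1 ≤ m i)
    (h3 : ∀ i, i < a → l a + 1 ≤ l i) :
    branch q t N (bump l a) m *
        ((∏ i ∈ range a, arcStep q t (node q t l i / (q * (t * node q t l a)))) *
          ∏ j ∈ Ico a N, arcStep q t (node q t l a / node q t m j)) =
      branch q t N l m *
        ((∏ j ∈ Ico a N, arcStep q t (node q t l a / (t * node q t l (j + 1)))) *
          ∏ i ∈ range a, arcStep q t (node q t m i / (q * (t * node q t l a)))) := by
  have E1 := h.triProd_update_left N l m a fun j hj _ => h1 j hj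
  have E2 := h.triProd_bump_succ_right ha h2
  have E3 := h.triProd_bump_succ_right ha (u := bump l a) fun i hi => by
    rw [bump, Function.update_of_ne hi.ne]; exact h3 i hi
  have E4 := h.triProd_bump_succ_left N a (u := l) (l := l) fun j hj => hl (by omega)
  rw [prod_congr rfl fun i hi => by rw [node_update_of_ne _ _ _ (mem_range.1 hi).ne], E4] at E3
  have n1 := h.triProd_ne N l m
  have n2 := h.triProd_ne N m (fun i => bump l a (i + 1))
  have n3 := h.triProd_ne N (bump l a) m
  rw [branch, branch, ← E2, div_mul_eq_mul_div, div_mul_eq_mul_div, div_eq_div_iff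
    (mul_ne_zero n3 n2) (by rw [E2]; exact mul_ne_zero n1 (h.triProd_ne _ _ _))]
  rw [E1]
  linear_combination (triProd q t N m m * (∏ j ∈ Ico a N, arcStep q t (node q t l a / node q t m j)) * triProd q t N l m * triProd q t N m (fun i => bump l a (i + 1)) *
     ∏ i ∈ range a, arcStep q t (node q t m i / (q * (t * node q t l a)))) * E3

theorem MulIndep.branch_mul_branch_down (h : MulIndep q t) {N a : ℕ} (hl : Antitone l)
    (hlm : RowInterlaces (bump l a) m) (ha : a < N) (h1 : m a ≤ l a) :
    branch q t N l m * branch q t N (bump l a) l = branch q t N (bump l a) m *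
      downCoef q t N (node q t m) (node q t (bump l a)) a := by
  have hm := hlm.anti_right
  have hq := h.q_ne
  have hlm' : ∀ i, i < a → l a + 1 ≤ m i := fun i hi => by
    have := hlm.le_of_lt hi
    rwa [bump, Function.update_self] at this
  have hl' : ∀ i, i < a → l a + 1 ≤ l i := fun i hi => by
    have := (hlm i).1
    rw [bump, Function.update_of_ne hi.ne] at this
    exact (hlm' i hi).trans this
  have E := h.branch_bump_left ha.le hl (m := m) (fun j hj => (hm hj).trans h1) hlm' hl'
  rw [h.branch_bump_self ha hl]
  rw [h.prod_arcStep_div_qt _ (h.node_ne l a), h.prod_arcStep_div_qt _ (h.node_ne l a)] at E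
  rw [downCoef, prod_range_erase ha, prod_range_split ha.le]
  have e1 : t / q * (q * node q t l a) = t * node q t l a := by field_simp
  have e2 : ∀ s : Finset ℕ, a ∉ s → ∏ i ∈ s,
      (t / q * node q t (bump l a) a - node q t (bump l a) i) /
        (node q t (bump l a) a - node q t (bump l a) i) =
      ∏ i ∈ s, (t * node q t l a - node q t l i) / (q * node q t l a - node q t l i) :=
    fun s hs => prod_congr rfl fun i hi => by
      rw [node_update_self, e1, node_update_of_ne _ _ _ (ne_of_mem_of_not_mem hi hs)]
  rw [e2 _ (by simp), e2 _ (by simp), node_update_self, e1]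
  simp only [arcStep_div q t (h.node_ne _ _)] at E ⊢
  rw [prod_div_inv (Ico (a + 1) N) (fun j => q * node q t l a - node q t l j)]
  rw [prod_div_inv (range a) (fun j => t * node q t l a - node q t m j)] at E
  have nE := prod_div_ne_zero (Ico (a + 1) N) (fun j => t * node q t l a - node q t l j)
    (fun j => q * node q t l a - node q t l j)
    (fun j hj => h.t_node_ne_node fun e => by have := mem_Ico.1 hj; omega)
    (fun j hj => h.q_node_ne_node fun e => by have := mem_Ico.1 hj; omega)
  have nD := prod_div_ne_zero (range a) (fun j => q * node q t l a - node q t m j)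
    (fun j => t * node q t l a - node q t m j)
    (fun j hj => h.q_node_ne_node fun e => by have := mem_range.1 hj; omega)
    (fun j hj => h.t_node_ne_node fun e => by
      have := mem_range.1 hj; have := hlm' j (by omega); omega)
  have nC : ∏ j ∈ Ico a N, arcStep q t (node q t l a / (t * node q t l (j + 1))) ≠ 0 := by
    rw [h.prod_arcStep_div_t]
    refine mul_ne_zero (pow_ne_zero _ (inv_ne_zero (div_ne_zero h.t_ne h.q_ne)))
      (prod_div_ne_zero _ _ _ (fun i hi => h.node_ne_s_node fun e => ?_)
        (fun i hi => h.node_ne_node fun e => ?_))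
    · have := hl (show a ≤ i by omega); omega
    · have := mem_Ico.1 hi; omega
  have ns : (t / q)⁻¹ ^ a ≠ 0 := pow_ne_zero _ (inv_ne_zero (div_ne_zero h.t_ne h.q_ne))
  have t4 := h.one_sub_q
  have t5 := h.one_sub_t
  rw [← div_eq_iff (mul_ne_zero nC (mul_ne_zero ns (inv_ne_zero nD)))] at E
  rw [← E, arcStep_one]
  generalize (∏ j ∈ Ico (a + 1) N, (t * node q t l a - node q t l j) /
    (q * node q t l a - node q t l j)) = P2 at *
  generalize (∏ j ∈ range a, (q * node q t l a - node q t m j) /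
    (t * node q t l a - node q t m j)) = P3 at *
  generalize (∏ j ∈ Ico a N, arcStep q t (node q t l a / (t * node q t l (j + 1)))) = P4 at *
  generalize (t / q)⁻¹ ^ a = c at *
  field_simp

/-- The one-box coefficient `φ_{l + a / l}`. -/
theorem MulIndep.branch_mul_rowNorm (h : MulIndep q t) {N a : ℕ} (ha : a < N)
    (hl : Antitone l) (h3 : ∀ i, i < a → l a + 1 ≤ l i) :
    branch q t N (bump l a) l * rowNorm q t N (bump l a) =
      rowNorm q t N l * ((arcStep q t 1)⁻¹ * ((t / q)⁻¹ ^ a *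
        ((∏ i ∈ range a, (t * node q t l a - node q t l i) / (q * node q t l a - node q t l i)) *
          ∏ i ∈ range a, (node q t l a - t / q * node q t l i) /
            (node q t l a - node q t l i)))) := by
  have E1 := h.triProd_bump_diag ha (m := l) (fun j hj => hl hj) h3
  have E3 := h.triProd_bump_succ_right ha.le (u := bump l a) fun i hi => by
    rw [bump, Function.update_of_ne hi.ne]; exact h3 i hi
  have E4 := h.triProd_bump_succ_left N a (u := l) (l := l) fun j hj => hl (by omega)
  rw [prod_congr rfl fun i hi => by rw [node_update_of_ne _ _ _ (mem_range.1 hi).ne], E4] at E3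
  rw [h.branch_bump_self ha hl, rowNorm, rowNorm]
  rw [h.prod_arcStep_div_qt _ (h.node_ne l a)] at E3
  simp only [arcStep_div_q h (h.node_ne l a)] at E1
  rw [prod_div_inv (range a) (fun i => node q t l a - t / q * node q t l i)]
  have nC : ∏ j ∈ Ico a N, arcStep q t (node q t l a / (t * node q t l (j + 1))) ≠ 0 := by
    rw [h.prod_arcStep_div_t]
    refine mul_ne_zero (pow_ne_zero _ (inv_ne_zero (div_ne_zero h.t_ne h.q_ne)))
      (prod_div_ne_zero _ _ _ (fun i hi => h.node_ne_s_node fun e => ?_)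
        (fun i hi => h.node_ne_node fun e => ?_))
    · have := hl (show a ≤ i by omega); omega
    · have := mem_Ico.1 hi; omega
  have nP2 : ∏ j ∈ Ico (a + 1) N, arcStep q t (node q t l a / node q t l j) ≠ 0 := by
    refine prod_ne_zero_iff.2 fun j hj => ?_
    rw [arcStep_div q t (h.node_ne _ _)]
    have := mem_Ico.1 hj
    exact div_ne_zero (h.q_node_ne_node fun e => by omega) (h.t_node_ne_node fun e => by omega)
  have nP3 := prod_div_ne_zero (range a) (fun i => node q t l a - node q t l i)
    (fun i => node q t l a - t / q * node q t l i)
    (fun i hi => h.node_ne_node fun e => by have := mem_range.1 hi; omega)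
    (fun i hi => h.node_ne_s_node fun e => by have := mem_range.1 hi; omega)
  have n1 := h.triProd_ne N (bump l a) (fun i => bump l a (i + 1))
  have n2 := h.triProd_ne N l (fun i => l (i + 1))
  rw [← eq_div_iff nP3] at E1
  rw [← div_eq_iff nC] at E3
  rw [E1, ← E3]
  have nPA : (∏ i ∈ range a, (t * node q t l a - node q t l i) /
      (q * node q t l a - node q t l i)) ≠ 0 := by
    intro e
    rw [e, mul_zero, mul_zero, zero_div] at E3
    exact n2 E3.symm
  have ns : (t / q)⁻¹ ^ a ≠ 0 := pow_ne_zero _ (inv_ne_zero (div_ne_zero h.t_ne h.q_ne))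
  have t4 := h.arcStep_one_ne
  generalize (∏ j ∈ Ico (a + 1) N, arcStep q t (node q t l a / node q t l j)) = P2 at *
  generalize (∏ i ∈ range a, (node q t l a - node q t l i) /
    (node q t l a - t / q * node q t l i)) = P3 at *
  generalize (∏ j ∈ Ico a N, arcStep q t (node q t l a / (t * node q t l (j + 1)))) = P4 at *
  generalize (∏ i ∈ range a, (t * node q t l a - node q t l i) /
      (q * node q t l a - node q t l i)) = P5 at *
  generalize (t / q)⁻¹ ^ a = c at *
  field_simp

theorem MulIndep.branch_add_box (h : MulIndep q t) {N a : ℕ} (ha : a < N)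
    (hlm : RowInterlaces l m) (h2 : ∀ i, i < a → l a + 1 ≤ m i) :
    branch q t N (bump l a) l * rowNorm q t N (bump l a) / rowNorm q t N l *
        branch q t N (bump l a) m =
      branch q t N l m * addCoef q t N (node q t m) (node q t l) a := by
  have hl := hlm.anti_left
  have hm := hlm.anti_right
  have E := h.branch_bump_left ha.le hl (m := m) (fun j hj => (hm hj).trans (hlm a).1) h2
    fun i hi => (h2 i hi).trans (hlm i).1
  rw [h.branch_mul_rowNorm ha hl fun i hi => (h2 i hi).trans (hlm i).1, mul_div_cancel_left₀ _
    (h.rowNorm_ne N l), arcStep_one, addCoef, prod_range_erase (by omega), prod_range_split ha.le]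
  rw [h.prod_arcStep_div_qt _ (h.node_ne l a), h.prod_arcStep_div_qt _ (h.node_ne l a),
    h.prod_arcStep_div_t] at E
  simp only [arcStep_div q t (h.node_ne _ _)] at E
  rw [prod_div_inv (Ico a N) (fun i => q * node q t l a - node q t m i)] at E
  have nPA := prod_div_ne_zero (range a) (fun i => t * node q t l a - node q t l i)
    (fun i => q * node q t l a - node q t l i)
    (fun i hi => h.t_node_ne_node fun e => by
      have := mem_range.1 hi; have := h2 i (by omega); have := (hlm i).1; omega)
    (fun i hi => h.q_node_ne_node fun e => by have := mem_range.1 hi; omega)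
  have nPB := prod_div_ne_zero (Ico a N) (fun i => t * node q t l a - node q t m i)
    (fun i => q * node q t l a - node q t m i)
    (fun i hi => h.t_node_ne_node fun e => by have := mem_Ico.1 hi; omega)
    (fun i hi => h.q_node_ne_node fun e => by subst e; have := (hlm a).1; omega)
  have ns : t / q ≠ 0 := div_ne_zero h.t_ne h.q_ne
  have t4 := h.one_sub_q
  have t5 := h.one_sub_t
  have hN : (t / q)⁻¹ ^ N = (t / q)⁻¹ ^ a * (t / q)⁻¹ ^ (N - a) := by
    rw [← pow_add]; congr 1; omega
  have ns' : (t / q)⁻¹ ^ a ≠ 0 := pow_ne_zero _ (inv_ne_zero ns)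
  rw [← eq_div_iff (mul_ne_zero (mul_ne_zero ns' nPA) (inv_ne_zero nPB))] at E
  rw [E, hN]
  generalize (∏ i ∈ range a, (t * node q t l a - node q t l i) /
      (q * node q t l a - node q t l i)) = P1 at *
  generalize (∏ i ∈ Ico a N, (t * node q t l a - node q t m i) /
      (q * node q t l a - node q t m i)) = P2 at *
  generalize (t / q)⁻¹ ^ a = c at *
  field_simp

/-- The coefficient is written in the nodes of the diagram before the box is removed, whose node in
row `a` is `q` times that of `m`. This is why `remCoef` evaluates its second product at `X a / q`.
-/
theorem MulIndep.branch_remove_box (h : MulIndep q t) {N a : ℕ} (ha : a < N)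
    (hlm : RowInterlaces l m) (hlt : m a < l a) :
    branch q t N l m *
        (branch q t N (bump m a) m * rowNorm q t N (bump m a) / rowNorm q t N m) =
      branch q t N l (bump m a) * remCoef q t N (node q t (bump m a)) (node q t l) a := by
  have hm := hlm.anti_right
  have hq := h.q_ne
  have hm' : ∀ i, i < a → m a + 1 ≤ m i := fun i hi => hlt.trans_le (hlm.le_of_lt hi)
  have E := h.branch_bump_right hlm ha hlt
  rw [h.branch_mul_rowNorm ha hm hm', mul_div_cancel_left₀ _ (h.rowNorm_ne N m), arcStep_one,
    remCoef, prod_range_erase (by omega), prod_range_split (show a + 1 ≤ N + 1 by omega)]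
  have e1 : t / q * (q * node q t m a) = t * node q t m a := by field_simp
  have e3 : q * node q t m a / q = node q t m a := by field_simp
  have e2 : ∀ s : Finset ℕ, a ∉ s → ∏ i ∈ s,
      (t / q * node q t (bump m a) a - node q t (bump m a) i) /
        (node q t (bump m a) a - node q t (bump m a) i) =
      ∏ i ∈ s, (t * node q t m a - node q t m i) / (q * node q t m a - node q t m i) :=
    fun s hs => prod_congr rfl fun i hi => by
      rw [node_update_self, e1, node_update_of_ne _ _ _ (ne_of_mem_of_not_mem hi hs)]
  rw [e2 _ (by simp), e2 _ (by simp), node_update_self, e3]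
  rw [h.prod_arcStep_div_t] at E
  simp only [arcStep_div_q h (h.node_ne m a), arcStep_div q t (h.node_ne _ _)] at E
  rw [prod_div_inv (range a) (fun i => node q t m a - t / q * node q t m i),
    prod_div_inv (range (a + 1)) (fun i => node q t m a - t / q * node q t l i)]
  rw [prod_div_inv (Ico (a + 1) N) (fun i => q * node q t m a - node q t m i)] at E
  have n1 := prod_div_ne_zero (range (a + 1)) (fun i => node q t m a - node q t l i)
    (fun i => node q t m a - t / q * node q t l i)
    (fun i hi => h.node_ne_node fun e => by subst e; omega)
    (fun i hi => h.node_ne_s_node fun e => by have := mem_range.1 hi; omega)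
  have n2 := prod_div_ne_zero (Ico (a + 1) N) (fun i => t * node q t m a - node q t m i)
    (fun i => q * node q t m a - node q t m i)
    (fun i hi => h.t_node_ne_node fun e => by have := mem_Ico.1 hi; omega)
    (fun i hi => h.q_node_ne_node fun e => by have := mem_Ico.1 hi; omega)
  have n3 := prod_div_ne_zero (range a) (fun i => node q t m a - node q t m i)
    (fun i => node q t m a - t / q * node q t m i)
    (fun i hi => h.node_ne_node fun e => by have := mem_range.1 hi; omega)
    (fun i hi => h.node_ne_s_node fun e => by have := mem_range.1 hi; omega)
  have ns : t / q ≠ 0 := div_ne_zero h.t_ne h.q_ne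
  have t4 := h.one_sub_q
  have t5 := h.one_sub_t
  have hN : (t / q)⁻¹ ^ N = (t / q)⁻¹ ^ a * (t / q)⁻¹ ^ (N - a) := by
    rw [← pow_add]; congr 1; omega
  rw [← div_eq_iff (mul_ne_zero (inv_ne_zero n2) n1)] at E
  rw [← E, hN]
  generalize (∏ i ∈ range a, (node q t m a - node q t m i) /
    (node q t m a - t / q * node q t m i)) = P1 at *
  generalize (∏ i ∈ Ico (a + 1) N, (t * node q t m a - node q t m i) /
      (q * node q t m a - node q t m i)) = P2 at *
  generalize (∏ i ∈ range (a + 1), (node q t m a - node q t l i) /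
    (node q t m a - t / q * node q t l i)) = P3 at *
  generalize (t / q)⁻¹ ^ a = c at *
  generalize (t / q)⁻¹ ^ (N - a) = c' at *
  field_simp

end Node

end

section

variable {l m : ℕ → ℕ}

/-! ### Summation identities for the one-box coefficients -/

/-- These zeros make the one-box formulas correct also for rows in which the step would leave the
horizontal strips, so that sums may run over all rows. -/
theorem upCoef_eq_zero (q t : K) {N a : ℕ} (ha : a < N) {X Y : ℕ → K} (h : X a = Y a) :
    upCoef q t N X Y a = 0 := by
  rw [upCoef, prod_eq_zero (mem_range.2 ha) (f := fun i => (X a - Y i) / (X a - t / q * Y i))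
    (by simp [h])]
  simp

theorem downCoef_eq_zero (q t : K) {N a : ℕ} (ha : a < N) {X Y : ℕ → K} (h : X a = Y a) :
    downCoef q t N X Y a = 0 := by
  rw [downCoef, prod_eq_zero (mem_range.2 ha) (f := fun i => (Y a - X i) / (t / q * Y a - X i))
    (by simp [h])]
  simp

theorem addCoef_eq_zero (q t : K) {N a i : ℕ} (hi : i < N) {X Y : ℕ → K} (h : t * Y a = X i) :
    addCoef q t N X Y a = 0 := by
  rw [addCoef, prod_eq_zero (mem_range.2 hi) (f := fun i => (t * Y a - X i) / (q * Y a - X i))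
    (by simp [h])]
  simp

theorem remCoef_eq_zero (q t : K) {N a i : ℕ} (hi : i ≤ N) {X Y : ℕ → K}
    (h : X a / q = t / q * Y i) : remCoef q t N X Y a = 0 := by
  rw [remCoef, prod_eq_zero (mem_range.2 (Nat.lt_succ_of_le hi))
    (f := fun i => (X a / q - t / q * Y i) / (X a / q - Y i)) (by rw [h]; simp)]
  simp

theorem MulIndep.node_injective (h : MulIndep q t) (u : ℕ → ℕ) :
    Function.Injective (node q t u) := fun i j e => by
  by_contra hij
  exact h.node_ne_node (u := u) (v := u) (i := i) (j := j) (fun e => absurd e hij) (sub_eq_zero.2 e)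

theorem MulIndep.s_ne (h : MulIndep q t) : t / q ≠ 0 := div_ne_zero h.t_ne h.q_ne

theorem MulIndep.one_sub_s (h : MulIndep q t) : 1 - t / q ≠ 0 := by
  intro e
  have := div_eq_one_iff_eq h.q_ne |>.1 (sub_eq_zero.1 e).symm
  exact h.q_ne_t this.symm

/-- With s = t / q, this is the residue at the pole X_a of ∏ (w - s X_j)(w - Y_j) / ∏ (w - X_j)(w -
s Y_j); the numerator factor with j = a supplies (1 - s) X_a. The poles s Y_a of the same function
are treated in `residue_down`. -/
theorem MulIndep.residue_up (h : MulIndep q t) {N a : ℕ} (ha : a ∈ range N) (X Y : ℕ → K) :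
    ((∏ j ∈ range N, (X a - t / q * X j)) * ∏ j ∈ range N, (X a - Y j)) /
        ((∏ j ∈ (range N).erase a, (X a - X j)) * ∏ j ∈ range N, (X a - t / q * Y j)) =
      X a * ((1 - t / q) * ((1 - q) / (1 - t)) * upCoef q t N X Y a) := by
  have t4 := h.one_sub_q
  have t5 := h.one_sub_t
  rw [← mul_prod_erase _ _ ha, upCoef, prod_div_distrib, prod_div_distrib, mul_assoc (X a - _),
    mul_div_assoc, mul_div_mul_comm]
  generalize (∏ j ∈ (range N).erase a, (X a - t / q * X j)) /
    ∏ j ∈ (range N).erase a, (X a - X j) = A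
  generalize (∏ j ∈ range N, (X a - Y j)) / ∏ j ∈ range N, (X a - t / q * Y j) = B
  generalize t / q = s
  field_simp

theorem MulIndep.residue_down (h : MulIndep q t) {N a : ℕ} (ha : a ∈ range N) (X Y : ℕ → K) :
    ((∏ j ∈ range N, (t / q * Y a - t / q * X j)) * ∏ j ∈ range N, (t / q * Y a - Y j)) /
        ((∏ j ∈ range N, (t / q * Y a - X j)) *
          ∏ j ∈ (range N).erase a, (t / q * Y a - t / q * Y j)) =
      t / q * Y a * (-((1 - t / q) * ((1 - q) / (1 - t))) * downCoef q t N X Y a) := by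
  have t4 := h.one_sub_q
  have t5 := h.one_sub_t
  have hs := h.s_ne
  obtain ⟨M, rfl⟩ : ∃ M, N = M + 1 := ⟨N - 1, by have := mem_range.1 ha; omega⟩
  simp only [← mul_sub, prod_mul_distrib, prod_const, card_range, card_erase_of_mem ha]
  rw [← mul_prod_erase (range (M + 1)) (fun j => t / q * Y a - Y j) ha, downCoef, prod_div_distrib,
    prod_div_distrib]
  rw [Nat.add_sub_cancel, pow_succ]
  generalize (∏ j ∈ (range (M + 1)).erase a, (t / q * Y a - Y j)) = A
  generalize ∏ j ∈ (range (M + 1)).erase a, (Y a - Y j) = B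
  generalize (∏ j ∈ range (M + 1), (Y a - X j)) = C
  generalize (∏ j ∈ range (M + 1), (t / q * Y a - X j)) = D
  generalize t / q = s at *
  field_simp
  ring

theorem RowInterlaces.up_nodes (h : MulIndep q t) (hlm : RowInterlaces l m) (i j : ℕ) :
    node q t m i ≠ t / q * node q t l j := by
  rw [← sub_ne_zero]
  exact h.node_ne_s_node fun e => by have := hlm.le_of_lt (show i < j by omega); omega

/-- Both sums are residues of one rational function divided by w. They total 1 - ∏ zeros / ∏ poles,
and this is 0 because zeros and poles have equal products: the factors t / q balance. -/
theorem MulIndep.sum_upCoef (h : MulIndep q t) (N : ℕ) (hlm : RowInterlaces l m) :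
    ∑ a ∈ range N, upCoef q t N (node q t m) (node q t l) a =
      ∑ a ∈ range N, downCoef q t N (node q t m) (node q t l) a := by
  have hs := h.s_ne
  have t4 := h.one_sub_q
  have t5 := h.one_sub_t
  have t6 := h.one_sub_s
  have E := sum_residue_div₂ (range N) (range N) (node q t m) (fun j => t / q * node q t l j)
    (fun j => t / q * node q t m j) (node q t l) (h.node_injective m).injOn
    (fun i _ j _ e => h.node_injective l (mul_left_cancel₀ hs e))
    (fun i _ j _ => hlm.up_nodes h i j) (fun i _ => h.node_ne m i)
    (fun i _ => mul_ne_zero hs (h.node_ne l i))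
  rw [sum_congr rfl fun a ha => (div_eq_iff (h.node_ne m a)).2
      ((h.residue_up ha (node q t m) (node q t l)).trans (mul_comm _ _)),
    sum_congr rfl fun a ha => (div_eq_iff (mul_ne_zero hs (h.node_ne l a))).2
      ((h.residue_down ha (node q t m) (node q t l)).trans (mul_comm _ _)),
    prod_congr rfl (g := fun _ => t / q) fun a _ => mul_div_cancel_right₀ _ (h.node_ne m a),
    ← prod_mul_distrib, prod_eq_one, sub_self, ← mul_sum, ← mul_sum] at E
  · have hc : (1 - t / q) * ((1 - q) / (1 - t)) ≠ 0 := mul_ne_zero t6 (div_ne_zero t4 t5)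
    apply mul_left_cancel₀ hc
    linear_combination E
  · intro i _
    rw [mul_div_assoc', div_self (mul_ne_zero hs (h.node_ne l i))]

/-- The same rational function without the division by w: its residues add up to the sum of the
poles minus the sum of the zeros. -/
theorem MulIndep.sum_upCoef_mul (h : MulIndep q t) (N : ℕ) (hlm : RowInterlaces l m) :
    t / q * ∑ a ∈ range N, downCoef q t N (node q t m) (node q t l) a * node q t l a -
        ∑ a ∈ range N, upCoef q t N (node q t m) (node q t l) a * node q t m a =
      (1 - t) / (1 - q) * ∑ a ∈ range N, (node q t l a - node q t m a) := by
  have hs := h.s_ne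
  have t4 := h.one_sub_q
  have t5 := h.one_sub_t
  have t6 := h.one_sub_s
  have E := sum_residue₂ (range N) (range N) (node q t m) (fun j => t / q * node q t l j)
    (fun j => t / q * node q t m j) (node q t l) (h.node_injective m).injOn
    (fun i _ j _ e => h.node_injective l (mul_left_cancel₀ hs e))
    (fun i _ j _ => hlm.up_nodes h i j)
  have c1 : ∀ (c : K) (f g : ℕ → K), ∑ a ∈ range N, g a * (c * f a) =
      c * ∑ a ∈ range N, f a * g a := fun c f g => by
    rw [mul_sum]; exact sum_congr rfl fun _ _ => by ring
  have c2 : ∀ (b c : K) (f g : ℕ → K), ∑ a ∈ range N, b * g a * (c * f a) =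
      c * b * ∑ a ∈ range N, f a * g a := fun b c f g => by
    rw [mul_sum]; exact sum_congr rfl fun _ _ => by ring
  rw [sum_congr rfl fun a ha => h.residue_up ha (node q t m) (node q t l),
    sum_congr rfl fun a ha => h.residue_down ha (node q t m) (node q t l), c1, c2,
    sum_congr rfl (s₂ := range N) (f := fun i => node q t m i - t / q * node q t m i)
      (g := fun i => (1 - t / q) * node q t m i)
      fun a _ => by ring, sum_congr rfl (f := fun i => t / q * node q t l i - node q t l i)
      (g := fun i => (1 - t / q) * -node q t l i) fun a _ => by ring,
    ← mul_sum, ← mul_sum, sum_neg_distrib] at E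
  rw [sum_sub_distrib]
  have hc : (1 - t / q) * ((1 - q) / (1 - t)) ≠ 0 := mul_ne_zero t6 (div_ne_zero t4 t5)
  apply mul_left_cancel₀ hc
  have e2 : (1 - t / q) * ((1 - q) / (1 - t)) * ((1 - t) / (1 - q) *
      (∑ x ∈ range N, node q t l x - ∑ x ∈ range N, node q t m x)) =
      (1 - t / q) * (∑ x ∈ range N, node q t l x - ∑ x ∈ range N, node q t m x) := by
    field_simp
  rw [e2]
  linear_combination -E

theorem MulIndep.residue_add (h : MulIndep q t) {N a : ℕ} (ha : a ∈ range (N + 1)) (X Y : ℕ → K) :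
    ((∏ j ∈ range (N + 1), (Y a - t / q * Y j)) * ∏ j ∈ range N, (Y a - X j / t)) /
        ((∏ j ∈ (range (N + 1)).erase a, (Y a - Y j)) * ∏ j ∈ range N, (Y a - X j / q)) =
      Y a * ((1 - t / q) * ((1 - q) / (1 - t)) * addCoef q t N X Y a) := by
  have t4 := h.one_sub_q
  have t5 := h.one_sub_t
  have hq := h.q_ne
  have ht := h.t_ne
  have e1 : ∏ j ∈ range N, (Y a - X j / t) = t⁻¹ ^ N * ∏ j ∈ range N, (t * Y a - X j) := by
    rw [← card_range N, ← prod_const, card_range, ← prod_mul_distrib]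
    exact prod_congr rfl fun j _ => by field_simp
  have e2 : ∏ j ∈ range N, (Y a - X j / q) = q⁻¹ ^ N * ∏ j ∈ range N, (q * Y a - X j) := by
    rw [← card_range N, ← prod_const, card_range, ← prod_mul_distrib]
    exact prod_congr rfl fun j _ => by field_simp
  rw [← mul_prod_erase _ _ ha, addCoef, prod_div_distrib, prod_div_distrib, e1, e2]
  have e3 : (t / q)⁻¹ ^ N = t⁻¹ ^ N / q⁻¹ ^ N := by rw [← div_pow]; congr 1; field_simp
  rw [e3]
  generalize (∏ j ∈ (range (N + 1)).erase a, (Y a - t / q * Y j)) = A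
  generalize ∏ j ∈ (range (N + 1)).erase a, (Y a - Y j) = B
  generalize (∏ j ∈ range N, (t * Y a - X j)) = C
  generalize (∏ j ∈ range N, (q * Y a - X j)) = D
  have n1 : q⁻¹ ^ N ≠ 0 := pow_ne_zero _ (inv_ne_zero hq)
  generalize t⁻¹ ^ N = c at *
  generalize q⁻¹ ^ N = d at *
  generalize t / q = s at *
  field_simp

theorem MulIndep.residue_rem (h : MulIndep q t) {N a : ℕ} (ha : a ∈ range N) (X Y : ℕ → K) :
    ((∏ j ∈ range (N + 1), (X a / q - t / q * Y j)) * ∏ j ∈ range N, (X a / q - X j / t)) /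
        ((∏ j ∈ range (N + 1), (X a / q - Y j)) * ∏ j ∈ (range N).erase a, (X a / q - X j / q)) =
      X a / q * (-((1 - t / q) * ((1 - q) / (1 - t))) * remCoef q t N X Y a) := by
  have t4 := h.one_sub_q
  have t5 := h.one_sub_t
  have hq := h.q_ne
  have ht := h.t_ne
  obtain ⟨M, rfl⟩ : ∃ M, N = M + 1 := ⟨N - 1, by have := mem_range.1 ha; omega⟩
  have hc : #((range (M + 1)).erase a) = M := by rw [card_erase_of_mem ha]; simp
  have e1 : ∏ j ∈ (range (M + 1)).erase a, (X a / q - X j / t) =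
      t⁻¹ ^ M * ∏ j ∈ (range (M + 1)).erase a, (t / q * X a - X j) := by
    rw [← hc, ← prod_const, hc, ← prod_mul_distrib]
    exact prod_congr rfl fun j _ => by field_simp
  have e2 : ∏ j ∈ (range (M + 1)).erase a, (X a / q - X j / q) =
      q⁻¹ ^ M * ∏ j ∈ (range (M + 1)).erase a, (X a - X j) := by
    rw [← hc, ← prod_const, hc, ← prod_mul_distrib]
    exact prod_congr rfl fun j _ => by field_simp
  rw [← mul_prod_erase (range (M + 1)) (fun j => X a / q - X j / t) ha, remCoef, prod_div_distrib,
    prod_div_distrib, e1, e2]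
  have e3 : (t / q)⁻¹ ^ (M + 1) = (q / t) * (t⁻¹ ^ M / q⁻¹ ^ M) := by
    rw [← div_pow, pow_succ, mul_comm]; congr 2 <;> field_simp
  rw [e3]
  generalize (∏ j ∈ range (M + 1 + 1), (X a / q - t / q * Y j)) = A
  generalize ∏ j ∈ range (M + 1 + 1), (X a / q - Y j) = B
  generalize (∏ j ∈ (range (M + 1)).erase a, (t / q * X a - X j)) = C
  generalize (∏ j ∈ (range (M + 1)).erase a, (X a - X j)) = D
  have n1 : q⁻¹ ^ M ≠ 0 := pow_ne_zero _ (inv_ne_zero hq)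
  generalize t⁻¹ ^ M = c at *
  generalize q⁻¹ ^ M = d at *
  field_simp
  ring

theorem RowInterlaces.add_nodes (h : MulIndep q t) (hlm : RowInterlaces l m) (i j : ℕ) :
    node q t l i ≠ node q t m j / q := by
  have hq := h.q_ne
  intro e
  refine h.q_node_ne_node (u := l) (v := m) (i := i) (j := j) (fun e => ?_) ?_
  · subst e; have := (hlm i).1; omega
  · rw [e]; field_simp; ring

/-- Now there are `N + 1` nodes of `l` against `N` of `m`, so the zeros and poles have products
differing by one factor t / q. The residues total 1 - t / q, and this surplus is the right-hand
side. -/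
theorem MulIndep.sum_addCoef (h : MulIndep q t) (N : ℕ) (hlm : RowInterlaces l m) :
    ∑ a ∈ range (N + 1), addCoef q t N (node q t m) (node q t l) a -
      ∑ a ∈ range N, remCoef q t N (node q t m) (node q t l) a = (1 - t) / (1 - q) := by
  have hs := h.s_ne
  have hq := h.q_ne
  have ht := h.t_ne
  have t4 := h.one_sub_q
  have t5 := h.one_sub_t
  have t6 := h.one_sub_s
  have E := sum_residue_div₂ (range (N + 1)) (range N) (node q t l) (fun j => node q t m j / q)
    (fun j => t / q * node q t l j) (fun j => node q t m j / t) (h.node_injective l).injOn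
    (fun i _ j _ e => h.node_injective m ((div_left_inj' hq).1 e))
    (fun i _ j _ => hlm.add_nodes h i j) (fun i _ => h.node_ne l i)
    (fun i _ => div_ne_zero (h.node_ne m i) hq)
  rw [sum_congr rfl fun a ha => (div_eq_iff (h.node_ne l a)).2
      ((h.residue_add ha (node q t m) (node q t l)).trans (mul_comm _ _)),
    sum_congr rfl fun a ha => (div_eq_iff (div_ne_zero (h.node_ne m a) hq)).2
      ((h.residue_rem ha (node q t m) (node q t l)).trans (mul_comm _ _)),
    prod_congr rfl (g := fun _ => t / q) fun a _ => mul_div_cancel_right₀ _ (h.node_ne l a),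
    prod_congr rfl (s₂ := range N) (g := fun _ => (t / q)⁻¹) fun a _ => by
      have := h.node_ne m a; field_simp,
    prod_const, prod_const, card_range, card_range, pow_succ, ← mul_sum, ← mul_sum, inv_pow,
    mul_right_comm ((t / q) ^ N), mul_inv_cancel₀ (pow_ne_zero _ hs), one_mul] at E
  have hc : (1 - t / q) * ((1 - q) / (1 - t)) ≠ 0 := mul_ne_zero t6 (div_ne_zero t4 t5)
  apply mul_left_cancel₀ hc
  have e2 : (1 - t / q) * ((1 - q) / (1 - t)) * ((1 - t) / (1 - q)) = 1 - t / q := by field_simp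
  rw [e2]
  linear_combination E

theorem MulIndep.sum_addCoef_mul (h : MulIndep q t) (N : ℕ) (hlm : RowInterlaces l m) :
    ∑ a ∈ range (N + 1), addCoef q t N (node q t m) (node q t l) a * node q t l a -
      ∑ a ∈ range N, remCoef q t N (node q t m) (node q t l) a * (node q t m a / q) =
      (1 - t) / (1 - q) * (∑ a ∈ range (N + 1), node q t l a -
        t⁻¹ * ∑ a ∈ range N, node q t m a) := by
  have hs := h.s_ne
  have hq := h.q_ne
  have ht := h.t_ne
  have t4 := h.one_sub_q
  have t5 := h.one_sub_t
  have t6 := h.one_sub_s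
  have E := sum_residue₂ (range (N + 1)) (range N) (node q t l) (fun j => node q t m j / q)
    (fun j => t / q * node q t l j) (fun j => node q t m j / t) (h.node_injective l).injOn
    (fun i _ j _ e => h.node_injective m ((div_left_inj' hq).1 e))
    (fun i _ j _ => hlm.add_nodes h i j)
  have c1 : ∀ (M : ℕ) (c : K) (f g : ℕ → K), ∑ a ∈ range M, g a * (c * f a) =
      c * ∑ a ∈ range M, f a * g a := fun M c f g => by
    rw [mul_sum]; exact sum_congr rfl fun _ _ => by ring
  have c2 : ∀ (c : K) (f g : ℕ → K), ∑ a ∈ range N, g a / q * (c * f a) =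
      c * ∑ a ∈ range N, f a * (g a / q) := fun c f g => by
    rw [mul_sum]; exact sum_congr rfl fun _ _ => by ring
  rw [sum_congr rfl fun a ha => h.residue_add ha (node q t m) (node q t l),
    sum_congr rfl fun a ha => h.residue_rem ha (node q t m) (node q t l), c1, c2,
    sum_congr rfl (f := fun i => node q t l i - t / q * node q t l i)
      (g := fun i => (1 - t / q) * node q t l i) fun a _ => by ring,
    sum_congr rfl (f := fun i => node q t m i / q - node q t m i / t)
      (g := fun i => (1 - t / q) * (-t⁻¹ * node q t m i)) fun a _ => by field_simp; ring,
    ← mul_sum, ← mul_sum, ← mul_sum] at E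
  have hc : (1 - t / q) * ((1 - q) / (1 - t)) ≠ 0 := mul_ne_zero t6 (div_ne_zero t4 t5)
  apply mul_left_cancel₀ hc
  rw [mul_sub]
  have e2 : ∀ z : K, (1 - t / q) * ((1 - q) / (1 - t)) * ((1 - t) / (1 - q) * z) =
      (1 - t / q) * z := fun z => by field_simp
  rw [e2]
  linear_combination E

end

/-! ### Horizontal strips of Young diagrams and one-box commutation identities. -/

section

variable {l m : ℕ → ℕ}

/-! ### Young diagrams by row lengths -/

theorem rowLen_injective : Function.Injective YoungDiagram.rowLen := fun μ ν h => by
  ext ⟨i, j⟩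
  rw [YoungDiagram.mem_cells, YoungDiagram.mem_cells, YoungDiagram.mem_iff_lt_rowLen,
    YoungDiagram.mem_iff_lt_rowLen, h]

theorem rowLen_antitone (μ : YoungDiagram) : Antitone μ.rowLen := fun _ _ h => μ.rowLen_anti _ _ h

theorem rowLen_eq_zero_iff (μ : YoungDiagram) (N : ℕ) : μ.rowLen N = 0 ↔ μ.colLen 0 ≤ N := by
  rw [← not_lt, ← YoungDiagram.mem_iff_lt_colLen, YoungDiagram.mem_iff_lt_rowLen]
  omega

/-- The Young diagram with given row lengths. -/
def ofRows (f : ℕ → ℕ) (hf : Antitone f) (N : ℕ) (_hN : f N = 0) : YoungDiagram where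
  cells := (range N ×ˢ range (f 0)).filter fun c => c.2 < f c.1
  isLowerSet := by
    rintro ⟨i, j⟩ ⟨i', j'⟩ h hm
    obtain ⟨h1, h2⟩ : i' ≤ i ∧ j' ≤ j := by simpa using h
    simp only [coe_filter, mem_product, mem_range, Set.mem_ofPred_eq] at hm ⊢
    have := hf h1
    omega

theorem rowLen_ofRows (f : ℕ → ℕ) (hf : Antitone f) (N : ℕ) (hN : f N = 0) :
    (ofRows f hf N hN).rowLen = f := by
  funext i
  have key : ∀ j, j < (ofRows f hf N hN).rowLen i ↔ j < f i := fun j => by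
    rw [← YoungDiagram.mem_iff_lt_rowLen, ← YoungDiagram.mem_cells]
    simp only [ofRows, mem_filter, mem_product, mem_range, and_iff_right_iff_imp]
    intro h
    refine ⟨?_, h.trans_le (hf (Nat.zero_le i))⟩
    by_contra hi
    have := hf (not_lt.1 hi)
    omega
  have h1 := key (f i)
  have h2 := key ((ofRows f hf N hN).rowLen i)
  omega

theorem card_eq_sum_rowLen (μ : YoungDiagram) {N : ℕ} (hN : μ.rowLen N = 0) :
    μ.card = ∑ i ∈ range N, μ.rowLen i := by
  rw [rowLen_eq_zero_iff] at hN
  rw [← sum_rowLens, YoungDiagram.rowLens, Multiset.sum_coe]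
  change ∑ i ∈ range (μ.colLen 0), μ.rowLen i = _
  refine sum_subset (range_subset_range.2 hN) fun i _ hi => ?_
  rw [rowLen_eq_zero_iff]
  simpa using hi

theorem Interlaces.rowLen_eq_zero {lam μ : YoungDiagram} (h : Interlaces lam μ) {N : ℕ}
    (hN : lam.rowLen N = 0) : μ.rowLen N = 0 := by
  have := (h N).1; omega

theorem Interlaces.rowLen_succ_eq_zero {lam μ : YoungDiagram} (h : Interlaces lam μ) {N : ℕ}
    (hN : μ.rowLen N = 0) : lam.rowLen (N + 1) = 0 := by
  have := (h N).2; omega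

theorem exists_rowLen_eq_zero (μ : YoungDiagram) : ∃ N, μ.rowLen N = 0 :=
  ⟨_, (rowLen_eq_zero_iff μ _).2 le_rfl⟩

theorem rowLen_eq_zero_of_le {μ : YoungDiagram} {M N : ℕ} (hM : μ.rowLen M = 0) (h : M ≤ N) :
    μ.rowLen N = 0 := by
  have := rowLen_antitone μ h; omega

theorem Interlaces.card_le {lam μ : YoungDiagram} (h : Interlaces lam μ) : μ.card ≤ lam.card := by
  obtain ⟨N, hN⟩ := exists_rowLen_eq_zero lam
  rw [card_eq_sum_rowLen lam hN, card_eq_sum_rowLen μ (h.rowLen_eq_zero hN)]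
  exact sum_le_sum fun i _ => (h i).1

theorem Interlaces.eq_of_card {lam μ : YoungDiagram} (h : Interlaces lam μ)
    (hc : lam.card = μ.card) : lam = μ := by
  obtain ⟨N, hN⟩ := exists_rowLen_eq_zero lam
  rw [card_eq_sum_rowLen lam hN, card_eq_sum_rowLen μ (h.rowLen_eq_zero hN), eq_comm,
    sum_eq_sum_iff_of_le fun i _ => (h i).1] at hc
  refine rowLen_injective (funext fun i => ?_)
  by_cases hi : i < N
  · exact (hc i (mem_range.2 hi)).symm
  · rw [rowLen_eq_zero_of_le hN (not_lt.1 hi),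
      rowLen_eq_zero_of_le (h.rowLen_eq_zero hN) (not_lt.1 hi)]

theorem interlaces_refl (μ : YoungDiagram) : Interlaces μ μ :=
  fun i => ⟨le_rfl, rowLen_antitone μ (Nat.le_succ i)⟩

/-- A box can be added to row `i`. -/
def Addable (μ : YoungDiagram) (i : ℕ) : Prop := ∀ j < i, μ.rowLen i + 1 ≤ μ.rowLen j

/-- A box can be removed from row `i`. -/
def Removable (μ : YoungDiagram) (i : ℕ) : Prop := μ.rowLen (i + 1) < μ.rowLen i

theorem Addable.antitone {μ : YoungDiagram} {i : ℕ} (h : Addable μ i) :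
    Antitone (bump μ.rowLen i) := by
  refine antitone_nat_of_succ_le fun n => ?_
  have h1 := rowLen_antitone μ (Nat.le_succ n)
  by_cases hn : n + 1 = i
  · subst hn
    rw [bump, Function.update_self, Function.update_of_ne (by omega)]
    exact h n (by omega)
  · rw [bump, Function.update_of_ne hn, Function.update_apply]
    split_ifs with h2
    · subst h2; exact h1.trans (Nat.le_succ _)
    · exact h1

theorem Addable.zero {μ : YoungDiagram} {i : ℕ} : bump μ.rowLen i (μ.colLen 0 + i + 1) = 0 := by
  rw [bump, Function.update_of_ne (by omega), rowLen_eq_zero_iff]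
  omega

theorem Removable.antitone {μ : YoungDiagram} {i : ℕ} (h : Removable μ i) :
    Antitone (Function.update μ.rowLen i (μ.rowLen i - 1)) := by
  refine antitone_nat_of_succ_le fun n => ?_
  have h1 : μ.rowLen (n + 1) ≤ μ.rowLen n := rowLen_antitone μ (Nat.le_succ n)
  rw [Function.update_apply, Function.update_apply]
  unfold Removable at h
  split_ifs with h2 h3 h3
  · omega
  · subst h2; omega
  · subst h3; omega
  · exact h1

theorem Removable.zero {μ : YoungDiagram} {i : ℕ} :
    Function.update μ.rowLen i (μ.rowLen i - 1) (μ.colLen 0) = 0 := by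
  have : μ.rowLen (μ.colLen 0) = 0 := (rowLen_eq_zero_iff _ _).2 le_rfl
  rw [Function.update_apply]
  split_ifs with h
  · rw [← h]; omega
  · exact this

open Classical in
/-- Add a box in row `i`, when possible. -/
def addBox (μ : YoungDiagram) (i : ℕ) : YoungDiagram :=
  if h : Addable μ i then ofRows (bump μ.rowLen i) h.antitone _ Addable.zero else ⊥

open Classical in
/-- Remove a box from row `i`, when possible. -/
def removeBox (μ : YoungDiagram) (i : ℕ) : YoungDiagram :=
  if h : Removable μ i then ofRows _ h.antitone _ Removable.zero else ⊥

theorem Addable.rowLen {μ : YoungDiagram} {i : ℕ} (h : Addable μ i) :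
    (addBox μ i).rowLen = bump μ.rowLen i := by
  rw [addBox, dif_pos h, rowLen_ofRows]

theorem Removable.rowLen {μ : YoungDiagram} {i : ℕ} (h : Removable μ i) :
    (removeBox μ i).rowLen = Function.update μ.rowLen i (μ.rowLen i - 1) := by
  rw [removeBox, dif_pos h, rowLen_ofRows]

theorem Removable.bump {μ : YoungDiagram} {i : ℕ} (h : Removable μ i) :
    bump (removeBox μ i).rowLen i = μ.rowLen := by
  unfold Removable at h
  rw [SpinVertex.bump, Removable.rowLen h]
  simp only [Function.update_self, Function.update_idem]
  rw [Nat.sub_add_cancel (by omega), Function.update_eq_self]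

theorem Removable.rowLen_self {μ : YoungDiagram} {i : ℕ} (h : Removable μ i) :
    (removeBox μ i).rowLen i + 1 = μ.rowLen i := by
  have := congrFun h.bump i
  rwa [SpinVertex.bump, Function.update_self] at this

theorem Removable.rowLen_ne {μ : YoungDiagram} {i j : ℕ} (h : Removable μ i) (hj : j ≠ i) :
    (removeBox μ i).rowLen j = μ.rowLen j := by
  rw [Removable.rowLen h, Function.update_of_ne hj]

theorem Addable.rowLen_self {μ : YoungDiagram} {i : ℕ} (h : Addable μ i) :
    (addBox μ i).rowLen i = μ.rowLen i + 1 := by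
  rw [Addable.rowLen h, SpinVertex.bump, Function.update_self]

theorem Addable.rowLen_ne {μ : YoungDiagram} {i j : ℕ} (h : Addable μ i) (hj : j ≠ i) :
    (addBox μ i).rowLen j = μ.rowLen j := by
  rw [Addable.rowLen h, SpinVertex.bump, Function.update_of_ne hj]

theorem Removable.addable {μ : YoungDiagram} {i : ℕ} (h : Removable μ i) :
    Addable (removeBox μ i) i := fun j hj => by
  rw [h.rowLen_self, h.rowLen_ne (by omega)]
  exact rowLen_antitone μ hj.le

theorem Removable.addBox {μ : YoungDiagram} {i : ℕ} (h : Removable μ i) :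
    addBox (removeBox μ i) i = μ :=
  rowLen_injective (by rw [h.addable.rowLen, h.bump])

theorem card_of_bump {lam μ : YoungDiagram} {i : ℕ} (h : lam.rowLen = bump μ.rowLen i) :
    lam.card = μ.card + 1 := by
  obtain ⟨M, hM⟩ := exists_rowLen_eq_zero μ
  have hN : μ.rowLen (M + i + 1) = 0 := rowLen_eq_zero_of_le hM (by omega)
  have hi : i ∈ range (M + i + 1) := by simp
  rw [card_eq_sum_rowLen μ hN, card_eq_sum_rowLen (N := M + i + 1) lam (by
    rw [h, bump, Function.update_of_ne (by omega), hN]), ← add_sum_erase _ _ hi,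
    ← add_sum_erase _ μ.rowLen hi, h, bump, Function.update_self,
    sum_congr rfl fun j hj => by rw [Function.update_of_ne (ne_of_mem_erase hj)]]
  exact Nat.add_right_comm _ _ _

theorem Addable.card {μ : YoungDiagram} {i : ℕ} (h : Addable μ i) :
    (SpinVertex.addBox μ i).card = μ.card + 1 := card_of_bump h.rowLen

theorem Removable.card {μ : YoungDiagram} {i : ℕ} (h : Removable μ i) :
    (SpinVertex.removeBox μ i).card + 1 = μ.card := (card_of_bump h.bump.symm).symm

theorem Addable.interlaces {μ : YoungDiagram} {i : ℕ} (h : Addable μ i) :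
    Interlaces (SpinVertex.addBox μ i) μ := fun j => by
  have h1 := rowLen_antitone μ (Nat.le_succ j)
  constructor
  · by_cases hj : j = i
    · subst hj; rw [h.rowLen_self]; omega
    · rw [h.rowLen_ne hj]
  · by_cases hj : j + 1 = i
    · rw [hj, h.rowLen_self]; exact h j (by omega)
    · rw [h.rowLen_ne hj]; exact h1

theorem Removable.interlaces {μ : YoungDiagram} {i : ℕ} (h : Removable μ i) :
    Interlaces μ (SpinVertex.removeBox μ i) := by
  have := h.addable.interlaces
  rwa [h.addBox] at this

/-- A skew diagram with one box consists of an addable box. -/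
theorem Interlaces.exists_addBox {lam μ : YoungDiagram} (h : Interlaces lam μ)
    (hc : lam.card = μ.card + 1) : ∃ i, Addable μ i ∧ addBox μ i = lam := by
  obtain ⟨N, hN⟩ := exists_rowLen_eq_zero lam
  have hN' := h.rowLen_eq_zero hN
  rw [card_eq_sum_rowLen lam hN, card_eq_sum_rowLen μ hN'] at hc
  obtain ⟨i, hi, hlt⟩ : ∃ i ∈ range N, μ.rowLen i < lam.rowLen i := by
    by_contra! hcon
    have := sum_le_sum hcon
    omega
  have hadd : Addable μ i := fun j hj => Nat.succ_le_of_lt (hlt.trans_le (RowInterlaces.le_of_lt h hj))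
  refine ⟨i, hadd, rowLen_injective ?_⟩
  rw [hadd.rowLen]
  rw [← add_sum_erase _ _ hi, ← add_sum_erase _ μ.rowLen hi] at hc
  have hle : ∑ j ∈ (range N).erase i, μ.rowLen j ≤ ∑ j ∈ (range N).erase i, lam.rowLen j :=
    sum_le_sum fun j _ => (h j).1
  have heq := (sum_eq_sum_iff_of_le (s := (range N).erase i) fun j _ => (h j).1).1 (by omega)
  funext j
  by_cases hj : j = i
  · subst hj; rw [bump, Function.update_self]; omega
  · rw [bump, Function.update_of_ne hj]
    by_cases hjN : j < N
    · exact heq j (by simp [hj, hjN])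
    · rw [rowLen_eq_zero_of_le hN (not_lt.1 hjN), rowLen_eq_zero_of_le hN' (not_lt.1 hjN)]

theorem Addable.removable {μ : YoungDiagram} {i : ℕ} (h : Addable μ i) :
    Removable (SpinVertex.addBox μ i) i := by
  rw [Removable, h.rowLen_self, h.rowLen_ne (by omega)]
  exact Nat.lt_succ_of_le (rowLen_antitone μ (Nat.le_succ i))

theorem Addable.removeBox {μ : YoungDiagram} {i : ℕ} (h : Addable μ i) :
    SpinVertex.removeBox (SpinVertex.addBox μ i) i = μ := by
  refine rowLen_injective ?_
  rw [Removable.rowLen h.removable, h.rowLen_self, h.rowLen]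
  simp

theorem Interlaces.exists_removeBox {lam μ : YoungDiagram} (h : Interlaces lam μ)
    (hc : lam.card = μ.card + 1) : ∃ i, Removable lam i ∧ removeBox lam i = μ := by
  obtain ⟨i, hi, rfl⟩ := h.exists_addBox hc
  exact ⟨i, hi.removable, hi.removeBox⟩

theorem Addable.lt {μ : YoungDiagram} {i N : ℕ} (h : Addable μ i) (hN : μ.rowLen N = 0) :
    i ≤ N := by
  by_contra hi
  have := h N (by omega)
  omega

theorem Removable.lt {μ : YoungDiagram} {i N : ℕ} (h : Removable μ i) (hN : μ.rowLen N = 0) :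
    i < N := by
  by_contra hi
  unfold Removable at h
  have := rowLen_eq_zero_of_le hN (not_lt.1 hi)
  omega

theorem addBox_injOn (μ : YoungDiagram) : Set.InjOn (addBox μ) {i | Addable μ i} := by
  intro i hi j hj h
  by_contra hij
  have h1 := congrArg (fun ν => ν.rowLen i) h
  simp only [Addable.rowLen_self hi, Addable.rowLen_ne hj hij] at h1
  omega

theorem removeBox_injOn (μ : YoungDiagram) : Set.InjOn (removeBox μ) {i | Removable μ i} := by
  intro i hi j hj h
  by_contra hij
  have h1 := congrArg (fun ν => ν.rowLen i) h
  have h2 := Removable.rowLen_self hi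
  simp only [Removable.rowLen_ne hj hij] at h1
  omega

theorem finite_card_eq (n : ℕ) : {μ : YoungDiagram | μ.card = n}.Finite := by
  refine Set.Finite.of_finite_image (f := YoungDiagram.cells) ?_ fun μ _ ν _ h => by
    ext c; rw [h]
  refine Set.Finite.subset ((range n ×ˢ range n).powerset.finite_toSet) ?_
  rintro _ ⟨μ, hμ, rfl⟩
  have hμ : μ.card = n := hμ
  rw [mem_coe, mem_powerset]
  rintro ⟨i, j⟩ hc
  rw [YoungDiagram.mem_cells] at hc
  simp only [mem_product, mem_range]
  constructor
  · have h1 : μ.col j ⊆ μ.cells := filter_subset _ _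
    have h2 := YoungDiagram.mem_iff_lt_colLen.1 hc
    rw [YoungDiagram.colLen_eq_card] at h2
    exact h2.trans_le (hμ ▸ card_le_card h1)
  · have h1 : μ.row i ⊆ μ.cells := filter_subset _ _
    have h2 := YoungDiagram.mem_iff_lt_rowLen.1 hc
    rw [YoungDiagram.rowLen_eq_card] at h2
    exact h2.trans_le (hμ ▸ card_le_card h1)

/-! ### Stable branching coefficients -/

theorem triProd_succ (q t : K) (N : ℕ) (u v : ℕ → ℕ) :
    triProd q t (N + 1) u v =
      triProd q t N u v * ∏ i ∈ range (N + 1), arcFactor q t (N - i) (u i - v N) := by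
  rw [triProd, prod_range_succ, triProd]

/-- With one more row each of the four products gains the factors of index `j = N`. There `m N` and
`l (N + 1)` are zero, so numerator and denominator gain the same ones. -/
theorem MulIndep.branch_succ (h : MulIndep q t) {N : ℕ} (hm : m N = 0) (hl : l (N + 1) = 0) :
    branch q t (N + 1) l m = branch q t N l m := by
  have n1 : ∀ u : ℕ → ℕ, ∏ i ∈ range (N + 1), arcFactor q t (N - i) (u i - 0) ≠ 0 := fun u =>
    prod_ne_zero_iff.2 fun _ _ => h.arcFactor_ne _ _
  rw [branch, branch, triProd_succ, triProd_succ, triProd_succ, triProd_succ, hm, hl]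
  have t1 := h.triProd_ne N l m
  have t2 := h.triProd_ne N m fun i => l (i + 1)
  have t3 := n1 l
  have t4 := n1 m
  field_simp

theorem MulIndep.branch_stable (h : MulIndep q t) {lam μ : YoungDiagram} {M N : ℕ} (hMN : M ≤ N)
    (hμ : μ.rowLen M = 0) (hl : lam.rowLen (M + 1) = 0) :
    branch q t N lam.rowLen μ.rowLen = branch q t M lam.rowLen μ.rowLen := by
  induction N, hMN using Nat.le_induction with
  | base => rfl
  | succ N hN ih =>
    rw [h.branch_succ (rowLen_eq_zero_of_le hμ hN) (rowLen_eq_zero_of_le hl (by omega)), ih]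

theorem MulIndep.rowNorm_succ (h : MulIndep q t) {N : ℕ} (hl : l N = 0) (hl' : l (N + 1) = 0) :
    rowNorm q t (N + 1) l = rowNorm q t N l := by
  have n1 : ∀ u : ℕ → ℕ, ∏ i ∈ range (N + 1), arcFactor q t (N - i) (u i - 0) ≠ 0 := fun u =>
    prod_ne_zero_iff.2 fun _ _ => h.arcFactor_ne _ _
  rw [rowNorm, rowNorm, triProd_succ, triProd_succ, hl, hl', mul_div_mul_right _ _ (n1 l)]

theorem MulIndep.rowNorm_stable (h : MulIndep q t) {lam : YoungDiagram} {M N : ℕ} (hMN : M ≤ N)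
    (hl : lam.rowLen M = 0) :
    rowNorm q t N lam.rowLen = rowNorm q t M lam.rowLen := by
  induction N, hMN using Nat.le_induction with
  | base => rfl
  | succ N hN ih =>
    rw [h.rowNorm_succ (rowLen_eq_zero_of_le hl hN) (rowLen_eq_zero_of_le hl (by omega)), ih]

open Classical in
/-- The branching coefficient `ψ_{λ/μ}`. -/
def psi (q t : K) (lam μ : YoungDiagram) : K :=
  if Interlaces lam μ then branch q t (μ.colLen 0) lam.rowLen μ.rowLen else 0

/-- The norm `b_λ = ⟨Q_λ, Q_λ⟩`. -/
def bNorm (q t : K) (lam : YoungDiagram) : K := rowNorm q t (lam.colLen 0) lam.rowLen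

theorem psi_of_not {lam μ : YoungDiagram} (h : ¬ Interlaces lam μ) : psi q t lam μ = 0 :=
  if_neg h

theorem MulIndep.psi_eq (h : MulIndep q t) {lam μ : YoungDiagram} (hlm : Interlaces lam μ) {N : ℕ}
    (hN : μ.rowLen N = 0) : psi q t lam μ = branch q t N lam.rowLen μ.rowLen := by
  rw [psi, if_pos hlm]
  have h0 : μ.rowLen (μ.colLen 0) = 0 := (rowLen_eq_zero_iff _ _).2 le_rfl
  exact (h.branch_stable ((rowLen_eq_zero_iff _ _).1 hN) h0 (hlm.rowLen_succ_eq_zero h0)).symm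

theorem MulIndep.bNorm_eq (h : MulIndep q t) {lam : YoungDiagram} {N : ℕ}
    (hN : lam.rowLen N = 0) : bNorm q t lam = rowNorm q t N lam.rowLen :=
  (h.rowNorm_stable ((rowLen_eq_zero_iff _ _).1 hN) ((rowLen_eq_zero_iff _ _).2 le_rfl)).symm

theorem MulIndep.bNorm_ne (h : MulIndep q t) (lam : YoungDiagram) : bNorm q t lam ≠ 0 :=
  h.rowNorm_ne _ _

theorem MulIndep.psi_ne (h : MulIndep q t) {lam μ : YoungDiagram} (hlm : Interlaces lam μ) :
    psi q t lam μ ≠ 0 := by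
  rw [psi, if_pos hlm]; exact h.branch_ne _ _ _

theorem MulIndep.branch_self (h : MulIndep q t) (N : ℕ) (l : ℕ → ℕ) : branch q t N l l = 1 :=
  div_self (mul_ne_zero (h.triProd_ne _ _ _) (h.triProd_ne _ _ _))

theorem MulIndep.psi_self (h : MulIndep q t) (μ : YoungDiagram) : psi q t μ μ = 1 := by
  rw [psi, if_pos (interlaces_refl μ), h.branch_self]

end

section

variable {l m : ℕ → ℕ}

/-! ### One-box transitions between Young diagrams -/

theorem rowLen_succ_le (μ : YoungDiagram) (i : ℕ) : μ.rowLen (i + 1) ≤ μ.rowLen i :=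
  rowLen_antitone μ (Nat.le_succ i)

/-- The dual branching coefficient `φ_{λ/μ} = ψ_{λ/μ} b_λ / b_μ`. -/
def phi (q t : K) (lam μ : YoungDiagram) : K := psi q t lam μ * bNorm q t lam / bNorm q t μ

open Classical in
/-- The contribution of the path `μ → μ + i → λ`. -/
def upTerm (q t : K) (lam μ : YoungDiagram) (i : ℕ) : K :=
  if Addable μ i then psi q t lam (addBox μ i) * psi q t (addBox μ i) μ else 0

open Classical in
/-- The contribution of the path `μ → λ - i → λ`. -/
def downTerm (q t : K) (lam μ : YoungDiagram) (i : ℕ) : K :=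
  if Removable lam i then psi q t lam (removeBox lam i) * psi q t (removeBox lam i) μ else 0

open Classical in
/-- The contribution of the path `μ → λ + i → λ`. -/
def addTerm (q t : K) (lam μ : YoungDiagram) (i : ℕ) : K :=
  if Addable lam i then phi q t (addBox lam i) lam * psi q t (addBox lam i) μ else 0

open Classical in
/-- The contribution of the path `μ → μ - i → λ`. -/
def remTerm (q t : K) (lam μ : YoungDiagram) (i : ℕ) : K :=
  if Removable μ i then psi q t lam (removeBox μ i) * phi q t μ (removeBox μ i) else 0

theorem MulIndep.phi_eq (h : MulIndep q t) {lam μ : YoungDiagram} (hlm : Interlaces lam μ) {N : ℕ}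
    (hN : lam.rowLen N = 0) :
    phi q t lam μ = branch q t N lam.rowLen μ.rowLen * rowNorm q t N lam.rowLen /
      rowNorm q t N μ.rowLen := by
  rw [phi, h.psi_eq hlm (hlm.rowLen_eq_zero hN), h.bNorm_eq hN,
    h.bNorm_eq (hlm.rowLen_eq_zero hN)]

/-- If the rows `i` of λ and μ agree, the added box sticks out of λ and the path does not exist; the
coefficient vanishes at the same time because the two nodes coincide. -/
theorem MulIndep.upTerm_eq (h : MulIndep q t) {lam μ : YoungDiagram} (hlm : Interlaces lam μ)
    {N i : ℕ} (hN : lam.rowLen N = 0) (hi : i < N) :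
    upTerm q t lam μ i =
      psi q t lam μ * upCoef q t N (node q t μ.rowLen) (node q t lam.rowLen) i := by
  have hN' := hlm.rowLen_eq_zero hN
  rcases (hlm i).1.lt_or_eq with hlt | heq
  · have ha : Addable μ i := fun j hj => by
      have := RowInterlaces.le_of_lt hlm hj; omega
    have hI : Interlaces lam (addBox μ i) := fun j => by
      by_cases hj : j = i
      · subst hj; rw [ha.rowLen_self]; have := hlm j; omega
      · rw [ha.rowLen_ne hj]; exact hlm j
    rw [upTerm, if_pos ha, h.psi_eq hI (hI.rowLen_eq_zero hN), h.psi_eq ha.interlaces hN',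
      h.psi_eq hlm hN', ha.rowLen, mul_comm (branch _ _ _ lam.rowLen _),
      h.branch_mul_branch_up hlm hi hlt (by rw [hN, hN'])]
  · rw [upCoef_eq_zero q t hi (by rw [node, node, heq]), mul_zero, upTerm]
    split_ifs with ha
    · rw [psi_of_not (fun hI => ?_), zero_mul]
      have := (hI i).1
      rw [ha.rowLen_self] at this
      omega
    · rfl

theorem MulIndep.downTerm_eq (h : MulIndep q t) {lam μ : YoungDiagram} (hlm : Interlaces lam μ)
    {N i : ℕ} (hN : lam.rowLen N = 0) (hi : i < N) :
    downTerm q t lam μ i =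
      psi q t lam μ * downCoef q t N (node q t μ.rowLen) (node q t lam.rowLen) i := by
  have hN' := hlm.rowLen_eq_zero hN
  rcases (hlm i).1.lt_or_eq with hlt | heq
  · have ha : Removable lam i := (hlm i).2.trans_lt hlt
    have hs := ha.rowLen_self
    have hI : Interlaces (removeBox lam i) μ := fun j => by
      have h1 := hlm j
      constructor
      · by_cases hj : j = i
        · subst hj; omega
        · rw [ha.rowLen_ne hj]; exact h1.1
      · by_cases hj : j + 1 = i
        · rw [hj] at h1 ⊢; omega
        · rw [ha.rowLen_ne hj]; exact h1.2
    have key := h.branch_mul_branch_down (N := N) (a := i) (l := (removeBox lam i).rowLen)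
      (m := μ.rowLen) (rowLen_antitone _) (by rw [ha.bump]; exact hlm) hi (by omega)
    rw [ha.bump] at key
    rw [downTerm, if_pos ha, h.psi_eq hI hN', h.psi_eq ha.interlaces
      (ha.interlaces.rowLen_eq_zero hN), h.psi_eq hlm hN', mul_comm, key]
  · rw [downCoef_eq_zero q t hi (by rw [node, node, heq]), mul_zero, downTerm]
    split_ifs with ha
    · rw [psi_of_not (lam := removeBox lam i) (fun hI => ?_), mul_zero]
      have := (hI i).1
      have := ha.rowLen_self
      omega
    · rfl

theorem MulIndep.addTerm_eq (h : MulIndep q t) {lam μ : YoungDiagram} (hlm : Interlaces lam μ)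
    {M i : ℕ} (hM : lam.rowLen M = 0) (hi : i ≤ M + 1) :
    addTerm q t lam μ i = psi q t lam μ *
      addCoef q t (M + 1) (node q t μ.rowLen) (node q t lam.rowLen) i := by
  have hN : lam.rowLen (M + 1) = 0 := rowLen_eq_zero_of_le hM (by omega)
  have hN' := hlm.rowLen_eq_zero hN
  by_cases h2 : ∀ j, j < i → lam.rowLen i + 1 ≤ μ.rowLen j
  · have ha : Addable lam i := fun j hj => (h2 j hj).trans (hlm j).1
    have hiM : i < M + 1 := Nat.lt_succ_of_le (ha.lt hM)
    have hI : Interlaces (addBox lam i) μ := fun j => by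
      have h1 := hlm j
      constructor
      · by_cases hj : j = i
        · subst hj; rw [ha.rowLen_self]; omega
        · rw [ha.rowLen_ne hj]; exact h1.1
      · by_cases hj : j + 1 = i
        · rw [hj, ha.rowLen_self]; exact h2 j (by omega)
        · rw [ha.rowLen_ne hj]; exact h1.2
    have hA : (addBox lam i).rowLen (M + 1) = 0 := by rw [ha.rowLen_ne (by omega), hN]
    rw [addTerm, if_pos ha, h.phi_eq ha.interlaces hA, h.psi_eq hI hN', h.psi_eq hlm hN', ha.rowLen,
      h.branch_add_box hiM hlm h2]
  · push Not at h2
    obtain ⟨j, hj, hlt⟩ := h2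
    obtain ⟨k, rfl⟩ : ∃ k, i = k + 1 := ⟨i - 1, by omega⟩
    have h3 := (hlm k).2
    have h4 : μ.rowLen k ≤ μ.rowLen j := rowLen_antitone μ (by omega)
    -- The blocked row satisfies λ_{k+1} = μ_k, which in terms of nodes is `t * Y (k + 1) = X k`, a
    -- zero of the coefficient.
    rw [addCoef_eq_zero q t (i := k) (by omega) (by
      rw [node, node, show lam.rowLen (k + 1) = μ.rowLen k by omega, pow_succ]
      have := h.t_ne
      field_simp), mul_zero, addTerm]
    split_ifs with ha
    · rw [psi_of_not (lam := addBox lam _) (fun hI => ?_), mul_zero]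
      have := (hI k).2
      rw [ha.rowLen_self] at this
      omega
    · rfl

theorem MulIndep.remTerm_eq (h : MulIndep q t) {lam μ : YoungDiagram} (hlm : Interlaces lam μ)
    {N i : ℕ} (hN : lam.rowLen N = 0) (hi : i < N) :
    remTerm q t lam μ i = psi q t lam μ *
      remCoef q t N (node q t μ.rowLen) (node q t lam.rowLen) i := by
  have hN' := hlm.rowLen_eq_zero hN
  rcases (hlm i).2.lt_or_eq with hlt | heq
  · have ha : Removable μ i := (hlm (i + 1)).1.trans_lt hlt
    have hs := ha.rowLen_self
    have hI : Interlaces lam (removeBox μ i) := fun j => by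
      have h1 := hlm j
      by_cases hj : j = i
      · subst hj; omega
      · rw [ha.rowLen_ne hj]; exact h1
    have key := h.branch_remove_box (N := N) (a := i) (l := lam.rowLen)
      (m := (removeBox μ i).rowLen) hi hI (by have := (hlm i).1; omega)
    rw [ha.bump] at key
    rw [remTerm, if_pos ha, h.psi_eq hI (hI.rowLen_eq_zero hN), h.phi_eq ha.interlaces hN',
      h.psi_eq hlm hN', key]
  · rw [remCoef_eq_zero q t (i := i + 1) hi (by
      rw [node, node, ← heq, pow_succ]
      have := h.t_ne
      have := h.q_ne
      field_simp), mul_zero, remTerm]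
    split_ifs with ha
    · rw [psi_of_not (lam := lam) (fun hI => ?_), zero_mul]
      have := (hI i).2
      have := ha.rowLen_self
      omega
    · rfl

/-- Adding one box to μ in row `i` repairs the interlacing, so the only violated inequality was
λ_{i+1} ≤ μ_i, and it failed by one. -/
theorem exists_of_upTerm_ne {lam μ : YoungDiagram} (hlm : ¬ Interlaces lam μ) {i : ℕ} (hi : upTerm q t lam μ i ≠ 0) :
    lam.rowLen (i + 1) = μ.rowLen i + 1 ∧ Addable μ i ∧ Interlaces lam (addBox μ i) := by
  rw [upTerm] at hi
  split_ifs at hi with ha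
  · have hI : Interlaces lam (addBox μ i) := by
      by_contra hI; rw [psi_of_not hI, zero_mul] at hi; exact hi rfl
    refine ⟨?_, ha, hI⟩
    by_contra hne
    refine hlm fun j => ?_
    have h1 := hI j
    by_cases hj : j = i
    · subst hj; rw [ha.rowLen_self] at h1; omega
    · rwa [ha.rowLen_ne hj] at h1
  · exact absurd rfl hi

theorem exists_of_downTerm_ne {lam μ : YoungDiagram} (hlm : ¬ Interlaces lam μ) {i : ℕ}
    (hi : downTerm q t lam μ i ≠ 0) : ∃ k, i = k + 1 ∧ lam.rowLen (k + 1) = μ.rowLen k + 1 ∧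
      Removable lam (k + 1) ∧ Interlaces (removeBox lam (k + 1)) μ := by
  rw [downTerm] at hi
  split_ifs at hi with ha
  · have hI : Interlaces (removeBox lam i) μ := by
      by_contra hI; rw [psi_of_not hI, mul_zero] at hi; exact hi rfl
    by_contra hne
    refine hlm fun j => ?_
    have h1 := hI j
    have hs := ha.rowLen_self
    constructor
    · by_cases hj : j = i
      · subst hj; omega
      · rw [ha.rowLen_ne hj] at h1; exact h1.1
    · by_cases hj : j + 1 = i
      · subst hj
        by_contra hlt
        exact hne ⟨j, rfl, by omega, ha, hI⟩
      · rw [ha.rowLen_ne hj] at h1; exact h1.2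
  · exact absurd rfl hi

/-- For λ_{i+1} = μ_i + 1 this compares the step up inside the strip (λ minus its box in row i +
1)/μ with the step down inside the strip λ/(μ plus a box in row i). The factors t / q pulled out of
the two products are inverse to each other. -/
theorem MulIndep.upCoef_eq_downCoef (h : MulIndep q t) {N i : ℕ} (hi : i + 1 < N) {X Y : ℕ → K}
    {y : K} (hy : y ≠ 0) (hX : X i = t * y) (hY : Y (i + 1) = y) :
    upCoef q t N X Y i = downCoef q t N (Function.update X i (q * X i))
      (Function.update Y (i + 1) (q * Y (i + 1))) (i + 1) := by
  have hq := h.q_ne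
  have ht := h.t_ne
  have h1 := h.one_sub_q
  have h2 := h.one_sub_t
  have hs := h.s_ne
  have hi1 : i ∈ range N := by simp; omega
  have hi2 : i + 1 ∈ range N := by simpa using hi
  have e1 : ∀ j ∈ (range N).erase i, (X i - t / q * X j) / (X i - X j) =
      t / q * ((q * y - X j) / (t * y - X j)) := fun j _ => by
    rw [hX, ← mul_div_assoc]; congr 1; field_simp
  have e2 : ∀ j ∈ (range N).erase (i + 1), (X i - Y j) / (X i - t / q * Y j) =
      (t / q)⁻¹ * ((t * y - Y j) / (q * y - Y j)) := fun j _ => by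
    rw [hX, show t * y - t / q * Y j = t / q * (q * y - Y j) by field_simp]
    rw [← div_div, inv_mul_eq_div, div_right_comm]
  have e3 : ∀ j ∈ (range N).erase i, (q * y - Function.update X i (q * (t * y)) j) /
      (t / q * (q * y) - Function.update X i (q * (t * y)) j) = (q * y - X j) / (t * y - X j) :=
    fun j hj => by
      rw [Function.update_of_ne (ne_of_mem_erase hj), show t / q * (q * y) = t * y by field_simp]
  have e4 : ∀ j ∈ (range N).erase (i + 1),
      (t / q * (q * y) - Function.update Y (i + 1) (q * y) j) /
      (q * y - Function.update Y (i + 1) (q * y) j) = (t * y - Y j) / (q * y - Y j) :=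
    fun j hj => by
      rw [Function.update_of_ne (ne_of_mem_erase hj), show t / q * (q * y) = t * y by field_simp]
  rw [upCoef, downCoef, prod_congr rfl e1, ← mul_prod_erase _ _ hi2, prod_congr rfl e2]
  simp only [hX, hY, Function.update_self]
  rw [prod_congr rfl e4, ← mul_prod_erase (range N) (fun j =>
    (q * y - Function.update X i (q * (t * y)) j) /
      (t / q * (q * y) - Function.update X i (q * (t * y)) j)) hi1, prod_congr rfl e3]
  simp only [prod_mul_distrib, prod_const, card_erase_of_mem hi1, card_erase_of_mem hi2,
    card_range, Function.update_self]
  have e5 : (t * y - y) / (t * y - t / q * y) =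
      (q * y - q * (t * y)) / (t / q * (q * y) - q * (t * y)) := by
    rw [show t * y - y = y * (t - 1) by ring, show t * y - t / q * y = y * t / q * (q - 1) by
      field_simp, show q * y - q * (t * y) = q * y * (1 - t) by ring,
      show t / q * (q * y) - q * (t * y) = t * y * (1 - q) by field_simp]
    have h3 : q - 1 ≠ 0 := by rw [← neg_sub]; exact neg_ne_zero.2 h1
    field_simp
    ring
  rw [← e5]
  have e6 : (t / q) ^ (N - 1) * (t / q)⁻¹ ^ (N - 1) = 1 := by
    rw [← mul_pow, mul_inv_cancel₀ hs, one_pow]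
  linear_combination ((1 - t) / (1 - q) * ((∏ j ∈ (range N).erase i, (q * y - X j) / (t * y - X j)) *
    ((t * y - y) / (t * y - t / q * y) *
      ∏ j ∈ (range N).erase (i + 1), (t * y - Y j) / (q * y - Y j)))) * e6

theorem node_bump (q t : K) (u : ℕ → ℕ) (a : ℕ) :
    node q t (bump u a) = Function.update (node q t u) a (q * node q t u a) := by
  funext i
  by_cases hi : i = a
  · subst hi; rw [Function.update_self, node_update_self]
  · rw [Function.update_of_ne hi, node_update_of_ne _ _ _ hi]

theorem MulIndep.remCoef_eq_addCoef (h : MulIndep q t) {N i : ℕ} (hi : i < N) {X Y : ℕ → K}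
    (hy : Y i ≠ 0) (hX : X i = Y i) :
    addCoef q t N X Y i = remCoef q t N (Function.update X i (q * X i))
      (Function.update Y i (q * Y i)) i := by
  have hq := h.q_ne
  have ht := h.t_ne
  have h1 := h.one_sub_q
  have h2 := h.one_sub_t
  have hi1 : i ∈ range N := by simpa using hi
  have hi2 : i ∈ range (N + 1) := by simp; omega
  have e1 : ∀ j ∈ (range N).erase i, (t * Y i - X j) / (q * Y i - X j) =
      (t / q * (q * Y i) - Function.update X i (q * Y i) j) /
        (q * Y i - Function.update X i (q * Y i) j) := fun j hj => by
    rw [Function.update_of_ne (ne_of_mem_erase hj), show t / q * (q * Y i) = t * Y i by field_simp]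
  have e2 : ∀ j ∈ (range (N + 1)).erase i, (Y i - t / q * Y j) / (Y i - Y j) =
      (q * Y i / q - t / q * Function.update Y i (q * Y i) j) /
        (q * Y i / q - Function.update Y i (q * Y i) j) := fun j hj => by
    rw [Function.update_of_ne (ne_of_mem_erase hj), show q * Y i / q = Y i by field_simp]
  rw [addCoef, remCoef, ← mul_prod_erase _ _ hi1, prod_congr rfl e1, prod_congr rfl e2]
  simp only [hX, Function.update_self]
  rw [← mul_prod_erase (range (N + 1)) (fun j =>
    (q * Y i / q - t / q * Function.update Y i (q * Y i) j) /
        (q * Y i / q - Function.update Y i (q * Y i) j)) hi2]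
  simp only [Function.update_self]
  have e5 : (t * Y i - Y i) / (q * Y i - Y i) =
      (q * Y i / q - t / q * (q * Y i)) / (q * Y i / q - q * Y i) := by
    rw [show t * Y i - Y i = Y i * (t - 1) by ring, show q * Y i - Y i = Y i * (q - 1) by ring,
      show q * Y i / q - t / q * (q * Y i) = Y i * (1 - t) by field_simp,
      show q * Y i / q - q * Y i = Y i * (1 - q) by field_simp]
    have h3 : q - 1 ≠ 0 := by rw [← neg_sub]; exact neg_ne_zero.2 h1
    field_simp
    ring
  rw [← e5]
  ring

theorem MulIndep.branch_upCoef_ne (h : MulIndep q t) {N a : ℕ} (hlm : RowInterlaces l m)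
    (ha : a < N) (hlt : m a < l a) (hN : m N = l N) :
    upCoef q t N (node q t m) (node q t l) a ≠ 0 := fun e => by
  have := h.branch_mul_branch_up hlm ha hlt hN
  rw [e, mul_zero] at this
  exact mul_ne_zero (h.branch_ne _ _ _) (h.branch_ne _ _ _) this

/-- Off the horizontal strips, the two paths through one-box steps have equal weights. -/
theorem MulIndep.upTerm_eq_downTerm (h : MulIndep q t) {lam μ : YoungDiagram}
    (hlm : ¬ Interlaces lam μ) (i : ℕ) : upTerm q t lam μ i = downTerm q t lam μ (i + 1) := by
  have main : ∀ (_ : lam.rowLen (i + 1) = μ.rowLen i + 1) (ha : Addable μ i)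
      (hI : Interlaces lam (addBox μ i)) (hr : Removable lam (i + 1))
      (hI' : Interlaces (removeBox lam (i + 1)) μ),
      upTerm q t lam μ i = downTerm q t lam μ (i + 1) := by
    intro h0 ha hI hr hI'
    obtain ⟨M, hM⟩ := exists_rowLen_eq_zero lam
    obtain ⟨N, hNM, hNi⟩ : ∃ N, M ≤ N ∧ i + 1 < N := ⟨M + i + 2, by omega, by omega⟩
    have hN := rowLen_eq_zero_of_le hM hNM
    have hAN := hI.rowLen_eq_zero hN
    have hμN := ha.interlaces.rowLen_eq_zero hAN
    have hνN := hr.interlaces.rowLen_eq_zero hN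
    have hs := hr.rowLen_self
    have hlt : μ.rowLen i < (removeBox lam (i + 1)).rowLen i := by
      have := (hI i).1
      rw [ha.rowLen_self] at this
      rw [hr.rowLen_ne (by omega)]; omega
    -- Write ν for λ without its box in row i + 1. Both `key1` and `key2` contain ψ of ν over μ plus
    -- a box in row i; eliminating it compares the two paths from μ to λ up to the quotient of two
    -- coefficients, and `hc` says that these are equal.
    have key1 := h.branch_mul_branch_up (N := N) (a := i) hI' (by omega) hlt (by rw [hμN, hνN])
    have key2 := h.branch_mul_branch_down (N := N) (a := i + 1)
      (l := (removeBox lam (i + 1)).rowLen) (m := (addBox μ i).rowLen) (rowLen_antitone _)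
      (by rw [hr.bump]; exact hI) hNi (by
        rw [ha.rowLen_ne (by omega)]
        have := rowLen_succ_le μ i; omega)
    have hne := h.branch_upCoef_ne (N := N) (a := i) hI' (by omega) hlt (by rw [hμN, hνN])
    have hc := h.upCoef_eq_downCoef (N := N) (i := i) hNi
      (X := node q t μ.rowLen) (Y := node q t (removeBox lam (i + 1)).rowLen)
      (h.node_ne _ _) (by
        rw [node, node, show (removeBox lam (i + 1)).rowLen (i + 1) = μ.rowLen i by omega, pow_succ]
        have := h.t_ne
        field_simp) rfl
    rw [← node_bump, ← node_bump, hr.bump, ← ha.rowLen] at hc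
    rw [hr.bump, ← hc] at key2
    rw [← ha.rowLen] at key1
    rw [upTerm, downTerm, if_pos ha, if_pos hr, h.psi_eq hI hAN, h.psi_eq ha.interlaces hμN,
      h.psi_eq hr.interlaces hνN, h.psi_eq hI' hμN]
    apply mul_right_cancel₀ hne
    linear_combination (-branch q t N (addBox μ i).rowLen μ.rowLen) * key2 +
      branch q t N lam.rowLen (removeBox lam (i + 1)).rowLen * key1
  -- If either term is nonzero, its shape already forces the configuration required by `main`;
  -- otherwise both vanish.
  by_cases hu : upTerm q t lam μ i = 0
  · by_cases hd : downTerm q t lam μ (i + 1) = 0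
    · rw [hu, hd]
    · obtain ⟨k, hk, h0, hr, hI'⟩ := exists_of_downTerm_ne hlm hd
      obtain rfl : i = k := by omega
      have hs := hr.rowLen_self
      have ha : Addable μ i := fun j hj => by
        have h1 := RowInterlaces.le_of_lt hI' (show j < j + 1 by omega)
        rw [hr.rowLen_ne (by omega)] at h1
        have := rowLen_antitone lam (show j + 1 ≤ i + 1 by omega)
        omega
      refine main h0 ha (fun j => ?_) hr hI'
      have h1 := hI' j
      by_cases hj : j = i
      · subst hj
        rw [ha.rowLen_self]
        have := rowLen_succ_le lam j
        omega
      · rw [ha.rowLen_ne hj]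
        rw [hr.rowLen_ne (j := j + 1) (by omega)] at h1
        have := (hr.interlaces j).1
        omega
  · obtain ⟨h0, ha, hI⟩ := exists_of_upTerm_ne hlm hu
    have hr : Removable lam (i + 1) := by
      have h1 := (hI (i + 1)).2
      rw [ha.rowLen_ne (by omega)] at h1
      have := rowLen_succ_le μ i
      rw [Removable]; omega
    have hs := hr.rowLen_self
    refine main h0 ha hI hr fun j => ?_
    have h1 := hI j
    have h2 := (ha.interlaces j).1
    constructor
    · by_cases hj : j = i + 1
      · subst hj
        have := rowLen_succ_le μ i
        omega
      · rw [hr.rowLen_ne hj]; omega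
    · by_cases hj : j = i
      · subst hj; omega
      · rw [hr.rowLen_ne (by omega)]
        rw [ha.rowLen_ne hj] at h1; exact h1.2

theorem downTerm_zero {lam μ : YoungDiagram} (hlm : ¬ Interlaces lam μ) :
    downTerm q t lam μ 0 = 0 := by
  by_contra hne
  obtain ⟨k, hk, -⟩ := exists_of_downTerm_ne hlm hne
  omega

theorem exists_of_addTerm_ne {lam μ : YoungDiagram} (hlm : ¬ Interlaces lam μ) {i : ℕ}
    (hi : addTerm q t lam μ i ≠ 0) :
    μ.rowLen i = lam.rowLen i + 1 ∧ Addable lam i ∧ Interlaces (addBox lam i) μ := by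
  rw [addTerm] at hi
  split_ifs at hi with ha
  · have hI : Interlaces (addBox lam i) μ := by
      by_contra hI; rw [psi_of_not hI, mul_zero] at hi; exact hi rfl
    refine ⟨?_, ha, hI⟩
    by_contra hne
    refine hlm fun j => ?_
    have h1 := hI j
    have h2 := (ha.interlaces (j + 1)).1
    by_cases hj : j = i
    · subst hj; rw [ha.rowLen_self] at h1; omega
    · rw [ha.rowLen_ne hj] at h1; omega
  · exact absurd rfl hi

theorem exists_of_remTerm_ne {lam μ : YoungDiagram} (hlm : ¬ Interlaces lam μ) {i : ℕ}
    (hi : remTerm q t lam μ i ≠ 0) :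
    μ.rowLen i = lam.rowLen i + 1 ∧ Removable μ i ∧ Interlaces lam (removeBox μ i) := by
  rw [remTerm] at hi
  split_ifs at hi with ha
  · have hI : Interlaces lam (removeBox μ i) := by
      by_contra hI; rw [psi_of_not hI, zero_mul] at hi; exact hi rfl
    have hs := ha.rowLen_self
    refine ⟨?_, ha, hI⟩
    by_contra hne
    refine hlm fun j => ?_
    have h1 := hI j
    by_cases hj : j = i
    · subst hj; omega
    · rwa [ha.rowLen_ne hj] at h1
  · exact absurd rfl hi

/-- Off the horizontal strips, adding and removing a box commute. -/
theorem MulIndep.addTerm_eq_remTerm (h : MulIndep q t) {lam μ : YoungDiagram}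
    (hlm : ¬ Interlaces lam μ) (i : ℕ) : addTerm q t lam μ i = remTerm q t lam μ i := by
  have main : ∀ (_ : μ.rowLen i = lam.rowLen i + 1) (ha : Addable lam i)
      (hI : Interlaces (addBox lam i) μ) (hr : Removable μ i)
      (hI' : Interlaces lam (removeBox μ i)),
      addTerm q t lam μ i = remTerm q t lam μ i := by
    intro h0 ha hI hr hI'
    obtain ⟨M, hM⟩ := exists_rowLen_eq_zero (addBox lam i)
    obtain ⟨N, hNM, hiN⟩ : ∃ N, M ≤ N ∧ i < N := ⟨M + i + 1, by omega, by omega⟩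
    have hAN := rowLen_eq_zero_of_le hM hNM
    have hN := ha.interlaces.rowLen_eq_zero hAN
    have hμN := hI.rowLen_eq_zero hAN
    have hνN := hr.interlaces.rowLen_eq_zero hμN
    have hs := hr.rowLen_self
    -- The common quantity to be eliminated between `key1` and `key2` is ψ of the largest strip: λ
    -- with the box added over μ with the box removed.
    have key1 := h.branch_add_box (N := N) hiN hI' fun j hj => by
      rw [hr.rowLen_ne (by omega), ← h0]; exact rowLen_antitone μ hj.le
    have hI'' : RowInterlaces (addBox lam i).rowLen (removeBox μ i).rowLen := fun j => by
      have h1 := hI j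
      have h2 := (hr.interlaces j).1
      refine ⟨h2.trans h1.1, ?_⟩
      by_cases hj : j = i
      · subst hj; rw [ha.rowLen_ne (by omega)]; exact (hI' j).2
      · rw [hr.rowLen_ne hj]; exact h1.2
    have key2 := h.branch_remove_box (N := N) (a := i) hiN hI'' (by rw [ha.rowLen_self]; omega)
    have hc := h.remCoef_eq_addCoef (N := N) hiN (X := node q t (removeBox μ i).rowLen)
      (Y := node q t lam.rowLen) (h.node_ne _ _) (by
        rw [node, node, show (removeBox μ i).rowLen i = lam.rowLen i by omega])
    rw [← node_bump, ← node_bump, hr.bump, ← ha.rowLen] at hc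
    rw [hr.bump, ← hc] at key2
    rw [← ha.rowLen] at key1
    rw [addTerm, remTerm, if_pos ha, if_pos hr, h.phi_eq ha.interlaces hAN, h.psi_eq hI hμN,
      h.psi_eq hI' hνN, h.phi_eq hr.interlaces hμN]
    have hne : addCoef q t N (node q t (removeBox μ i).rowLen) (node q t lam.rowLen) i ≠ 0 :=
      fun e => by
        rw [e, mul_zero] at key1
        exact mul_ne_zero (div_ne_zero (mul_ne_zero (h.branch_ne _ _ _) (h.rowNorm_ne _ _))
          (h.rowNorm_ne _ _)) (h.branch_ne _ _ _) key1
    apply mul_right_cancel₀ hne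
    linear_combination (-(branch q t N (addBox lam i).rowLen lam.rowLen *
      rowNorm q t N (addBox lam i).rowLen / rowNorm q t N lam.rowLen)) * key2 +
      branch q t N μ.rowLen (removeBox μ i).rowLen * rowNorm q t N μ.rowLen /
        rowNorm q t N (removeBox μ i).rowLen * key1
  by_cases hu : addTerm q t lam μ i = 0
  · by_cases hd : remTerm q t lam μ i = 0
    · rw [hu, hd]
    · obtain ⟨h0, hr, hI'⟩ := exists_of_remTerm_ne hlm hd
      have hs := hr.rowLen_self
      have ha : Addable lam i := fun j hj => by
        have h1 := (hI' j).1
        have := rowLen_antitone μ hj.le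
        rw [hr.rowLen_ne (by omega)] at h1
        omega
      refine main h0 ha (fun j => ?_) hr hI'
      have h1 := hI' j
      have h2 := (hr.interlaces j).1
      have h3 := (ha.interlaces j).1
      constructor
      · by_cases hj : j = i
        · subst hj; rw [ha.rowLen_self]; omega
        · rw [hr.rowLen_ne hj] at h1; omega
      · by_cases hj : j + 1 = i
        · subst hj
          rw [ha.rowLen_self, ← h0]; exact rowLen_succ_le μ j
        · rw [ha.rowLen_ne hj]; omega
  · obtain ⟨h0, ha, hI⟩ := exists_of_addTerm_ne hlm hu
    have hr : Removable μ i := by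
      have h1 := (hI (i + 1)).1
      rw [ha.rowLen_ne (by omega)] at h1
      have := rowLen_succ_le lam i
      rw [Removable]; omega
    have hs := hr.rowLen_self
    refine main h0 ha hI hr fun j => ?_
    have h1 := hI j
    constructor
    · by_cases hj : j = i
      · subst hj; omega
      · rw [hr.rowLen_ne hj]; rw [ha.rowLen_ne hj] at h1; exact h1.1
    · by_cases hj : j = i
      · subst hj
        have := rowLen_succ_le lam j
        omega
      · rw [hr.rowLen_ne hj]
        have := (ha.interlaces (j + 1)).1
        omega

/-- The node of row `i`. -/
abbrev rowNode (q t : K) (lam : YoungDiagram) (i : ℕ) : K := node q t lam.rowLen i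

/-- First commutation identity of one-box steps with horizontal strips. -/
theorem MulIndep.sum_upTerm (h : MulIndep q t) (lam μ : YoungDiagram) {N : ℕ}
    (hl : lam.rowLen N = 0) :
    ∑ i ∈ range (N + 1), upTerm q t lam μ i = ∑ i ∈ range (N + 1), downTerm q t lam μ i := by
  by_cases hlm : Interlaces lam μ
  · have hl' : lam.rowLen (N + 1) = 0 := rowLen_eq_zero_of_le hl (by omega)
    rw [sum_congr rfl fun i hi => h.upTerm_eq hlm hl' (mem_range.1 hi),
      sum_congr rfl fun i hi => h.downTerm_eq hlm hl' (mem_range.1 hi), ← mul_sum, ← mul_sum,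
      h.sum_upCoef _ hlm]
  -- Off the strips the terms agree after a shift by one row; row 0 admits no step down, and row `N
  -- + 1` of λ is empty.
  · rw [sum_range_succ, sum_range_succ', downTerm_zero hlm, h.upTerm_eq_downTerm hlm N]
    congr 1
    · exact sum_congr rfl fun i _ => h.upTerm_eq_downTerm hlm i
    · rw [downTerm, if_neg]
      intro hr
      have := hr.lt hl
      omega

theorem MulIndep.sum_upTerm_mul (h : MulIndep q t) (lam μ : YoungDiagram) {N : ℕ}
    (hl : lam.rowLen N = 0) (hm : μ.rowLen N = 0) :
    t / q * ∑ i ∈ range (N + 1), downTerm q t lam μ i * rowNode q t lam i -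
        ∑ i ∈ range (N + 1), upTerm q t lam μ i * rowNode q t μ i =
      (1 - t) / (1 - q) * ((∑ i ∈ range N, (rowNode q t lam i - rowNode q t μ i)) *
        psi q t lam μ) := by
  by_cases hlm : Interlaces lam μ
  · have hl' : lam.rowLen (N + 1) = 0 := rowLen_eq_zero_of_le hl (by omega)
    have e1 := fun i (hi : i ∈ range (N + 1)) =>
      congrArg (· * rowNode q t lam i) (h.downTerm_eq hlm hl' (mem_range.1 hi))
    have e2 := fun i (hi : i ∈ range (N + 1)) =>
      congrArg (· * rowNode q t μ i) (h.upTerm_eq hlm hl' (mem_range.1 hi))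
    rw [sum_congr rfl e1, sum_congr rfl e2]
    simp only [mul_assoc, ← mul_sum]
    have := h.sum_upCoef_mul (N + 1) hlm
    rw [sum_range_succ (fun a => node q t lam.rowLen a - node q t μ.rowLen a), node, node, hl, hm,
      sub_self, add_zero] at this
    linear_combination psi q t lam μ * this
  · rw [psi_of_not hlm, mul_zero, mul_zero, sub_eq_zero, sum_range_succ',
      sum_range_succ _ N, downTerm_zero hlm, h.upTerm_eq_downTerm hlm N]
    have h0 : downTerm q t lam μ (N + 1) = 0 := by
      rw [downTerm, if_neg]
      intro hr
      have := hr.lt hl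
      omega
    rw [h0, zero_mul, zero_mul, add_zero, add_zero, mul_sum]
    refine sum_congr rfl fun i _ => ?_
    rw [← h.upTerm_eq_downTerm hlm i]
    by_cases hu : upTerm q t lam μ i = 0
    · rw [hu]; ring
    · obtain ⟨h0, -, -⟩ := exists_of_upTerm_ne hlm hu
      have hq := h.q_ne
      have ht := h.t_ne
      -- From λ_{i+1} = μ_i + 1, the node of λ in row i + 1 is q / t times the node of μ in row i;
      -- the prefactor t / q compensates.
      rw [rowNode, rowNode, node, node, h0, pow_succ, pow_succ]
      field_simp

theorem MulIndep.sum_addTerm (h : MulIndep q t) (lam μ : YoungDiagram) {N : ℕ}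
    (hl : lam.rowLen N = 0) (hm : μ.rowLen N = 0) :
    ∑ i ∈ range (N + 2), addTerm q t lam μ i - ∑ i ∈ range (N + 1), remTerm q t lam μ i =
      (1 - t) / (1 - q) * psi q t lam μ := by
  by_cases hlm : Interlaces lam μ
  · have hl' : lam.rowLen (N + 1) = 0 := rowLen_eq_zero_of_le hl (by omega)
    rw [sum_congr rfl fun i hi => h.addTerm_eq hlm hl (Nat.le_of_lt_succ (mem_range.1 hi)),
      sum_congr rfl fun i hi => h.remTerm_eq hlm hl' (mem_range.1 hi), ← mul_sum, ← mul_sum]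
    linear_combination psi q t lam μ * h.sum_addCoef (N + 1) hlm
  · rw [psi_of_not hlm, mul_zero, sub_eq_zero, sum_range_succ,
      sum_congr rfl fun i _ => h.addTerm_eq_remTerm hlm i, h.addTerm_eq_remTerm hlm, remTerm,
      if_neg, add_zero]
    intro hr
    have := hr.lt hm
    omega

theorem MulIndep.sum_addTerm_mul (h : MulIndep q t) (lam μ : YoungDiagram) {N : ℕ}
    (hl : lam.rowLen N = 0) (hm : μ.rowLen N = 0) :
    ∑ i ∈ range (N + 2), addTerm q t lam μ i * rowNode q t lam i -
        ∑ i ∈ range (N + 1), remTerm q t lam μ i * (rowNode q t μ i / q) =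
      (1 - t) / (1 - q) * ((∑ i ∈ range (N + 2), rowNode q t lam i -
        t⁻¹ * ∑ i ∈ range (N + 1), rowNode q t μ i) * psi q t lam μ) := by
  by_cases hlm : Interlaces lam μ
  · have hl' : lam.rowLen (N + 1) = 0 := rowLen_eq_zero_of_le hl (by omega)
    have e1 := fun i (hi : i ∈ range (N + 2)) =>
      congrArg (· * rowNode q t lam i) (h.addTerm_eq hlm hl (Nat.le_of_lt_succ (mem_range.1 hi)))
    have e2 := fun i (hi : i ∈ range (N + 1)) =>
      congrArg (· * (rowNode q t μ i / q)) (h.remTerm_eq hlm hl' (mem_range.1 hi))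
    rw [sum_congr rfl e1, sum_congr rfl e2]
    simp only [mul_assoc, ← mul_sum]
    linear_combination psi q t lam μ * h.sum_addCoef_mul (N + 1) hlm
  · rw [psi_of_not hlm, mul_zero, mul_zero, sub_eq_zero, sum_range_succ]
    have h0 : addTerm q t lam μ (N + 1) = 0 := by
      rw [h.addTerm_eq_remTerm hlm, remTerm, if_neg]
      intro hr
      have := hr.lt hm
      omega
    rw [h0, zero_mul, add_zero]
    refine sum_congr rfl fun i _ => ?_
    rw [← h.addTerm_eq_remTerm hlm i]
    by_cases hu : addTerm q t lam μ i = 0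
    · rw [hu]; ring
    · obtain ⟨h0, -, -⟩ := exists_of_addTerm_ne hlm hu
      have hq := h.q_ne
      rw [rowNode, rowNode, node, node, h0, pow_succ]
      field_simp

end

/-! ### Raising, lowering and Macdonald operators and their relations. -/

section

variable {l m : ℕ → ℕ}

/-! ### Operators on the space spanned by Young diagrams -/

/-- The space with basis the Young diagrams. -/
abbrev Fock (K : Type*) [Field K] : Type _ := YoungDiagram →₀ K

/-- The Young diagrams of a given size. -/
def level (z : ℤ) : Finset YoungDiagram := (finite_card_eq z.toNat).toFinset.filter fun μ => (μ.card : ℤ) = z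

theorem mem_level {z : ℤ} {μ : YoungDiagram} : μ ∈ level z ↔ (μ.card : ℤ) = z := by
  simp only [level, mem_filter, Set.Finite.mem_toFinset, Set.mem_ofPred_eq, and_iff_right_iff_imp]
  rintro rfl
  simp

/-- The homogeneous operator with matrix `k`. -/
def kernelOp (d : ℤ) (k : YoungDiagram → YoungDiagram → K) : Module.End K (Fock K) :=
  Finsupp.linearCombination K fun μ => ∑ lam ∈ level (μ.card + d), Finsupp.single lam (k lam μ)

/-- The diagonal operator with eigenvalues `e`. -/
def diagOp (e : YoungDiagram → K) : Module.End K (Fock K) :=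
  Finsupp.linearCombination K fun μ => Finsupp.single μ (e μ)

/-- Matrix entries of an operator. -/
def entry (A : Module.End K (Fock K)) (lam μ : YoungDiagram) : K := A (Finsupp.single μ 1) lam

theorem end_ext {A B : Module.End K (Fock K)} (h : ∀ lam μ, entry A lam μ = entry B lam μ) :
    A = B :=
  Finsupp.lhom_ext' fun μ => LinearMap.ext_ring (Finsupp.ext fun lam => h lam μ)

theorem entry_sub (A B : Module.End K (Fock K)) (lam μ : YoungDiagram) :
    entry (A - B) lam μ = entry A lam μ - entry B lam μ := rfl

theorem entry_smul (c : K) (A : Module.End K (Fock K)) (lam μ : YoungDiagram) :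
    entry (c • A) lam μ = c * entry A lam μ := rfl

theorem entry_zero (lam μ : YoungDiagram) : entry (0 : Module.End K (Fock K)) lam μ = 0 := rfl

theorem kernelOp_single (d : ℤ) (k : YoungDiagram → YoungDiagram → K) (μ : YoungDiagram) :
    kernelOp d k (Finsupp.single μ 1) =
      ∑ lam ∈ level (μ.card + d), Finsupp.single lam (k lam μ) := by
  rw [kernelOp, Finsupp.linearCombination_single, one_smul]

theorem entry_kernelOp (d : ℤ) (k : YoungDiagram → YoungDiagram → K) (lam μ : YoungDiagram) :
    entry (kernelOp d k) lam μ = if (lam.card : ℤ) = μ.card + d then k lam μ else 0 := by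
  classical
  rw [entry, kernelOp_single, Finsupp.finsetSum_apply]
  simp only [Finsupp.single_apply]
  rw [sum_ite_eq' (level (μ.card + d)) lam (fun κ => k κ μ)]
  simp only [mem_level]

theorem entry_mul_kernelOp (A : Module.End K (Fock K)) (d : ℤ)
    (k : YoungDiagram → YoungDiagram → K) (lam μ : YoungDiagram) :
    entry (A * kernelOp d k) lam μ = ∑ κ ∈ level (μ.card + d), entry A lam κ * k κ μ := by
  rw [entry, Module.End.mul_apply, kernelOp_single, map_sum, Finsupp.finsetSum_apply]
  refine sum_congr rfl fun κ _ => ?_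
  rw [← mul_one (k κ μ), ← smul_eq_mul, ← Finsupp.smul_single, map_smul, Finsupp.smul_apply,
    smul_eq_mul, smul_eq_mul, mul_one, mul_comm, entry]

theorem entry_kernelOp_mul (d e : ℤ) (k k' : YoungDiagram → YoungDiagram → K)
    (lam μ : YoungDiagram) :
    entry (kernelOp d k * kernelOp e k') lam μ = if (lam.card : ℤ) = μ.card + e + d then
      ∑ κ ∈ level (μ.card + e), k lam κ * k' κ μ else 0 := by
  rw [entry_mul_kernelOp]
  split_ifs with h
  · exact sum_congr rfl fun κ hκ => by rw [entry_kernelOp, if_pos (by rw [mem_level.1 hκ, h])]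
  · exact sum_eq_zero fun κ hκ => by
      rw [entry_kernelOp, if_neg (by rw [mem_level.1 hκ]; exact h), zero_mul]

theorem diagOp_apply (e : YoungDiagram → K) (f : Fock K) (lam : YoungDiagram) :
    diagOp e f lam = e lam * f lam := by
  classical
  induction f using Finsupp.induction_linear with
  | zero => simp
  | add f g hf hg => rw [map_add, Finsupp.add_apply, hf, hg, Finsupp.add_apply, mul_add]
  | single μ c =>
    rw [diagOp, Finsupp.linearCombination_single, Finsupp.smul_apply, Finsupp.single_apply,
      Finsupp.single_apply]
    split_ifs with h
    · subst h; rw [smul_eq_mul, mul_comm]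
    · simp

theorem diagOp_single (e : YoungDiagram → K) (μ : YoungDiagram) :
    diagOp e (Finsupp.single μ 1) = e μ • Finsupp.single μ 1 := by
  rw [diagOp, Finsupp.linearCombination_single, one_smul, Finsupp.smul_single, smul_eq_mul, mul_one]

theorem entry_diagOp_comm (e : YoungDiagram → K) (A : Module.End K (Fock K))
    (lam μ : YoungDiagram) :
    entry (diagOp e * A - A * diagOp e) lam μ = (e lam - e μ) * entry A lam μ := by
  rw [entry_sub, entry, entry, Module.End.mul_apply, Module.End.mul_apply, diagOp_apply,
    diagOp_single, map_smul, Finsupp.smul_apply, smul_eq_mul, entry, sub_mul]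

-- A matrix product with a one-box operator sums over all diagrams of the right size; only one-box
-- strips contribute, so it becomes a sum over rows, to which the residue identities apply.
open Classical in
theorem sum_level_up {μ : YoungDiagram} {N : ℕ} (hN : μ.rowLen N = 0) (g : YoungDiagram → K)
    (hg : ∀ κ, ¬ Interlaces κ μ → g κ = 0) {z : ℤ} (hz : z = μ.card + 1) :
    ∑ κ ∈ level z, g κ = ∑ i ∈ range (N + 1), if Addable μ i then g (addBox μ i) else 0 := by
  rw [← sum_filter]
  symm
  rw [← sum_image (g := addBox μ) (f := g) fun i hi j hj e => addBox_injOn μ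
    (by simpa using (mem_filter.1 hi).2) (by simpa using (mem_filter.1 hj).2) e]
  refine sum_subset (fun κ hκ => ?_) fun κ hκ hκ' => hg κ fun hI => hκ' ?_
  · obtain ⟨i, hi, rfl⟩ := mem_image.1 hκ
    rw [mem_level, (mem_filter.1 hi).2.card, hz]; push_cast; rfl
  · rw [mem_level] at hκ
    obtain ⟨i, hi, rfl⟩ := hI.exists_addBox (by omega)
    exact mem_image_of_mem _ (mem_filter.2 ⟨mem_range.2 (Nat.lt_succ_of_le (hi.lt hN)), hi⟩)

open Classical in
theorem sum_level_down {lam : YoungDiagram} {N : ℕ} (hN : lam.rowLen N = 0) (g : YoungDiagram → K)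
    (hg : ∀ κ, ¬ Interlaces lam κ → g κ = 0) {z : ℤ} (hz : z + 1 = lam.card) :
    ∑ κ ∈ level z, g κ =
      ∑ i ∈ range (N + 1), if Removable lam i then g (removeBox lam i) else 0 := by
  rw [← sum_filter]
  symm
  rw [← sum_image (g := removeBox lam) (f := g) fun i hi j hj e => removeBox_injOn lam
    (by simpa using (mem_filter.1 hi).2) (by simpa using (mem_filter.1 hj).2) e]
  refine sum_subset (fun κ hκ => ?_) fun κ hκ hκ' => hg κ fun hI => hκ' ?_
  · obtain ⟨i, hi, rfl⟩ := mem_image.1 hκ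
    rw [mem_level]
    have := (mem_filter.1 hi).2.card
    omega
  · rw [mem_level] at hκ
    obtain ⟨i, hi, rfl⟩ := hI.exists_removeBox (by omega)
    exact mem_image_of_mem _ (mem_filter.2 ⟨mem_range.2 ((hi.lt hN).trans (Nat.lt_succ_self _)), hi⟩)

/-- The operator adding horizontal strips of size `r`. -/
def raiseOp (q t : K) (r : ℤ) : Module.End K (Fock K) := kernelOp r (psi q t)

/-- The operator removing horizontal strips of size `r`. -/
def lowerOp (q t : K) (r : ℤ) : Module.End K (Fock K) := kernelOp (-r) fun lam μ => phi q t μ lam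

/-- The eigenvalues of the Macdonald operator. -/
def eig (q t : K) (μ : YoungDiagram) : K :=
  (t ^ μ.colLen 0)⁻¹ + (1 - t⁻¹) * ∑ i ∈ range (μ.colLen 0), rowNode q t μ i

/-- An extra empty row adds (1 - t⁻¹) t^{-M}, exactly the loss in passing from t^{-M} to t^{-(M+1)}.
Two diagrams can thus be compared with a common number of rows. -/
theorem eig_eq (ht : t ≠ 0) {μ : YoungDiagram} {N : ℕ} (hN : μ.rowLen N = 0) :
    eig q t μ = (t ^ N)⁻¹ + (1 - t⁻¹) * ∑ i ∈ range N, rowNode q t μ i := by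
  have key : ∀ M, μ.colLen 0 ≤ M →
      eig q t μ = (t ^ M)⁻¹ + (1 - t⁻¹) * ∑ i ∈ range M, rowNode q t μ i := fun M hM => by
    induction M, hM using Nat.le_induction with
    | base => rfl
    | succ M hM ih =>
      rw [ih, sum_range_succ, rowNode, node, (rowLen_eq_zero_iff μ M).2 hM, pow_succ]
      field_simp
      ring
  exact key N ((rowLen_eq_zero_iff μ N).1 hN)

/-- The Macdonald operator. -/
def macOp (q t : K) : Module.End K (Fock K) := diagOp (eig q t)

theorem eig_of_bump (ht : t ≠ 0) {lam μ : YoungDiagram} {i : ℕ}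
    (h : lam.rowLen = bump μ.rowLen i) :
    eig q t lam - eig q t μ = (1 - t⁻¹) * ((q - 1) * rowNode q t μ i) := by
  obtain ⟨M, hM⟩ := exists_rowLen_eq_zero μ
  have hN : μ.rowLen (M + i + 1) = 0 := rowLen_eq_zero_of_le hM (by omega)
  have hi : i ∈ range (M + i + 1) := by simp
  rw [eig_eq ht hN, eig_eq (N := M + i + 1) ht (by
    rw [h, bump, Function.update_of_ne (by omega), hN]), ← add_sum_erase _ _ hi,
    ← add_sum_erase _ (rowNode q t μ) hi, sum_congr rfl fun j hj => by
      rw [rowNode, h, node_update_of_ne _ _ _ (ne_of_mem_erase hj)]]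
  rw [rowNode, h, node_update_self]
  change _ = (1 - t⁻¹) * ((q - 1) * node q t μ.rowLen i)
  ring_nf

theorem eig_addBox (ht : t ≠ 0) {μ : YoungDiagram} {i : ℕ} (h : Addable μ i) :
    eig q t (addBox μ i) - eig q t μ = (1 - t⁻¹) * ((q - 1) * rowNode q t μ i) :=
  eig_of_bump ht h.rowLen

theorem eig_removeBox (hq : q ≠ 0) (ht : t ≠ 0) {μ : YoungDiagram} {i : ℕ} (h : Removable μ i) :
    eig q t μ - eig q t (removeBox μ i) = (1 - t⁻¹) * ((q - 1) * (rowNode q t μ i / q)) := by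
  rw [eig_of_bump (q := q) ht h.bump.symm, rowNode, rowNode, node, node, ← h.rowLen_self, pow_succ]
  field_simp

theorem psi_eq_zero_of_lt {lam μ : YoungDiagram} (h : lam.card < μ.card) : psi q t lam μ = 0 :=
  psi_of_not fun hI => by have := hI.card_le; omega

theorem phi_of_not {lam μ : YoungDiagram} (h : ¬ Interlaces lam μ) : phi q t lam μ = 0 := by
  rw [phi, psi_of_not h, zero_mul, zero_div]

theorem raiseOp_neg {r : ℤ} (hr : r < 0) : raiseOp q t r = 0 := end_ext fun lam μ => by
  rw [raiseOp, entry_kernelOp, entry_zero]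
  split_ifs with h
  · exact psi_eq_zero_of_lt (by omega)
  · rfl

theorem lowerOp_neg {r : ℤ} (hr : r < 0) : lowerOp q t r = 0 := end_ext fun lam μ => by
  rw [lowerOp, entry_kernelOp, entry_zero]
  split_ifs with h
  · exact phi_of_not fun hI => by have := hI.card_le; omega
  · rfl

theorem MulIndep.raiseOp_zero (h : MulIndep q t) : raiseOp q t 0 = 1 := end_ext fun lam μ => by
  classical
  rw [raiseOp, entry_kernelOp, entry, Module.End.one_apply, Finsupp.single_apply]
  split_ifs with h1 h2 h2
  · rw [h2, h.psi_self]
  · exact psi_of_not fun hI => h2 (hI.eq_of_card (by omega)).symm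
  · subst h2; simp at h1
  · rfl

theorem MulIndep.lowerOp_zero (h : MulIndep q t) : lowerOp q t 0 = 1 := end_ext fun lam μ => by
  classical
  rw [lowerOp, entry_kernelOp, entry, Module.End.one_apply, Finsupp.single_apply]
  split_ifs with h1 h2 h2
  · rw [h2, phi, h.psi_self, one_mul, div_self (h.bNorm_ne _)]
  · exact phi_of_not fun hI => h2 (hI.eq_of_card (by omega))
  · subst h2; simp at h1
  · rfl

theorem exists_common_zero (lam μ : YoungDiagram) : ∃ N, lam.rowLen N = 0 ∧ μ.rowLen N = 0 := by
  obtain ⟨M, hM⟩ := exists_rowLen_eq_zero lam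
  obtain ⟨N, hN⟩ := exists_rowLen_eq_zero μ
  exact ⟨M + N, rowLen_eq_zero_of_le hM (by omega), rowLen_eq_zero_of_le hN (by omega)⟩

theorem sum_level_upTerm {lam μ : YoungDiagram} {N : ℕ} (hN : μ.rowLen N = 0) {z : ℤ}
    (hz : z = μ.card + 1) (w : YoungDiagram → K) (w' : ℕ → K)
    (hw : ∀ i, Addable μ i → w (addBox μ i) = w' i) :
    ∑ κ ∈ level z, w κ * (psi q t lam κ * psi q t κ μ) =
      ∑ i ∈ range (N + 1), upTerm q t lam μ i * w' i := by
  classical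
  rw [sum_level_up hN _ (fun κ hκ => by rw [psi_of_not hκ, mul_zero, mul_zero]) hz]
  refine sum_congr rfl fun i _ => ?_
  rw [upTerm]
  split_ifs with h
  · rw [hw i h, mul_comm]
  · rw [zero_mul]

theorem sum_level_downTerm {lam μ : YoungDiagram} {N : ℕ} (hN : lam.rowLen N = 0) {z : ℤ}
    (hz : z + 1 = lam.card) (w : YoungDiagram → K) (w' : ℕ → K)
    (hw : ∀ i, Removable lam i → w (removeBox lam i) = w' i) :
    ∑ κ ∈ level z, w κ * (psi q t lam κ * psi q t κ μ) =
      ∑ i ∈ range (N + 1), downTerm q t lam μ i * w' i := by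
  classical
  rw [sum_level_down hN _ (fun κ hκ => by rw [psi_of_not hκ, zero_mul, mul_zero]) hz]
  refine sum_congr rfl fun i _ => ?_
  rw [downTerm]
  split_ifs with h
  · rw [hw i h, mul_comm]
  · rw [zero_mul]

theorem sum_level_addTerm {lam μ : YoungDiagram} {N : ℕ} (hN : lam.rowLen N = 0) {z : ℤ}
    (hz : z = lam.card + 1) (w : YoungDiagram → K) (w' : ℕ → K)
    (hw : ∀ i, Addable lam i → w (addBox lam i) = w' i) :
    ∑ κ ∈ level z, w κ * (phi q t κ lam * psi q t κ μ) =
      ∑ i ∈ range (N + 1), addTerm q t lam μ i * w' i := by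
  classical
  rw [sum_level_up hN _ (fun κ hκ => by rw [phi_of_not hκ, zero_mul, mul_zero]) hz]
  refine sum_congr rfl fun i _ => ?_
  rw [addTerm]
  split_ifs with h
  · rw [hw i h, mul_comm]
  · rw [zero_mul]

theorem sum_level_remTerm {lam μ : YoungDiagram} {N : ℕ} (hN : μ.rowLen N = 0) {z : ℤ}
    (hz : z + 1 = μ.card) (w : YoungDiagram → K) (w' : ℕ → K)
    (hw : ∀ i, Removable μ i → w (removeBox μ i) = w' i) :
    ∑ κ ∈ level z, w κ * (psi q t lam κ * phi q t μ κ) =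
      ∑ i ∈ range (N + 1), remTerm q t lam μ i * w' i := by
  classical
  rw [sum_level_down hN _ (fun κ hκ => by rw [phi_of_not hκ, mul_zero, mul_zero]) hz]
  refine sum_congr rfl fun i _ => ?_
  rw [remTerm]
  split_ifs with h
  · rw [hw i h, mul_comm]
  · rw [zero_mul]

/-! ### Commutation relations -/

theorem diagOp_comm_kernelOp (e : YoungDiagram → K) (d : ℤ) (k : YoungDiagram → YoungDiagram → K) :
    diagOp e * kernelOp d k - kernelOp d k * diagOp e =
      kernelOp d fun lam μ => (e lam - e μ) * k lam μ := end_ext fun lam μ => by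
  rw [entry_diagOp_comm, entry_kernelOp, entry_kernelOp]
  split_ifs <;> simp

theorem kernelOp_comm_diagOp (e : YoungDiagram → K) (d : ℤ) (k : YoungDiagram → YoungDiagram → K) :
    kernelOp d k * diagOp e - diagOp e * kernelOp d k =
      kernelOp d fun lam μ => (e μ - e lam) * k lam μ := end_ext fun lam μ => by
  have := entry_diagOp_comm e (kernelOp d k) lam μ
  rw [entry_sub, entry_kernelOp] at this
  rw [entry_sub, entry_kernelOp, ← neg_sub, this]
  split_ifs <;> ring

theorem MulIndep.raiseOp_one_comm (h : MulIndep q t) (r : ℤ) :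
    raiseOp q t 1 * raiseOp q t r = raiseOp q t r * raiseOp q t 1 := end_ext fun lam μ => by
  obtain ⟨N, hl, hm⟩ := exists_common_zero lam μ
  rw [raiseOp, raiseOp, entry_kernelOp_mul, entry_kernelOp_mul, add_right_comm]
  split_ifs with hc
  · have e1 := sum_level_upTerm (q := q) (t := t) (lam := lam) hm rfl (fun _ => 1) (fun _ => 1)
      fun _ _ => rfl
    have e2 := sum_level_downTerm (q := q) (t := t) (μ := μ) hl (z := μ.card + r)
      (by rw [hc, add_right_comm]) (fun _ => 1) (fun _ => 1) fun _ _ => rfl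
    simp only [mul_one, one_mul] at e1 e2
    rw [e1, e2, h.sum_upTerm lam μ hl]
  · rfl

/-- Bracketing with D multiplies ψ_{λ/μ} by a multiple of the sum of the node differences, while [D,
G 1] weights an added box by a multiple of its node. `sum_upTerm_mul` therefore expresses [D, G r]
through [D, G 1] and G (r - 1). -/
theorem MulIndep.macOp_raiseOp (h : MulIndep q t) (r : ℤ) :
    macOp q t * raiseOp q t r - raiseOp q t r * macOp q t = ((1 - q) / (1 - t) / (q - 1)) •
      (t • ((macOp q t * raiseOp q t 1 - raiseOp q t 1 * macOp q t) * raiseOp q t (r - 1)) -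
        raiseOp q t (r - 1) * (macOp q t * raiseOp q t 1 - raiseOp q t 1 * macOp q t)) :=
  end_ext fun lam μ => by
  have hq := h.q_ne
  have ht := h.t_ne
  obtain ⟨N, hl, hm⟩ := exists_common_zero lam μ
  have h1 := h.one_sub_q
  have h2 := h.one_sub_t
  have h3 : q - 1 ≠ 0 := by rw [← neg_sub]; exact neg_ne_zero.2 h1
  simp only [macOp, raiseOp, diagOp_comm_kernelOp, entry_smul, entry_sub, entry_kernelOp_mul,
    entry_kernelOp]
  rw [show (μ.card : ℤ) + (r - 1) + 1 = μ.card + r by ring,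
    show (μ.card : ℤ) + 1 + (r - 1) = μ.card + r by ring]
  split_ifs with hc
  · have e1 := sum_level_upTerm (q := q) (t := t) (lam := lam) hm rfl
      (fun κ => eig q t κ - eig q t μ) _ fun _ hi => eig_addBox ht hi
    have e2 := sum_level_downTerm (q := q) (t := t) (μ := μ) hl (z := μ.card + (r - 1))
      (by rw [hc]; ring) (fun κ => eig q t lam - eig q t κ) _ fun _ hi => eig_removeBox hq ht hi
    have e3 := h.sum_upTerm_mul lam μ hl hm
    have e4 : eig q t lam - eig q t μ =
        (1 - t⁻¹) * ∑ i ∈ range N, (rowNode q t lam i - rowNode q t μ i) := by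
      rw [eig_eq ht hl, eig_eq ht hm, sum_sub_distrib]; ring
    have e5 : ∑ i ∈ range (N + 1), upTerm q t lam μ i *
        ((1 - t⁻¹) * ((q - 1) * rowNode q t μ i)) = (1 - t⁻¹) * (q - 1) *
          ∑ i ∈ range (N + 1), upTerm q t lam μ i * rowNode q t μ i := by
      rw [mul_sum]; exact sum_congr rfl fun _ _ => by ring
    have e6 : ∑ i ∈ range (N + 1), downTerm q t lam μ i *
        ((1 - t⁻¹) * ((q - 1) * (rowNode q t lam i / q))) = (1 - t⁻¹) * (q - 1) / q *
          ∑ i ∈ range (N + 1), downTerm q t lam μ i * rowNode q t lam i := by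
      rw [mul_sum]; exact sum_congr rfl fun _ _ => by ring
    simp only [mul_left_comm (psi q t lam _), mul_assoc (eig q t lam - _)]
    rw [e1, e2, e4, e5, e6]
    have e7 : (1 - q) / (1 - t) / (q - 1) * (q - 1) * ((1 - t) / (1 - q)) = 1 / (q - 1) * (q - 1) := by
      field_simp
    rw [one_div, inv_mul_cancel₀ h3] at e7
    generalize (1 - q) / (1 - t) / (q - 1) = c at *
    linear_combination (-(1 - t⁻¹) * c * (q - 1)) * e3 - (1 - t⁻¹) *
      (∑ i ∈ range N, (rowNode q t lam i - rowNode q t μ i)) * psi q t lam μ * e7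
  · simp

/-- Lowering after raising sums over boxes added to λ, raising after lowering over boxes removed
from μ; `sum_addTerm` evaluates the difference. -/
theorem MulIndep.lowerOp_one_raiseOp (h : MulIndep q t) (r : ℤ) :
    lowerOp q t 1 * raiseOp q t r - raiseOp q t r * lowerOp q t 1 =
      ((1 - t) / (1 - q)) • raiseOp q t (r - 1) := end_ext fun lam μ => by
  obtain ⟨N, hl, hm⟩ := exists_common_zero lam μ
  simp only [lowerOp, raiseOp, entry_smul, entry_sub, entry_kernelOp_mul, entry_kernelOp]
  rw [show (μ.card : ℤ) + -1 + r = μ.card + (r - 1) by ring,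
    show (μ.card : ℤ) + r + -1 = μ.card + (r - 1) by ring]
  split_ifs with hc
  · have e1 := sum_level_addTerm (q := q) (t := t) (μ := μ) (N := N + 1) (z := μ.card + r)
      (rowLen_eq_zero_of_le hl (Nat.le_succ N))
      (by rw [hc]; ring) (fun _ => 1) (fun _ => 1) fun _ _ => rfl
    have e2 := sum_level_remTerm (q := q) (t := t) (lam := lam) hm (z := μ.card + -1)
      (by ring) (fun _ => 1) (fun _ => 1) fun _ _ => rfl
    simp only [mul_one, one_mul] at e1 e2
    rw [e1, e2, h.sum_addTerm lam μ hl hm]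
  · simp

theorem MulIndep.lowerOp_macOp_raiseOp (h : MulIndep q t) :
    (lowerOp q t 1 * macOp q t - macOp q t * lowerOp q t 1) * raiseOp q t 1 -
      raiseOp q t 1 * (lowerOp q t 1 * macOp q t - macOp q t * lowerOp q t 1) =
      ((1 - t⁻¹) * (q - 1) * ((1 - t) / (1 - q))) • macOp q t := end_ext fun lam μ => by
  have hq := h.q_ne
  have ht := h.t_ne
  obtain ⟨N, hl, hm⟩ := exists_common_zero lam μ
  rw [macOp, lowerOp, raiseOp, kernelOp_comm_diagOp]
  simp only [entry_smul, entry_sub, entry_kernelOp_mul]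
  rw [show (μ.card : ℤ) + -1 + 1 = μ.card by ring, show (μ.card : ℤ) + 1 + -1 = μ.card by ring]
  -- A horizontal strip of size zero is trivial, so in degree 0 the identity matrix can be written
  -- with `psi`, the form in which the residue identity arrives.
  have e0 : entry (diagOp (eig q t)) lam μ = eig q t lam * psi q t lam μ * if (lam.card : ℤ) = μ.card then 1 else 0 := by
    classical
    rw [entry, diagOp_apply, Finsupp.single_apply]
    split_ifs with h1 h2 h2
    · subst h1; rw [h.psi_self]; ring
    · subst h1; exact absurd rfl h2
    · rw [psi_of_not fun hI => h1 (hI.eq_of_card (by omega)).symm]; ring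
    · ring
  rw [e0]
  split_ifs with hc
  · have e1 := sum_level_addTerm (q := q) (t := t) (μ := μ) (N := N + 1) (z := μ.card + 1)
      (rowLen_eq_zero_of_le hl (Nat.le_succ N))
      (by rw [hc]) (fun κ => eig q t κ - eig q t lam) _ fun _ hi => eig_addBox ht hi
    have e2 := sum_level_remTerm (q := q) (t := t) (lam := lam) hm (z := μ.card + -1)
      (by ring) (fun κ => eig q t μ - eig q t κ) _ fun _ hi => eig_removeBox hq ht hi
    have e3 := h.sum_addTerm_mul lam μ hl hm
    have e5 : ∑ i ∈ range (N + 2), addTerm q t lam μ i *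
        ((1 - t⁻¹) * ((q - 1) * rowNode q t lam i)) = (1 - t⁻¹) * (q - 1) *
          ∑ i ∈ range (N + 2), addTerm q t lam μ i * rowNode q t lam i := by
      rw [mul_sum]; exact sum_congr rfl fun _ _ => by ring
    have e6 : ∑ i ∈ range (N + 1), remTerm q t lam μ i *
        ((1 - t⁻¹) * ((q - 1) * (rowNode q t μ i / q))) = (1 - t⁻¹) * (q - 1) *
          ∑ i ∈ range (N + 1), remTerm q t lam μ i * (rowNode q t μ i / q) := by
      rw [mul_sum]; exact sum_congr rfl fun _ _ => by ring
    have e7 : (∑ i ∈ range (N + 2), rowNode q t lam i -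
        t⁻¹ * ∑ i ∈ range (N + 1), rowNode q t μ i) * psi q t lam μ =
        eig q t lam * psi q t lam μ := by
      by_cases hlm : lam = μ
      · subst hlm
        rw [eig_eq (N := N + 1) ht (rowLen_eq_zero_of_le hl (Nat.le_succ N)), sum_range_succ _ (N + 1),
          rowNode, node, rowLen_eq_zero_of_le hl (Nat.le_succ N)]
        ring
      · rw [psi_of_not fun hI => hlm (hI.eq_of_card (by omega)), mul_zero, mul_zero]
    rw [e7] at e3
    simp only [mul_left_comm (psi q t lam _), mul_assoc (eig q t _ - _)]
    rw [e1, e2, e5, e6]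
    linear_combination (1 - t⁻¹) * (q - 1) * e3
  · simp

end

section

variable {l m : ℕ → ℕ}

/-! ### Consequences of the commutation relations in an algebra -/

section Abstract

variable {E : Type*} [Ring E] [Algebra K E] {G H : ℤ → E} {D D₁ D₂ D' p a : E} {c : K}

/-- Bracket the relation with `p`. As `p` commutes with every `G r`, the only effect is to move `D`
to `D₁` and `D₁` to `D₂`. -/
theorem rel_succ (hc : c ≠ 0) (hpG : ∀ r, p * G r = G r * p)
    (rel : ∀ r, D * G r - t • (D₁ * G (r - 1)) = G r * D - G (r - 1) * D₁)
    (h01 : D * p - p * D = c • D₁) (h12 : D₁ * p - p * D₁ = c • D₂) (r : ℤ) :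
    D₁ * G r - t • (D₂ * G (r - 1)) = G r * D₁ - G (r - 1) * D₂ := by
  have e1 := congrArg (· * p) (rel r)
  have e2 := congrArg (p * ·) (rel r)
  have e3 := congrArg (· * G r) h01
  have e4 := congrArg (G r * ·) h01
  have e5 := congrArg (· * G (r - 1)) h12
  have e6 := congrArg (G (r - 1) * ·) h12
  have hp' : ∀ r x, p * (G r * x) = G r * (p * x) := fun r x => by
    rw [← mul_assoc, hpG, mul_assoc]
  simp only [sub_mul, mul_sub, mul_assoc, smul_mul_assoc, mul_smul_comm, hpG, hp'] at e1 e2 e3 e4 e5 e6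
  apply smul_right_injective E hc
  simp only [smul_sub, smul_comm c t, ← e3, ← e4, ← e5, ← e6]
  linear_combination (norm := module) e1 - e2

/-- Bracket the relation with `a`. Besides moving `D₁` to `D` and `D` to `D'`, this lowers the index
of `G`, and these extra terms form the relation at `r - 1`, which is subtracted. -/
theorem rel_pred (ht : t ≠ 0) (hc : c ≠ 0) (haG : ∀ r, a * G r - G r * a = G (r - 1))
    (rel : ∀ r, D * G r - t • (D₁ * G (r - 1)) = G r * D - G (r - 1) * D₁)
    (h0 : a * D - D * a = (c * t⁻¹) • D') (h1 : a * D₁ - D₁ * a = (c * t⁻¹) • D) (r : ℤ) :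
    D' * G r - t • (D * G (r - 1)) = G r * D' - G (r - 1) * D := by
  have e1 := congrArg (· * a) (rel r)
  have e2 := congrArg (a * ·) (rel r)
  have e3 := congrArg (· * G r) h0
  have e4 := congrArg (G r * ·) h0
  have e5 := congrArg (· * G (r - 1)) h1
  have e6 := congrArg (G (r - 1) * ·) h1
  have e7 := rel (r - 1)
  have ha : ∀ r, a * G r = G r * a + G (r - 1) := fun r => by rw [← haG r]; abel
  have ha' : ∀ r x, a * (G r * x) = G r * (a * x) + G (r - 1) * x := fun r x => by
    rw [← mul_assoc, ha, add_mul, mul_assoc]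
  simp only [sub_mul, mul_sub, mul_assoc, smul_mul_assoc, mul_smul_comm, ha, ha', mul_add] at e1 e2 e3 e4 e5 e6
  apply smul_right_injective E (mul_ne_zero hc (inv_ne_zero ht))
  simp only [smul_sub, smul_comm (c * t⁻¹) t, ← e3, ← e4, ← e5, ← e6]
  linear_combination (norm := module) e2 - e1 - e7

/-- Carrying `D` through both factors leaves only products of smaller total index. The right-hand
side is symmetric in `r` and `s` as soon as those products commute. -/
theorem op_mul_raise_raise
    (rel : ∀ r, D * G r - t • (D₁ * G (r - 1)) = G r * D - G (r - 1) * D₁)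
    (rel₁ : ∀ r, D₁ * G r - t • (D₂ * G (r - 1)) = G r * D₁ - G (r - 1) * D₂) (r s : ℤ) :
    D * (G r * G s) - G r * G s * D =
      t • (D₁ * (G (r - 1) * G s + G r * G (s - 1))) - (t * t) • (D₂ * (G (r - 1) * G (s - 1))) -
        (G r * G (s - 1) + G (r - 1) * G s) * D₁ + G (r - 1) * G (s - 1) * D₂ := by
  have e1 := congrArg (· * G s) (rel r)
  have e2 := congrArg (G r * ·) (rel s)
  have e3 := congrArg (G (r - 1) * ·) (rel₁ s)
  have e4 := congrArg (· * G (s - 1)) (rel₁ r)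
  simp only [sub_mul, mul_sub, mul_assoc, smul_mul_assoc, mul_smul_comm, add_mul, mul_add] at *
  linear_combination (norm := module) e1 + e2 - e3 - t • e4

/-- Arranged to have the same shape as `op_mul_raise_lower`, so that a formula reordering `H` and
`G` at smaller indices makes the two brackets comparable. -/
theorem op_mul_lower_raise
    (rel : ∀ r, D * G r - t • (D₁ * G (r - 1)) = G r * D - G (r - 1) * D₁)
    (rel' : ∀ r, D' * G r - t • (D * G (r - 1)) = G r * D' - G (r - 1) * D)
    (arel : ∀ s, H s * D - H (s - 1) * D' = D * H s - t⁻¹ • (D' * H (s - 1)))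
    (arel₁ : ∀ s, H s * D₁ - H (s - 1) * D = D₁ * H s - t⁻¹ • (D * H (s - 1))) (ht : t ≠ 0)
    (r s : ℤ) :
    D * (H s * G r) - H s * G r * D = t • (D₁ * (H s * G (r - 1))) - D * (H (s - 1) * G (r - 1)) -
      H s * G (r - 1) * D₁ - H (s - 1) * G r * D' + H (s - 1) * G (r - 1) * D +
        t⁻¹ • (D' * (H (s - 1) * G r)) := by
  have e1 := congrArg (· * G r) (arel s)
  have e2 := congrArg (H s * ·) (rel r)
  have e3 := congrArg (H (s - 1) * ·) (rel' r)
  have e4 := congrArg (· * G (r - 1)) (arel₁ s)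
  simp only [sub_mul, mul_sub, mul_assoc, smul_mul_assoc, mul_smul_comm] at *
  have e5 := congrArg (t • ·) e4
  simp only [smul_sub, smul_smul, mul_inv_cancel₀ ht, one_smul] at e5
  linear_combination (norm := module) e2 - e1 - e3 + e5

theorem op_mul_raise_lower
    (rel : ∀ r, D * G r - t • (D₁ * G (r - 1)) = G r * D - G (r - 1) * D₁)
    (rel' : ∀ r, D' * G r - t • (D * G (r - 1)) = G r * D' - G (r - 1) * D)
    (arel : ∀ s, H s * D - H (s - 1) * D' = D * H s - t⁻¹ • (D' * H (s - 1)))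
    (arel₁ : ∀ s, H s * D₁ - H (s - 1) * D = D₁ * H s - t⁻¹ • (D * H (s - 1))) (ht : t ≠ 0)
    (r s : ℤ) :
    D * (G r * H s) - G r * H s * D = t • (D₁ * (G (r - 1) * H s)) - D * (G (r - 1) * H (s - 1)) -
      G (r - 1) * H s * D₁ - G r * H (s - 1) * D' + G (r - 1) * H (s - 1) * D +
        t⁻¹ • (D' * (G r * H (s - 1))) := by
  have e1 := congrArg (· * H s) (rel r)
  have e2 := congrArg (G r * ·) (arel s)
  have e3 := congrArg (· * H (s - 1)) (rel' r)
  have e4 := congrArg (G (r - 1) * ·) (arel₁ s)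
  simp only [sub_mul, mul_sub, mul_assoc, smul_mul_assoc, mul_smul_comm] at *
  have e5 := congrArg (t⁻¹ • ·) e3
  simp only [smul_sub, smul_smul, inv_mul_cancel₀ ht, one_smul] at e5
  linear_combination (norm := module) e1 - e2 + e4 - e5

end Abstract

/-! ### The bilinear form and degrees -/

/-- The symmetric form in which the Young diagrams are orthogonal with norms `b_λ`. -/
def fockForm (q t : K) : Fock K →ₗ[K] Fock K →ₗ[K] K :=
  Finsupp.linearCombination K fun μ => bNorm q t μ • Finsupp.lapply μ

theorem fockForm_single (μ : YoungDiagram) (f : Fock K) :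
    fockForm q t (Finsupp.single μ 1) f = bNorm q t μ * f μ := by
  rw [fockForm, Finsupp.linearCombination_single, one_smul, LinearMap.smul_apply, smul_eq_mul,
    Finsupp.lapply_apply]

theorem fockForm_apply (f g : Fock K) :
    fockForm q t f g = f.sum fun μ c => c * (bNorm q t μ * g μ) := by
  rw [fockForm, Finsupp.linearCombination_apply, LinearMap.finsupp_sum_apply]
  rfl

theorem fockForm_comm (f g : Fock K) : fockForm q t f g = fockForm q t g f := by
  classical
  rw [fockForm_apply, fockForm_apply, Finsupp.sum_of_support_subset _ (subset_union_left (s₂ := g.support)) _ (by simp),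
    Finsupp.sum_of_support_subset _ (subset_union_right (s₁ := f.support)) _ (by simp)]
  exact sum_congr rfl fun _ _ => by ring

/-- `B` is adjoint to `A` for the form. -/
abbrev IsAdj (q t : K) (A B : Module.End K (Fock K)) : Prop :=
  LinearMap.IsAdjointPair (fockForm q t) (fockForm q t) A B

theorem isAdj_iff {A B : Module.End K (Fock K)} :
    IsAdj q t A B ↔ ∀ lam μ, bNorm q t μ * entry A μ lam = bNorm q t lam * entry B lam μ := by
  constructor
  · intro h lam μ
    have := h (Finsupp.single lam 1) (Finsupp.single μ 1)
    rwa [fockForm_comm, fockForm_single, fockForm_single] at this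
  · intro h
    rw [IsAdj, LinearMap.isAdjointPair_iff_comp_eq_compl₂]
    refine Finsupp.lhom_ext' fun lam => LinearMap.ext_ring (Finsupp.lhom_ext' fun μ =>
      LinearMap.ext_ring ?_)
    have := h lam μ
    simp only [LinearMap.comp_apply, Finsupp.lsingle_apply, LinearMap.compl₂_apply]
    rw [fockForm_comm, fockForm_single, fockForm_single]
    exact this

theorem IsAdj.unique (h : MulIndep q t) {A B B' : Module.End K (Fock K)} (h1 : IsAdj q t A B)
    (h2 : IsAdj q t A B') : B = B' := end_ext fun lam μ =>
  mul_left_cancel₀ (h.bNorm_ne lam) ((isAdj_iff.1 h1 lam μ).symm.trans (isAdj_iff.1 h2 lam μ))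

theorem MulIndep.isAdj_raiseOp (h : MulIndep q t) (r : ℤ) :
    IsAdj q t (raiseOp q t r) (lowerOp q t r) := isAdj_iff.2 fun lam μ => by
  rw [raiseOp, lowerOp, entry_kernelOp, entry_kernelOp, phi]
  have := h.bNorm_ne lam
  by_cases hc : (μ.card : ℤ) = lam.card + r
  · rw [if_pos hc, if_pos (by omega)]; field_simp
  · rw [if_neg hc, if_neg (by omega), mul_zero, mul_zero]

theorem MulIndep.isAdj_lowerOp (h : MulIndep q t) (r : ℤ) :
    IsAdj q t (lowerOp q t r) (raiseOp q t r) := isAdj_iff.2 fun lam μ =>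
  (isAdj_iff.1 (h.isAdj_raiseOp r) μ lam).symm

theorem entry_diagOp (e : YoungDiagram → K) (lam μ : YoungDiagram) :
    entry (diagOp e) lam μ = e μ * entry 1 lam μ := by
  rw [entry, diagOp_single]; rfl

theorem isAdj_macOp : IsAdj q t (macOp q t) (macOp q t) := isAdj_iff.2 fun lam μ => by
  classical
  rw [macOp, entry_diagOp, entry_diagOp, entry, entry, Module.End.one_apply, Module.End.one_apply,
    Finsupp.single_apply, Finsupp.single_apply]
  by_cases hlm : lam = μ
  · subst hlm; rfl
  · rw [if_neg hlm, if_neg (Ne.symm hlm)]; simp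

theorem IsAdj.sub {A B A' B' : Module.End K (Fock K)} (h1 : IsAdj q t A A') (h2 : IsAdj q t B B') :
    IsAdj q t (A - B) (A' - B') := LinearMap.IsAdjointPair.sub h1 h2

theorem IsAdj.smul {A A' : Module.End K (Fock K)} (c : K) (h1 : IsAdj q t A A') :
    IsAdj q t (c • A) (c • A') := LinearMap.IsAdjointPair.smul c h1

theorem IsAdj.mul {A B A' B' : Module.End K (Fock K)} (h1 : IsAdj q t A A') (h2 : IsAdj q t B B') :
    IsAdj q t (A * B) (B' * A') := LinearMap.IsAdjointPair.mul h1 h2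

theorem MulIndep.lowerOp_raiseOp_one (h : MulIndep q t) (r : ℤ) :
    lowerOp q t r * raiseOp q t 1 - raiseOp q t 1 * lowerOp q t r =
      ((1 - t) / (1 - q)) • lowerOp q t (r - 1) := by
  have h1 := ((h.isAdj_lowerOp 1).mul (h.isAdj_raiseOp r)).sub
    ((h.isAdj_raiseOp r).mul (h.isAdj_lowerOp 1))
  rw [h.lowerOp_one_raiseOp r] at h1
  exact h1.unique h ((h.isAdj_raiseOp (r - 1)).smul _)

/-- Jacobi identity: [H, G] is a scalar, so the brackets with H and with G commute. -/
theorem jacobi_of_comm {E : Type*} [Ring E] [Algebra K E] {H D G : E} {k : K}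
    (h : H * G - G * H = k • 1) :
    H * (D * G - G * D) - (D * G - G * D) * H = (H * D - D * H) * G - G * (H * D - D * H) := by
  have e1 := congrArg (D * ·) h
  have e2 := congrArg (· * D) h
  simp only [sub_mul, mul_sub, mul_assoc, smul_mul_assoc, mul_smul_comm, mul_one, one_mul] at *
  linear_combination (norm := module) e1 - e2

/-- The commutation relations of raising and lowering elements with a Macdonald element and its
companions. -/
theorem exists_companions_of_adj {E : Type*} [Ring E] [Algebra K E] {G H : ℤ → E} {D : E} {κ : K}
    (adj : E → E → Prop) (unique : ∀ a b b', adj a b → adj a b' → b = b')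
    (sub : ∀ a b a' b', adj a a' → adj b b' → adj (a - b) (a' - b'))
    (smul : ∀ (c : K) a a', adj a a' → adj (c • a) (c • a'))
    (mul : ∀ a b a' b', adj a a' → adj b b' → adj (a * b) (b' * a'))
    (aG : ∀ r, adj (G r) (H r)) (aH : ∀ r, adj (H r) (G r)) (aD : adj D D)
    (hq : q - 1 ≠ 0) (ht : t ≠ 0) (hκ : κ ≠ 0) (hG : G 0 = 1)
    (key1 : ∀ r, G 1 * G r = G r * G 1)
    (key2 : ∀ r, D * G r - G r * D = (κ / (q - 1)) •
      (t • ((D * G 1 - G 1 * D) * G (r - 1)) - G (r - 1) * (D * G 1 - G 1 * D)))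
    (key3 : ∀ r, H 1 * G r - G r * H 1 = κ⁻¹ • G (r - 1))
    (key4 : (H 1 * D - D * H 1) * G 1 - G 1 * (H 1 * D - D * H 1) =
      ((q - 1) * t⁻¹ * ((q - 1) / κ ^ 2)) • D) :
    ∃ D₁ D₂ D' : E,
    (∀ r, D * G r - t • (D₁ * G (r - 1)) = G r * D - G (r - 1) * D₁) ∧
    (∀ r, D₁ * G r - t • (D₂ * G (r - 1)) = G r * D₁ - G (r - 1) * D₂) ∧
    (∀ r, D' * G r - t • (D * G (r - 1)) = G r * D' - G (r - 1) * D) ∧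
    (∀ s, H s * D - H (s - 1) * D' = D * H s - t⁻¹ • (D' * H (s - 1))) ∧
    (∀ s, H s * D₁ - H (s - 1) * D = D₁ * H s - t⁻¹ • (D * H (s - 1))) := by
  have key5 := jacobi_of_comm (D := D) (k := κ⁻¹) (by rw [key3 1, sub_self, hG])
  -- The companions play the role of neighbouring modes of a current whose zero mode is `D`: `D₁`
  -- and `D₂` follow it and come from brackets with `G 1`, while `D'` precedes it and comes from a
  -- bracket with `H 1`. The constant is the one in `key2`.
  set D₁ := (κ / (q - 1)) • (D * G 1 - G 1 * D) with hD₁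
  set D₂ := (κ / (q - 1)) • (D₁ * G 1 - G 1 * D₁) with hD₂
  set D' := (t * (κ / (q - 1))) • (H 1 * D - D * H 1) with hD'
  have hcomm : ∀ r, (κ • G 1) * G r = G r * (κ • G 1) := fun r => by
    rw [smul_mul_assoc, key1, mul_smul_comm]
  have rel : ∀ r, D * G r - t • (D₁ * G (r - 1)) = G r * D - G (r - 1) * D₁ := fun r => by
    have := key2 r
    rw [hD₁, smul_mul_assoc, mul_smul_comm]
    rw [smul_sub, smul_comm (κ / (q - 1)) t] at this
    linear_combination (norm := module) this
  have aD₁ : adj D₁ (t⁻¹ • D') := by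
    have := smul (κ / (q - 1)) _ _ (sub _ _ _ _ (mul _ _ _ _ aD (aG 1)) (mul _ _ _ _ (aG 1) aD))
    rwa [hD', smul_smul, ← mul_assoc, inv_mul_cancel₀ ht, one_mul]
  have aD' : adj D' (t • D₁) := by
    have := smul (t * (κ / (q - 1))) _ _ (sub _ _ _ _ (mul _ _ _ _ (aH 1) aD) (mul _ _ _ _ aD (aH 1)))
    rwa [hD₁, smul_smul]
  -- `rel_pred` needs [H 1, D₁] to be a multiple of `D`. The Jacobi identity `key5` turns it into
  -- [[H 1, D], G 1], which `key4` evaluates.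
  have rel' : ∀ r, D' * G r - t • (D * G (r - 1)) = G r * D' - G (r - 1) * D :=
    rel_pred (a := κ • H 1) (c := q - 1) ht hq (fun r => by
      rw [smul_mul_assoc, mul_smul_comm, ← smul_sub, key3, smul_smul, mul_inv_cancel₀ hκ, one_smul])
      rel (by
        rw [hD', smul_smul, smul_mul_assoc, mul_smul_comm, ← smul_sub]
        congr 1
        field_simp) (by
        rw [hD₁, smul_mul_assoc, mul_smul_comm, smul_mul_assoc, mul_smul_comm,
          smul_comm κ (κ / (q - 1)), ← smul_sub, ← smul_sub, key5, key4, smul_smul, smul_smul]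
        congr 1
        field_simp)
  refine ⟨D₁, D₂, D', rel, rel_succ (c := q - 1) hq hcomm rel ?_ ?_, rel', fun s => ?_, fun s => ?_⟩
  · rw [hD₁, smul_smul, smul_mul_assoc, mul_smul_comm, ← smul_sub]
    congr 1
    field_simp
  · rw [hD₂, smul_smul, mul_smul_comm, smul_mul_assoc κ (G 1), ← smul_sub]
    congr 1
    field_simp
  -- The relations for `H` are the adjoints of those for `G`, with `D₁` and `t⁻¹ • D'` exchanged.
  · have e1 := sub _ _ _ _ (mul _ _ _ _ aD (aG s)) (smul t _ _ (mul _ _ _ _ aD₁ (aG (s - 1))))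
    have e2 := sub _ _ _ _ (mul _ _ _ _ (aG s) aD) (mul _ _ _ _ (aG (s - 1)) aD₁)
    rw [rel s] at e1
    have := unique _ _ _ e1 e2
    rwa [mul_smul_comm, smul_smul, mul_inv_cancel₀ ht, one_smul, smul_mul_assoc] at this
  · have e1 := sub _ _ _ _ (mul _ _ _ _ aD' (aG s)) (smul t _ _ (mul _ _ _ _ aD (aG (s - 1))))
    have e2 := sub _ _ _ _ (mul _ _ _ _ (aG s) aD') (mul _ _ _ _ (aG (s - 1)) aD)
    rw [rel' s] at e1
    have := congrArg (t⁻¹ • ·) (unique _ _ _ e1 e2)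
    simp only [mul_smul_comm, smul_mul_assoc, smul_sub, smul_smul, inv_mul_cancel₀ ht,
      one_smul] at this
    exact this

theorem MulIndep.exists_companions (h : MulIndep q t) : ∃ D₁ D₂ D' : Module.End K (Fock K),
    (∀ r, macOp q t * raiseOp q t r - t • (D₁ * raiseOp q t (r - 1)) =
      raiseOp q t r * macOp q t - raiseOp q t (r - 1) * D₁) ∧
    (∀ r, D₁ * raiseOp q t r - t • (D₂ * raiseOp q t (r - 1)) =
      raiseOp q t r * D₁ - raiseOp q t (r - 1) * D₂) ∧
    (∀ r, D' * raiseOp q t r - t • (macOp q t * raiseOp q t (r - 1)) =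
      raiseOp q t r * D' - raiseOp q t (r - 1) * macOp q t) ∧
    (∀ s, lowerOp q t s * macOp q t - lowerOp q t (s - 1) * D' =
      macOp q t * lowerOp q t s - t⁻¹ • (D' * lowerOp q t (s - 1))) ∧
    (∀ s, lowerOp q t s * D₁ - lowerOp q t (s - 1) * macOp q t =
      D₁ * lowerOp q t s - t⁻¹ • (macOp q t * lowerOp q t (s - 1))) := by
  have ht := h.t_ne
  have h1 := h.one_sub_q
  have h2 := h.one_sub_t
  have h3 : q - 1 ≠ 0 := by rw [← neg_sub]; exact neg_ne_zero.2 h1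
  refine exists_companions_of_adj (E := Module.End K (Fock K)) (κ := (1 - q) / (1 - t)) (IsAdj q t)
    (fun a b b' => IsAdj.unique h) (fun a b a' b' => IsAdj.sub) (fun c a a' => IsAdj.smul c)
    (fun a b a' b' => IsAdj.mul) h.isAdj_raiseOp h.isAdj_lowerOp isAdj_macOp h3 ht
    (div_ne_zero h1 h2) h.raiseOp_zero h.raiseOp_one_comm h.macOp_raiseOp ?_ ?_
  · intro r
    rw [inv_div]
    exact h.lowerOp_one_raiseOp r
  · have e : (q - 1) * t⁻¹ * ((q - 1) / ((1 - q) / (1 - t)) ^ 2) =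
        (1 - t⁻¹) * (q - 1) * ((1 - t) / (1 - q)) := by
      field_simp
      ring
    rw [e]
    exact h.lowerOp_macOp_raiseOp

theorem op_comm_raise_raise {E : Type*} [Ring E] [Algebra K E] {G : ℤ → E} {D D₁ D₂ : E}
    (rel : ∀ r, D * G r - t • (D₁ * G (r - 1)) = G r * D - G (r - 1) * D₁)
    (rel₁ : ∀ r, D₁ * G r - t • (D₂ * G (r - 1)) = G r * D₁ - G (r - 1) * D₂) {r s : ℤ}
    (h1 : G (r - 1) * G s = G s * G (r - 1)) (h2 : G r * G (s - 1) = G (s - 1) * G r)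
    (h3 : G (r - 1) * G (s - 1) = G (s - 1) * G (r - 1)) :
    D * (G r * G s - G s * G r) = (G r * G s - G s * G r) * D := by
  have e1 := op_mul_raise_raise rel rel₁ r s
  have e2 := op_mul_raise_raise rel rel₁ s r
  rw [h1, h2, h3] at e1
  rw [mul_sub, sub_mul, sub_eq_sub_iff_sub_eq_sub, e1, e2, add_comm (G (s - 1) * G r)]

/-- The bracket of `D` with either side of the reordering formula involves the index pairs (r-1, s),
(r, s-1) and (r-1, s-1) only. If the formula holds for these, the two brackets agree and the defect
commutes with `D`. -/
theorem op_comm_lower_raise {E : Type*} [Ring E] [Algebra K E] {G H : ℤ → E} {D D₁ D' : E}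
    (rel : ∀ r, D * G r - t • (D₁ * G (r - 1)) = G r * D - G (r - 1) * D₁)
    (rel' : ∀ r, D' * G r - t • (D * G (r - 1)) = G r * D' - G (r - 1) * D)
    (arel : ∀ s, H s * D - H (s - 1) * D' = D * H s - t⁻¹ • (D' * H (s - 1)))
    (arel₁ : ∀ s, H s * D₁ - H (s - 1) * D = D₁ * H s - t⁻¹ • (D * H (s - 1))) (ht : t ≠ 0)
    (f : ℕ → K) (N : ℕ) {r s : ℤ}
    (h1 : H s * G (r - 1) = ∑ j ∈ range N, f j • (G (r - 1 - j) * H (s - j)))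
    (h2 : H (s - 1) * G r = ∑ j ∈ range N, f j • (G (r - j) * H (s - 1 - j)))
    (h3 : H (s - 1) * G (r - 1) = ∑ j ∈ range N, f j • (G (r - 1 - j) * H (s - 1 - j))) :
    D * (H s * G r - ∑ j ∈ range N, f j • (G (r - j) * H (s - j))) =
      (H s * G r - ∑ j ∈ range N, f j • (G (r - j) * H (s - j))) * D := by
  have e1 := op_mul_lower_raise rel rel' arel arel₁ ht r s
  have e2 : D * (∑ j ∈ range N, f j • (G (r - j) * H (s - j))) -
      (∑ j ∈ range N, f j • (G (r - j) * H (s - j))) * D =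
        ∑ j ∈ range N, f j • (t • (D₁ * (G (r - 1 - j) * H (s - j))) -
          D * (G (r - 1 - j) * H (s - 1 - j)) - G (r - 1 - j) * H (s - j) * D₁ -
          G (r - j) * H (s - 1 - j) * D' + G (r - 1 - j) * H (s - 1 - j) * D +
          t⁻¹ • (D' * (G (r - j) * H (s - 1 - j)))) := by
    rw [mul_sum, sum_mul, ← sum_sub_distrib]
    exact sum_congr rfl fun j _ => by
      rw [mul_smul_comm, smul_mul_assoc, ← smul_sub,
        op_mul_raise_lower rel rel' arel arel₁ ht, sub_right_comm r, sub_right_comm s]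
  rw [h1, h2, h3] at e1
  rw [mul_sub, sub_mul, sub_eq_sub_iff_sub_eq_sub, e1, e2]
  simp only [smul_add, smul_sub, sum_add_distrib, sum_sub_distrib, mul_sum, sum_mul, smul_sum,
    mul_smul_comm, smul_mul_assoc]
  simp only [smul_comm t, smul_comm t⁻¹]

end

section

variable {l m : ℕ → ℕ}

/-! ### Independence of the parameters -/

theorem aeval_ne_zero_of_algebraicIndependent [CharZero K]
    (h : AlgebraicIndependent ℚ ![q, t]) {P : MvPolynomial (Fin 2) ℚ} (hP : P ≠ 0) :
    MvPolynomial.aeval ![q, t] P ≠ 0 := fun e =>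
  hP (h (by rw [e, map_zero]))

theorem mulIndep_of_algebraicIndependent [CharZero K] (h : AlgebraicIndependent ℚ ![q, t]) :
    MulIndep q t := by
  have hq : q ≠ 0 := by
    simpa using aeval_ne_zero_of_algebraicIndependent h (MvPolynomial.X_ne_zero 0)
  have ht : t ≠ 0 := by
    simpa using aeval_ne_zero_of_algebraicIndependent h (MvPolynomial.X_ne_zero 1)
  refine ⟨hq, ht, fun a b e => ?_⟩
  have e1 : q ^ a.toNat * t ^ b.toNat = q ^ (-a).toNat * t ^ (-b).toNat := by
    have ha : a = a.toNat - (-a).toNat := by omega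
    have hb : b = b.toNat - (-b).toNat := by omega
    rw [ha, hb, zpow_sub₀ hq, zpow_sub₀ ht] at e
    simp only [zpow_natCast] at e
    field_simp at e
    exact e
  have hm : ∀ c d : ℕ, MvPolynomial.aeval ![q, t] (MvPolynomial.monomial
      (Finsupp.single (0 : Fin 2) c + Finsupp.single 1 d) (1 : ℚ)) = q ^ c * t ^ d := by
    intro c d
    rw [MvPolynomial.aeval_monomial, Finsupp.prod_add_index' (by simp) (by simp [pow_add]),
      Finsupp.prod_single_index (by simp), Finsupp.prod_single_index (by simp)]
    simp
  have e2 := h ((hm _ _).trans (e1.trans (hm _ _).symm))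
  have e3 := (MvPolynomial.monomial_left_injective one_ne_zero) e2
  have e4 := DFunLike.congr_fun e3 0
  have e5 := DFunLike.congr_fun e3 1
  simp at e4 e5
  omega

/-- Up to an additive constant and the nonzero factor (1 - t⁻¹) t^{-N}, the eigenvalue is the
polynomial ∑ q^{λ_i} t^{N-i}. The power of t names the row and the power of q its length; by
algebraic independence the value determines the polynomial. -/
theorem eig_injective [CharZero K] (h : AlgebraicIndependent ℚ ![q, t]) :
    Function.Injective (eig q t) := fun lam μ e => by
  have hM := mulIndep_of_algebraicIndependent h
  have ht := hM.t_ne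
  have h2 := hM.one_sub_t
  obtain ⟨N, hl, hm⟩ := exists_common_zero lam μ
  rw [eig_eq ht hl, eig_eq ht hm, add_right_inj] at e
  have h3 : 1 - t⁻¹ ≠ 0 := by
    intro h4
    apply h2
    rw [sub_eq_zero, eq_comm, inv_eq_one] at h4
    rw [h4, sub_self]
  have e1 := mul_left_cancel₀ h3 e
  let P (ν : YoungDiagram) : MvPolynomial (Fin 2) ℚ := ∑ i ∈ range N,
    MvPolynomial.monomial (Finsupp.single 0 (ν.rowLen i) + Finsupp.single 1 (N - i)) 1
  have hP : ∀ ν, MvPolynomial.aeval ![q, t] (P ν) = t ^ N * ∑ i ∈ range N, rowNode q t ν i := by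
    intro ν
    rw [map_sum, mul_sum]
    refine sum_congr rfl fun i hi => ?_
    rw [MvPolynomial.aeval_monomial, Finsupp.prod_add_index' (by simp) (by simp [pow_add]),
      Finsupp.prod_single_index (by simp), Finsupp.prod_single_index (by simp), rowNode, node]
    simp only [Matrix.cons_val_zero, Matrix.cons_val_one, map_one, one_mul]
    rw [pow_sub₀ _ ht (mem_range.1 hi).le]
    ring
  have e2 : P lam = P μ := h (by rw [hP, hP, e1])
  have hc : ∀ (ν : YoungDiagram) i, i < N → ∀ a, MvPolynomial.coeff
      (Finsupp.single 0 a + Finsupp.single 1 (N - i)) (P ν) = if ν.rowLen i = a then 1 else 0 := by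
    intro ν i hi a
    have : ∀ j ∈ range N, MvPolynomial.coeff (Finsupp.single 0 a + Finsupp.single 1 (N - i))
        (MvPolynomial.monomial (Finsupp.single (0 : Fin 2) (ν.rowLen j) +
          Finsupp.single 1 (N - j)) (1 : ℚ)) = if j = i then (if ν.rowLen i = a then 1 else 0)
            else 0 := by
      intro j hj
      rw [MvPolynomial.coeff_monomial]
      have hj := mem_range.1 hj
      have : (Finsupp.single (0 : Fin 2) (ν.rowLen j) + Finsupp.single 1 (N - j) =
          Finsupp.single 0 a + Finsupp.single 1 (N - i)) ↔ j = i ∧ ν.rowLen i = a := by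
        constructor
        · intro e
          have e0 := DFunLike.congr_fun e 0
          have e1 := DFunLike.congr_fun e 1
          simp at e0 e1
          have : j = i := by omega
          subst this
          exact ⟨rfl, e0⟩
        · rintro ⟨rfl, rfl⟩; rfl
      simp only [this]
      split_ifs <;> simp_all
    rw [MvPolynomial.coeff_sum, sum_congr rfl this, sum_ite_eq', if_pos (mem_range.2 hi)]
  refine rowLen_injective (funext fun i => ?_)
  by_cases hi : i < N
  · have := hc lam i hi (lam.rowLen i)
    rw [e2, hc μ i hi, if_pos rfl] at this
    by_contra hne
    rw [if_neg (Ne.symm hne)] at this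
    exact zero_ne_one this
  · rw [rowLen_eq_zero_of_le hl (by omega), rowLen_eq_zero_of_le hm (by omega)]

/-! ### Degrees of operators -/

/-- An operator homogeneous of degree `d`. -/
def HasDegree (d : ℤ) (A : Module.End K (Fock K)) : Prop :=
  ∀ lam μ, (lam.card : ℤ) ≠ μ.card + d → entry A lam μ = 0

theorem hasDegree_kernelOp (d : ℤ) (k : YoungDiagram → YoungDiagram → K) :
    HasDegree d (kernelOp d k) := fun lam μ h => by rw [entry_kernelOp, if_neg h]

theorem entry_mul (A B : Module.End K (Fock K)) (lam μ : YoungDiagram) :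
    entry (A * B) lam μ = ∑ κ ∈ (B (Finsupp.single μ 1)).support, entry A lam κ * entry B κ μ := by
  rw [entry, Module.End.mul_apply]
  conv_lhs => rw [← Finsupp.sum_single (B (Finsupp.single μ 1)), Finsupp.sum, map_sum,
    Finsupp.finsetSum_apply]
  refine sum_congr rfl fun κ _ => ?_
  rw [← mul_one (B _ κ), ← smul_eq_mul, ← Finsupp.smul_single, map_smul, Finsupp.smul_apply,
    smul_eq_mul, mul_comm]
  rfl

theorem HasDegree.mul {d e : ℤ} {A B : Module.End K (Fock K)} (hA : HasDegree d A)
    (hB : HasDegree e B) : HasDegree (d + e) (A * B) := fun lam μ h => by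
  rw [entry_mul]
  refine sum_eq_zero fun κ _ => ?_
  by_cases hκ : (κ.card : ℤ) = μ.card + e
  · rw [hA lam κ (by omega), zero_mul]
  · rw [hB κ μ hκ, mul_zero]

theorem HasDegree.sub {d : ℤ} {A B : Module.End K (Fock K)} (hA : HasDegree d A)
    (hB : HasDegree d B) : HasDegree d (A - B) := fun lam μ h => by
  rw [entry_sub, hA _ _ h, hB _ _ h, sub_zero]

theorem HasDegree.smul {d : ℤ} (c : K) {A : Module.End K (Fock K)} (hA : HasDegree d A) :
    HasDegree d (c • A) := fun lam μ h => by
  rw [entry_smul, hA _ _ h, mul_zero]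

theorem entry_sum {ι : Type*} (s : Finset ι) (A : ι → Module.End K (Fock K)) (lam μ : YoungDiagram) :
    entry (∑ i ∈ s, A i) lam μ = ∑ i ∈ s, entry (A i) lam μ := by
  rw [entry, LinearMap.sum_apply, Finsupp.finsetSum_apply]; rfl

theorem HasDegree.sum {ι : Type*} {d : ℤ} (s : Finset ι) {A : ι → Module.End K (Fock K)}
    (hA : ∀ i ∈ s, HasDegree d (A i)) : HasDegree d (∑ i ∈ s, A i) := fun lam μ h => by
  rw [entry_sum]
  exact sum_eq_zero fun i hi => hA i hi lam μ h

theorem entry_eq_zero_of_comm (hinj : Function.Injective (eig q t)) {A : Module.End K (Fock K)}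
    (hA : macOp q t * A = A * macOp q t) {lam μ : YoungDiagram} (hne : lam ≠ μ) :
    entry A lam μ = 0 := by
  have := entry_diagOp_comm (eig q t) A lam μ
  rw [entry_sub, show diagOp (eig q t) * A = A * diagOp (eig q t) from hA, sub_self] at this
  exact (mul_eq_zero.1 this.symm).resolve_left (sub_ne_zero.2 fun e => hne (hinj e))

/-! ### Commutativity of the raising operators and normal ordering. -/

theorem MulIndep.raiseOp_comm (h : MulIndep q t) (hinj : Function.Injective (eig q t)) (r s : ℤ) :
    raiseOp q t r * raiseOp q t s = raiseOp q t s * raiseOp q t r := by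
  obtain ⟨D₁, D₂, D', rel, rel₁, -⟩ := h.exists_companions
  have key : ∀ n : ℕ, ∀ r s : ℤ, r + s < n →
      raiseOp q t r * raiseOp q t s = raiseOp q t s * raiseOp q t r := by
    intro n
    induction n with
    | zero =>
      intro r s hrs
      rcases lt_or_ge r 0 with hr | hr
      · rw [raiseOp_neg hr]; exact (zero_mul (raiseOp q t s)).trans (mul_zero (raiseOp q t s)).symm
      · rw [raiseOp_neg (r := s) (by simp at hrs; omega)]
        exact (mul_zero (raiseOp q t r)).trans (zero_mul (raiseOp q t r)).symm
    | succ n ih =>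
      intro r s hrs
      push_cast at hrs
      -- By induction on r + s the commutator of G r and G s commutes with D, hence is diagonal;
      -- being homogeneous of degree r + s it vanishes unless r + s = 0. In that case r = s or one
      -- index is negative.
      have hc := op_comm_raise_raise (E := Module.End K (Fock K)) rel rel₁ (r := r) (s := s)
        (ih _ _ (by omega)) (ih _ _ (by omega)) (ih _ _ (by omega))
      by_cases h0 : r = s
      · rw [h0]
      refine end_ext fun lam μ => sub_eq_zero.1 ?_
      rw [← entry_sub]
      by_cases hlm : lam = μ
      · subst hlm
        by_cases h1 : r + s = 0
        · have h2 : r < 0 ∨ s < 0 := by omega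
          rcases h2 with h2 | h2
          · rw [raiseOp_neg h2]
            simp [entry]
          · rw [raiseOp_neg h2]
            simp [entry]
        · refine (((hasDegree_kernelOp r _).mul (hasDegree_kernelOp s _)).sub ?_) lam lam (by omega)
          rw [add_comm]
          exact (hasDegree_kernelOp s _).mul (hasDegree_kernelOp r _)
      · exact entry_eq_zero_of_comm hinj hc hlm
  exact key (r + s + 1).toNat r s (by omega)

/-- The constant `f_r = ⟨g_r, g_r⟩`. -/
def rowConst (q t : K) (r : ℕ) : K := entry (lowerOp q t r * raiseOp q t r) ⊥ ⊥

theorem Removable.exists {μ : YoungDiagram} (h : μ ≠ ⊥) : ∃ i, Removable μ i := by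
  by_contra! hc
  have h0 : ∀ i, μ.rowLen 0 ≤ μ.rowLen i := fun i => by
    induction i with
    | zero => rfl
    | succ i ih =>
      have := hc i
      rw [Removable] at this
      omega
  obtain ⟨N, hN⟩ := exists_rowLen_eq_zero μ
  have h1 := h0 N
  refine h (rowLen_injective (funext fun i => ?_))
  have h2 := rowLen_antitone μ (Nat.zero_le i)
  have h3 : (⊥ : YoungDiagram).rowLen i = 0 := by
    rw [rowLen_eq_zero_iff, YoungDiagram.colLen_eq_card]
    simp [YoungDiagram.col]
  omega

/-- G 1 has a nonzero entry from a diagram minus a box to the diagram, so commuting with G 1 forces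
neighbouring diagonal entries to agree; every diagram is linked to the empty one in this way. -/
theorem diag_const_of_comm (h : MulIndep q t) {A : Module.End K (Fock K)}
    (hA : ∀ lam μ, lam ≠ μ → entry A lam μ = 0)
    (hp : A * raiseOp q t 1 = raiseOp q t 1 * A) (μ : YoungDiagram) :
    entry A μ μ = entry A ⊥ ⊥ := by
  have key : ∀ n, ∀ μ : YoungDiagram, μ.card = n → entry A μ μ = entry A ⊥ ⊥ := by
    intro n
    induction n with
    | zero =>
      intro μ hμ
      by_cases h0 : μ = ⊥
      · rw [h0]
      · obtain ⟨i, hi⟩ := Removable.exists h0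
        have := hi.card
        omega
    | succ n ih =>
      intro μ hμ
      have h0 : μ ≠ ⊥ := by rintro rfl; exact absurd hμ (by simp [YoungDiagram.card])
      obtain ⟨i, hi⟩ := Removable.exists h0
      have hc := hi.card
      rw [← ih (removeBox μ i) (by omega)]
      have e := congrArg (fun B => entry B μ (removeBox μ i)) hp
      have hA' : A = diagOp fun ν => entry A ν ν := end_ext fun lam ν => by
        rw [entry_diagOp]
        by_cases hlm : lam = ν
        · subst hlm; simp [entry]
        · rw [hA _ _ hlm]
          simp [entry, Ne.symm hlm]
      have e2 := entry_diagOp_comm (fun ν => entry A ν ν) (raiseOp q t 1) μ (removeBox μ i)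
      rw [← hA', entry_sub, e, sub_self, raiseOp, entry_kernelOp, if_pos (by omega)] at e2
      exact sub_eq_zero.1 ((mul_eq_zero.1 e2.symm).resolve_right (h.psi_ne hi.interlaces))
  exact key _ μ rfl

/-- Bracketing with `g` replaces `H s` by a multiple of `H (s - 1)` in both terms of the difference,
so the defect at `s` commutes with `g` once the formula holds at `s - 1`. -/
theorem lower_raise_comm_one {E : Type*} [Ring E] [Algebra K E] {G H : ℤ → E} {g : E} {k : K}
    (hH : ∀ s, H s * g - g * H s = k • H (s - 1)) (hG : ∀ r, g * G r = G r * g)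
    (f : ℕ → K) (N : ℕ) (r s : ℤ)
    (h0 : H (s - 1) * G r = ∑ j ∈ range N, f j • (G (r - j) * H (s - 1 - j))) :
    (H s * G r - ∑ j ∈ range N, f j • (G (r - j) * H (s - j))) * g =
      g * (H s * G r - ∑ j ∈ range N, f j • (G (r - j) * H (s - j))) := by
  have e1 : H s * G r * g - g * (H s * G r) = k • (H (s - 1) * G r) := by
    rw [mul_assoc, ← hG, ← mul_assoc, ← mul_assoc, ← sub_mul, hH, smul_mul_assoc]
  have e2 : (∑ j ∈ range N, f j • (G (r - j) * H (s - j))) * g -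
      g * (∑ j ∈ range N, f j • (G (r - j) * H (s - j))) =
      k • ∑ j ∈ range N, f j • (G (r - j) * H (s - 1 - j)) := by
    rw [mul_sum, sum_mul, ← sum_sub_distrib, smul_sum]
    exact sum_congr rfl fun j _ => by
      rw [mul_smul_comm, smul_mul_assoc, ← smul_sub, mul_assoc, ← mul_assoc g, hG, mul_assoc,
        ← mul_sub, hH, mul_smul_comm, smul_comm, sub_right_comm]
  rw [sub_mul, mul_sub, sub_eq_sub_iff_sub_eq_sub, e1, e2, h0]

/-- As for `raiseOp_comm`, the defect is diagonal, and homogeneous of degree r - s, so only r = s is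
left. There it commutes with G 1, hence is a scalar, and `rowConst` is defined so that this scalar
vanishes on the vacuum. The bound `s < N` ensures that no nonzero term is cut off. -/
theorem MulIndep.lowerOp_mul_raiseOp (h : MulIndep q t) (hinj : Function.Injective (eig q t))
    (N : ℕ) (r s : ℤ) (hs : s < N) :
    lowerOp q t s * raiseOp q t r =
      ∑ j ∈ range N, rowConst q t j • (raiseOp q t (r - j) * lowerOp q t (s - j)) := by
  obtain ⟨D₁, D₂, D', rel, rel₁, rel', arel, arel₁⟩ := h.exists_companions
  have key : ∀ n : ℕ, ∀ r s : ℤ, r + s < n → s < N → lowerOp q t s * raiseOp q t r =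
      ∑ j ∈ range N, rowConst q t j • (raiseOp q t (r - j) * lowerOp q t (s - j)) := by
    have hneg : ∀ r s : ℤ, r < 0 ∨ s < 0 → lowerOp q t s * raiseOp q t r =
        ∑ j ∈ range N, rowConst q t j • (raiseOp q t (r - j) * lowerOp q t (s - j)) := by
      intro r s hrs
      have hz : ∀ (a b : ℤ) (A B : Module.End K (Fock K)), A = 0 ∨ B = 0 → A * B = 0 := by
        rintro a b A B (rfl | rfl)
        · exact zero_mul B
        · exact mul_zero A
      rw [hz s r _ _ (hrs.symm.imp lowerOp_neg raiseOp_neg), sum_eq_zero fun j _ => ?_]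
      rw [hz (r - j) (s - j) _ _ (hrs.imp (fun h => raiseOp_neg (by omega))
        fun h => lowerOp_neg (by omega)), smul_zero]
    intro n
    induction n with
    | zero =>
      intro r s hrs hsN
      exact hneg r s (by simp at hrs; omega)
    | succ n ih =>
      intro r s hrs hsN
      push_cast at hrs
      by_cases h0 : r < 0 ∨ s < 0
      · exact hneg r s h0
      have hdeg : HasDegree (r - s) (lowerOp q t s * raiseOp q t r -
          ∑ j ∈ range N, rowConst q t j • (raiseOp q t (r - j) * lowerOp q t (s - j))) := by
        refine HasDegree.sub ?_ (HasDegree.sum _ fun j _ => HasDegree.smul _ ?_)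
        · have := (hasDegree_kernelOp (-s) fun lam μ => phi q t μ lam).mul
            (hasDegree_kernelOp r (psi q t))
          rwa [show -s + r = r - s by ring] at this
        · have := (hasDegree_kernelOp (r - j) (psi q t)).mul
            (hasDegree_kernelOp (-(s - j)) fun lam μ => phi q t μ lam)
          rwa [show r - j + -(s - j) = r - s by ring] at this
      have hc := op_comm_lower_raise (E := Module.End K (Fock K)) rel rel' arel arel₁ h.t_ne
        (rowConst q t) N (r := r) (s := s)
        (ih _ _ (by omega) hsN) (ih _ _ (by omega) (by omega)) (ih _ _ (by omega) (by omega))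
      have hoff : ∀ lam μ, lam ≠ μ → entry (lowerOp q t s * raiseOp q t r -
          ∑ j ∈ range N, rowConst q t j • (raiseOp q t (r - j) * lowerOp q t (s - j))) lam μ = 0 :=
        fun lam μ hne => entry_eq_zero_of_comm hinj hc hne
      refine end_ext fun lam μ => sub_eq_zero.1 ?_
      rw [← entry_sub]
      by_cases hlm : lam = μ
      · subst hlm
        by_cases hrs' : r = s
        · subst hrs'
          have hcomm := lower_raise_comm_one (E := Module.End K (Fock K)) h.lowerOp_raiseOp_one
            h.raiseOp_one_comm (rowConst q t) N r r (ih _ _ (by omega) (by omega))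
          rw [diag_const_of_comm h hoff hcomm lam, entry_sub, entry_sum]
          obtain ⟨k, rfl⟩ : ∃ k : ℕ, r = k := ⟨r.toNat, by omega⟩
          -- On the vacuum only `j = k` survives: for `j < k` the lowering operator kills it, for `j
          -- > k` the index of the raising operator is negative.
          rw [sum_eq_single_of_mem k (mem_range.2 (by omega)) fun j _ hj => ?_]
          · rw [entry_smul, sub_self, h.raiseOp_zero, h.lowerOp_zero, rowConst, sub_eq_zero]
            exact (mul_one _).symm.trans (congrArg _ (by
              rw [show (1 : Module.End K (Fock K)) * 1 = 1 from mul_one _]; simp [entry]))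
          · rw [entry_smul]
            rcases lt_or_gt_of_ne hj with hj | hj
            · rw [lowerOp, entry_mul_kernelOp, sum_eq_zero fun κ hκ => ?_, mul_zero]
              have h1 := mem_level.1 hκ
              rw [show (⊥ : YoungDiagram).card = 0 by simp [YoungDiagram.card]] at h1
              omega
            · rw [raiseOp_neg (by omega), show (0 : Module.End K (Fock K)) * _ = 0 from zero_mul _,
                entry_zero, mul_zero]
        · exact hdeg lam lam (by omega)
      · exact hoff lam μ hlm
  exact key (r + s + 1).toNat r s (by omega) hs

end

/-! ### Symmetric functions and their realization on the Fock space. -/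

section

/-! ### The Macdonald inner product and skewing operators -/

/-- The norm of the power sum monomial with exponents `m`. -/
def powNorm (q t : K) (m : ℕ+ →₀ ℕ) : K :=
  m.prod fun k e => (k : K) ^ e * (e.factorial : K) * ((1 - q ^ (k : ℕ)) / (1 - t ^ (k : ℕ))) ^ e

theorem macInner_eq_sum (f g : SymFun K) {s : Finset (ℕ+ →₀ ℕ)} (hs : f.support ⊆ s) :
    macInner q t f g = ∑ m ∈ s, f.coeff m * g.coeff m * powNorm q t m :=
  sum_subset hs fun m _ hm => by rw [MvPolynomial.notMem_support_iff.1 hm, zero_mul, zero_mul]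

theorem macInner_add_left (f f' g : SymFun K) :
    macInner q t (f + f') g = macInner q t f g + macInner q t f' g := by
  classical
  rw [macInner_eq_sum (f + f') g MvPolynomial.support_add,
    macInner_eq_sum f g subset_union_left, macInner_eq_sum f' g subset_union_right,
    ← sum_add_distrib]
  exact sum_congr rfl fun m _ => by rw [MvPolynomial.coeff_add]; ring

theorem macInner_comm (f g : SymFun K) : macInner q t f g = macInner q t g f := by
  classical
  rw [macInner_eq_sum f g (subset_union_left (s₂ := g.support)),
    macInner_eq_sum g f (subset_union_right (s₁ := f.support))]
  exact sum_congr rfl fun m _ => by ring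

theorem macInner_smul_left (c : K) (f g : SymFun K) :
    macInner q t (c • f) g = c * macInner q t f g := by
  rw [macInner_eq_sum (c • f) g MvPolynomial.support_smul, macInner_eq_sum f g Subset.rfl, mul_sum]
  exact sum_congr rfl fun m _ => by rw [MvPolynomial.coeff_smul, smul_eq_mul]; ring

theorem macInner_add_right (f g g' : SymFun K) :
    macInner q t f (g + g') = macInner q t f g + macInner q t f g' := by
  rw [macInner_comm, macInner_add_left, macInner_comm g, macInner_comm g']

theorem macInner_smul_right (c : K) (f g : SymFun K) :
    macInner q t f (c • g) = c * macInner q t f g := by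
  rw [macInner_comm, macInner_smul_left, macInner_comm g]

theorem macInner_monomial (m : ℕ+ →₀ ℕ) (a : K) (g : SymFun K) :
    macInner q t (MvPolynomial.monomial m a) g = a * g.coeff m * powNorm q t m := by
  classical
  rw [macInner_eq_sum _ g MvPolynomial.support_monomial_subset, sum_singleton,
    MvPolynomial.coeff_monomial, if_pos rfl]

theorem macInner_zero_left (g : SymFun K) : macInner q t 0 g = 0 := by
  rw [← zero_smul K (0 : SymFun K), macInner_smul_left, zero_mul]

theorem macInner_zero_right (f : SymFun K) : macInner q t f 0 = 0 := by
  rw [macInner_comm, macInner_zero_left]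

theorem macInner_sum_left {ι : Type*} (s : Finset ι) (f : ι → SymFun K) (g : SymFun K) :
    macInner q t (∑ i ∈ s, f i) g = ∑ i ∈ s, macInner q t (f i) g := by
  classical
  induction s using Finset.induction_on with
  | empty => simp [macInner_zero_left]
  | insert a s ha ih => rw [sum_insert ha, sum_insert ha, macInner_add_left, ih]

theorem macInner_sum_right {ι : Type*} (s : Finset ι) (f : SymFun K) (g : ι → SymFun K) :
    macInner q t f (∑ i ∈ s, g i) = ∑ i ∈ s, macInner q t f (g i) := by
  rw [macInner_comm, macInner_sum_left]
  exact sum_congr rfl fun i _ => macInner_comm _ _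

theorem MulIndep.pow_q_ne (h : MulIndep q t) (k : ℕ+) : 1 - q ^ (k : ℕ) ≠ 0 := by
  have := h.one_sub_ne (a := k) (b := 0) (by have := k.pos; omega)
  simpa using this

theorem MulIndep.pow_t_ne (h : MulIndep q t) (k : ℕ+) : 1 - t ^ (k : ℕ) ≠ 0 := by
  have := h.one_sub_ne (a := 0) (b := k) (by have := k.pos; omega)
  simpa using this

theorem MulIndep.powNorm_ne [CharZero K] (h : MulIndep q t) (m : ℕ+ →₀ ℕ) : powNorm q t m ≠ 0 :=
  prod_ne_zero_iff.2 fun k _ => mul_ne_zero (mul_ne_zero (pow_ne_zero _ (by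
    exact_mod_cast k.pos.ne')) (by exact_mod_cast Nat.factorial_ne_zero _))
    (pow_ne_zero _ (div_ne_zero (h.pow_q_ne k) (h.pow_t_ne k)))

theorem macInner_left_injective [CharZero K] (h : MulIndep q t) {f f' : SymFun K}
    (e : ∀ g, macInner q t f g = macInner q t f' g) : f = f' := by
  refine MvPolynomial.ext _ _ fun m => ?_
  have := e (MvPolynomial.monomial m 1)
  rw [macInner_comm, macInner_comm f', macInner_monomial, macInner_monomial, one_mul, one_mul] at this
  exact mul_right_cancel₀ (h.powNorm_ne m) this

theorem powNorm_add_single (m : ℕ+ →₀ ℕ) (k : ℕ+) :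
    powNorm q t (m + Finsupp.single k 1) = powNorm q t m *
      (k * (m k + 1) * ((1 - q ^ (k : ℕ)) / (1 - t ^ (k : ℕ)))) := by
  classical
  have h0 : ∀ i : ℕ+, (i : K) ^ 0 * ((0 : ℕ).factorial : K) *
      ((1 - q ^ (i : ℕ)) / (1 - t ^ (i : ℕ))) ^ 0 = 1 := by simp
  have hs1 : (m + Finsupp.single k 1).support ⊆ insert k m.support := fun i hi => by
    simp only [Finsupp.mem_support_iff, Finsupp.add_apply, mem_insert, Finsupp.single_apply] at hi ⊢
    by_contra hc
    push Not at hc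
    rw [if_neg (Ne.symm hc.1)] at hi
    exact hi (by omega)
  rw [powNorm, powNorm, Finsupp.prod_of_support_subset _ hs1 _ fun i _ => h0 i,
    Finsupp.prod_of_support_subset m (subset_insert k _) _ fun i _ => h0 i,
    ← mul_prod_erase _ _ (mem_insert_self k m.support),
    ← mul_prod_erase _ (fun i : ℕ+ => (i : K) ^ m i * ((m i).factorial : K) *
      ((1 - q ^ (i : ℕ)) / (1 - t ^ (i : ℕ))) ^ m i) (mem_insert_self k m.support),
    prod_congr rfl fun i hi => by
      rw [Finsupp.add_apply, Finsupp.single_eq_of_ne (ne_of_mem_erase hi), add_zero]]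
  rw [Finsupp.add_apply, Finsupp.single_eq_same, pow_succ, pow_succ, Nat.factorial_succ]
  push_cast
  ring

/-- Multiplication by a power sum is adjoint to a multiple of a partial derivative. -/
theorem macInner_X_mul (k : ℕ+) (f g : SymFun K) :
    macInner q t (MvPolynomial.X k * f) g = macInner q t f
      (((k : K) * ((1 - q ^ (k : ℕ)) / (1 - t ^ (k : ℕ)))) • MvPolynomial.pderiv k g) := by
  induction f using MvPolynomial.induction_on' with
  | monomial m a =>
    rw [MvPolynomial.X, MvPolynomial.monomial_mul, one_mul, add_comm, macInner_monomial,
      macInner_monomial, powNorm_add_single, MvPolynomial.coeff_smul, MvPolynomial.coeff_pderiv,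
      smul_eq_mul]
    ring
  | add f f' h h' => rw [mul_add, macInner_add_left, h, h', macInner_add_left]

/-- The homomorphism `p_k ↦ p_k + z ^ k`. -/
def shiftHom : SymFun K →ₐ[K] Polynomial (SymFun K) :=
  MvPolynomial.aeval fun k : ℕ+ => Polynomial.C (MvPolynomial.X k) + Polynomial.X ^ (k : ℕ)

/-- The coefficients of `shiftHom`; adjoint to multiplication by `rowFun`. -/
def shiftCoeff (r : ℕ) : SymFun K →ₗ[K] SymFun K where
  toFun f := (shiftHom f).coeff r
  map_add' f g := by rw [map_add, Polynomial.coeff_add]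
  map_smul' c f := by rw [map_smul, Polynomial.coeff_smul, RingHom.id_apply]

theorem shiftCoeff_mul (r : ℕ) (f g : SymFun K) :
    shiftCoeff r (f * g) = ∑ x ∈ antidiagonal r, shiftCoeff x.1 f * shiftCoeff x.2 g := by
  change (shiftHom (f * g)).coeff r = _
  rw [map_mul, Polynomial.coeff_mul]
  rfl

theorem shiftCoeff_one (r : ℕ) : shiftCoeff r (1 : SymFun K) = if r = 0 then 1 else 0 := by
  change (shiftHom (1 : SymFun K)).coeff r = _
  rw [map_one, Polynomial.coeff_one]

theorem shiftCoeff_zero (f : SymFun K) : shiftCoeff 0 f = f := by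
  have e : ((Polynomial.aeval (0 : SymFun K)).restrictScalars K).comp
      (shiftHom (K := K)) = AlgHom.id K _ := MvPolynomial.algHom_ext fun k => by
    simp [shiftHom]
  have e2 := DFunLike.congr_fun e f
  change (shiftHom f).coeff 0 = f
  rw [Polynomial.coeff_zero_eq_aeval_zero]
  exact e2

theorem shiftCoeff_X_mul (r : ℕ) (k : ℕ+) (f : SymFun K) :
    shiftCoeff r (MvPolynomial.X k * f) = MvPolynomial.X k * shiftCoeff r f +
      if (k : ℕ) ≤ r then shiftCoeff (r - k) f else 0 := by
  change (shiftHom (MvPolynomial.X k * f)).coeff r = _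
  rw [map_mul, shiftHom, MvPolynomial.aeval_X, ← shiftHom, add_mul, Polynomial.coeff_add,
    Polynomial.coeff_C_mul, Polynomial.coeff_X_pow_mul']
  rfl

/-- Chain rule for z d/dz, the image of p_k depending on z through z^k. The set `s₀` contains the
variables met in `f`; enlarging it adds only zero derivatives, which allows different `f` to be
combined. -/
theorem exists_derivative_shiftHom (f : SymFun K) : ∃ s₀ : Finset ℕ+, ∀ s, s₀ ⊆ s →
    Polynomial.X * Polynomial.derivative (shiftHom f) =
      ∑ k ∈ s, (k : Polynomial (SymFun K)) * Polynomial.X ^ (k : ℕ) *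
        shiftHom (MvPolynomial.pderiv k f) := by
  classical
  induction f using MvPolynomial.induction_on with
  | C a =>
    refine ⟨∅, fun s _ => ?_⟩
    rw [sum_eq_zero fun k _ => by rw [MvPolynomial.pderiv_C, map_zero, mul_zero], shiftHom,
      MvPolynomial.aeval_C, IsScalarTower.algebraMap_apply K (SymFun K) (Polynomial (SymFun K)),
      Polynomial.algebraMap_apply, Algebra.algebraMap_self, RingHom.id_apply, Polynomial.derivative_C, mul_zero]
  | add f g hf hg =>
    obtain ⟨s₁, h₁⟩ := hf
    obtain ⟨s₂, h₂⟩ := hg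
    refine ⟨s₁ ∪ s₂, fun s hs => ?_⟩
    rw [map_add, Polynomial.derivative_add, mul_add, h₁ s (subset_union_left.trans hs),
      h₂ s (subset_union_right.trans hs), ← sum_add_distrib]
    exact sum_congr rfl fun k _ => by rw [map_add, map_add, mul_add]
  | mul_X f i hf =>
    obtain ⟨s₁, h₁⟩ := hf
    refine ⟨insert i s₁, fun s hs => ?_⟩
    have h2 := h₁ s ((subset_insert _ _).trans hs)
    have hi : i ∈ s := hs (mem_insert_self _ _)
    have hX : shiftHom (MvPolynomial.X i : SymFun K) =
        Polynomial.C (MvPolynomial.X i) + Polynomial.X ^ (i : ℕ) := MvPolynomial.aeval_X _ _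
    have e : ∀ k ∈ s, (k : Polynomial (SymFun K)) * Polynomial.X ^ (k : ℕ) *
        shiftHom (MvPolynomial.pderiv k (f * MvPolynomial.X i)) =
        (k : Polynomial (SymFun K)) * Polynomial.X ^ (k : ℕ) *
          shiftHom (MvPolynomial.pderiv k f) * shiftHom (MvPolynomial.X i) +
        if i = k then (i : Polynomial (SymFun K)) * Polynomial.X ^ (i : ℕ) * shiftHom f else 0 := by
      intro k _
      rw [Derivation.leibniz, MvPolynomial.pderiv_X, Pi.single_apply, smul_eq_mul, smul_eq_mul,
        map_add, map_mul, map_mul]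
      by_cases hik : i = k
      · subst hik; rw [if_pos rfl, if_pos rfl, map_one]; ring
      · rw [if_neg hik, if_neg hik, map_zero]; ring
    rw [sum_congr rfl e, sum_add_distrib, ← sum_mul, ← h2, sum_ite_eq, if_pos hi, map_mul,
      Polynomial.derivative_mul, hX, Polynomial.derivative_add, Polynomial.derivative_C,
      Polynomial.derivative_X_pow, zero_add]
    have h3 : (Polynomial.X : Polynomial (SymFun K)) ^ (i : ℕ) =
        Polynomial.X * Polynomial.X ^ ((i : ℕ) - 1) := by
      rw [← pow_succ', Nat.sub_add_cancel i.pos]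
    rw [h3]
    simp only [map_natCast]
    ring

theorem shiftCoeff_succ (r : ℕ) (f : SymFun K) :
    ((r : K) + 1) • shiftCoeff (r + 1) f = ∑ k ∈ range (r + 1),
      ((k : K) + 1) • shiftCoeff (r - k) (MvPolynomial.pderiv k.succPNat f) := by
  classical
  obtain ⟨s₀, h⟩ := exists_derivative_shiftHom f
  have h1 := congrArg (fun P => Polynomial.coeff P (r + 1))
    (h (s₀ ∪ (range (r + 1)).image Nat.succPNat) subset_union_left)
  have h2 : ∀ (k : ℕ+) (Q : Polynomial (SymFun K)),
      ((k : Polynomial (SymFun K)) * Polynomial.X ^ (k : ℕ) * Q).coeff (r + 1) =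
        if (k : ℕ) ≤ r + 1 then (k : K) • Q.coeff (r + 1 - k) else 0 := fun k Q => by
    rw [mul_assoc, Polynomial.coeff_natCast_mul, Polynomial.coeff_X_pow_mul']
    split_ifs
    · rw [← nsmul_eq_mul, Nat.cast_smul_eq_nsmul]
    · rw [mul_zero]
  simp only [Polynomial.coeff_X_mul, Polynomial.coeff_derivative, Polynomial.finsetSum_coeff,
    h2] at h1
  rw [← sum_subset (subset_union_right (s₁ := s₀)),
    sum_image fun a _ b _ e => Nat.succPNat_injective e] at h1
  · have h3 : ((r : K) + 1) • shiftCoeff (r + 1) f = (shiftHom f).coeff (r + 1) * ((r : SymFun K) + 1) := by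
      rw [mul_comm, ← Nat.cast_succ, ← Nat.cast_succ, Nat.cast_smul_eq_nsmul, nsmul_eq_mul]
      rfl
    rw [h3, h1]
    refine sum_congr rfl fun k hk => ?_
    rw [if_pos (by simpa using Nat.lt_succ_iff.1 (mem_range.1 hk)), Nat.succPNat_coe, Nat.cast_succ,
      Nat.succ_sub_succ]
    rfl
  · intro k _ hk
    rw [if_neg]
    intro hle
    refine hk (mem_image.2 ⟨(k : ℕ) - 1, mem_range.2 (by have := k.pos; omega), ?_⟩)
    exact PNat.eq (by rw [Nat.succPNat_coe]; have := k.pos; omega)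

/-- The coefficients `(1 - t ^ k) / (1 - q ^ k)`. -/
def powWeight (q t : K) (k : ℕ) : K := (1 - t ^ k) / (1 - q ^ k)

/-- The symmetric functions `g_r`, with `r g_r = ∑ₖ (1 - t ^ k) / (1 - q ^ k) p_k g_{r - k}`. -/
def rowFun (q t : K) : ℕ → SymFun K
  | 0 => 1
  | r + 1 => ((r : K) + 1)⁻¹ • ∑ k : Fin (r + 1),
      powWeight q t (k + 1) • (MvPolynomial.X (k : ℕ).succPNat * rowFun q t (r - k))
  decreasing_by omega

theorem rowFun_zero : rowFun q t 0 = 1 := by rw [rowFun]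

theorem rowFun_succ [CharZero K] (r : ℕ) : ((r : K) + 1) • rowFun q t (r + 1) =
    ∑ k ∈ range (r + 1),
      powWeight q t (k + 1) • (MvPolynomial.X k.succPNat * rowFun q t (r - k)) := by
  rw [rowFun, smul_smul, mul_inv_cancel₀ (Nat.cast_add_one_ne_zero r), one_smul,
    Fin.sum_univ_eq_sum_range fun k =>
      powWeight q t (k + 1) • (MvPolynomial.X k.succPNat * rowFun q t (r - k))]

theorem MulIndep.powWeight_mul (h : MulIndep q t) (k : ℕ) :
    powWeight q t (k + 1) * ((k.succPNat : ℕ) * ((1 - q ^ (k.succPNat : ℕ)) /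
      (1 - t ^ (k.succPNat : ℕ)))) = (k : K) + 1 := by
  have h1 := h.pow_q_ne k.succPNat
  have h2 := h.pow_t_ne k.succPNat
  rw [Nat.succPNat_coe] at *
  rw [powWeight]
  push_cast
  field_simp

/-- Multiplication by p_k has adjoint k (1 - q^k)/(1 - t^k) ∂/∂p_k. The weight (1 - t^k)/(1 - q^k)
in Newton's recursion for g_r leaves k ∂/∂p_k, which is the recursion `shiftCoeff_succ` of the shift
coefficients. -/
theorem MulIndep.macInner_rowFun_mul [CharZero K] (h : MulIndep q t) (r : ℕ) (f g : SymFun K) :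
    macInner q t (rowFun q t r * f) g = macInner q t f (shiftCoeff r g) := by
  induction r using Nat.strong_induction_on generalizing g with
  | _ r ih =>
    rcases r with _ | r
    · rw [rowFun_zero, one_mul, shiftCoeff_zero]
    · have hr : ((r : K) + 1) ≠ 0 := Nat.cast_add_one_ne_zero r
      apply mul_left_cancel₀ hr
      rw [← macInner_smul_left, ← macInner_smul_right, shiftCoeff_succ, ← smul_mul_assoc,
        rowFun_succ, sum_mul, macInner_sum_left, macInner_sum_right]
      refine sum_congr rfl fun k hk => ?_
      rw [smul_mul_assoc, mul_assoc, macInner_smul_left, macInner_X_mul, macInner_smul_right,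
        ih _ (by have := mem_range.1 hk; omega), ← mul_assoc, h.powWeight_mul, macInner_smul_right]

/-- The constants `(t; q)_r / (q; q)_r`. -/
def qBinom (q t : K) (r : ℕ) : K := ∏ k ∈ range r, (1 - t * q ^ k) / (1 - q ^ (k + 1))

theorem MulIndep.qBinom_succ (h : MulIndep q t) (r : ℕ) :
    qBinom q t (r + 1) * (1 - q ^ (r + 1)) = qBinom q t r * (1 - t * q ^ r) := by
  have := h.pow_q_ne r.succPNat
  rw [Nat.succPNat_coe] at this
  rw [qBinom, prod_range_succ, ← qBinom, mul_assoc, div_mul_cancel₀ _ this]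

theorem MulIndep.qBinom_mul (h : MulIndep q t) (r : ℕ) :
    qBinom q t r * (1 - q ^ r) = (1 - t) * ∑ j ∈ range r, q ^ j * qBinom q t j := by
  induction r with
  | zero => simp
  | succ r ih =>
    rw [h.qBinom_succ, sum_range_succ, mul_add, ← ih]
    ring

/-- Newton's recursion for the series F(z) with coefficients (t; q)_r / (q; q)_r, characterized by
(1 - z) F(z) = (1 - t z) F(q z). The proof multiplies by 1 - q^{r+1} and splits it as (1 - q^{r-k})
+ q^{r-k} (1 - q^{k+1}). -/
theorem MulIndep.qBinom_rec (h : MulIndep q t) (r : ℕ) :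
    (r : K) * qBinom q t r = ∑ k ∈ range r, powWeight q t (k + 1) * qBinom q t (r - 1 - k) := by
  induction r with
  | zero => simp
  | succ r ih =>
    have hr := h.pow_q_ne r.succPNat
    rw [Nat.succPNat_coe] at hr
    apply mul_right_cancel₀ hr
    set f := qBinom q t with hf
    have hw : ∀ k, powWeight q t (k + 1) * (1 - q ^ (k + 1)) = 1 - t ^ (k + 1) := fun k => by
      have := h.pow_q_ne k.succPNat
      rw [Nat.succPNat_coe] at this
      exact div_mul_cancel₀ _ this
    have e1 : (∑ k ∈ range (r + 1), powWeight q t (k + 1) * f (r - k)) * (1 - q ^ (r + 1)) =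
        ∑ k ∈ range r, powWeight q t (k + 1) * (f (r - 1 - k) * (1 - t * q ^ (r - 1 - k))) +
          ∑ k ∈ range (r + 1), (1 - t ^ (k + 1)) * (q ^ (r - k) * f (r - k)) := by
      have e2 : ∀ k ∈ range (r + 1), powWeight q t (k + 1) * f (r - k) * (1 - q ^ (r + 1)) =
          powWeight q t (k + 1) * (f (r - k) * (1 - q ^ (r - k))) +
            (1 - t ^ (k + 1)) * (q ^ (r - k) * f (r - k)) := fun k hk => by
        have hk := mem_range.1 hk
        rw [← hw k, show q ^ (r + 1) = q ^ (r - k) * q ^ (k + 1) by rw [← pow_add]; congr 1; omega]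
        ring
      rw [sum_mul, sum_congr rfl e2, sum_add_distrib, sum_range_succ]
      congr 1
      rw [Nat.sub_self, pow_zero, sub_self, mul_zero, mul_zero, add_zero]
      refine sum_congr rfl fun k hk => ?_
      have hk := mem_range.1 hk
      rw [show r - k = r - 1 - k + 1 by omega, hf, h.qBinom_succ]
    have e3 : (∑ k ∈ range r, powWeight q t (k + 1) * f (r - 1 - k)) * (1 - t * q ^ r) =
        ∑ k ∈ range r, powWeight q t (k + 1) * (f (r - 1 - k) * (1 - t * q ^ (r - 1 - k))) +
          ∑ k ∈ range r, (1 - t ^ (k + 1)) * t * (q ^ (r - 1 - k) * f (r - 1 - k)) := by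
      rw [sum_mul, ← sum_add_distrib]
      refine sum_congr rfl fun k hk => ?_
      have hk := mem_range.1 hk
      rw [← hw k, show q ^ r = q ^ (r - 1 - k) * q ^ (k + 1) by rw [← pow_add]; congr 1; omega]
      ring
    have e4 : ∑ k ∈ range (r + 1), (1 - t ^ (k + 1)) * (q ^ (r - k) * f (r - k)) =
        (1 - t) * (q ^ r * f r) + ∑ k ∈ range r, (1 - t ^ (k + 1)) * t *
          (q ^ (r - 1 - k) * f (r - 1 - k)) + (1 - t) * ∑ j ∈ range r, q ^ j * f j := by
      rw [← sum_range_reflect (fun j => q ^ j * f j) r, mul_sum, sum_range_succ', add_assoc, ← sum_add_distrib, add_comm]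
      congr 1
      · simp
      · refine sum_congr rfl fun k _ => ?_
        rw [show r - (k + 1) = r - 1 - k by omega]
        ring
    rw [Nat.add_sub_cancel, e1, mul_assoc, hf, h.qBinom_succ, ← hf]
    push_cast
    rw [add_mul, ← mul_assoc, ih, e3, e4, ← h.qBinom_mul, ← hf]
    ring

theorem qBinom_zero : qBinom q t 0 = 1 := prod_range_zero _

/-- The shift p_k ↦ p_k + z^k multiplies the generating series of the g_s at w by ∑ (t; q)_r / (q;
q)_r (z w)^r. In Newton's recursion for g_{s+1} the summand p_k contributes s - r times the answer
for index r + 1 and the summand z^k contributes r + 1 times it, in total s + 1. -/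
theorem MulIndep.shiftCoeff_rowFun [CharZero K] (h : MulIndep q t) (s r : ℕ) :
    shiftCoeff r (rowFun q t s) = if r ≤ s then qBinom q t r • rowFun q t (s - r) else 0 := by
  induction s using Nat.strong_induction_on generalizing r with
  | _ s ih =>
    rcases r with _ | r
    · rw [shiftCoeff_zero, if_pos (Nat.zero_le s), qBinom_zero, one_smul, Nat.sub_zero]
    rcases s with _ | s
    · rw [rowFun_zero, shiftCoeff_one, if_neg (by omega), if_neg (by omega)]
    have hs : ((s : K) + 1) ≠ 0 := Nat.cast_add_one_ne_zero s
    apply smul_right_injective _ hs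
    simp only
    rw [← map_smul, rowFun_succ, map_sum]
    have e : ∀ k ∈ range (s + 1), shiftCoeff (r + 1)
        (powWeight q t (k + 1) • (MvPolynomial.X k.succPNat * rowFun q t (s - k))) =
        (if r + 1 ≤ s - k then powWeight q t (k + 1) • (MvPolynomial.X k.succPNat *
          (qBinom q t (r + 1) • rowFun q t (s - k - (r + 1)))) else 0) +
        (if k ≤ r ∧ r ≤ s then (powWeight q t (k + 1) * qBinom q t (r - k)) • rowFun q t (s - r)
          else 0) := by
      intro k hk
      have hk := mem_range.1 hk
      rw [map_smul, shiftCoeff_X_mul, ih _ (by omega), ih _ (by omega), Nat.succPNat_coe, smul_add]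
      congr 1
      · split_ifs
        · rfl
        · rw [mul_zero, smul_zero]
      · simp only [Nat.succ_eq_add_one, Nat.add_sub_add_right, Nat.add_le_add_iff_right]
        by_cases h1 : k ≤ r
        · by_cases h2 : r ≤ s
          · rw [if_pos h1, if_pos (by omega), if_pos ⟨h1, h2⟩, smul_smul,
              show s - k - (r - k) = s - r by omega]
          · rw [if_pos h1, if_neg (by omega), if_neg (by tauto), smul_zero]
        · rw [if_neg h1, if_neg (by tauto), smul_zero]
    rw [sum_congr rfl e, sum_add_distrib]
    by_cases hrs : r ≤ s
    · rw [if_pos (by omega), Nat.add_sub_add_right]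
      have e1 : ∑ k ∈ range (s + 1), (if k ≤ r ∧ r ≤ s then
          (powWeight q t (k + 1) * qBinom q t (r - k)) • rowFun q t (s - r) else 0) =
          (((r : K) + 1) * qBinom q t (r + 1)) • rowFun q t (s - r) := by
        have := h.qBinom_rec (r + 1)
        push_cast at this
        rw [this, sum_smul, ← sum_filter]
        refine sum_congr ?_ fun _ _ => rfl
        ext k
        simp only [mem_filter, mem_range]
        omega
      have e2 : ∑ k ∈ range (s + 1), (if r + 1 ≤ s - k then powWeight q t (k + 1) •
          (MvPolynomial.X k.succPNat * (qBinom q t (r + 1) • rowFun q t (s - k - (r + 1)))) else 0) =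
          (((s : K) - r) * qBinom q t (r + 1)) • rowFun q t (s - r) := by
        rw [← sum_filter]
        rcases hrs.eq_or_lt with rfl | hlt
        · rw [sub_self, zero_mul, zero_smul]
          refine sum_eq_zero fun k hk => ?_
          have := (mem_filter.1 hk).2
          omega
        · obtain ⟨d, rfl⟩ : ∃ d, s = r + (d + 1) := ⟨s - r - 1, by omega⟩
          rw [show ((r + (d + 1) : ℕ) : K) - r = (d : K) + 1 by push_cast; ring,
            Nat.add_sub_cancel_left, mul_comm, ← smul_smul, rowFun_succ, smul_sum]
          refine sum_congr ?_ fun k _ => ?_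
          · ext k
            simp only [mem_filter, mem_range]
            omega
          · rw [mul_smul_comm, smul_comm, show r + (d + 1) - k - (r + 1) = d - k by omega]
      rw [e1, e2, ← add_smul, smul_smul]
      congr 1
      ring
    · rw [if_neg (by omega), smul_zero, sum_eq_zero, sum_eq_zero, add_zero]
      · exact fun k _ => if_neg (by omega)
      · exact fun k _ => if_neg (by omega)

/-- In Newton's recursion the power sum of highest index occurs with a nonzero coefficient and can
be solved for. -/
theorem adjoin_rowFun [CharZero K] (h : MulIndep q t) :
    Algebra.adjoin K (Set.range (rowFun q t)) = ⊤ := by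
  have hX : ∀ k : ℕ, (MvPolynomial.X k.succPNat : SymFun K) ∈
      Algebra.adjoin K (Set.range (rowFun q t)) := by
    intro k
    induction k using Nat.strong_induction_on with
    | _ k ih =>
      have h1 := rowFun_succ (q := q) (t := t) k
      rw [sum_range_succ, Nat.sub_self, rowFun_zero, mul_one] at h1
      have hw : powWeight q t (k + 1) ≠ 0 := by
        have h1 := h.pow_q_ne k.succPNat
        have h2 := h.pow_t_ne k.succPNat
        rw [Nat.succPNat_coe] at h1 h2
        exact div_ne_zero h2 h1
      have h2 : (MvPolynomial.X k.succPNat : SymFun K) = (powWeight q t (k + 1))⁻¹ •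
          (((k : K) + 1) • rowFun q t (k + 1) - ∑ i ∈ range k,
            powWeight q t (i + 1) • (MvPolynomial.X i.succPNat * rowFun q t (k - i))) := by
        rw [h1, add_sub_cancel_left, smul_smul, inv_mul_cancel₀ hw, one_smul]
      have hg : ∀ r, rowFun q t r ∈ Algebra.adjoin K (Set.range (rowFun q t)) := fun r =>
        Algebra.subset_adjoin ⟨r, rfl⟩
      rw [h2]
      refine Subalgebra.smul_mem _ (Subalgebra.sub_mem _ (Subalgebra.smul_mem _ (hg _) _)
        (Subalgebra.sum_mem _ fun i hi => Subalgebra.smul_mem _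
          (Subalgebra.mul_mem _ (ih i (mem_range.1 hi)) (hg _)) _)) _
  rw [eq_top_iff, ← MvPolynomial.adjoin_range_X, Algebra.adjoin_le_iff]
  rintro _ ⟨k, rfl⟩
  have := hX k.natPred
  rwa [PNat.succPNat_natPred] at this

/-- Induction on symmetric functions through products of the `g_r`. -/
theorem rowFun_induction [CharZero K] (h : MulIndep q t) {p : SymFun K → Prop} (h1 : p 1)
    (hadd : ∀ f g, p f → p g → p (f + g)) (hsmul : ∀ (c : K) f, p f → p (c • f))
    (hmul : ∀ r f, p f → p (rowFun q t r * f)) (f : SymFun K) : p f := by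
  have key : ∀ f ∈ Algebra.adjoin K (Set.range (rowFun q t)), ∀ g, p g → p (f * g) := by
    intro f hf
    induction hf using Algebra.adjoin_induction with
    | mem x hx => obtain ⟨r, rfl⟩ := hx; exact fun g hg => hmul r g hg
    | algebraMap c => intro g hg; rw [← Algebra.smul_def]; exact hsmul c g hg
    | add x y _ _ hx hy => intro g hg; rw [add_mul]; exact hadd _ _ (hx g hg) (hy g hg)
    | mul x y _ _ hx hy => intro g hg; rw [mul_assoc]; exact hx _ (hy g hg)
  have := key f (by rw [adjoin_rowFun h]; exact Algebra.mem_top) 1 h1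
  rwa [mul_one] at this

end

section

/-! ### Single rows -/

/-- The one-row diagram. -/
def rowDiagram (r : ℕ) : YoungDiagram :=
  ofRows (fun i => if i = 0 then r else 0)
    (antitone_nat_of_succ_le fun n => by simp) 1 rfl

theorem rowLen_rowDiagram (r : ℕ) : (rowDiagram r).rowLen = fun i => if i = 0 then r else 0 :=
  rowLen_ofRows _ _ _ _

theorem card_rowDiagram (r : ℕ) : (rowDiagram r).card = r := by
  rw [card_eq_sum_rowLen (N := 1) _ (by rw [rowLen_rowDiagram]; rfl), rowLen_rowDiagram]
  simp

theorem rowLen_bot (i : ℕ) : (⊥ : YoungDiagram).rowLen i = 0 := by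
  rw [rowLen_eq_zero_iff, YoungDiagram.colLen_eq_card]
  simp [YoungDiagram.col]

theorem colLen_bot (i : ℕ) : (⊥ : YoungDiagram).colLen i = 0 := by
  rw [YoungDiagram.colLen_eq_card]
  simp [YoungDiagram.col]

theorem card_bot : (⊥ : YoungDiagram).card = 0 := by simp [YoungDiagram.card]

theorem eq_bot_of_card {μ : YoungDiagram} (h : μ.card = 0) : μ = ⊥ := by
  by_contra hne
  obtain ⟨i, hi⟩ := Removable.exists hne
  have := hi.card
  omega

theorem interlaces_bot_iff {μ : YoungDiagram} : Interlaces μ ⊥ ↔ μ = rowDiagram μ.card := by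
  constructor
  · intro h
    have h0 : ∀ i, μ.rowLen (i + 1) = 0 := fun i => by
      have := (h i).2
      rw [rowLen_bot] at this
      omega
    have hc := card_eq_sum_rowLen μ (h0 0)
    rw [sum_range_one] at hc
    refine rowLen_injective (funext fun i => ?_)
    rw [rowLen_rowDiagram]
    rcases i with _ | i
    · simp [hc]
    · simp [h0]
  · intro h i
    rw [h, rowLen_rowDiagram, rowLen_bot]
    simp

theorem interlaces_rowDiagram (r : ℕ) : Interlaces (rowDiagram r) ⊥ :=
  interlaces_bot_iff.2 (by rw [card_rowDiagram])

theorem psi_bot {μ : YoungDiagram} (h : Interlaces μ ⊥) : psi q t μ ⊥ = 1 := by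
  rw [psi, if_pos h, colLen_bot, branch]
  simp [triProd]

theorem bNorm_bot : bNorm q t ⊥ = 1 := by
  rw [bNorm, colLen_bot, rowNorm]
  simp [triProd]

theorem MulIndep.bNorm_rowDiagram (h : MulIndep q t) (r : ℕ) :
    bNorm q t (rowDiagram r) = qBinom q t r := by
  rw [h.bNorm_eq (N := 1) (by rw [rowLen_rowDiagram]; rfl), rowNorm, triProd, triProd]
  simp only [rowLen_rowDiagram, range_one, prod_singleton, zero_add, Nat.sub_self,
    arcFactor_zero, if_pos, one_ne_zero, if_false, Nat.sub_zero]
  rw [one_div, arcFactor, qBinom, ← prod_inv_distrib]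
  refine prod_congr rfl fun k _ => ?_
  rw [inv_div]
  simp [mul_comm]

/-- From the vacuum and back there is a single intermediate diagram, the row of length `r`. -/
theorem MulIndep.rowConst_eq (h : MulIndep q t) (r : ℕ) : rowConst q t r = qBinom q t r := by
  rw [rowConst, raiseOp, entry_mul_kernelOp, sum_eq_single (rowDiagram r)]
  · rw [lowerOp, entry_kernelOp, if_pos (by simp [card_rowDiagram, card_bot]), phi,
      psi_bot (interlaces_rowDiagram r), bNorm_bot, h.bNorm_rowDiagram]
    simp
  · intro κ hκ hne
    rw [psi_of_not, mul_zero]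
    intro hI
    have := mem_level.1 hκ
    rw [card_bot] at this
    have h2 := interlaces_bot_iff.1 hI
    rw [show κ.card = r by omega] at h2
    exact hne h2
  · intro hc
    rw [mem_level, card_rowDiagram, card_bot] at hc
    simp at hc

/-! ### Symmetric functions act on the Fock space -/

/-- Elements `p_r` satisfying Newton's identities with respect to `g`. -/
def newton {A : Type*} [CommRing A] [Algebra K A] (q t : K) (g : ℕ → A) : ℕ → A
  | r => (powWeight q t (r + 1))⁻¹ • (((r : K) + 1) • g (r + 1) -
      ∑ k : Fin r, powWeight q t (k + 1) • (newton q t g k * g (r - k)))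
  decreasing_by exact k.2

theorem MulIndep.powWeight_ne (h : MulIndep q t) (k : ℕ) : powWeight q t (k + 1) ≠ 0 := by
  have h1 := h.pow_q_ne k.succPNat
  have h2 := h.pow_t_ne k.succPNat
  rw [Nat.succPNat_coe] at h1 h2
  exact div_ne_zero h2 h1

theorem MulIndep.newton_sum (h : MulIndep q t) {A : Type*} [CommRing A] [Algebra K A] {g : ℕ → A}
    (h0 : g 0 = 1) (r : ℕ) : ((r : K) + 1) • g (r + 1) =
      ∑ k ∈ range (r + 1), powWeight q t (k + 1) • (newton q t g k * g (r - k)) := by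
  rw [sum_range_succ, Nat.sub_self, h0, mul_one]
  conv_rhs => rw [newton]
  rw [smul_smul, mul_inv_cancel₀ (h.powWeight_ne r), one_smul,
    Fin.sum_univ_eq_sum_range fun k => powWeight q t (k + 1) • (newton q t g k * g (r - k))]
  abel

-- The `G r` generate a commutative subalgebra, in which Newton's identities can be solved for
-- elements to serve as images of the power sums. The recursion for the g_r then forces g_r ↦ `G r`.
open scoped IsMulCommutative in
theorem exists_action [CharZero K] (h : MulIndep q t) {E : Type*} [Ring E] [Algebra K E] (G : ℕ → E)
    (hG : ∀ r s, G r * G s = G s * G r) (h0 : G 0 = 1) :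
    ∃ ρ : SymFun K →ₐ[K] E, ∀ r, ρ (rowFun q t r) = G r := by
  have := Algebra.isMulCommutative_adjoin K (s := Set.range G) (by
    rintro _ ⟨r, rfl⟩ _ ⟨s, rfl⟩; exact hG r s)
  let g (r : ℕ) : Algebra.adjoin K (Set.range G) := ⟨G r, Algebra.subset_adjoin ⟨r, rfl⟩⟩
  have hp := h.newton_sum (g := g) (Subtype.ext h0)
  let φ : SymFun K →ₐ[K] Algebra.adjoin K (Set.range G) :=
    MvPolynomial.aeval fun k : ℕ+ => newton q t g k.natPred
  refine ⟨(Subalgebra.val _).comp φ, fun r => ?_⟩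
  have key : φ (rowFun q t r) = g r := by
    induction r using Nat.strong_induction_on with
    | _ r ih =>
      rcases r with _ | r
      · rw [rowFun_zero, map_one]
        exact Subtype.ext h0.symm
      · have hr : ((r : K) + 1) ≠ 0 := Nat.cast_add_one_ne_zero r
        apply smul_right_injective _ hr
        simp only
        rw [← map_smul, rowFun_succ, map_sum, hp]
        refine sum_congr rfl fun k hk => ?_
        rw [map_smul, map_mul, ih _ (by have := mem_range.1 hk; omega), MvPolynomial.aeval_X]
        simp
  rw [AlgHom.comp_apply, key]
  rfl

/-- The linear map to the Fock space intertwining multiplication by the `g_r` with the raising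
operators. -/
structure IsFockMap (q t : K) (S : SymFun K →ₗ[K] Fock K) : Prop where
  map_one : S 1 = Finsupp.single ⊥ 1
  map_rowFun_mul : ∀ (r : ℕ) f, S (rowFun q t r * f) = raiseOp q t r (S f)

theorem MulIndep.exists_isFockMap [CharZero K] (h : MulIndep q t)
    (hinj : Function.Injective (eig q t)) : ∃ S : SymFun K →ₗ[K] Fock K, IsFockMap q t S := by
  obtain ⟨ρ, hρ⟩ := exists_action (E := Module.End K (Fock K)) h (fun r => raiseOp q t r)
    (fun r s => h.raiseOp_comm hinj r s) h.raiseOp_zero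
  refine ⟨(LinearMap.applyₗ (Finsupp.single ⊥ 1)).comp ρ.toLinearMap, ?_, fun r f => ?_⟩
  · change ρ 1 (Finsupp.single ⊥ 1) = _
    rw [map_one]
    rfl
  · change ρ (rowFun q t r * f) (Finsupp.single ⊥ 1) = _
    rw [map_mul, hρ]
    rfl

theorem lowerOp_vacuum (h : MulIndep q t) (s : ℕ) : lowerOp q t s (Finsupp.single ⊥ 1) =
    if s = 0 then Finsupp.single ⊥ 1 else 0 := by
  split_ifs with hs
  · subst hs
    rw [Nat.cast_zero, h.lowerOp_zero]
    rfl
  · refine Finsupp.ext fun lam => ?_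
    change entry (lowerOp q t s) lam ⊥ = 0
    rw [lowerOp, entry_kernelOp, if_neg]
    rw [card_bot]
    omega

/-- Lowering operators and shift coefficients act alike on the vacuum and pass g_r by the same rule
with the same constants (t; q)_j / (q; q)_j; induction over products of the g_r finishes. -/
theorem IsFockMap.lowerOp_apply [CharZero K] {S : SymFun K →ₗ[K] Fock K} (hS : IsFockMap q t S)
    (h : MulIndep q t) (hinj : Function.Injective (eig q t)) (s : ℕ) (f : SymFun K) :
    lowerOp q t s (S f) = S (shiftCoeff s f) := by
  induction f using rowFun_induction h generalizing s with
  | h1 =>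
    rw [hS.map_one, lowerOp_vacuum h, shiftCoeff_one]
    split_ifs
    · exact hS.map_one.symm
    · exact (map_zero S).symm
  | hadd f g hf hg => rw [map_add, map_add, hf, hg, map_add, map_add]
  | hsmul c f hf => rw [map_smul, map_smul, hf, map_smul, map_smul]
  | hmul r f hf =>
    rw [hS.map_rowFun_mul, ← Module.End.mul_apply,
      h.lowerOp_mul_raiseOp hinj (s + 1) r s (by push_cast; omega), LinearMap.sum_apply,
      shiftCoeff_mul, Nat.sum_antidiagonal_eq_sum_range_succ
        (fun i j => shiftCoeff i (rowFun q t r) * shiftCoeff j f), map_sum]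
    refine sum_congr rfl fun j hj => ?_
    have hj := mem_range.1 hj
    rw [h.rowConst_eq, LinearMap.smul_apply, Module.End.mul_apply,
      show (s : ℤ) - j = ((s - j : ℕ) : ℤ) by omega, hf, h.shiftCoeff_rowFun]
    split_ifs with hjr
    · rw [show (r : ℤ) - j = ((r - j : ℕ) : ℤ) by omega, ← hS.map_rowFun_mul, smul_mul_assoc,
        map_smul]
    · rw [raiseOp_neg (by omega), zero_mul, map_zero]
      exact smul_zero _

/-- Multiplication by g_r has corresponding adjoints on the two sides, so the factors g_r can be
moved across until both arguments are 1. -/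
theorem IsFockMap.fockForm_apply [CharZero K] {S : SymFun K →ₗ[K] Fock K} (hS : IsFockMap q t S)
    (h : MulIndep q t) (hinj : Function.Injective (eig q t)) (f g : SymFun K) :
    fockForm q t (S f) (S g) = macInner q t f g := by
  have step : ∀ r f g, fockForm q t (S f) (S (shiftCoeff r g)) = macInner q t f (shiftCoeff r g) →
      fockForm q t (S (rowFun q t r * f)) (S g) = macInner q t (rowFun q t r * f) g := by
    intro r f g e
    rw [hS.map_rowFun_mul, h.isAdj_raiseOp, hS.lowerOp_apply h hinj, e, h.macInner_rowFun_mul]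
  induction f using rowFun_induction h generalizing g with
  | h1 =>
    rw [fockForm_comm, macInner_comm]
    induction g using rowFun_induction h with
    | h1 =>
      rw [hS.map_one, fockForm_single, bNorm_bot, Finsupp.single_eq_same, ← MvPolynomial.C_1,
        ← MvPolynomial.monomial_zero', macInner_monomial, MvPolynomial.coeff_monomial, if_pos rfl,
        powNorm, Finsupp.prod_zero_index, one_mul, one_mul]
    | hadd f g hf hg => rw [map_add, map_add, LinearMap.add_apply, macInner_add_left, hf, hg]
    | hsmul c f hf =>
      rw [map_smul, map_smul, LinearMap.smul_apply, macInner_smul_left, hf, smul_eq_mul]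
    | hmul r f hf =>
      refine step r f 1 ?_
      rw [shiftCoeff_one]
      split_ifs
      · exact hf
      · rw [map_zero, map_zero, macInner_zero_right]
  | hadd f g hf hg => rw [map_add, map_add, LinearMap.add_apply, macInner_add_left, hf, hg]
  | hsmul c f hf =>
    rw [map_smul, map_smul, LinearMap.smul_apply, macInner_smul_left, hf, smul_eq_mul]
  | hmul r f hf => exact step r f g (hf _)

theorem IsFockMap.injective [CharZero K] {S : SymFun K →ₗ[K] Fock K} (hS : IsFockMap q t S)
    (h : MulIndep q t) (hinj : Function.Injective (eig q t)) : Function.Injective S :=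
  fun f g e => macInner_left_injective h fun u => by
    rw [← hS.fockForm_apply h hinj, e, hS.fockForm_apply h hinj]

end

/-! ### Triangularity and identification of the Macdonald functions. -/

section

/-! ### Monomial coefficients of symmetric functions -/

/-- The power sums in N + 1 variables are those in N variables plus x₀^k, so separating the first
variable is the shift homomorphism. -/
theorem finSuccEquiv_toVars (N : ℕ) (f : SymFun K) :
    MvPolynomial.finSuccEquiv K N (toVars (N + 1) f) =
      Polynomial.mapAlgHom (toVars N) (shiftHom f) := by
  have e : (MvPolynomial.finSuccEquiv K N).toAlgHom.comp (toVars (N + 1)) =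
      (Polynomial.mapAlgHom (toVars N)).comp shiftHom := MvPolynomial.algHom_ext fun k => by
    simp only [AlgHom.comp_apply, toVars, shiftHom, MvPolynomial.aeval_X, MvPolynomial.psum,
      Fin.sum_univ_succ]
    simp [MvPolynomial.finSuccEquiv_X_zero, MvPolynomial.finSuccEquiv_X_succ, add_comm]
  exact DFunLike.congr_fun e f

theorem coeff_toVars_succ (N : ℕ) (f : SymFun K) (i : ℕ) (m : Fin N →₀ ℕ) :
    (toVars (N + 1) f).coeff (m.cons i) = (toVars N (shiftCoeff i f)).coeff m := by
  rw [← MvPolynomial.finSuccEquiv_coeff_coeff, finSuccEquiv_toVars, Polynomial.coe_mapAlgHom,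
    Polynomial.coeff_map]
  rfl

/-- The product of lowering operators indexed by a list. -/
def lowerProd (q t : K) (l : List ℕ) : Module.End K (Fock K) :=
  (l.map fun a : ℕ => lowerOp q t a).prod

theorem MulIndep.lowerOp_comm (h : MulIndep q t) (hinj : Function.Injective (eig q t)) (r s : ℤ) :
    lowerOp q t r * lowerOp q t s = lowerOp q t s * lowerOp q t r := by
  refine IsAdj.unique h ((h.isAdj_raiseOp s).mul (h.isAdj_raiseOp r)) ?_
  rw [h.raiseOp_comm hinj]
  exact (h.isAdj_raiseOp r).mul (h.isAdj_raiseOp s)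

theorem lowerProd_cons (a : ℕ) (l : List ℕ) :
    lowerProd q t (a :: l) = lowerOp q t a * lowerProd q t l := List.prod_cons

theorem lowerProd_append (l l' : List ℕ) :
    lowerProd q t (l ++ l') = lowerProd q t l * lowerProd q t l' := by
  rw [lowerProd, List.map_append, List.prod_append]
  rfl

theorem lowerProd_singleton (a : ℕ) : lowerProd q t [a] = lowerOp q t a := List.prod_singleton

theorem MulIndep.lowerProd_perm (h : MulIndep q t) (hinj : Function.Injective (eig q t))
    {l l' : List ℕ} (hl : l.Perm l') : lowerProd q t l = lowerProd q t l' := by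
  induction hl with
  | nil => rfl
  | cons a _ ih => rw [lowerProd_cons, lowerProd_cons, ih]
  | swap a b l =>
    rw [lowerProd_cons, lowerProd_cons, lowerProd_cons, lowerProd_cons, ← mul_assoc, ← mul_assoc,
      h.lowerOp_comm hinj]
  | trans _ _ h1 h2 => rw [h1, h2]

theorem MulIndep.lowerProd_filter (h : MulIndep q t) (l : List ℕ) :
    lowerProd q t (l.filter (· ≠ 0)) = lowerProd q t l := by
  induction l with
  | nil => rfl
  | cons a l ih =>
    by_cases ha : a = 0
    · subst ha
      rw [List.filter_cons_of_neg (by simp), ih, lowerProd_cons, Nat.cast_zero, h.lowerOp_zero]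
      exact (one_mul (lowerProd q t l)).symm
    · rw [List.filter_cons_of_pos (by simpa using ha), lowerProd_cons, lowerProd_cons, ih]

theorem IsFockMap.coeff_zero [CharZero K] {S : SymFun K →ₗ[K] Fock K} (hS : IsFockMap q t S)
    (h : MulIndep q t) (hinj : Function.Injective (eig q t)) (f : SymFun K) :
    S f ⊥ = f.coeff 0 := by
  have e := hS.fockForm_apply h hinj 1 f
  rwa [hS.map_one, fockForm_single, bNorm_bot, one_mul, ← MvPolynomial.C_1,
    ← MvPolynomial.monomial_zero', macInner_monomial, powNorm, Finsupp.prod_zero_index, one_mul,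
    mul_one] at e

theorem IsFockMap.coeff_toVars [CharZero K] {S : SymFun K →ₗ[K] Fock K} (hS : IsFockMap q t S)
    (h : MulIndep q t) (hinj : Function.Injective (eig q t)) {N : ℕ} (f : SymFun K)
    (m : Fin N →₀ ℕ) : (toVars N f).coeff m = lowerProd q t (List.ofFn m) (S f) ⊥ := by
  induction N generalizing f with
  | zero =>
    rw [List.ofFn_zero]
    change _ = S f ⊥
    rw [hS.coeff_zero h hinj, Subsingleton.elim m 0]
    induction f using MvPolynomial.induction_on with
    | C a => simp [toVars]
    | add f g hf hg => rw [map_add, MvPolynomial.coeff_add, hf, hg, MvPolynomial.coeff_add]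
    | mul_X f k _ =>
      rw [map_mul, toVars, MvPolynomial.aeval_X, MvPolynomial.psum]
      simp [MvPolynomial.coeff_mul_X']
  | succ N ih =>
    rw [← Finsupp.cons_tail m, coeff_toVars_succ, ih, List.ofFn_succ, Finsupp.cons_zero]
    simp only [Finsupp.cons_succ]
    -- The variable split off first has to act first on `S f`, that is, stand last in the product;
    -- the lowering operators commute, so the order may be changed.
    rw [h.lowerProd_perm hinj (List.perm_append_singleton (m 0) (List.ofFn (Finsupp.tail m))).symm,
      lowerProd_append, lowerProd_singleton, Module.End.mul_apply, hS.lowerOp_apply h hinj]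

/-! ### Triangularity -/

/-- A nonzero entry comes from a chain of horizontal strips from the empty diagram to λ with the
sizes in the list. Its k-th diagram has at most k rows and lies inside λ, so its size is at most
that of the first k rows. -/
theorem lowerProd_triangular (l : List ℕ) {lam : YoungDiagram}
    (hne : entry (lowerProd q t l) ⊥ lam ≠ 0) : lam.rowLen l.length = 0 ∧ l.sum = lam.card ∧
      ∀ k, (l.take k).sum ≤ ∑ i ∈ range k, lam.rowLen i := by
  induction l using List.reverseRecOn generalizing lam with
  | nil =>
    have hl : lam = ⊥ := by
      by_contra hc
      exact hne (Finsupp.single_eq_of_ne (Ne.symm hc))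
    subst hl
    simp [rowLen_bot, card_bot]
  | append_singleton l a ih =>
    rw [lowerProd_append, lowerProd_singleton, lowerOp, entry_mul_kernelOp] at hne
    obtain ⟨κ, hκ, hne⟩ := exists_ne_zero_of_sum_ne_zero hne
    have hκ := mem_level.1 hκ
    obtain ⟨h1, h2, h3⟩ := ih (left_ne_zero_of_mul hne)
    have hI : Interlaces lam κ := by
      by_contra hc
      exact right_ne_zero_of_mul hne (phi_of_not hc)
    have h0 : lam.rowLen (l.length + 1) = 0 := hI.rowLen_succ_eq_zero h1
    have hs : (l ++ [a]).sum = lam.card := by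
      rw [List.sum_append, List.sum_singleton]
      omega
    refine ⟨by rwa [List.length_append], hs, fun k => ?_⟩
    rcases le_or_gt k l.length with hk | hk
    · rw [List.take_append_of_le_length hk]
      exact (h3 k).trans (sum_le_sum fun i _ => (hI i).1)
    · rw [List.take_of_length_le (by simpa using hk), hs,
        card_eq_sum_rowLen (N := k) lam (rowLen_eq_zero_of_le h0 hk)]

/-- The diagram formed by the first `N` rows. -/
def truncRows (μ : YoungDiagram) (N : ℕ) : YoungDiagram :=
  ofRows (fun i => if i < N then μ.rowLen i else 0) (antitone_nat_of_succ_le fun n => by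
    have := rowLen_succ_le μ n
    split_ifs <;> omega) N (by simp)

theorem rowLen_truncRows (μ : YoungDiagram) (N : ℕ) :
    (truncRows μ N).rowLen = fun i => if i < N then μ.rowLen i else 0 := rowLen_ofRows _ _ _ _

theorem interlaces_truncRows {μ : YoungDiagram} {N : ℕ} (hN : μ.rowLen (N + 1) = 0) :
    Interlaces μ (truncRows μ N) := fun i => by
  have h1 := rowLen_succ_le μ i
  rw [rowLen_truncRows]
  dsimp only
  split_ifs with hi
  · omega
  · exact ⟨by omega, (rowLen_eq_zero_of_le hN (by omega)).le⟩

theorem triProd_congr_left {N : ℕ} {u u' : ℕ → ℕ} (hu : ∀ i < N, u i = u' i) (v : ℕ → ℕ) :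
    triProd q t N u v = triProd q t N u' v := by
  rw [triProd, triProd]
  refine prod_congr rfl fun j hj => prod_congr rfl fun i hi => ?_
  have := mem_range.1 hi
  have := mem_range.1 hj
  rw [hu i (by omega)]

theorem MulIndep.psi_truncRows (h : MulIndep q t) {μ : YoungDiagram} {N : ℕ}
    (hN : μ.rowLen (N + 1) = 0) : psi q t μ (truncRows μ N) = 1 := by
  have e : ∀ i < N, μ.rowLen i = (truncRows μ N).rowLen i := fun i hi => by
    rw [rowLen_truncRows]; simp [hi]
  rw [h.psi_eq (N := N) (interlaces_truncRows hN) (by rw [rowLen_truncRows]; simp), branch,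
    triProd_congr_left e, triProd_congr_left (u := μ.rowLen) e]
  exact div_self (mul_ne_zero (h.triProd_ne _ _ _) (h.triProd_ne _ _ _))

/-- When the strip sizes are the row lengths, the k-th diagram of the chain has to consist of the
first k rows. Each ψ along this chain is 1, so the φ telescope to b_λ. -/
theorem MulIndep.entry_lowerProd_self (h : MulIndep q t) {lam : YoungDiagram} {N : ℕ}
    (hN : lam.rowLen N = 0) :
    entry (lowerProd q t ((List.range N).map lam.rowLen)) ⊥ lam = bNorm q t lam := by
  induction N generalizing lam with
  | zero =>
    have hl : lam = ⊥ := eq_bot_of_card (by rw [card_eq_sum_rowLen lam hN, sum_range_zero])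
    subst hl
    rw [bNorm_bot]
    exact Finsupp.single_eq_same
  | succ N ih =>
    have hI := interlaces_truncRows hN
    have e : ∀ i < N, lam.rowLen i = (truncRows lam N).rowLen i := fun i hi => by
      rw [rowLen_truncRows]; simp [hi]
    have h0 : (truncRows lam N).rowLen N = 0 := by rw [rowLen_truncRows]; simp
    have hc := card_eq_sum_rowLen lam hN
    have hc' := card_eq_sum_rowLen _ h0
    rw [sum_range_succ, sum_congr rfl fun i hi => e i (mem_range.1 hi), ← hc'] at hc
    rw [List.range_succ, List.map_append, lowerProd_append, List.map_singleton,
      lowerProd_singleton, lowerOp, entry_mul_kernelOp, sum_eq_single (truncRows lam N)]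
    · have hl : (List.range N).map lam.rowLen = (List.range N).map (truncRows lam N).rowLen :=
        List.map_congr_left fun i hi => e i (List.mem_range.1 hi)
      rw [hl, ih h0, phi, h.psi_truncRows hN, one_mul, mul_div_cancel₀ _ (h.bNorm_ne _)]
    · intro κ hκ hne
      by_contra hc2
      have hκ := mem_level.1 hκ
      obtain ⟨h1, -, -⟩ := lowerProd_triangular _ (left_ne_zero_of_mul hc2)
      rw [List.length_map, List.length_range] at h1
      have hI' : Interlaces lam κ := by
        by_contra hc3
        exact right_ne_zero_of_mul hc2 (phi_of_not hc3)
      have hs := card_eq_sum_rowLen κ h1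
      have hle : ∀ i ∈ range N, κ.rowLen i ≤ (truncRows lam N).rowLen i := fun i hi => by
        rw [← e i (mem_range.1 hi)]; exact (hI' i).1
      have heq := (sum_eq_sum_iff_of_le hle).1 (by rw [← hs, ← hc']; omega)
      refine hne (rowLen_injective (funext fun i => ?_))
      by_cases hi : i < N
      · exact heq i (mem_range.2 hi)
      · rw [rowLen_eq_zero_of_le h1 (not_lt.1 hi), rowLen_eq_zero_of_le h0 (not_lt.1 hi)]
    · intro hc2
      refine absurd (mem_level.2 ?_) hc2
      omega

theorem rowLens_eq (μ : YoungDiagram) : μ.rowLens = (List.range (μ.colLen 0)).map μ.rowLen := rfl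

theorem sum_take_rowLens (μ : YoungDiagram) (k : ℕ) :
    (μ.rowLens.take k).sum = ∑ i ∈ range k, μ.rowLen i := by
  rw [rowLens_eq, ← List.map_take, List.take_range]
  change ∑ i ∈ range (min k (μ.colLen 0)), μ.rowLen i = _
  refine sum_subset (range_subset_range.2 (min_le_left _ _)) fun i h1 h2 => ?_
  rw [mem_range] at h1 h2
  exact (rowLen_eq_zero_iff _ _).2 (by omega)

/-- The functional extracting the coefficient of the monomial symmetric function `m_μ`. -/
def monCoeff (q t : K) (μ : YoungDiagram) (f : Fock K) : K := lowerProd q t μ.rowLens f ⊥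

theorem dominated_of_entry_ne_zero {μ lam : YoungDiagram}
    (hne : entry (lowerProd q t μ.rowLens) ⊥ lam ≠ 0) : Dominated μ lam := by
  obtain ⟨-, h2, h3⟩ := lowerProd_triangular _ hne
  exact ⟨by rw [← h2, ← sum_rowLens, Multiset.sum_coe], fun k => by rw [← sum_take_rowLens]; exact h3 k⟩

theorem MulIndep.entry_rowLens_self (h : MulIndep q t) (lam : YoungDiagram) :
    entry (lowerProd q t lam.rowLens) ⊥ lam = bNorm q t lam :=
  h.entry_lowerProd_self ((rowLen_eq_zero_iff _ _).2 le_rfl)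

theorem monCoeff_eq_sum (μ : YoungDiagram) (f : Fock K) :
    monCoeff q t μ f = f.sum fun κ c => c * entry (lowerProd q t μ.rowLens) ⊥ κ := by
  rw [monCoeff]
  conv_lhs => rw [← Finsupp.sum_single f, Finsupp.sum, map_sum, Finsupp.finsetSum_apply]
  refine sum_congr rfl fun κ _ => ?_
  rw [← mul_one (f κ), ← smul_eq_mul, ← Finsupp.smul_single, map_smul, Finsupp.smul_apply,
    smul_eq_mul, smul_eq_mul, mul_one]
  rfl

theorem monCoeff_single (μ lam : YoungDiagram) :
    monCoeff q t μ (Finsupp.single lam 1) = entry (lowerProd q t μ.rowLens) ⊥ lam := rfl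

theorem monCoeff_smul (μ : YoungDiagram) (c : K) (f : Fock K) :
    monCoeff q t μ (c • f) = c * monCoeff q t μ f := by
  rw [monCoeff, map_smul]
  rfl

theorem rowLens_injective : Function.Injective YoungDiagram.rowLens := fun μ ν e => by
  have := YoungDiagram.equivListRowLens.injective (a₁ := μ) (a₂ := ν) (Subtype.ext e)
  exact this

theorem rowLens_coe_injective :
    Function.Injective fun μ : YoungDiagram => (μ.rowLens : Multiset ℕ) := fun μ ν e =>
  rowLens_injective ((Multiset.coe_eq_coe.1 e).eq_of_sortedGE μ.rowLens_sorted ν.rowLens_sorted)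

theorem exists_rowLens_eq (s : Multiset ℕ) (hs : ∀ x ∈ s, 0 < x) :
    ∃ μ : YoungDiagram, (μ.rowLens : Multiset ℕ) = s := by
  refine ⟨YoungDiagram.ofRowLens (s.sort (· ≥ ·)) (Multiset.pairwise_sort s _).sortedGE, ?_⟩
  rw [YoungDiagram.rowLens_ofRowLens_eq_self, Multiset.sort_eq]
  simpa using hs

theorem coeff_map_X_prod {σ : Type*} [DecidableEq σ] (s : Multiset σ) (m : σ →₀ ℕ) :
    ((s.map MvPolynomial.X).prod : MvPolynomial σ K).coeff m =
      if s = Finsupp.toMultiset m then 1 else 0 := by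
  have e : ((s.map MvPolynomial.X).prod : MvPolynomial σ K) =
      MvPolynomial.monomial (Multiset.toFinsupp s) 1 := by
    induction s using Multiset.induction_on with
    | empty => simp
    | cons a s ih =>
      rw [Multiset.map_cons, Multiset.prod_cons, ih, MvPolynomial.X, MvPolynomial.monomial_mul,
        one_mul, ← Multiset.singleton_add, map_add, Multiset.toFinsupp_singleton]
  rw [e, MvPolynomial.coeff_monomial]
  refine if_congr ⟨fun h => ?_, fun h => ?_⟩ rfl rfl
  · rw [← h, Multiset.toFinsupp_toMultiset]
  · rw [h, Finsupp.toMultiset_toFinsupp]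

theorem coeff_msymm {σ : Type*} [Fintype σ] [DecidableEq σ] {n : ℕ} (p : n.Partition)
    (m : σ →₀ ℕ) : (MvPolynomial.msymm σ K p).coeff m =
      if m.support.val.map m = p.parts then 1 else 0 := by
  have hparts : ∀ s : Multiset σ, s = Finsupp.toMultiset m →
      s.dedup.map s.count = m.support.val.map m := by
    rintro s rfl
    rw [← Multiset.toFinset_val, Finsupp.toFinset_toMultiset]
    exact Multiset.map_congr rfl fun i _ => Finsupp.count_toMultiset m i
  rw [MvPolynomial.msymm, MvPolynomial.coeff_sum]
  simp only [coeff_map_X_prod]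
  split_ifs with hm
  · have hc : (Finsupp.toMultiset m).card = n := by
      rw [Finsupp.card_toMultiset, ← p.parts_sum, ← hm]
      rfl
    rw [sum_eq_single ⟨⟨Finsupp.toMultiset m, hc⟩, Nat.Partition.ext ((hparts _ rfl).trans hm)⟩]
    · exact if_pos rfl
    · intro s _ hs
      refine if_neg fun hc => hs (Subtype.ext (Subtype.ext hc))
    · simp
  · refine sum_eq_zero fun s _ => if_neg fun hc => hm ?_
    exact (hparts _ hc).symm.trans (congrArg Nat.Partition.parts s.2)

theorem exists_exponent (μ : YoungDiagram) :
    ∃ m : Fin (μ.colLen 0) →₀ ℕ, m.support.val.map m = (μ.rowLens : Multiset ℕ) := by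
  refine ⟨Finsupp.equivFunOnFinite.symm fun i => μ.rowLen i, ?_⟩
  have hsup : (Finsupp.equivFunOnFinite.symm fun i : Fin (μ.colLen 0) => μ.rowLen i).support =
      univ := by
    ext i
    simp only [Finsupp.mem_support_iff, Finsupp.equivFunOnFinite_symm_apply_apply, mem_univ,
      iff_true, ne_eq, rowLen_eq_zero_iff]
    omega
  rw [hsup, rowLens_eq]
  change _ = Multiset.map μ.rowLen (Multiset.range (μ.colLen 0))
  rw [← range_val, ← Nat.Iio_eq_range, ← Fin.map_valEmbedding_univ, map_val, Multiset.map_map]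
  rfl

theorem IsFockMap.coeff_toVars_rowLens [CharZero K] {S : SymFun K →ₗ[K] Fock K}
    (hS : IsFockMap q t S) (h : MulIndep q t) (hinj : Function.Injective (eig q t)) {N : ℕ}
    (f : SymFun K) {m : Fin N →₀ ℕ} {μ : YoungDiagram}
    (hm : m.support.val.map m = (μ.rowLens : Multiset ℕ)) :
    (toVars N f).coeff m = monCoeff q t μ (S f) := by
  rw [hS.coeff_toVars h hinj, ← h.lowerProd_filter, monCoeff,
    h.lowerProd_perm hinj (l' := μ.rowLens)]
  rw [← Multiset.coe_eq_coe, ← hm, List.ofFn_eq_map, ← Multiset.filter_coe, ← Multiset.map_coe,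
    Multiset.filter_map]
  congr 1
  have e : univ.filter (fun i => m i ≠ 0) = m.support := by ext i; simp
  rw [← e, filter_val]
  exact Multiset.filter_congr fun i _ => by simp

/-- A coefficient of a symmetric polynomial depends only on its multiset of nonzero exponents, and
every such multiset is the list of rows of one diagram. An identity in all numbers of variables is
thus one scalar equation per diagram. -/
theorem IsFockMap.toVars_eq_sum_iff [CharZero K] {S : SymFun K →ₗ[K] Fock K}
    (hS : IsFockMap q t S) (h : MulIndep q t) (hinj : Function.Injective (eig q t))
    (f : SymFun K) (u : YoungDiagram →₀ K) :
    (∀ N, toVars N f = u.sum fun μ c => c • MvPolynomial.msymm (Fin N) K (toPartition μ)) ↔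
      ∀ μ, u μ = monCoeff q t μ (S f) := by
  have key : ∀ N (m : Fin N →₀ ℕ) (μ : YoungDiagram),
      m.support.val.map m = (μ.rowLens : Multiset ℕ) →
      (u.sum fun μ c => c • MvPolynomial.msymm (Fin N) K (toPartition μ)).coeff m = u μ := by
    intro N m μ hm
    classical
    rw [Finsupp.sum, MvPolynomial.coeff_sum]
    have e : ∀ κ ∈ u.support, (u κ • MvPolynomial.msymm (Fin N) K (toPartition κ)).coeff m =
        if κ = μ then u κ else 0 := by
      intro κ _
      rw [MvPolynomial.coeff_smul, coeff_msymm, hm, smul_eq_mul,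
        show (toPartition κ).parts = (κ.rowLens : Multiset ℕ) from rfl]
      by_cases hκ : κ = μ
      · subst hκ
        rw [if_pos rfl, if_pos rfl, mul_one]
      · rw [if_neg hκ, if_neg (show ¬ (μ.rowLens : Multiset ℕ) = κ.rowLens from
          fun hc => hκ (rowLens_coe_injective hc).symm), mul_zero]
    rw [sum_congr rfl e, sum_ite_eq' u.support μ fun κ => u κ]
    split_ifs with hμ
    · rfl
    · exact (Finsupp.notMem_support_iff.1 hμ).symm
  constructor
  · intro hf μ
    obtain ⟨m, hm⟩ := exists_exponent μ
    rw [← key _ m μ hm, ← hf, hS.coeff_toVars_rowLens h hinj f hm]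
  · intro hu N
    refine MvPolynomial.ext _ _ fun m => ?_
    obtain ⟨μ, hμ⟩ := exists_rowLens_eq (m.support.val.map m) (by
      intro x hx
      obtain ⟨i, hi, rfl⟩ := Multiset.mem_map.1 hx
      exact Nat.pos_of_ne_zero (Finsupp.mem_support_iff.1 hi))
    rw [key _ m μ hμ.symm, hu, hS.coeff_toVars_rowLens h hinj f hμ.symm]

/-! ### Dominance -/

theorem Dominated.trans {κ μ lam : YoungDiagram} (h1 : Dominated κ μ) (h2 : Dominated μ lam) :
    Dominated κ lam := ⟨h1.1.trans h2.1, fun k => (h1.2 k).trans (h2.2 k)⟩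

theorem rowLen_card (μ : YoungDiagram) : μ.rowLen μ.card = 0 := by
  by_contra hc
  obtain ⟨N, hN⟩ := exists_rowLen_eq_zero μ
  have hlt : μ.card + 1 ≤ N := by
    by_contra hc2
    exact hc (rowLen_eq_zero_of_le hN (by omega))
  have h1 := card_eq_sum_rowLen μ hN
  have h2 : ∑ i ∈ range (μ.card + 1), 1 ≤ ∑ i ∈ range N, μ.rowLen i :=
    (sum_le_sum fun i hi => by
      have := rowLen_antitone μ (Nat.lt_succ_iff.1 (mem_range.1 hi))
      omega).trans (sum_le_sum_of_subset (range_subset_range.2 hlt))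
  rw [sum_const, card_range, smul_eq_mul] at h2
  omega

/-- A statistic that is strictly monotone for the dominance order. -/
def domRank (μ : YoungDiagram) : ℕ := ∑ k ∈ range (μ.card + 1), ∑ i ∈ range k, μ.rowLen i

theorem Dominated.domRank_le {μ lam : YoungDiagram} (h : Dominated μ lam) :
    domRank μ ≤ domRank lam := by
  rw [domRank, domRank, h.1]
  exact sum_le_sum fun k _ => h.2 k

/-- If the sums of all partial sums agree, so do the partial sums, and with them the rows. -/
theorem Dominated.domRank_lt {μ lam : YoungDiagram} (h : Dominated μ lam) (hne : μ ≠ lam) :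
    domRank μ < domRank lam := by
  refine lt_of_le_of_ne h.domRank_le fun he => hne ?_
  rw [domRank, domRank, h.1, sum_eq_sum_iff_of_le fun k _ => h.2 k] at he
  refine rowLen_injective (funext fun i => ?_)
  by_cases hi : i < lam.card
  · have h1 := he i (mem_range.2 (by omega))
    have h2 := he (i + 1) (mem_range.2 (by omega))
    rw [sum_range_succ, sum_range_succ] at h2
    omega
  · rw [rowLen_eq_zero_of_le (rowLen_card lam) (not_lt.1 hi),
      rowLen_eq_zero_of_le (rowLen_card μ) (by rw [h.1]; exact not_lt.1 hi)]

theorem domRank_le_sq (μ : YoungDiagram) : domRank μ ≤ (μ.card + 1) * μ.card := by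
  rw [domRank, ← smul_eq_mul, ← card_range (μ.card + 1), ← sum_const, card_range]
  refine sum_le_sum fun k hk => ?_
  have hk := mem_range.1 hk
  calc ∑ i ∈ range k, μ.rowLen i ≤ ∑ i ∈ range μ.card, μ.rowLen i :=
        sum_le_sum_of_subset (range_subset_range.2 (by omega))
    _ = μ.card := (card_eq_sum_rowLen μ (rowLen_card μ)).symm

/-! ### The Macdonald family -/

theorem fock_sum_single (f : Fock K) : f = f.sum fun κ c => c • Finsupp.single κ 1 := by
  conv_lhs => rw [← Finsupp.sum_single f]
  exact Finsupp.sum_congr fun κ _ => by rw [Finsupp.smul_single, smul_eq_mul, mul_one]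

/-- The product of the g's indexed by the list represents the functional, by adjointness. -/
theorem IsFockMap.exists_prod [CharZero K] {S : SymFun K →ₗ[K] Fock K} (hS : IsFockMap q t S)
    (h : MulIndep q t) (hinj : Function.Injective (eig q t)) (l : List ℕ) :
    ∃ f, ∀ g : Fock K, fockForm q t (S f) g = lowerProd q t l g ⊥ := by
  induction l with
  | nil =>
    refine ⟨1, fun g => ?_⟩
    rw [hS.map_one, fockForm_single, bNorm_bot, one_mul]
    rfl
  | cons a l ih =>
    obtain ⟨f, hf⟩ := ih
    refine ⟨rowFun q t a * f, fun g => ?_⟩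
    rw [hS.map_rowFun_mul, h.isAdj_raiseOp, hf,
      h.lowerProd_perm hinj (List.perm_append_singleton a l).symm, lowerProd_append,
      lowerProd_singleton]
    rfl

/-- The image of the product of the g's indexed by the rows of λ is the basis vector of λ plus
multiples of vectors of diagrams strictly dominating λ. Descending induction on dominance applies
because `domRank` is bounded in each size. -/
theorem IsFockMap.surjective [CharZero K] {S : SymFun K →ₗ[K] Fock K} (hS : IsFockMap q t S)
    (h : MulIndep q t) (hinj : Function.Injective (eig q t)) : Function.Surjective S := by
  classical
  have key : ∀ (n : ℕ) (lam : YoungDiagram), (lam.card + 1) * lam.card - domRank lam < n →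
      Finsupp.single lam 1 ∈ LinearMap.range S := by
    intro n
    induction n with
    | zero => intro lam hl; omega
    | succ n ih =>
      intro lam hl
      obtain ⟨f, hf⟩ := hS.exists_prod h hinj lam.rowLens
      have hc : ∀ κ, bNorm q t κ * S f κ = entry (lowerProd q t lam.rowLens) ⊥ κ := fun κ => by
        rw [← fockForm_single, fockForm_comm, hf]
        rfl
      have h1 : S f lam = 1 := by
        have := hc lam
        rw [h.entry_rowLens_self] at this
        exact mul_left_cancel₀ (h.bNorm_ne lam) (this.trans (mul_one _).symm)
      have h2 : ∀ κ, κ ≠ lam → S f κ ≠ 0 → Finsupp.single κ 1 ∈ LinearMap.range S := by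
        intro κ hne hκ
        have hd : Dominated lam κ := dominated_of_entry_ne_zero (q := q) (t := t) (by
          rw [← hc]; exact mul_ne_zero (h.bNorm_ne κ) hκ)
        have hlt := hd.domRank_lt (Ne.symm hne)
        have hle := domRank_le_sq κ
        have hcard := hd.1
        refine ih κ ?_
        rw [← hcard] at hle ⊢
        omega
      have h3 : Finsupp.single lam 1 = S f - ∑ κ ∈ (S f).support.erase lam,
          S f κ • Finsupp.single κ (1 : K) := by
        have h4 := fock_sum_single (S f)
        rw [Finsupp.sum, ← add_sum_erase _ _ (Finsupp.mem_support_iff.2 (by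
          rw [h1]; exact one_ne_zero : S f lam ≠ 0)), h1, one_smul] at h4
        exact eq_sub_of_add_eq h4.symm
      rw [h3]
      refine Submodule.sub_mem _ ⟨f, rfl⟩ (Submodule.sum_mem _ fun κ hκ =>
        Submodule.smul_mem _ _ (h2 κ (ne_of_mem_erase hκ) ?_))
      exact Finsupp.mem_support_iff.1 (mem_of_mem_erase hκ)
  intro g
  change g ∈ LinearMap.range S
  rw [fock_sum_single g]
  exact Submodule.sum_mem _ fun κ _ => Submodule.smul_mem _ _ (key _ κ (Nat.lt_succ_self _))

theorem IsFockMap.isMacdonaldFamily [CharZero K] {S : SymFun K →ₗ[K] Fock K}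
    (hS : IsFockMap q t S) (h : MulIndep q t) (hinj : Function.Injective (eig q t))
    {P : YoungDiagram → SymFun K}
    (hP : ∀ lam, S (P lam) = (bNorm q t lam)⁻¹ • Finsupp.single lam 1) :
    IsMacdonaldFamily q t P := by
  constructor
  · intro lam
    have hu : ∀ μ, monCoeff q t μ (S (P lam)) =
        (bNorm q t lam)⁻¹ * entry (lowerProd q t μ.rowLens) ⊥ lam := fun μ => by
      rw [hP, monCoeff_smul, monCoeff_single]
    have hd : ∀ μ, monCoeff q t μ (S (P lam)) ≠ 0 → Dominated μ lam := fun μ hμ => by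
      rw [hu] at hμ
      exact dominated_of_entry_ne_zero (right_ne_zero_of_mul hμ)
    have hfin : (Function.support fun μ => monCoeff q t μ (S (P lam))).Finite :=
      (finite_card_eq lam.card).subset fun μ hμ => (hd μ hμ).1
    refine ⟨Finsupp.ofSupportFinite _ hfin, ?_, hd, ?_⟩
    · rw [Finsupp.ofSupportFinite_coe, hu, h.entry_rowLens_self,
        inv_mul_cancel₀ (h.bNorm_ne lam)]
    · exact (hS.toVars_eq_sum_iff h hinj _ _).2 fun μ => rfl
  · intro lam μ hne
    rw [← hS.fockForm_apply h hinj, hP, hP, map_smul, map_smul, LinearMap.smul_apply,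
      fockForm_single, Finsupp.single_eq_of_ne hne, mul_zero, smul_zero, smul_zero]

/-- Triangularity in monomial functions first becomes triangularity in the basis vectors: a
component of maximal rank outside the allowed range would be visible as a monomial coefficient.
Orthogonality to the vectors of smaller rank, known by induction, removes the remaining lower
components. -/
theorem IsFockMap.eq_of_isMacdonaldFamily [CharZero K] {S : SymFun K →ₗ[K] Fock K}
    (hS : IsFockMap q t S) (h : MulIndep q t) (hinj : Function.Injective (eig q t))
    {P : YoungDiagram → SymFun K} (hP : IsMacdonaldFamily q t P) (lam : YoungDiagram) :
    S (P lam) = (bNorm q t lam)⁻¹ • Finsupp.single lam 1 := by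
  have hdom : ∀ lam κ, S (P lam) κ ≠ 0 → Dominated κ lam := by
    intro lam κ hκ
    obtain ⟨u, -, hu, hu'⟩ := hP.1 lam
    have hu' := (hS.toVars_eq_sum_iff h hinj _ _).1 hu'
    by_contra hc
    classical
    obtain ⟨κ, hκ, hmax⟩ := exists_max_image
      ((S (P lam)).support.filter fun κ => ¬ Dominated κ lam) domRank
      ⟨κ, mem_filter.2 ⟨Finsupp.mem_support_iff.2 hκ, hc⟩⟩
    obtain ⟨hκ, hc⟩ := mem_filter.1 hκ
    have e : u κ = S (P lam) κ * bNorm q t κ := by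
      rw [hu', monCoeff_eq_sum, Finsupp.sum, sum_eq_single κ]
      · rw [h.entry_rowLens_self]
      · intro μ hμ hne
        by_contra hz
        have hd := dominated_of_entry_ne_zero (right_ne_zero_of_mul hz)
        by_cases hml : Dominated μ lam
        · exact hc (hd.trans hml)
        · have := hmax μ (mem_filter.2 ⟨hμ, hml⟩)
          have := hd.domRank_lt hne.symm
          omega
      · intro hn
        exact absurd hκ hn
    exact hc (hu κ (by
      rw [e]; exact mul_ne_zero (Finsupp.mem_support_iff.1 hκ) (h.bNorm_ne κ)))
  have hdiag : ∀ lam, S (P lam) lam = (bNorm q t lam)⁻¹ := by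
    intro lam
    obtain ⟨u, hu1, -, hu'⟩ := hP.1 lam
    have hu' := (hS.toVars_eq_sum_iff h hinj _ _).1 hu'
    refine eq_inv_of_mul_eq_one_left ?_
    rw [← hu1, hu', monCoeff_eq_sum, Finsupp.sum, sum_eq_single lam]
    · rw [h.entry_rowLens_self]
    · intro μ hμ hne
      by_contra hz
      have h1 := (dominated_of_entry_ne_zero (right_ne_zero_of_mul hz)).domRank_lt hne.symm
      have h2 := (hdom lam μ (Finsupp.mem_support_iff.1 hμ)).domRank_le
      omega
    · intro hn
      rw [Finsupp.notMem_support_iff.1 hn, zero_mul]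
  have key : ∀ (n : ℕ) (lam : YoungDiagram), domRank lam < n →
      S (P lam) = (bNorm q t lam)⁻¹ • Finsupp.single lam 1 := by
    intro n
    induction n with
    | zero => intro lam hl; omega
    | succ n ih =>
      intro lam hl
      refine Finsupp.ext fun κ => ?_
      rw [Finsupp.smul_apply, smul_eq_mul]
      by_cases hκ : κ = lam
      · subst hκ
        rw [hdiag, Finsupp.single_eq_same, mul_one]
      · rw [Finsupp.single_eq_of_ne hκ, mul_zero]
        by_contra hne
        have hlt := (hdom lam κ hne).domRank_lt hκ
        have e := hP.2 κ lam hκ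
        rw [← hS.fockForm_apply h hinj, ih κ (by omega), map_smul, LinearMap.smul_apply,
          fockForm_single, smul_eq_mul, inv_mul_cancel_left₀ (h.bNorm_ne κ)] at e
        exact hne e
  exact key _ lam (Nat.lt_succ_self _)

/-- The images of the Macdonald polynomials are the rescaled basis vectors. -/
theorem IsFockMap.macP [CharZero K] {S : SymFun K →ₗ[K] Fock K}
    (hS : IsFockMap q t S) (h : MulIndep q t) (hinj : Function.Injective (eig q t))
    (lam : YoungDiagram) : S (macP q t lam) = (bNorm q t lam)⁻¹ • Finsupp.single lam 1 := by
  choose P hP using fun lam => hS.surjective h hinj ((bNorm q t lam)⁻¹ • Finsupp.single lam 1)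
  -- `macP` is a choice among families with the defining properties. The preimages of the rescaled
  -- basis vectors show that one exists, so the choice has the properties, and uniqueness determines
  -- it.
  exact hS.eq_of_isMacdonaldFamily h hinj
    (Classical.epsilon_spec (p := IsMacdonaldFamily q t) ⟨P, hS.isMacdonaldFamily h hinj hP⟩) lam

theorem IsFockMap.macQ [CharZero K] {S : SymFun K →ₗ[K] Fock K}
    (hS : IsFockMap q t S) (h : MulIndep q t) (hinj : Function.Injective (eig q t))
    (lam : YoungDiagram) : S (macQ q t lam) = Finsupp.single lam 1 := by
  rw [SpinVertex.macQ, ← hS.fockForm_apply h hinj, map_smul, hS.macP h hinj, map_smul,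
    map_smul, LinearMap.smul_apply, fockForm_single, Finsupp.single_eq_same, mul_one, smul_eq_mul,
    smul_eq_mul, inv_mul_cancel₀ (h.bNorm_ne lam), mul_one, inv_inv, smul_smul,
    mul_inv_cancel₀ (h.bNorm_ne lam), one_smul]

end

section

/-! ### One-variable specializations -/

/-- Multiplication by g_r has an adjoint and the g_r generate, so multiplication by any `f` has one.
Skew functions can thus be handled through an element representing them. -/
theorem exists_adjoint [CharZero K] (h : MulIndep q t) (f g : SymFun K) :
    ∃ F, ∀ u, macInner q t u F = macInner q t (f * u) g := by
  induction f using rowFun_induction h generalizing g with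
  | h1 => exact ⟨g, fun u => by rw [one_mul]⟩
  | hadd f f' hf hf' =>
    obtain ⟨F, hF⟩ := hf g
    obtain ⟨F', hF'⟩ := hf' g
    exact ⟨F + F', fun u => by rw [macInner_add_right, hF, hF', add_mul, macInner_add_left]⟩
  | hsmul c f hf =>
    obtain ⟨F, hF⟩ := hf g
    exact ⟨c • F, fun u => by rw [macInner_smul_right, hF, smul_mul_assoc, macInner_smul_left]⟩
  | hmul r f hf =>
    obtain ⟨F, hF⟩ := hf (shiftCoeff r g)
    exact ⟨F, fun u => by rw [hF, mul_assoc, h.macInner_rowFun_mul]⟩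

/-- The specialization to one indeterminate. -/
def oneVarPoly : SymFun K →ₐ[K] Polynomial K := MvPolynomial.aeval fun k : ℕ+ => Polynomial.X ^ (k : ℕ)

theorem oneVar_eq_aeval {L : Type*} [Field L] [Algebra K L] (x : L) (f : SymFun K) :
    oneVar x f = Polynomial.aeval x (oneVarPoly f) := by
  have e : oneVar x = (Polynomial.aeval x).comp (oneVarPoly (K := K)) :=
    MvPolynomial.algHom_ext fun k => by simp [oneVar, oneVarPoly]
  exact DFunLike.congr_fun e f

theorem coeff_oneVarPoly (f : SymFun K) (r : ℕ) :
    (oneVarPoly f).coeff r = MvPolynomial.coeff 0 (shiftCoeff r f) := by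
  have e : oneVarPoly (K := K) =
      (Polynomial.mapAlgHom (MvPolynomial.aeval fun _ : ℕ+ => (0 : K))).comp shiftHom :=
    MvPolynomial.algHom_ext fun k => by simp [oneVarPoly, shiftHom]
  have e2 : ∀ g : SymFun K, MvPolynomial.aeval (fun _ : ℕ+ => (0 : K)) g = MvPolynomial.coeff 0 g :=
    fun g => MvPolynomial.aeval_zero' g
  rw [e, AlgHom.comp_apply, Polynomial.coe_mapAlgHom, Polynomial.coeff_map]
  exact e2 _

/-- Pairing with g_r takes the constant term of the z^r coefficient of the shifted function, that
is, the z^r coefficient of `f` at p_k = z^k. -/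
theorem coeff_oneVarPoly_eq_macInner [CharZero K] (h : MulIndep q t) (f : SymFun K) (r : ℕ) :
    (oneVarPoly f).coeff r = macInner q t (rowFun q t r) f := by
  rw [coeff_oneVarPoly, ← mul_one (rowFun q t r), h.macInner_rowFun_mul, ← MvPolynomial.C_1,
    ← MvPolynomial.monomial_zero', macInner_monomial, powNorm, Finsupp.prod_zero_index, one_mul,
    mul_one]

theorem oneVar_of_macInner [CharZero K] (h : MulIndep q t) {L : Type*} [Field L] [Algebra K L]
    (x : L) {f : SymFun K} {d : ℕ} {c : K}
    (hf : ∀ r, macInner q t (rowFun q t r) f = if r = d then c else 0) :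
    oneVar x f = algebraMap K L c * x ^ d := by
  have e : oneVarPoly f = Polynomial.C c * Polynomial.X ^ d := Polynomial.ext fun r => by
    rw [coeff_oneVarPoly_eq_macInner h, hf, Polynomial.coeff_C_mul, Polynomial.coeff_X_pow,
      mul_ite, mul_one, mul_zero]
  rw [oneVar_eq_aeval, e, map_mul, Polynomial.aeval_C, map_pow, Polynomial.aeval_X]

/-- The skew function represents u ↦ ⟨Q_μ u, P_λ⟩, so its coefficient of x^r is ⟨Q_μ g_r, P_λ⟩.
Transported to the Fock space this is the matrix entry of G r from μ to λ, which is ψ_{λ/μ} in the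
right degree. -/
theorem oneVar_skewP [CharZero K] (h : MulIndep q t) (hinj : Function.Injective (eig q t))
    {L : Type*} [Field L] [Algebra K L] (x : L) (lam μ : YoungDiagram) :
    oneVar x (skewP q t lam μ) = algebraMap K L (psi q t lam μ) * x ^ (lam.card - μ.card) := by
  obtain ⟨S, hS⟩ := h.exists_isFockMap hinj
  obtain ⟨F, hF⟩ := exists_adjoint h (macQ q t μ) (macP q t lam)
  have e : skewP q t lam μ = F := by
    have e1 : ∀ ν, macInner q t (macP q t lam) (macQ q t μ * macQ q t ν) = bNorm q t ν * S F ν :=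
      fun ν => by
        rw [macInner_comm, ← hF, ← hS.fockForm_apply h hinj, hS.macQ h hinj, fockForm_single]
    apply hS.injective h hinj
    rw [skewP, finsum_eq_sum_of_support_subset (s := (S F).support), map_sum]
    · conv_rhs => rw [fock_sum_single (S F), Finsupp.sum]
      refine sum_congr rfl fun ν _ => ?_
      rw [map_smul, hS.macP h hinj, e1, smul_smul, mul_right_comm,
        mul_inv_cancel₀ (h.bNorm_ne ν), one_mul]
    · intro ν hν
      refine Finset.mem_coe.2 (Finsupp.mem_support_iff.2 fun h0 => hν ?_)
      dsimp only
      rw [e1, h0, mul_zero, zero_smul]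
  rw [e]
  refine oneVar_of_macInner h x fun r => ?_
  rw [hF, mul_comm, ← hS.fockForm_apply h hinj, hS.map_rowFun_mul, hS.macQ h hinj, hS.macP h hinj,
    map_smul, fockForm_comm, fockForm_single, smul_eq_mul, inv_mul_cancel_left₀ (h.bNorm_ne lam)]
  change entry (raiseOp q t r) lam μ = _
  rw [raiseOp, entry_kernelOp]
  by_cases hI : Interlaces lam μ
  · have := hI.card_le
    exact if_congr (by omega) rfl rfl
  -- Without interlacing the truncated difference of sizes is meaningless, but the coefficient is
  -- zero.
  · rw [psi_of_not hI, ite_self, ite_self]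

theorem oneVar_skewQ [CharZero K] (h : MulIndep q t) (hinj : Function.Injective (eig q t))
    {L : Type*} [Field L] [Algebra K L] (x : L) (lam μ : YoungDiagram) :
    oneVar x (skewQ q t lam μ) = algebraMap K L (phi q t lam μ) * x ^ (lam.card - μ.card) := by
  obtain ⟨S, hS⟩ := h.exists_isFockMap hinj
  obtain ⟨F, hF⟩ := exists_adjoint h (macP q t μ) (macQ q t lam)
  have e : skewQ q t lam μ = F := by
    have e1 : ∀ ν, macInner q t (macQ q t lam) (macP q t μ * macP q t ν) = S F ν :=
      fun ν => by
        rw [macInner_comm, ← hF, ← hS.fockForm_apply h hinj, hS.macP h hinj, map_smul,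
          LinearMap.smul_apply, fockForm_single, smul_eq_mul,
          inv_mul_cancel_left₀ (h.bNorm_ne ν)]
    apply hS.injective h hinj
    rw [skewQ, finsum_eq_sum_of_support_subset (s := (S F).support), map_sum]
    · conv_rhs => rw [fock_sum_single (S F), Finsupp.sum]
      refine sum_congr rfl fun ν _ => ?_
      rw [map_smul, hS.macQ h hinj, e1]
    · intro ν hν
      refine Finset.mem_coe.2 (Finsupp.mem_support_iff.2 fun h0 => hν ?_)
      dsimp only
      rw [e1, h0, zero_smul]
  rw [e]
  refine oneVar_of_macInner h x fun r => ?_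
  rw [hF, mul_comm, ← hS.fockForm_apply h hinj, hS.map_rowFun_mul, hS.macQ h hinj, hS.macP h hinj,
    map_smul, map_smul, LinearMap.smul_apply, fockForm_comm, fockForm_single, smul_eq_mul]
  change (bNorm q t μ)⁻¹ * (bNorm q t lam * entry (raiseOp q t r) lam μ) = _
  rw [raiseOp, entry_kernelOp, phi]
  by_cases hI : Interlaces lam μ
  · have := hI.card_le
    rw [if_congr (show (lam.card : ℤ) = μ.card + r ↔ r = lam.card - μ.card by omega) rfl rfl]
    split_ifs
    · rw [div_eq_mul_inv]; ring
    · rw [mul_zero, mul_zero]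
  · rw [psi_of_not hI, ite_self, mul_zero, mul_zero, zero_mul, zero_div, ite_self]

theorem oneVar_macP [CharZero K] (h : MulIndep q t) (hinj : Function.Injective (eig q t))
    {L : Type*} [Field L] [Algebra K L] (x : L) (lam : YoungDiagram) :
    oneVar x (macP q t lam) = algebraMap K L (psi q t lam ⊥) * x ^ lam.card := by
  obtain ⟨S, hS⟩ := h.exists_isFockMap hinj
  refine oneVar_of_macInner h x fun r => ?_
  rw [← mul_one (rowFun q t r), ← hS.fockForm_apply h hinj, hS.map_rowFun_mul, hS.map_one,
    hS.macP h hinj,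
    map_smul, fockForm_comm, fockForm_single, smul_eq_mul, inv_mul_cancel_left₀ (h.bNorm_ne lam)]
  change entry (raiseOp q t r) lam ⊥ = _
  rw [raiseOp, entry_kernelOp, card_bot]
  exact if_congr (by omega) rfl rfl

end

/-! ### Product formulas: from branching coefficients to vertex factors. -/

section

/-! ### Ratios of `q`-Pochhammer symbols -/

/-- The ratio `(t ^ (c + 1))_d / (q t ^ c)_d`. -/
def pochRatio (q t : K) (c d : ℤ) : K := qPoch q (t ^ (c + 1)) d / qPoch q (q * t ^ c) d

theorem pochRatio_of_nonneg (c d : ℕ) :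
    pochRatio q t c d = (arcFactor q t c d)⁻¹ := by
  rw [pochRatio, qPoch, qPoch, if_pos (Int.natCast_nonneg d), if_pos (Int.natCast_nonneg d),
    Int.toNat_natCast, ← prod_div_distrib, arcFactor, ← prod_inv_distrib]
  refine prod_congr rfl fun i _ => ?_
  rw [inv_div, zpow_natCast, ← Nat.cast_succ, zpow_natCast, Nat.succ_eq_add_one]
  congr 1 <;> ring

/-- Reflection: taking the negative monomial out of each factor turns it into a factor of the
positive range, at the cost of one q / t per factor. -/
theorem MulIndep.pochRatio_of_neg (h : MulIndep q t) (b e : ℕ) :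
    pochRatio q t (-(b + 1)) (-e) = (q / t) ^ e * (arcFactor q t b e)⁻¹ := by
  rcases Nat.eq_zero_or_pos e with rfl | he
  · simp [pochRatio, qPoch]
  have hq := h.q_ne
  have ht := h.t_ne
  rw [pochRatio, qPoch, qPoch, if_neg (by omega), if_neg (by omega), neg_neg, Int.toNat_natCast,
    ← prod_div_distrib, arcFactor, ← prod_inv_distrib, ← card_range e, ← prod_const, card_range,
    ← prod_mul_distrib]
  refine prod_congr rfl fun i _ => ?_
  have e1 : 1 - t ^ (-((b : ℤ) + 1) + 1) * q ^ (-((i : ℤ) + 1)) =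
      -(1 - q ^ (i + 1) * t ^ b) * (t ^ b * q ^ (i + 1))⁻¹ := by
    rw [show -((b : ℤ) + 1) + 1 = -(b : ℤ) by ring, zpow_neg, zpow_neg, zpow_natCast,
      ← Nat.cast_succ, zpow_natCast]
    field_simp
    ring
  have e2 : 1 - q * t ^ (-((b : ℤ) + 1)) * q ^ (-((i : ℤ) + 1)) =
      -(1 - q ^ i * t ^ (b + 1)) * (t ^ (b + 1) * q ^ i)⁻¹ := by
    rw [zpow_neg, zpow_neg, ← Nat.cast_succ, ← Nat.cast_succ, zpow_natCast, zpow_natCast, pow_succ q]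
    field_simp
    ring
  have n1 : 1 - q ^ (i + 1) * t ^ b ≠ 0 := h.one_sub_ne (by omega)
  have n2 : 1 - q ^ i * t ^ (b + 1) ≠ 0 := h.one_sub_ne (by omega)
  rw [e1, e2, inv_div_inv, inv_div]
  rw [pow_succ, pow_succ]
  field_simp

theorem pochRatio_of_le {c d : ℤ} {c' d' : ℕ} (hc : c = c')
    (hd : d = d') : pochRatio q t c d = (arcFactor q t c' d')⁻¹ := by
  rw [hc, hd, pochRatio_of_nonneg]

theorem MulIndep.pochRatio_of_ge (h : MulIndep q t) {c d : ℤ} {b e : ℕ} (hc : c = -(b + 1))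
    (hd : d = -e) : pochRatio q t c d = (arcFactor q t b e)⁻¹ * (q / t) ^ (e : ℤ) := by
  rw [hc, hd, h.pochRatio_of_neg, mul_comm, zpow_natCast]

theorem prod_zpow_eq {ι : Type*} {a : K} (ha : a ≠ 0) (s : Finset ι) (f : ι → ℤ) :
    ∏ i ∈ s, a ^ f i = a ^ ∑ i ∈ s, f i := by
  classical
  induction s using Finset.induction_on with
  | empty => simp
  | insert i s hi ih => rw [prod_insert hi, sum_insert hi, ih, zpow_add₀ ha]

theorem prod_Icc_one {M : Type*} [CommMonoid M] (l : ℕ) (f : ℕ → M) :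
    ∏ j ∈ Icc 1 l, f j = ∏ j ∈ range l, f (j + 1) := by
  induction l with
  | zero => simp
  | succ l ih => rw [prod_Icc_succ_top (by omega), ih, prod_range_succ]

theorem sum_Icc_one {M : Type*} [AddCommMonoid M] (l : ℕ) (f : ℕ → M) :
    ∑ j ∈ Icc 1 l, f j = ∑ j ∈ range l, f (j + 1) := by
  induction l with
  | zero => simp
  | succ l ih => rw [sum_Icc_succ_top (by omega), ih, sum_range_succ]

/-! ### Triangular products -/

theorem prod_range_ite_lt {M : Type*} [CommMonoid M] {N j : ℕ} (hj : j ≤ N) (f : ℕ → M) :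
    (∏ i ∈ range N, if i < j then f i else 1) = ∏ i ∈ range j, f i := by
  rw [← prod_filter]
  refine prod_congr ?_ fun _ _ => rfl
  ext i
  simp only [mem_filter, mem_range]
  omega

theorem triProd_eq_ite (q t : K) (N : ℕ) (u v : ℕ → ℕ) : triProd q t N u v =
    ∏ j ∈ range N, ∏ i ∈ range N, if i ≤ j then arcFactor q t (j - i) (u i - v j) else 1 := by
  rw [triProd]
  refine prod_congr rfl fun j hj => ?_
  have := mem_range.1 hj
  rw [← prod_range_ite_lt (by omega : j + 1 ≤ N)]
  exact prod_congr rfl fun i _ => if_congr Nat.lt_succ_iff rfl rfl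

/-- The product of the factors `F_{j - 1 - i}(u_i - v_j)` over `i < j < N`. -/
def strictTriProd (q t : K) (N : ℕ) (u v : ℕ → ℕ) : K :=
  ∏ j ∈ range N, ∏ i ∈ range j, arcFactor q t (j - 1 - i) (u i - v j)

theorem strictTriProd_eq_ite (q t : K) (N : ℕ) (u v : ℕ → ℕ) : strictTriProd q t N u v =
    ∏ j ∈ range N, ∏ i ∈ range N, if i < j then arcFactor q t (j - 1 - i) (u i - v j) else 1 := by
  rw [strictTriProd]
  refine prod_congr rfl fun j hj => ?_
  have := mem_range.1 hj
  rw [← prod_range_ite_lt (by omega : j ≤ N)]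

theorem strictTriProd_succ (q t : K) (N : ℕ) (u v : ℕ → ℕ) :
    strictTriProd q t (N + 1) u v = triProd q t N u fun i => v (i + 1) := by
  rw [strictTriProd, prod_range_succ', range_zero, prod_empty, mul_one, triProd]
  rfl

theorem MulIndep.strictTriProd_ne (h : MulIndep q t) (N : ℕ) (u v : ℕ → ℕ) :
    strictTriProd q t N u v ≠ 0 :=
  prod_ne_zero_iff.2 fun _ _ => prod_ne_zero_iff.2 fun _ _ => h.arcFactor_ne _ _

/-- Interlacing fixes all signs: the index differences are nonnegative for k ≤ j and nonpositive for
j < k. The first kind gives one triangular product, the second, reflected, gives the other and the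
power of q / t. -/
theorem MulIndep.prod_pochRatio_up (h : MulIndep q t) {m : ℕ} {u v : ℕ → ℕ}
    (hI : RowInterlaces u v) :
    ∏ j ∈ range m, ∏ k ∈ range (m + 1), pochRatio q t ((j : ℤ) - k) ((u k : ℤ) - v j) =
      (triProd q t m u v)⁻¹ * (triProd q t m v fun i => u (i + 1))⁻¹ *
        (q / t) ^ ∑ j ∈ range m, ∑ k ∈ range (m + 1),
          if j < k then (v j : ℤ) - u k else 0 := by
  have hρ : q / t ≠ 0 := div_ne_zero h.q_ne h.t_ne
  have e : ∀ j ∈ range m, ∀ k ∈ range (m + 1),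
      pochRatio q t ((j : ℤ) - k) ((u k : ℤ) - v j) =
        (if k ≤ j then arcFactor q t (j - k) (u k - v j) else 1)⁻¹ *
        (if j < k then arcFactor q t (k - 1 - j) (v j - u k) else 1)⁻¹ *
        (q / t) ^ (if j < k then (v j : ℤ) - u k else 0) := by
    intro j _ k _
    rcases le_or_gt k j with hk | hk
    · have h1 := hI.anti_left hk
      have h2 := (hI j).1
      rw [if_pos hk, if_neg (by omega), if_neg (by omega),
        pochRatio_of_le (c' := j - k) (d' := u k - v j) (by omega) (by omega)]
      simp
    · have h1 := hI.le_of_lt hk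
      rw [if_neg (by omega), if_pos hk, if_pos hk,
        h.pochRatio_of_ge (b := k - 1 - j) (e := v j - u k) (by omega) (by omega), inv_one, one_mul]
      congr 2
      omega
  rw [prod_congr rfl fun j hj => prod_congr rfl (e j hj)]
  simp only [prod_mul_distrib, prod_inv_distrib, prod_zpow_eq hρ]
  congr 3
  · rw [triProd_eq_ite]
    refine prod_congr rfl fun j hj => ?_
    have := mem_range.1 hj
    rw [prod_range_succ, if_neg (by omega), mul_one]
  · rw [triProd_eq_ite, prod_comm]
    rw [prod_range_succ']
    simp only [Nat.not_lt_zero, if_false, prod_const_one, mul_one, Nat.lt_succ_iff,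
      Nat.add_sub_cancel]

theorem MulIndep.prod_pochRatio_down (h : MulIndep q t) {m : ℕ} {u v : ℕ → ℕ}
    (hI : RowInterlaces v u) :
    ∏ j ∈ range m, ∏ k ∈ range m, pochRatio q t ((j : ℤ) - k - 1) ((u k : ℤ) - v j) =
      (strictTriProd q t m u v)⁻¹ * (triProd q t m v u)⁻¹ *
        (q / t) ^ ∑ j ∈ range m, ∑ k ∈ range m, if j ≤ k then (v j : ℤ) - u k else 0 := by
  have hρ : q / t ≠ 0 := div_ne_zero h.q_ne h.t_ne
  have e : ∀ j ∈ range m, ∀ k ∈ range m,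
      pochRatio q t ((j : ℤ) - k - 1) ((u k : ℤ) - v j) =
        (if k < j then arcFactor q t (j - 1 - k) (u k - v j) else 1)⁻¹ *
        (if j ≤ k then arcFactor q t (k - j) (v j - u k) else 1)⁻¹ *
        (q / t) ^ (if j ≤ k then (v j : ℤ) - u k else 0) := by
    intro j _ k _
    rcases lt_or_ge k j with hk | hk
    · have h1 := hI.le_of_lt hk
      rw [if_pos hk, if_neg (by omega), if_neg (by omega),
        pochRatio_of_le (c' := j - 1 - k) (d' := u k - v j) (by omega) (by omega)]
      simp
    · have h1 := hI.anti_right hk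
      have h2 := (hI j).1
      rw [if_neg (by omega), if_pos hk, if_pos hk,
        h.pochRatio_of_ge (b := k - j) (e := v j - u k) (by omega) (by omega), inv_one, one_mul]
      congr 2
      omega
  rw [prod_congr rfl fun j hj => prod_congr rfl (e j hj)]
  simp only [prod_mul_distrib, prod_inv_distrib, prod_zpow_eq hρ]
  rw [triProd_eq_ite, strictTriProd_eq_ite, prod_comm (s := range m) (t := range m)
    (f := fun j i => if i ≤ j then arcFactor q t (j - i) (v i - u j) else 1)]

theorem MulIndep.prod_pochRatio_self (h : MulIndep q t) {m : ℕ} {u : ℕ → ℕ} (hu : Antitone u)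
    (p : ℕ → ℕ → Prop) [DecidableRel p] :
    (∏ j ∈ range m, ∏ k ∈ range m,
      if p j k then (pochRatio q t ((j : ℤ) - k) ((u k : ℤ) - u j))⁻¹ else 1) =
      (∏ j ∈ range m, ∏ k ∈ range m,
        if p j k then if k ≤ j then arcFactor q t (j - k) (u k - u j) else 1 else 1) *
      (∏ j ∈ range m, ∏ k ∈ range m,
        if p j k then if j < k then arcFactor q t (k - 1 - j) (u j - u k) else 1 else 1) *
        (q / t) ^ (-∑ j ∈ range m, ∑ k ∈ range m,
          if p j k then if j < k then (u j : ℤ) - u k else 0 else 0) := by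
  have hρ : q / t ≠ 0 := div_ne_zero h.q_ne h.t_ne
  have e : ∀ j ∈ range m, ∀ k ∈ range m,
      (if p j k then (pochRatio q t ((j : ℤ) - k) ((u k : ℤ) - u j))⁻¹ else 1) =
        (if p j k then if k ≤ j then arcFactor q t (j - k) (u k - u j) else 1 else 1) *
        (if p j k then if j < k then arcFactor q t (k - 1 - j) (u j - u k) else 1 else 1) *
        (q / t) ^ (-if p j k then if j < k then (u j : ℤ) - u k else 0 else 0) := by
    intro j _ k _
    split_ifs with hp h1 h2 h2
    · omega
    · have := hu h1
      rw [pochRatio_of_le (c' := j - k) (d' := u k - u j) (by omega) (by omega)]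
      simp
    · have := hu h2.le
      rw [h.pochRatio_of_ge (b := k - 1 - j) (e := u j - u k) (by omega) (by omega), mul_inv,
        inv_inv, one_mul, ← zpow_neg]
      congr 2
      omega
    · omega
    · simp
  rw [prod_congr rfl fun j hj => prod_congr rfl (e j hj)]
  simp only [prod_mul_distrib, prod_zpow_eq hρ, sum_neg_distrib]

/-! ### Exponents -/

theorem sum_range_ite_le (N j : ℕ) (c : ℤ) (hj : j ≤ N) :
    (∑ k ∈ range N, if j ≤ k then c else 0) = c * (N - j) := by
  rw [← sum_filter, sum_const, show (range N).filter (j ≤ ·) = Ico j N by ext; simp [and_comm],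
    Nat.card_Ico, nsmul_eq_mul, Nat.cast_sub hj]
  ring

theorem sum_range_ite_lt (N j : ℕ) (c : ℤ) (hj : j ≤ N) :
    (∑ k ∈ range N, if k < j then c else 0) = c * j := by
  rw [← sum_filter, sum_const, show (range N).filter (· < j) = range j by ext; simp; omega,
    card_range, nsmul_eq_mul]
  ring

theorem sum_exponent_le (m : ℕ) (u v : ℕ → ℕ) :
    (∑ j ∈ range m, ∑ k ∈ range m, if j ≤ k then (v j : ℤ) - u k else 0) =
      ∑ j ∈ range m, (v j : ℤ) * (m - j) - ∑ k ∈ range m, (u k : ℤ) * (k + 1) := by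
  have e : ∀ j k : ℕ, (if j ≤ k then (v j : ℤ) - u k else 0) =
      (if j ≤ k then (v j : ℤ) else 0) - if j < k + 1 then (u k : ℤ) else 0 := fun j k => by
    by_cases hk : j ≤ k
    · rw [if_pos hk, if_pos hk, if_pos (by omega)]
    · rw [if_neg hk, if_neg hk, if_neg (by omega), sub_zero]
  simp only [e, sum_sub_distrib]
  congr 1
  · exact sum_congr rfl fun j hj => sum_range_ite_le m j _ (mem_range.1 hj).le
  · rw [sum_comm]
    refine sum_congr rfl fun k hk => ?_
    rw [sum_range_ite_lt m (k + 1) _ (mem_range.1 hk)]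
    push_cast
    ring

theorem sum_exponent_lt (m : ℕ) (u v : ℕ → ℕ) :
    (∑ j ∈ range m, ∑ k ∈ range (m + 1), if j < k then (v j : ℤ) - u k else 0) =
      ∑ j ∈ range m, (v j : ℤ) * (m - j) - ∑ k ∈ range (m + 1), (u k : ℤ) * k := by
  have e := sum_exponent_le m (fun k => u (k + 1)) v
  rw [sum_range_succ' (fun k => (u k : ℤ) * k), Nat.cast_zero, mul_zero, add_zero]
  push_cast
  rw [← e]
  refine sum_congr rfl fun j _ => ?_
  rw [sum_range_succ', if_neg (by omega), add_zero]
  exact sum_congr rfl fun k _ => if_congr Nat.lt_succ_iff rfl rfl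

end

section

/-! ### Branching coefficients in terms of vertex factors -/

/-- The part of a branching coefficient depending on the smaller index. -/
def tailPart (q t : K) (m : ℕ) (u : ℕ → ℕ) : K :=
  triProd q t m u u * (q / t) ^ (-∑ j ∈ range m, (u j : ℤ) * (m - j))

/-- The part of a branching coefficient depending on the larger index. -/
def headPart (q t : K) (m : ℕ) (e : ℤ) (u : ℕ → ℕ) : K :=
  strictTriProd q t m u u * (q / t) ^ ∑ k ∈ range m, (u k : ℤ) * (k + 1 - e)

/-- The numerator of ψ already separates into a product in μ alone and one in λ alone; the
denominator is the mixed product, and each side takes its share of the power of q / t. -/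
theorem MulIndep.psi_eq_prod (h : MulIndep q t) {m : ℕ} {lam μ : YoungDiagram}
    (hI : Interlaces lam μ) (hm : μ.rowLen m = 0) :
    psi q t lam μ = tailPart q t m μ.rowLen * headPart q t (m + 1) 1 lam.rowLen *
      ∏ j ∈ range m, ∏ k ∈ range (m + 1),
        pochRatio q t ((j : ℤ) - k) ((lam.rowLen k : ℤ) - μ.rowLen j) := by
  have hρ : q / t ≠ 0 := div_ne_zero h.q_ne h.t_ne
  rw [h.psi_eq hI hm, branch, h.prod_pochRatio_up hI, sum_exponent_lt, tailPart, headPart,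
    strictTriProd_succ, sub_eq_add_neg, zpow_add₀ hρ, zpow_neg, zpow_neg]
  simp only [add_sub_cancel_right]
  have n1 := zpow_ne_zero (∑ j ∈ range m, (μ.rowLen j : ℤ) * (m - j)) hρ
  have n2 := zpow_ne_zero (∑ k ∈ range (m + 1), (lam.rowLen k : ℤ) * k) hρ
  generalize (q / t) ^ (∑ j ∈ range m, (μ.rowLen j : ℤ) * (m - j)) = a at *
  generalize (q / t) ^ (∑ k ∈ range (m + 1), (lam.rowLen k : ℤ) * k) = b at *
  have t1 := h.triProd_ne m lam.rowLen μ.rowLen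
  have t2 := h.triProd_ne m μ.rowLen fun i => lam.rowLen (i + 1)
  field_simp

theorem MulIndep.phi_eq_prod (h : MulIndep q t) {m : ℕ} {lam μ : YoungDiagram}
    (hI : Interlaces lam μ) (hm : lam.rowLen m = 0) :
    phi q t lam μ = tailPart q t m lam.rowLen * headPart q t m 0 μ.rowLen *
      ∏ j ∈ range m, ∏ k ∈ range m,
        pochRatio q t ((j : ℤ) - k - 1) ((μ.rowLen k : ℤ) - lam.rowLen j) := by
  have hρ : q / t ≠ 0 := div_ne_zero h.q_ne h.t_ne
  have hm' := hI.rowLen_eq_zero hm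
  have e1 := strictTriProd_succ q t m μ.rowLen μ.rowLen
  have e2 := strictTriProd_succ q t m μ.rowLen lam.rowLen
  -- Undoing the index shift brings in the factors of row `m`. This row is empty in both diagrams,
  -- so the same correction appears in `e1` and `e2` and cancels.
  rw [strictTriProd, prod_range_succ, ← strictTriProd, hm'] at e1
  rw [strictTriProd, prod_range_succ, ← strictTriProd, hm] at e2
  have n0 : ∏ i ∈ range m, arcFactor q t (m - 1 - i) (μ.rowLen i - 0) ≠ 0 :=
    prod_ne_zero_iff.2 fun _ _ => h.arcFactor_ne _ _
  rw [phi, h.psi_eq hI hm', h.bNorm_eq hm, h.bNorm_eq hm', rowNorm, rowNorm, branch,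
    h.prod_pochRatio_down hI, sum_exponent_le, tailPart, headPart, ← e1, ← e2,
    sub_eq_add_neg, zpow_add₀ hρ, zpow_neg, zpow_neg]
  simp only [sub_zero] at n0 ⊢
  have n1 := zpow_ne_zero (∑ j ∈ range m, (lam.rowLen j : ℤ) * (m - j)) hρ
  have n2 := zpow_ne_zero (∑ k ∈ range m, (μ.rowLen k : ℤ) * (k + 1)) hρ
  generalize (q / t) ^ (∑ j ∈ range m, (lam.rowLen j : ℤ) * (m - j)) = a at *
  generalize (q / t) ^ (∑ k ∈ range m, (μ.rowLen k : ℤ) * (k + 1)) = b at *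
  generalize (∏ i ∈ range m, arcFactor q t (m - 1 - i) (μ.rowLen i)) = c at *
  have t1 := h.triProd_ne m lam.rowLen μ.rowLen
  have t2 := h.triProd_ne m lam.rowLen fun i => lam.rowLen (i + 1)
  have t3 := h.triProd_ne m μ.rowLen μ.rowLen
  have t4 := h.strictTriProd_ne m μ.rowLen μ.rowLen
  have t5 := h.strictTriProd_ne m μ.rowLen lam.rowLen
  field_simp

/-! ### The product `b^el` -/

/-- The columns meeting row `i` are grouped by their height k + 1; on each group the leg length is
constant. -/
theorem prod_range_rowLen {M : Type*} [CommMonoid M] (μ : YoungDiagram) {i N : ℕ} (hi : i ≤ N)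
    (hN : μ.rowLen N = 0) (g : ℕ → M) :
    ∏ j ∈ range (μ.rowLen i), g j =
      ∏ k ∈ Ico i N, ∏ j ∈ Ico (μ.rowLen (k + 1)) (μ.rowLen k), g j := by
  have key : ∀ N, i ≤ N → ∏ j ∈ Ico (μ.rowLen N) (μ.rowLen i), g j =
      ∏ k ∈ Ico i N, ∏ j ∈ Ico (μ.rowLen (k + 1)) (μ.rowLen k), g j := by
    intro N hN
    induction N, hN using Nat.le_induction with
    | base => simp
    | succ N hN ih =>
      rw [prod_Ico_succ_top hN, ← ih, mul_comm,
        prod_Ico_consecutive _ (rowLen_succ_le μ N) (rowLen_antitone μ hN)]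
  rw [← key N hi, hN, range_eq_Ico]

theorem MulIndep.prod_Ico_arcFactor (h : MulIndep q t) (b : ℕ) {x y z : ℕ} (hxy : x ≤ y)
    (hyz : y ≤ z) :
    ∏ j ∈ Ico x y, (1 - q ^ (z - (j + 1)) * t ^ (b + 1)) / (1 - q ^ (z - (j + 1) + 1) * t ^ b) =
      arcFactor q t b (z - y) / arcFactor q t b (z - x) := by
  induction y, hxy using Nat.le_induction with
  | base => rw [Ico_self, prod_empty, div_self (h.arcFactor_ne _ _)]
  | succ y hy ih =>
    rw [prod_Ico_succ_top hy, ih (by omega), show z - y = z - (y + 1) + 1 by omega,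
      arcFactor_succ]
    have n1 := h.one_sub_ne (a := z - (y + 1) + 1) (b := b) (by omega)
    have n2 := h.one_sub_ne (a := z - (y + 1)) (b := b + 1) (by omega)
    have n3 := h.arcFactor_ne b (z - x)
    field_simp

/-- The product `b^el` computed with `N` rows. -/
def elProd (q t : K) (N : ℕ) (u : ℕ → ℕ) : K :=
  ∏ i ∈ range N, ∏ k ∈ range N, if i ≤ k ∧ Even (k - i) then
    arcFactor q t (k - i) (u i - u k) / arcFactor q t (k - i) (u i - u (k + 1)) else 1

theorem colLen_eq_of_mem_Ico {μ : YoungDiagram} {j k : ℕ}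
    (hj : j ∈ Ico (μ.rowLen (k + 1)) (μ.rowLen k)) : μ.colLen j = k + 1 := by
  rw [mem_Ico] at hj
  have h1 : k < μ.colLen j := by
    rw [← YoungDiagram.mem_iff_lt_colLen, YoungDiagram.mem_iff_lt_rowLen]; exact hj.2
  have h2 : ¬ k + 1 < μ.colLen j := by
    rw [← YoungDiagram.mem_iff_lt_colLen, YoungDiagram.mem_iff_lt_rowLen]; omega
  omega

/-- On a group of columns of equal height the arms run through an interval while the leg is fixed,
so the product telescopes to a quotient of two arc factors. -/
theorem MulIndep.bEl_eq (h : MulIndep q t) {μ : YoungDiagram} {N : ℕ} (hN : μ.rowLen N = 0) :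
    bEl q t μ = elProd q t N μ.rowLen := by
  rw [bEl, prod_filter, prod_finset_product μ.cells (range N) (fun i => range (μ.rowLen i))]
  · refine prod_congr rfl fun i hi => ?_
    have hi := mem_range.1 hi
    rw [prod_range_rowLen μ hi.le hN]
    have hs : Ico i N = (range N).filter (i ≤ ·) := by ext; simp [and_comm]
    rw [hs, prod_filter]
    refine prod_congr rfl fun k _ => ?_
    by_cases hik : i ≤ k
    · rw [if_pos hik]
      have e : ∀ j ∈ Ico (μ.rowLen (k + 1)) (μ.rowLen k), leg μ (i, j) = k - i := fun j hj => by
        rw [leg, colLen_eq_of_mem_Ico hj]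
        omega
      by_cases he : Even (k - i)
      · rw [if_pos ⟨hik, he⟩, ← h.prod_Ico_arcFactor (k - i) (rowLen_succ_le μ k)
          (rowLen_antitone μ hik)]
        refine prod_congr rfl fun j hj => ?_
        rw [e j hj, if_pos he]
        rfl
      · rw [if_neg fun hc => he hc.2]
        exact prod_eq_one fun j hj => by rw [e j hj, if_neg he]
    · rw [if_neg hik, if_neg fun hc => hik hc.1]
  · rintro ⟨i, j⟩
    rw [YoungDiagram.mem_cells, YoungDiagram.mem_iff_lt_rowLen, mem_range, mem_range]
    refine ⟨fun hj => ⟨?_, hj⟩, fun hj => hj.2⟩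
    by_contra hc
    have h0 : μ.rowLen i = 0 := rowLen_eq_zero_of_le hN (not_lt.1 hc)
    change j < μ.rowLen i at hj
    omega

theorem conjEven_iff (μ : YoungDiagram) :
    ConjEven μ ↔ ∀ i, μ.rowLen (2 * i) = μ.rowLen (2 * i + 1) := by
  constructor
  · intro h i
    by_contra hne
    have h1 := rowLen_succ_le μ (2 * i)
    have h2 := h (μ.rowLen (2 * i + 1))
    rw [colLen_eq_of_mem_Ico (mem_Ico.2 ⟨le_rfl, by omega⟩)] at h2
    exact Nat.not_even_two_mul_add_one i h2
  · intro h j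
    by_contra ho
    obtain ⟨i, hi⟩ := Nat.not_even_iff_odd.1 ho
    have h1 : j < μ.rowLen (2 * i) := by
      rw [← YoungDiagram.mem_iff_lt_rowLen, YoungDiagram.mem_iff_lt_colLen]; omega
    have h2 : ¬ j < μ.rowLen (2 * i + 1) := by
      rw [← YoungDiagram.mem_iff_lt_rowLen, YoungDiagram.mem_iff_lt_colLen]; omega
    have := h i
    omega

/-- The diagram with rows `λ₁, λ₁, λ₃, λ₃, …`. -/
def evenHull (lam : YoungDiagram) : YoungDiagram :=
  ofRows (fun i => lam.rowLen (2 * (i / 2))) (fun _ _ h => rowLen_antitone lam (by omega))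
    (2 * lam.colLen 0) (by rw [rowLen_eq_zero_iff]; omega)

theorem rowLen_evenHull (lam : YoungDiagram) :
    (evenHull lam).rowLen = fun i => lam.rowLen (2 * (i / 2)) := rowLen_ofRows _ _ _ _

theorem conjEven_evenHull (lam : YoungDiagram) : ConjEven (evenHull lam) := by
  rw [conjEven_iff, rowLen_evenHull]
  intro i
  dsimp only
  congr 1
  omega

theorem interlaces_evenHull (lam : YoungDiagram) : Interlaces (evenHull lam) lam := fun i => by
  rw [rowLen_evenHull]
  exact ⟨rowLen_antitone lam (by omega), rowLen_antitone lam (by omega)⟩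

/-- With rows counted from 0, the rows of μ are squeezed: λ_{2i} ≤ μ_{2i} = μ_{2i+1} ≤ λ_{2i}. -/
theorem eq_evenHull {lam μ : YoungDiagram} (he : ConjEven μ) (hI : Interlaces μ lam) :
    μ = evenHull lam := by
  rw [conjEven_iff] at he
  refine rowLen_injective (funext fun i => ?_)
  rw [rowLen_evenHull]
  dsimp only
  have h1 := hI (2 * (i / 2))
  have h2 := he (i / 2)
  have h3 : i = 2 * (i / 2) ∨ i = 2 * (i / 2) + 1 := by omega
  have h4 : μ.rowLen i = μ.rowLen (2 * (i / 2)) := by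
    rcases h3 with h3 | h3
    · rw [← h3]
    · rw [h2, ← h3]
  omega

theorem prod_range_two_mul {M : Type*} [CommMonoid M] (N : ℕ) (f : ℕ → M) :
    ∏ i ∈ range (2 * N), f i = ∏ a ∈ range N, f (2 * a) * f (2 * a + 1) := by
  induction N with
  | zero => simp
  | succ N ih =>
    rw [show 2 * (N + 1) = 2 * N + 1 + 1 by ring, prod_range_succ, prod_range_succ, ih,
      prod_range_succ, mul_assoc]

theorem sum_range_two_mul {M : Type*} [AddCommMonoid M] (N : ℕ) (f : ℕ → M) :
    ∑ i ∈ range (2 * N), f i = ∑ a ∈ range N, (f (2 * a) + f (2 * a + 1)) := by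
  induction N with
  | zero => simp
  | succ N ih =>
    rw [show 2 * (N + 1) = 2 * N + 1 + 1 by ring, sum_range_succ, sum_range_succ, ih,
      sum_range_succ, add_assoc]

theorem branch_eq_ite (q t : K) (N : ℕ) (l m : ℕ → ℕ) : branch q t N l m =
    ∏ i ∈ range N, ∏ k ∈ range N, if i ≤ k then
      arcFactor q t (k - i) (m i - m k) * arcFactor q t (k - i) (l i - l (k + 1)) /
        (arcFactor q t (k - i) (l i - m k) * arcFactor q t (k - i) (m i - l (k + 1))) else 1 := by
  rw [branch, prod_comm]
  simp only [triProd_eq_ite, ← prod_mul_distrib, ← prod_div_distrib]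
  refine prod_congr rfl fun k _ => prod_congr rfl fun i _ => ?_
  split_ifs <;> simp

/-- Compare 2 × 2 blocks of row indices. Even legs couple rows of equal parity, the two rows of a
pair agree in the hull, and within a block the factors of ψ cancel or exchange the arc factors of
the hull for those of λ. -/
theorem MulIndep.bEl_evenHull_mul_psi (h : MulIndep q t) (lam : YoungDiagram) :
    bEl q t (evenHull lam) * psi q t (evenHull lam) lam = bEl q t lam := by
  set M := lam.colLen 0 with hM
  have h1 : lam.rowLen (2 * M) = 0 := by rw [rowLen_eq_zero_iff]; omega
  have h2 : (evenHull lam).rowLen (2 * M) = 0 := by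
    rw [rowLen_evenHull]
    dsimp only
    rwa [Nat.mul_div_cancel_left _ (by omega)]
  rw [h.bEl_eq h2, h.psi_eq (interlaces_evenHull lam) h1, h.bEl_eq h1, elProd, elProd,
    branch_eq_ite]
  simp only [prod_range_two_mul, ← prod_mul_distrib]
  refine prod_congr rfl fun a _ => prod_congr rfl fun b _ => ?_
  have v : ∀ c, (evenHull lam).rowLen (2 * c) = lam.rowLen (2 * c) := fun c => by
    rw [rowLen_evenHull]; dsimp only; congr 1; omega
  have v1 : ∀ c, (evenHull lam).rowLen (2 * c + 1) = lam.rowLen (2 * c) := fun c => by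
    rw [rowLen_evenHull]; dsimp only; congr 1; omega
  have v2 : ∀ c, (evenHull lam).rowLen (2 * c + 1 + 1) = lam.rowLen (2 * c + 2) := fun c => by
    rw [rowLen_evenHull]; dsimp only; congr 1; omega
  have o1 : ¬ (2 * a ≤ 2 * b + 1 ∧ Even (2 * b + 1 - 2 * a)) := fun hc => by
    obtain ⟨r, hr⟩ := hc.2; omega
  have o2 : ¬ (2 * a + 1 ≤ 2 * b ∧ Even (2 * b - (2 * a + 1))) := fun hc => by
    obtain ⟨r, hr⟩ := hc.2; omega
  simp only [if_neg o1, if_neg o2, v, v1, v2, mul_one, one_mul]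
  rcases le_or_gt a b with hab | hab
  · have e1 : 2 * a ≤ 2 * b ∧ Even (2 * b - 2 * a) := ⟨by omega, ⟨b - a, by omega⟩⟩
    have e2 : 2 * a + 1 ≤ 2 * b + 1 ∧ Even (2 * b + 1 - (2 * a + 1)) :=
      ⟨by omega, ⟨b - a, by omega⟩⟩
    rw [if_pos e1, if_pos e2, if_pos e1, if_pos e2, if_pos e1.1, if_pos e2.1,
      if_pos (show 2 * a ≤ 2 * b + 1 by omega)]
    have hd : 2 * b + 1 - (2 * a + 1) = 2 * b - 2 * a := by omega
    rw [hd]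
    have n := h.arcFactor_ne
    have c1 : (if 2 * a + 1 ≤ 2 * b then
        arcFactor q t (2 * b - (2 * a + 1)) (lam.rowLen (2 * a + 1) - lam.rowLen (2 * b)) *
          arcFactor q t (2 * b - (2 * a + 1)) (lam.rowLen (2 * a) - lam.rowLen (2 * b)) /
        (arcFactor q t (2 * b - (2 * a + 1)) (lam.rowLen (2 * a) - lam.rowLen (2 * b)) *
          arcFactor q t (2 * b - (2 * a + 1)) (lam.rowLen (2 * a + 1) - lam.rowLen (2 * b)))
        else 1) = 1 := by
      split_ifs
      · rw [mul_comm]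
        exact div_self (mul_ne_zero (n _ _) (n _ _))
      · rfl
    rw [c1, div_self (mul_ne_zero (n _ _) (n _ _)), div_self (mul_ne_zero (n _ _) (n _ _)),
      div_self (n _ _)]
    have n1 := n (2 * b - 2 * a) (lam.rowLen (2 * a) - lam.rowLen (2 * b + 2))
    have n2 := n (2 * b - 2 * a) (lam.rowLen (2 * a + 1) - lam.rowLen (2 * b + 2))
    have n3 := n (2 * b - 2 * a) (lam.rowLen (2 * a) - lam.rowLen (2 * b + 1))
    have n4 := n (2 * b - 2 * a) (lam.rowLen (2 * a) - lam.rowLen (2 * b))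
    field_simp
  · rw [if_neg (by omega), if_neg (by omega), if_neg (by omega), if_neg (by omega),
      if_neg (by omega), if_neg (by omega), if_neg (by omega), if_neg (by omega)]
    simp

/-! ### The even part function -/

theorem oneVar_smul {L : Type*} [Field L] [Algebra K L] (x : L) (c : K) (f : SymFun K) :
    oneVar x (c • f) = algebraMap K L c * oneVar x f := by
  rw [map_smul, Algebra.smul_def]

theorem conjEven_bot : ConjEven ⊥ := fun j => by rw [colLen_bot]; exact Even.zero

/-- In one variable only one-row diagrams survive, and among these only the empty one has all
columns of even height. -/
theorem evenPhi_eq_one [CharZero K] (h : MulIndep q t) (hinj : Function.Injective (eig q t))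
    {L : Type*} [Field L] [Algebra K L] (x : L) : evenPhi q t x = 1 := by
  classical
  rw [evenPhi, finsum_eq_single _ ⊥]
  · rw [finsum_eq_if, if_pos conjEven_bot, oneVar_smul, oneVar_macP h hinj,
      psi_bot (interlaces_refl ⊥), card_bot, h.bEl_eq (N := 0) (rowLen_bot 0), elProd]
    simp
  · intro ν hν
    rw [finsum_eq_if]
    split_ifs with he
    · rw [oneVar_smul, oneVar_macP h hinj, psi_of_not, map_zero, zero_mul, mul_zero]
      intro hI
      refine hν ?_
      rw [eq_evenHull he hI]
      refine rowLen_injective ?_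
      rw [rowLen_evenHull]
      funext i
      rw [rowLen_bot, rowLen_bot]
    · rfl

theorem evenPart_eq [CharZero K] (h : MulIndep q t) (hinj : Function.Injective (eig q t))
    {L : Type*} [Field L] [Algebra K L] (lam : YoungDiagram) (x : L) :
    evenPart q t lam x = algebraMap K L (bEl q t lam) * x ^ ((evenHull lam).card - lam.card) := by
  classical
  rw [evenPart, evenPhi_eq_one h hinj, inv_one, one_mul, finsum_eq_single _ (evenHull lam)]
  · rw [finsum_eq_if, if_pos ⟨conjEven_evenHull lam, interlaces_evenHull lam⟩, oneVar_smul,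
      oneVar_skewP h hinj, ← mul_assoc, ← map_mul, h.bEl_evenHull_mul_psi]
  · intro ν hν
    rw [finsum_eq_if, if_neg]
    exact fun hc => hν (eq_evenHull hc.1 hc.2)

theorem card_evenHull_sub (lam : YoungDiagram) {l : ℕ} (hl : lam.rowLen l = 0) :
    ((evenHull lam).card : ℤ) - lam.card = ∑ j ∈ range l, (-1) ^ j * (lam.rowLen j : ℤ) := by
  have h1 : lam.rowLen (2 * l) = 0 := rowLen_eq_zero_of_le hl (by omega)
  have h2 : (evenHull lam).rowLen (2 * l) = 0 := by
    rw [rowLen_evenHull]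
    dsimp only
    rwa [Nat.mul_div_cancel_left _ (by omega)]
  have h3 : ∑ j ∈ range l, (-1) ^ j * (lam.rowLen j : ℤ) =
      ∑ j ∈ range (2 * l), (-1) ^ j * (lam.rowLen j : ℤ) :=
    sum_subset (range_subset_range.2 (by omega)) fun j _ hj => by
      rw [rowLen_eq_zero_of_le hl (by simpa using hj), Nat.cast_zero, mul_zero]
  rw [h3, card_eq_sum_rowLen _ h1, card_eq_sum_rowLen _ h2, sum_range_two_mul, sum_range_two_mul,
    sum_range_two_mul]
  push_cast
  rw [← sum_sub_distrib]
  refine sum_congr rfl fun a _ => ?_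
  rw [rowLen_evenHull]
  dsimp only
  rw [show 2 * (2 * a / 2) = 2 * a by omega, show 2 * ((2 * a + 1) / 2) = 2 * a by omega,
    pow_succ, pow_mul]
  norm_num
  ring

end

section

/-! ### The weights of the half-space process -/

theorem betaFactor_eq (q t : K) (n : ℕ) (v : ℕ → ℕ) (lam : ℕ → YoungDiagram) (i : ℕ) :
    betaFactor q t n v lam i = ∏ j ∈ range (len n v i), ∏ k ∈ range (len n v (i + 1)),
      pochRatio q t ((len n v (i + 1) : ℤ) - len n v i - k + j - 1)
        (((lam (i + 1)).rowLen k : ℤ) - (lam i).rowLen j) := by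
  rw [betaFactor, prod_Icc_one]
  refine prod_congr rfl fun j _ => ?_
  rw [prod_Icc_one]
  refine prod_congr rfl fun k _ => ?_
  rw [pochRatio, part, part, Nat.add_sub_cancel, Nat.add_sub_cancel]
  refine congrArg₂ (· / ·) (congrArg₂ (qPoch q) (congrArg (t ^ ·) ?_) rfl)
    (congrArg₂ (qPoch q) (congrArg (q * t ^ ·) ?_) rfl) <;> push_cast <;> ring

theorem gammaFactor_eq (q t : K) (n : ℕ) (v : ℕ → ℕ) (lam : ℕ → YoungDiagram) (i : ℕ) :
    gammaFactor q t n v lam i = ∏ j ∈ range (len n v i), ∏ k ∈ range (len n v i),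
      if i = n - 1 → j % 2 = k % 2 then
        (pochRatio q t ((j : ℤ) - k) (((lam i).rowLen k : ℤ) - (lam i).rowLen j))⁻¹ else 1 := by
  rw [gammaFactor, prod_Icc_one]
  refine prod_congr rfl fun j _ => ?_
  rw [prod_filter, prod_Icc_one]
  refine prod_congr rfl fun k _ => ?_
  refine ite_congr (propext ?_) (fun _ => ?_) fun _ => rfl
  · refine imp_congr_right fun _ => ?_
    rw [Nat.even_iff, Nat.even_iff]
    omega
  · rw [pochRatio, part, part, Nat.add_sub_cancel, Nat.add_sub_cancel, inv_div]
    congr 4 <;> push_cast <;> ring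

theorem alphaFactor_eq (q t : K) (n : ℕ) (v : ℕ → ℕ) (lam : ℕ → YoungDiagram) :
    alphaFactor q t n v lam = ∏ i ∈ range (len n v (n - 1)),
      (if i < len n v (n - 1) ∧ Odd (len n v (n - 1) - i) then
        arcFactor q t (len n v (n - 1) - 1 - i) ((lam (n - 1)).rowLen i) else 1)⁻¹ := by
  rw [alphaFactor, prod_filter, prod_Icc_one]
  refine prod_congr rfl fun i hi => ?_
  have hi := mem_range.1 hi
  by_cases he : Even (len n v (n - 1) - (i + 1))
  · rw [if_pos he, if_pos ⟨hi, by rw [Nat.even_iff] at he; rw [Nat.odd_iff]; omega⟩, part,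
      Nat.add_sub_cancel, ← pochRatio_of_nonneg, pochRatio, ← Nat.cast_succ, zpow_natCast,
      zpow_natCast, Nat.sub_sub, add_comm 1 i]
  · rw [if_neg he, if_neg, inv_one]
    rw [Nat.even_iff] at he
    rw [Nat.odd_iff]
    omega

theorem sgn_succ_of_eq {n : ℕ} {v : ℕ → ℕ} {i : ℕ} (h : len n v (i + 1) = len n v i) :
    sgn n v (i + 1) = -1 := by
  rw [sgn, Nat.add_sub_cancel, h, sub_self, zero_sub]
  rfl

theorem sgn_succ_of_succ {n : ℕ} {v : ℕ → ℕ} {i : ℕ} (h : len n v (i + 1) = len n v i + 1) :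
    sgn n v (i + 1) = 1 := by
  rw [sgn, Nat.add_sub_cancel, h, Nat.cast_succ, add_sub_cancel_left, sub_self]
  rfl

/-- The sign τ is 1 exactly when the length grows, so the choice between ψ and φ, the number of rows
in the head factor and the shift in β change together. All of it depends on e = l_{i+1} - l_i, and
the two cases get the same form. -/
theorem weightAt_succ [CharZero K] (h : MulIndep q t) (hinj : Function.Injective (eig q t))
    {L : Type*} [Field L] [Algebra K L] {n : ℕ} {v : ℕ → ℕ} {lam : ℕ → YoungDiagram}
    (hlam : lam ∈ interlacingTuples n v) {i : ℕ} (hi : i + 1 < n)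
    (hstep : len n v (i + 1) = len n v i ∨ len n v (i + 1) = len n v i + 1)
    (h0 : (lam i).rowLen (len n v i) = 0) (x : ℕ → L) :
    weightAt q t n v x lam (i + 1) = algebraMap K L (tailPart q t (len n v i) (lam i).rowLen *
      headPart q t (len n v (i + 1)) ((len n v (i + 1) : ℤ) - len n v i) (lam (i + 1)).rowLen *
        betaFactor q t n v lam i) *
      x (i + 1) ^ (sgn n v (i + 1) * (((lam (i + 1)).card : ℤ) - (lam i).card)) := by
  obtain ⟨hI1, hI2, -⟩ := hlam.2.2 (i + 1) (mem_Icc.2 ⟨by omega, by omega⟩)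
  rw [weightAt, if_neg (by omega), betaFactor_eq]
  rw [Nat.add_sub_cancel] at *
  rcases hstep with hs | hs
  · have hI := hI2 (sgn_succ_of_eq hs)
    have hc := hI.card_le
    rw [sgn_succ_of_eq hs, if_pos rfl, oneVar_skewQ h hinj, h.phi_eq_prod hI h0, hs, sub_self]
    congr 1
    · congr 2
      refine prod_congr rfl fun j _ => prod_congr rfl fun k _ => ?_
      congr 1
      ring
    · rw [← zpow_natCast, Nat.cast_sub hc]
      congr 1
      ring
  · have hI := hI1 (sgn_succ_of_succ hs)
    have hc := hI.card_le
    rw [sgn_succ_of_succ hs, if_neg (by decide), oneVar_skewP h hinj, h.psi_eq_prod hI h0, hs]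
    congr 1
    · congr 2
      · congr 2
        push_cast
        ring
      refine prod_congr rfl fun j _ => prod_congr rfl fun k _ => ?_
      congr 1
      push_cast
      ring
    · rw [← zpow_natCast, Nat.cast_sub hc, one_mul]

/-- The tail supplies the factors of γ with k ≤ j and the head those with j < k. Of the powers of q
/ t only the e-dependent part of the head is left, a multiple of the size. -/
theorem MulIndep.gammaFactor_eq_mul (h : MulIndep q t) {n : ℕ} {v : ℕ → ℕ}
    {lam : ℕ → YoungDiagram} {i : ℕ} (hi : i ≠ n - 1) (h0 : (lam i).rowLen (len n v i) = 0) (e : ℤ) :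
    tailPart q t (len n v i) (lam i).rowLen * headPart q t (len n v i) e (lam i).rowLen =
      gammaFactor q t n v lam i * (q / t) ^ (-e * ((lam i).card : ℤ)) := by
  have hρ : q / t ≠ 0 := div_ne_zero h.q_ne h.t_ne
  have hS := sum_exponent_le (len n v i) (lam i).rowLen (lam i).rowLen
  have hS' : (∑ j ∈ range (len n v i), ∑ k ∈ range (len n v i),
      if j < k then ((lam i).rowLen j : ℤ) - (lam i).rowLen k else 0) =
      ∑ j ∈ range (len n v i), ∑ k ∈ range (len n v i),
        if j ≤ k then ((lam i).rowLen j : ℤ) - (lam i).rowLen k else 0 := by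
    refine sum_congr rfl fun j _ => sum_congr rfl fun k _ => ?_
    rcases lt_trichotomy j k with hjk | hjk | hjk
    · rw [if_pos hjk, if_pos hjk.le]
    · subst hjk; simp
    · rw [if_neg (by omega), if_neg (by omega)]
  have h1 := h.prod_pochRatio_self (m := len n v i) (rowLen_antitone (lam i))
    (fun j k => i = n - 1 → j % 2 = k % 2)
  rw [← gammaFactor_eq q t n v lam i] at h1
  simp only [hi, false_imp_iff, if_true] at h1
  rw [hS', hS] at h1
  rw [h1, tailPart, headPart, triProd_eq_ite, strictTriProd_eq_ite,
    prod_comm (s := range (len n v i)) (t := range (len n v i))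
      (f := fun j k => if j < k then arcFactor q t (k - 1 - j)
        ((lam i).rowLen j - (lam i).rowLen k) else 1), mul_mul_mul_comm, mul_assoc, mul_assoc,
    ← zpow_add₀ hρ, ← zpow_add₀ hρ, ← mul_assoc]
  congr 2
  rw [card_eq_sum_rowLen (lam i) h0]
  push_cast
  rw [mul_sum, neg_sub, sub_add_eq_add_sub, ← sum_add_distrib, neg_add_eq_sub]
  congr 1
  exact sum_congr rfl fun k _ => by ring

theorem sum_parity_gt (N j : ℕ) (hj : j < N) (c : ℤ) :
    (∑ k ∈ range N, if j % 2 = k % 2 ∧ j < k then c else 0) = c * ((N - 1 - j) / 2 : ℕ) := by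
  induction N, hj using Nat.le_induction with
  | base =>
    rw [sum_eq_zero fun k hk => if_neg fun hc => by have := mem_range.1 hk; omega]
    simp
  | succ N hN ih =>
    rw [sum_range_succ, ih]
    by_cases hp : j % 2 = N % 2
    · rw [if_pos ⟨hp, by omega⟩,
        show ((N + 1 - 1 - j) / 2 : ℕ) = ((N - 1 - j) / 2 : ℕ) + 1 by omega]
      push_cast
      ring
    · rw [if_neg fun hc => hp hc.1, add_zero,
        show ((N + 1 - 1 - j) / 2 : ℕ) = ((N - 1 - j) / 2 : ℕ) by omega]

theorem sum_parity_lt (N k : ℕ) (hk : k ≤ N) (c : ℤ) :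
    (∑ j ∈ range N, if j % 2 = k % 2 ∧ j < k then c else 0) = c * (k / 2 : ℕ) := by
  have e : (∑ j ∈ range N, if j % 2 = k % 2 ∧ j < k then c else 0) =
      ∑ j ∈ range k, if j % 2 = k % 2 then c else 0 := by
    rw [← sum_filter, ← sum_filter]
    refine sum_congr ?_ fun _ _ => rfl
    ext j
    simp only [mem_filter, mem_range]
    omega
  rw [e]
  clear e hk
  induction k using Nat.twoStepInduction with
  | zero => simp
  | one => simp
  | more k ih _ =>
    rw [sum_range_succ, sum_range_succ, show (k + 1 + 1) % 2 = k % 2 by omega, ih, if_pos rfl,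
      if_neg (by omega), show (k + 1 + 1) / 2 = k / 2 + 1 by omega]
    push_cast
    ring

/-- Row k has ⌊(l - 1 - k)/2⌋ rows of its parity below it and ⌊k/2⌋ above. Added to the linear
exponent of the head, these counts leave a coefficient depending only on the parity of l - 1 - k. -/
theorem sum_exponent_parity (l : ℕ) (e : ℤ) (u : ℕ → ℕ) :
    (∑ k ∈ range l, (u k : ℤ) * (k + 1 - e)) +
      (∑ j ∈ range l, ∑ k ∈ range l,
        if j % 2 = k % 2 then if j < k then (u j : ℤ) - u k else 0 else 0) =
      ∑ k ∈ range l, (u k : ℤ) *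
        if Even (l - (k + 1)) then l - e - ((l + 1) / 2 : ℕ) + 1 else l - e - (l / 2 : ℕ) := by
  have e1 : ∀ j k : ℕ, (if j % 2 = k % 2 then if j < k then (u j : ℤ) - u k else 0 else 0) =
      (if j % 2 = k % 2 ∧ j < k then (u j : ℤ) else 0) -
        if j % 2 = k % 2 ∧ j < k then (u k : ℤ) else 0 := fun j k => by
    split_ifs <;> first | rfl | omega
  have e2 : (∑ j ∈ range l, ∑ k ∈ range l,
      if j % 2 = k % 2 then if j < k then (u j : ℤ) - u k else 0 else 0) =
      ∑ j ∈ range l, (u j : ℤ) * (((l - 1 - j) / 2 : ℕ) - (j / 2 : ℕ)) := by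
    simp only [e1, sum_sub_distrib, mul_sub]
    congr 1
    · exact sum_congr rfl fun j hj => sum_parity_gt l j (mem_range.1 hj) _
    · rw [sum_comm]
      exact sum_congr rfl fun k hk => sum_parity_lt l k (mem_range.1 hk).le _
  rw [e2, ← sum_add_distrib]
  refine sum_congr rfl fun k hk => ?_
  have hk := mem_range.1 hk
  rw [← mul_add]
  congr 1
  by_cases he : Even (l - (k + 1))
  · rw [if_pos he]
    rw [Nat.even_iff] at he
    omega
  · rw [if_neg he]
    rw [Nat.even_iff] at he
    omega

/-- Equal-parity factors of b^el and of the head make up the restricted γ. The opposite-parity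
factors of the head cancel against the shifted denominators of b^el up to the boundary index l,
where the row is empty; the boundary factors are α. -/
theorem MulIndep.bEl_mul_headPart (h : MulIndep q t) {n : ℕ} {v : ℕ → ℕ}
    {lam : ℕ → YoungDiagram} (h0 : (lam (n - 1)).rowLen (len n v (n - 1)) = 0) (e : ℤ) :
    bEl q t (lam (n - 1)) * headPart q t (len n v (n - 1)) e (lam (n - 1)).rowLen =
      alphaFactor q t n v lam * gammaFactor q t n v lam (n - 1) *
        (q / t) ^ ∑ k ∈ range (len n v (n - 1)), ((lam (n - 1)).rowLen k : ℤ) *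
          if Even (len n v (n - 1) - (k + 1)) then
            (len n v (n - 1) : ℤ) - e - ((len n v (n - 1) + 1) / 2 : ℕ) + 1
          else (len n v (n - 1) : ℤ) - e - (len n v (n - 1) / 2 : ℕ) := by
  have hρ : q / t ≠ 0 := div_ne_zero h.q_ne h.t_ne
  have h1 := h.prod_pochRatio_self (m := len n v (n - 1)) (rowLen_antitone (lam (n - 1)))
    (fun j k => n - 1 = n - 1 → j % 2 = k % 2)
  rw [← gammaFactor_eq q t n v lam (n - 1)] at h1
  simp only [forall_true_left] at h1
  rw [h1, h.bEl_eq h0, headPart, strictTriProd_eq_ite, elProd, alphaFactor_eq,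
    ← sum_exponent_parity]
  generalize hl : len n v (n - 1) = l at *
  generalize hu : (lam (n - 1)).rowLen = u at *
  generalize hE : (∑ j ∈ range l, ∑ k ∈ range l,
    if j % 2 = k % 2 then if j < k then (u j : ℤ) - u k else 0 else 0) = E
  rw [zpow_add₀ hρ, zpow_neg]
  have key : (∏ i ∈ range l, ∏ k ∈ range l, if i ≤ k ∧ Even (k - i) then
      arcFactor q t (k - i) (u i - u k) / arcFactor q t (k - i) (u i - u (k + 1)) else 1) *
      (∏ j ∈ range l, ∏ i ∈ range l, if i < j then arcFactor q t (j - 1 - i) (u i - u j) else 1) =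
      (∏ i ∈ range l, (if i < l ∧ Odd (l - i) then arcFactor q t (l - 1 - i) (u i) else 1)⁻¹) *
      ((∏ j ∈ range l, ∏ k ∈ range l,
        if j % 2 = k % 2 then if k ≤ j then arcFactor q t (j - k) (u k - u j) else 1 else 1) *
      ∏ j ∈ range l, ∏ k ∈ range l,
        if j % 2 = k % 2 then if j < k then arcFactor q t (k - 1 - j) (u j - u k) else 1 else 1) := by
    rw [prod_comm (s := range l) (t := range l)
      (f := fun j i => if i < j then arcFactor q t (j - 1 - i) (u i - u j) else 1),
      prod_comm (s := range l) (t := range l) (f := fun j k => if j % 2 = k % 2 then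
        if k ≤ j then arcFactor q t (j - k) (u k - u j) else 1 else 1), ← prod_mul_distrib,
      ← prod_mul_distrib, ← prod_mul_distrib]
    refine prod_congr rfl fun i hi => ?_
    have hi := mem_range.1 hi
    have e1 := prod_range_succ' (fun k => if i < k ∧ Odd (k - i) then
      arcFactor q t (k - 1 - i) (u i - u k) else 1) l
    rw [prod_range_succ, if_neg (show ¬ (i < 0 ∧ Odd (0 - i)) from fun hc => absurd hc.1 (Nat.not_lt_zero i)), mul_one, h0,
      Nat.sub_zero] at e1
    set W := if i < l ∧ Odd (l - i) then arcFactor q t (l - 1 - i) (u i) else 1 with hW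
    have nW : W ≠ 0 := by
      rw [hW]
      split_ifs
      · exact h.arcFactor_ne _ _
      · exact one_ne_zero
    rw [inv_mul_eq_div, eq_div_iff nW]
    have e2 : ∀ k, (if i ≤ k ∧ Even (k - i) then
        arcFactor q t (k - i) (u i - u k) / arcFactor q t (k - i) (u i - u (k + 1)) else 1) =
        (if k % 2 = i % 2 then if i ≤ k then arcFactor q t (k - i) (u i - u k) else 1 else 1) *
          (if i < k + 1 ∧ Odd (k + 1 - i) then
            arcFactor q t (k + 1 - 1 - i) (u i - u (k + 1)) else 1)⁻¹ := fun k => by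
      by_cases hk : i ≤ k
      · by_cases hp : k % 2 = i % 2
        · rw [if_pos ⟨hk, by rw [Nat.even_iff]; omega⟩, if_pos hp, if_pos hk,
            if_pos ⟨by omega, by rw [Nat.odd_iff]; omega⟩, Nat.add_sub_cancel, div_eq_mul_inv]
        · rw [if_neg (by rw [Nat.even_iff]; omega), if_neg hp,
            if_neg (by rw [Nat.odd_iff]; omega), inv_one, one_mul]
      · rw [if_neg (by omega), if_neg hk, ite_self, if_neg (by omega), inv_one, one_mul]
    have e3 : ∀ k, (if i < k then arcFactor q t (k - 1 - i) (u i - u k) else 1) =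
        (if i % 2 = k % 2 then if i < k then arcFactor q t (k - 1 - i) (u i - u k) else 1 else 1) *
          (if i < k ∧ Odd (k - i) then arcFactor q t (k - 1 - i) (u i - u k) else 1) := fun k => by
      by_cases hk : i < k
      · by_cases hp : i % 2 = k % 2
        · rw [if_pos hk, if_pos hp, if_neg (by rw [Nat.odd_iff]; omega), mul_one]
        · rw [if_pos hk, if_neg hp, if_pos ⟨hk, by rw [Nat.odd_iff]; omega⟩, one_mul]
      · rw [if_neg hk, ite_self, if_neg (by omega), one_mul]
    rw [prod_congr rfl fun k _ => e2 k, prod_congr rfl fun k _ => e3 k, prod_mul_distrib,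
      prod_mul_distrib, prod_inv_distrib, ← e1]
    have n1 : ∏ k ∈ range l, (if i < k ∧ Odd (k - i) then
        arcFactor q t (k - 1 - i) (u i - u k) else 1) ≠ 0 :=
      prod_ne_zero_iff.2 fun k _ => by
        split_ifs
        · exact h.arcFactor_ne _ _
        · exact one_ne_zero
    generalize (∏ k ∈ range l, (if i < k ∧ Odd (k - i) then
        arcFactor q t (k - 1 - i) (u i - u k) else 1)) = X at *
    field_simp
  have nE := zpow_ne_zero E hρ
  rw [← mul_assoc, key]
  generalize (q / t) ^ E = Z at *
  field_simp

end

section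

/-! ### Weights and vertex terms -/

/-- The numerical consequences of the existence of a stable point. -/
structure Admissible (n : ℕ) (v : ℕ → ℕ) : Prop where
  step : ∀ i, i + 1 < n → len n v (i + 1) = len n v i ∨ len n v (i + 1) = len n v i + 1
  last : v n = (len n v (n - 1) + 1) / 2

theorem len_zero (M : ℕ) (v : ℕ → ℕ) : len (M + 2) v 0 = 0 := by
  rw [len, if_neg (by omega), if_neg (by simp)]

theorem len_mid {M i : ℕ} (v : ℕ → ℕ) (hi : i < M) : len (M + 2) v (i + 1) = v (i + 1) := by
  rw [len, if_neg (by omega), if_pos (mem_Icc.2 ⟨by omega, by omega⟩)]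

theorem len_last (M : ℕ) (v : ℕ → ℕ) : len (M + 2) v (M + 1) = v (M + 1) + v (M + 2) := by
  rw [len, if_pos (by omega)]
  rfl

theorem mem_arrows (M j i : ℕ) :
    (j, i) ∈ arrows (M + 2) ↔ (j = M ∧ i = M + 2) ∨ (1 ≤ j ∧ j ≤ M ∧ i = j + 1) := by
  simp only [arrows, mem_insert, mem_image, mem_Icc, Prod.mk.injEq, Nat.add_sub_cancel]
  constructor
  · rintro (h | ⟨a, h, rfl, rfl⟩)
    · exact Or.inl h
    · exact Or.inr ⟨h.1, h.2, rfl⟩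
  · rintro (h | ⟨h1, h2, rfl⟩)
    · exact Or.inl h
    · exact Or.inr ⟨j, ⟨h1, h2⟩, rfl, rfl⟩

theorem bExp_sub_aExp (n : ℕ) (v : ℕ → ℕ) (i : ℕ) : bExp n v i - aExp n v i =
    ∑ j ∈ Icc 1 n with (j, i) ∈ arrows n, (v j : ℤ) - v i + deltaFraming n i := by
  rw [bExp, aExp]
  ring

theorem sum_incoming_mid {M i : ℕ} (hM : 1 ≤ M) (v : ℕ → ℕ) (hi : i ≤ M) :
    ∑ j ∈ Icc 1 (M + 2) with (j, i + 1) ∈ arrows (M + 2), (v j : ℤ) = len (M + 2) v i := by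
  simp only [mem_arrows]
  rcases i with _ | i
  · rw [len_zero, sum_eq_zero fun j hj => ?_, Nat.cast_zero]
    rw [mem_filter, mem_Icc] at hj
    omega
  · rw [len_mid v (by omega), ← sum_singleton (fun j => (v j : ℤ)) (i + 1)]
    refine sum_congr ?_ fun _ _ => rfl
    ext j
    rw [mem_filter, mem_Icc, mem_singleton]
    omega

theorem sum_incoming_last {M : ℕ} (hM : 1 ≤ M) (v : ℕ → ℕ) :
    ∑ j ∈ Icc 1 (M + 2) with (j, M + 2) ∈ arrows (M + 2), (v j : ℤ) = len (M + 2) v M := by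
  obtain ⟨m, rfl⟩ : ∃ m, M = m + 1 := ⟨M - 1, by omega⟩
  simp only [mem_arrows, and_true]
  rw [len_mid v (by omega), ← sum_singleton (fun j => (v j : ℤ)) (m + 1)]
  refine sum_congr ?_ fun _ _ => rfl
  ext j
  rw [mem_filter, mem_Icc, mem_singleton]
  omega

theorem tupleDegree_mid {M i : ℕ} (v : ℕ → ℕ) (lam : ℕ → YoungDiagram) (hi : i < M) :
    tupleDegree (M + 2) v lam (i + 1) = (lam (i + 1)).card := by
  rw [tupleDegree, if_neg (by omega), if_neg (by omega), if_pos (mem_Icc.2 ⟨by omega, by omega⟩)]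

theorem tupleDegree_penult (M : ℕ) (v : ℕ → ℕ) (lam : ℕ → YoungDiagram) :
    tupleDegree (M + 2) v lam (M + 1) = ∑ k ∈ range (len (M + 2) v (M + 1)),
      if Even (len (M + 2) v (M + 1) - (k + 1)) then 0 else (lam (M + 1)).rowLen k := by
  rw [tupleDegree, if_neg (by omega), if_pos (by omega), sum_filter, sum_Icc_one]
  refine sum_congr rfl fun k _ => ?_
  simp only [← Nat.not_even_iff_odd, ite_not]
  rfl

theorem tupleDegree_last (M : ℕ) (v : ℕ → ℕ) (lam : ℕ → YoungDiagram) :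
    tupleDegree (M + 2) v lam (M + 2) = ∑ k ∈ range (len (M + 2) v (M + 1)),
      if Even (len (M + 2) v (M + 1) - (k + 1)) then (lam (M + 1)).rowLen k else 0 := by
  rw [tupleDegree, if_pos rfl, sum_filter, sum_Icc_one]
  rfl

theorem rowLen_len_eq_zero {M : ℕ} {v : ℕ → ℕ} {lam : ℕ → YoungDiagram}
    (hlam : lam ∈ interlacingTuples (M + 2) v) {i : ℕ} (hi : i ≤ M + 1) :
    (lam i).rowLen (len (M + 2) v i) = 0 := by
  rcases i with _ | i
  · rw [hlam.1, rowLen_bot]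
  · exact (rowLen_eq_zero_iff _ _).2 (hlam.2.2 (i + 1) (mem_Icc.2 ⟨by omega, hi⟩)).2.2

theorem card_eq_tupleDegree_add {M : ℕ} {v : ℕ → ℕ} {lam : ℕ → YoungDiagram}
    (hlam : lam ∈ interlacingTuples (M + 2) v) :
    (lam (M + 1)).card =
      tupleDegree (M + 2) v lam (M + 1) + tupleDegree (M + 2) v lam (M + 2) := by
  rw [tupleDegree_penult, tupleDegree_last, ← sum_add_distrib,
    card_eq_sum_rowLen _ (rowLen_len_eq_zero hlam le_rfl)]
  refine sum_congr rfl fun k _ => ?_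
  split_ifs <;> omega

theorem card_evenHull_eq {M : ℕ} {v : ℕ → ℕ} {lam : ℕ → YoungDiagram}
    (hlam : lam ∈ interlacingTuples (M + 2) v) :
    ((evenHull (lam (M + 1))).card : ℤ) - (lam (M + 1)).card = sgn (M + 2) v (M + 2) *
      ((tupleDegree (M + 2) v lam (M + 2) : ℤ) - tupleDegree (M + 2) v lam (M + 1)) := by
  have hl : len (M + 2) v (M + 2) = 0 := by
    rw [len, if_neg (by omega), if_neg (by rw [mem_Icc]; omega)]
  have hs : sgn (M + 2) v (M + 2) = (-1) ^ (len (M + 2) v (M + 1) + 1) := by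
    rw [sgn, hl, show M + 2 - 1 = M + 1 from rfl,
      show ((0 : ℕ) : ℤ) - len (M + 2) v (M + 1) - 1 = -((len (M + 2) v (M + 1) + 1 : ℕ) : ℤ) by
        push_cast; ring, zpow_neg, zpow_natCast, ← inv_pow]
    push_cast
    rfl
  rw [card_evenHull_sub _ (rowLen_len_eq_zero hlam le_rfl), hs, tupleDegree_penult,
    tupleDegree_last]
  push_cast
  rw [← sum_sub_distrib, mul_sum]
  refine sum_congr rfl fun k hk => ?_
  have hk := mem_range.1 hk
  generalize len (M + 2) v (M + 1) = l at *
  obtain ⟨d, rfl⟩ : ∃ d, l = k + 1 + d := ⟨l - (k + 1), by omega⟩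
  rw [Nat.add_sub_cancel_left, show k + 1 + d + 1 = 2 + k + d by ring, pow_add, pow_add]
  by_cases hd : Even d
  · rw [if_pos hd, if_pos hd, hd.neg_one_pow]
    ring
  · rw [if_neg hd, if_neg hd, (Nat.not_even_iff_odd.1 hd).neg_one_pow]
    ring

/-- Summation by parts in the exponents; the boundary term at 0 vanishes because λ^0 is empty. -/
theorem prod_telescope {L : Type*} [Field L] (x : ℕ → L) (s c : ℕ → ℤ) (hc : c 0 = 0) (m : ℕ)
    (hx : ∀ i ≤ m, x (i + 1) ≠ 0) :
    ∏ i ∈ range (m + 1), x (i + 1) ^ (s (i + 1) * (c (i + 1) - c i)) =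
      (∏ i ∈ range m, (x (i + 1) ^ s (i + 1) * x (i + 2) ^ (-s (i + 2))) ^ c (i + 1)) *
        x (m + 1) ^ (s (m + 1) * c (m + 1)) := by
  induction m with
  | zero => simp [hc]
  | succ m ih =>
    rw [prod_range_succ, ih fun i hi => hx i (by omega), prod_range_succ, mul_sub, zpow_sub₀
      (hx _ le_rfl), mul_zpow, ← zpow_mul, ← zpow_mul, neg_mul, zpow_neg]
    ring

/-- By `bExp_sub_aExp`, b_i - a_i is the incoming dimension minus v_i plus the framing. For i ≤ n -
2 this is -(l_i - l_{i-1}), the exponent left over from γ; at the two ends v_n = ⌈l/2⌉ and v_{n-1} =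
⌊l/2⌋ match the exponents of the two parity classes. -/
theorem exponent_identity {M : ℕ} (hM : 1 ≤ M) {v : ℕ → ℕ} (hv : Admissible (M + 2) v)
    (lam : ℕ → YoungDiagram) :
    ∑ i ∈ range M, -(((len (M + 2) v (i + 1) : ℤ) - len (M + 2) v i) * (lam (i + 1)).card) +
      ∑ k ∈ range (len (M + 2) v (M + 1)), ((lam (M + 1)).rowLen k : ℤ) *
        (if Even (len (M + 2) v (M + 1) - (k + 1)) then
          (len (M + 2) v (M + 1) : ℤ) - (len (M + 2) v (M + 1) - len (M + 2) v M) -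
            ((len (M + 2) v (M + 1) + 1) / 2 : ℕ) + 1
        else (len (M + 2) v (M + 1) : ℤ) - (len (M + 2) v (M + 1) - len (M + 2) v M) -
          (len (M + 2) v (M + 1) / 2 : ℕ)) =
      nExp (M + 2) v (tupleDegree (M + 2) v lam) -
        ∑ i ∈ Icc 1 (M + 2), aExp (M + 2) v i * tupleDegree (M + 2) v lam i := by
  rw [nExp, ← sum_sub_distrib, sum_Icc_one, sum_range_succ, sum_range_succ]
  simp only [← sub_mul, bExp_sub_aExp]
  have hlast := hv.last
  have hl := len_last M v
  rw [show M + 2 - 1 = M + 1 from rfl] at hlast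
  rw [sum_incoming_mid hM v le_rfl, sum_incoming_last hM, add_assoc]
  congr 1
  · refine sum_congr rfl fun i hi => ?_
    have hi := mem_range.1 hi
    rw [sum_incoming_mid hM v hi.le, tupleDegree_mid v lam hi, deltaFraming, if_neg (by omega),
      len_mid v hi]
    push_cast
    ring
  · rw [tupleDegree_penult, tupleDegree_last, deltaFraming, deltaFraming, if_neg (by omega),
      if_pos rfl]
    push_cast
    rw [mul_sum, mul_sum, ← sum_add_distrib]
    refine sum_congr rfl fun k _ => ?_
    by_cases he : Even (len (M + 2) v (M + 1) - (k + 1))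
    · simp only [if_pos he]
      have : ((len (M + 2) v (M + 1) + 1) / 2 : ℕ) = v (M + 2) := hlast.symm
      zify at this
      rw [this]
      ring
    · simp only [if_neg he]
      have : (len (M + 2) v (M + 1) / 2 : ℕ) = v (M + 1) := by omega
      zify at this
      rw [this]
      ring

/-- Step i contributes a head factor in λ^i and step i + 1 a tail factor in λ^i; regrouped by
diagram they give the γ's, with b^el entering at the last one. The coefficient carries (q / t) to
the power N(d) - ∑ a_i d_i, and the monomial in x restores ∑ a_i d_i through the substitution for z.
-/
theorem weight_eq [CharZero K] (h : MulIndep q t) (hinj : Function.Injective (eig q t))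
    {L : Type*} [Field L] [Algebra K L] {M : ℕ} (hM : 1 ≤ M) {v : ℕ → ℕ}
    (hv : Admissible (M + 2) v) {x z : ℕ → L} (hx : ∀ i ∈ Icc 1 (M + 2), x i ≠ 0)
    (hz : ∀ i ∈ Icc 1 (M + 1), algebraMap K L ((q / t) ^ aExp (M + 2) v i) * z i =
      x i ^ sgn (M + 2) v i * x (i + 1) ^ (-sgn (M + 2) v (i + 1)))
    (hzn : algebraMap K L ((q / t) ^ aExp (M + 2) v (M + 2)) * z (M + 2) =
      x (M + 1) ^ sgn (M + 2) v (M + 1) * x (M + 2) ^ sgn (M + 2) v (M + 2))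
    {lam : ℕ → YoungDiagram} (hlam : lam ∈ interlacingTuples (M + 2) v) :
    weight q t (M + 2) v x lam = algebraMap K L (alphaFactor q t (M + 2) v lam *
      (∏ i ∈ Icc 1 M, betaFactor q t (M + 2) v lam i) *
      ∏ i ∈ Icc 1 (M + 1), gammaFactor q t (M + 2) v lam i) *
        zMonomial q t (M + 2) v z lam := by
  have hρ : q / t ≠ 0 := div_ne_zero h.q_ne h.t_ne
  have hP : algebraMap K L (q / t) ≠ 0 := (map_ne_zero _).2 hρ
  set s := sgn (M + 2) v with hs
  set l := len (M + 2) v with hl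
  set d := tupleDegree (M + 2) v lam with hd
  set B := betaFactor q t (M + 2) v lam with hB
  set G := gammaFactor q t (M + 2) v lam with hG
  set e : ℕ → ℤ := fun i => (l (i + 1) : ℤ) - l i with he
  have h0 : ∀ i ≤ M + 1, (lam i).rowLen (l i) = 0 := fun i hi => rowLen_len_eq_zero hlam hi
  -- the coefficient
  have hcoef : (∏ i ∈ range (M + 1), tailPart q t (l i) (lam i).rowLen *
      headPart q t (l (i + 1)) (e i) (lam (i + 1)).rowLen * B i) * bEl q t (lam (M + 1)) =
      alphaFactor q t (M + 2) v lam * (∏ i ∈ Icc 1 M, B i) * (∏ i ∈ Icc 1 (M + 1), G i) *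
        (q / t) ^ (nExp (M + 2) v d - ∑ i ∈ Icc 1 (M + 2), aExp (M + 2) v i * d i) := by
    rw [← exponent_identity hM hv, zpow_add₀ hρ, ← prod_zpow_eq hρ, prod_Icc_one, prod_Icc_one,
      prod_mul_distrib, prod_mul_distrib, prod_range_succ' (fun i => tailPart q t (l i) _),
      prod_range_succ (fun i => headPart q t (l (i + 1)) (e i) _), prod_range_succ' B,
      prod_range_succ (fun i => G (i + 1))]
    have t0 : tailPart q t (l 0) (lam 0).rowLen = 1 := by
      rw [hl, len_zero, tailPart, triProd]
      simp
    have b0 : B 0 = 1 := by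
      rw [hB, betaFactor_eq, ← hl, hl, len_zero, range_zero, prod_empty]
    have hlast := h.bEl_mul_headPart (n := M + 2) (v := v) (lam := lam) (h0 (M + 1) le_rfl) (e M)
    rw [show M + 2 - 1 = M + 1 from rfl] at hlast
    have hmid : ∏ i ∈ range M, tailPart q t (l (i + 1)) (lam (i + 1)).rowLen *
        headPart q t (l (i + 1)) (e i) (lam (i + 1)).rowLen =
        (∏ i ∈ range M, G (i + 1)) *
          ∏ i ∈ range M, (q / t) ^ (-(((l (i + 1) : ℤ) - l i) * (lam (i + 1)).card)) := by
      rw [← prod_mul_distrib]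
      refine prod_congr rfl fun i hi => ?_
      have hi := mem_range.1 hi
      rw [h.gammaFactor_eq_mul (by omega) (h0 (i + 1) (by omega)), neg_mul]
    rw [prod_mul_distrib] at hmid
    rw [t0, b0, mul_one, mul_one]
    calc _ = ((∏ i ∈ range M, tailPart q t (l (i + 1)) (lam (i + 1)).rowLen) *
          ∏ i ∈ range M, headPart q t (l (i + 1)) (e i) (lam (i + 1)).rowLen) *
          (bEl q t (lam (M + 1)) * headPart q t (l (M + 1)) (e M) (lam (M + 1)).rowLen) *
          ∏ i ∈ range M, B (i + 1) := by ring
      _ = _ := by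
        rw [hmid, hlast]
        ring
  -- the monomial
  have hmon : (∏ i ∈ range (M + 1), x (i + 1) ^ (s (i + 1) *
      (((lam (i + 1)).card : ℤ) - (lam i).card))) *
      x (M + 2) ^ ((evenHull (lam (M + 1))).card - (lam (M + 1)).card) =
      ∏ i ∈ Icc 1 (M + 2), (algebraMap K L ((q / t) ^ aExp (M + 2) v i) * z i) ^ d i := by
    have hx1 : ∀ i ≤ M + 1, x (i + 1) ≠ 0 := fun i hi => hx _ (mem_Icc.2 ⟨by omega, by omega⟩)
    have hc := card_evenHull_eq hlam
    have hcle := (interlaces_evenHull (lam (M + 1))).card_le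
    rw [prod_telescope x s (fun i => ((lam i).card : ℤ)) (by rw [hlam.1, card_bot]; rfl) M
      (fun i hi => hx1 i (by omega)), ← zpow_natCast, Nat.cast_sub hcle, hc, prod_Icc_one,
      prod_range_succ, prod_range_succ, hzn, hz (M + 1) (mem_Icc.2 ⟨by omega, le_rfl⟩), mul_assoc,
      mul_assoc, card_eq_tupleDegree_add hlam]
    congr 1
    · refine prod_congr rfl fun i hi => ?_
      have hi := mem_range.1 hi
      rw [hz (i + 1) (mem_Icc.2 ⟨by omega, by omega⟩), hd, tupleDegree_mid v lam hi, zpow_natCast]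
    · have n1 := hx1 M (by omega)
      have n2 := hx1 (M + 1) le_rfl
      rw [← hs, ← hd, ← zpow_natCast _ (d (M + 1)), ← zpow_natCast _ (d (M + 1 + 1)), mul_zpow,
        mul_zpow, ← zpow_mul, ← zpow_mul, ← zpow_mul, ← zpow_mul, mul_mul_mul_comm,
        ← zpow_add₀ n1, ← zpow_add₀ n2]
      push_cast
      congr 2 <;> ring
  have hw : weight q t (M + 2) v x lam =
      algebraMap K L ((∏ i ∈ range (M + 1), tailPart q t (l i) (lam i).rowLen *
        headPart q t (l (i + 1)) (e i) (lam (i + 1)).rowLen * B i) * bEl q t (lam (M + 1))) *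
      ((∏ i ∈ range (M + 1), x (i + 1) ^ (s (i + 1) *
        (((lam (i + 1)).card : ℤ) - (lam i).card))) *
        x (M + 2) ^ ((evenHull (lam (M + 1))).card - (lam (M + 1)).card)) := by
    rw [weight, prod_Icc_one, prod_range_succ, weightAt, if_pos rfl,
      show M + 2 - 1 = M + 1 from rfl, evenPart_eq h hinj, map_mul, map_prod, mul_mul_mul_comm,
      ← prod_mul_distrib]
    congr 1
    refine prod_congr rfl fun i hi => ?_
    have hi := mem_range.1 hi
    exact weightAt_succ h hinj hlam (by omega) (hv.step i (by omega)) (h0 i (by omega)) x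
  rw [hw, hcoef, hmon, zMonomial, map_mul, mul_assoc, ← hd]
  congr 1
  have e2 : ∏ i ∈ Icc 1 (M + 2), (algebraMap K L ((q / t) ^ aExp (M + 2) v i) * z i) ^ d i =
      algebraMap K L (q / t) ^ (∑ i ∈ Icc 1 (M + 2), aExp (M + 2) v i * d i) *
        ∏ i ∈ Icc 1 (M + 2), z i ^ d i := by
    rw [← prod_zpow_eq hP, ← prod_mul_distrib]
    refine prod_congr rfl fun i _ => ?_
    rw [mul_pow, map_zpow₀, zpow_mul, zpow_natCast]
  rw [e2, map_zpow₀, map_zpow₀, ← mul_assoc, ← zpow_add₀ hP, sub_add_cancel]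

end

section

/-! ### Dimension vectors of stable points -/

/-! ### Vectors generated by two alternating loops. -/

section Alternating

variable {V P R : Type*} [AddCommGroup V] [Module K V] [AddCommGroup P] [Module K P]
  [AddCommGroup R] [Module K R]

theorem span_image_Iio_succ (e : ℕ → V) (k : ℕ) : Submodule.span K (e '' Set.Iio (k + 1)) =
    Submodule.span K {e k} ⊔ Submodule.span K (e '' Set.Iio k) := by
  rw [← Submodule.span_union, ← Set.image_singleton, ← Set.image_union]
  congr 2
  ext j
  simp only [Set.mem_Iio, Set.mem_union, Set.mem_singleton_iff]
  omega

/-- Krylov argument: once e_k depends on its predecessors, their span contains e_0 and is stable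
under `c`, so it contains all later vectors. -/
theorem span_image_Iio_eq_top {c : V →ₗ[K] V} {e : ℕ → V}
    (hc : ∀ k, ∃ s : K, e (k + 1) = c (e k) + s • e 0)
    (htop : Submodule.span K (Set.range e) = ⊤) {k : ℕ}
    (hk : e k ∈ Submodule.span K (e '' Set.Iio k)) :
    Submodule.span K (e '' Set.Iio k) = ⊤ := by
  have hsucc : Submodule.span K (e '' Set.Iio (k + 1)) = Submodule.span K (e '' Set.Iio k) := by
    rw [span_image_Iio_succ, sup_eq_right, Submodule.span_singleton_le_iff_mem]
    exact hk
  -- This covers `k = 0` too, where the hypothesis says e_0 = 0.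
  have h0 : e 0 ∈ Submodule.span K (e '' Set.Iio k) := by
    rw [← hsucc]
    exact Submodule.subset_span ⟨0, Nat.succ_pos k, rfl⟩
  have hstab : ∀ x ∈ Submodule.span K (e '' Set.Iio k),
      c x ∈ Submodule.span K (e '' Set.Iio k) := by
    intro x hx
    induction hx using Submodule.span_induction with
    | mem x hx =>
      obtain ⟨j, hj, rfl⟩ := hx
      obtain ⟨s, hs⟩ := hc j
      rw [← add_sub_cancel_right (c (e j)) (s • e 0), ← hs]
      refine Submodule.sub_mem _ ?_ (Submodule.smul_mem _ _ h0)
      rw [← hsucc]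
      exact Submodule.subset_span ⟨j + 1, Nat.succ_lt_succ hj, rfl⟩
    | zero => rw [map_zero]; exact Submodule.zero_mem _
    | add x y _ _ hx hy => rw [map_add]; exact Submodule.add_mem _ hx hy
    | smul s x _ hx => rw [map_smul]; exact Submodule.smul_mem _ _ hx
  rw [eq_top_iff, ← htop, Submodule.span_le]
  rintro _ ⟨j, rfl⟩
  induction j with
  | zero => exact h0
  | succ j ih =>
    obtain ⟨s, hs⟩ := hc j
    rw [hs]
    exact Submodule.add_mem _ (hstab _ ih) (Submodule.smul_mem _ _ h0)

theorem span_image_Iio_finrank [FiniteDimensional K V] {c : V →ₗ[K] V} {e : ℕ → V}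
    (hc : ∀ k, ∃ s : K, e (k + 1) = c (e k) + s • e 0)
    (htop : Submodule.span K (Set.range e) = ⊤) :
    Submodule.span K (e '' Set.Iio (Module.finrank K V)) = ⊤ := by
  have key : ∀ k, k ≤ Module.finrank K (Submodule.span K (e '' Set.Iio k)) ∨
      Submodule.span K (e '' Set.Iio k) = ⊤ := by
    intro k
    induction k with
    | zero => exact Or.inl (Nat.zero_le _)
    | succ k ih =>
      by_cases hk : e k ∈ Submodule.span K (e '' Set.Iio k)
      · refine Or.inr (eq_top_iff.2 ?_)
        rw [← span_image_Iio_eq_top hc htop hk]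
        exact Submodule.span_mono (Set.image_mono (Set.Iio_subset_Iio (Nat.le_succ k)))
      · have hle : Submodule.span K (e '' Set.Iio k) < Submodule.span K (e '' Set.Iio (k + 1)) := by
          refine lt_of_le_of_ne
            (Submodule.span_mono (Set.image_mono (Set.Iio_subset_Iio (Nat.le_succ k)))) ?_
          intro heq
          rw [heq] at hk
          exact hk (Submodule.subset_span ⟨k, Nat.lt_succ_self k, rfl⟩)
        rcases ih with ih | ih
        · exact Or.inl (lt_of_le_of_lt ih (Submodule.finrank_lt_finrank_of_lt hle))
        · rw [ih] at hk
          exact absurd Submodule.mem_top hk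
  rcases key (Module.finrank K V) with h | h
  · exact Submodule.eq_top_of_finrank_eq (le_antisymm (Submodule.finrank_le _) h)
  · exact h

theorem linearIndependent_finrank [FiniteDimensional K V] {c : V →ₗ[K] V} {e : ℕ → V}
    (hc : ∀ k, ∃ s : K, e (k + 1) = c (e k) + s • e 0)
    (htop : Submodule.span K (Set.range e) = ⊤) :
    LinearIndependent K fun i : Fin (Module.finrank K V) => e i := by
  refine linearIndependent_of_top_le_span_of_card_eq_finrank ?_ (Fintype.card_fin _)
  rw [← span_image_Iio_finrank hc htop]
  refine Submodule.span_mono ?_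
  rintro _ ⟨j, hj, rfl⟩
  exact ⟨⟨j, hj⟩, rfl⟩

theorem finrank_le_of_span [FiniteDimensional K P] (f : ℕ → P) (m : ℕ)
    (h : Submodule.span K (f '' Set.Iio m) = ⊤) : Module.finrank K P ≤ m := by
  classical
  have h' : Submodule.span K (((range m).image f : Finset P) : Set P) = ⊤ := by
    rw [coe_image, coe_range, h]
  have := finrank_span_finset_le_card (R := K) ((range m).image f)
  rw [Set.finrank, h', finrank_top] at this
  exact this.trans (card_image_le.trans (card_range m).le)

theorem le_finrank_of_comp [FiniteDimensional K V] [FiniteDimensional K P] {e : ℕ → V}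
    (he : LinearIndependent K fun i : Fin (Module.finrank K V) => e i) (f : P →ₗ[K] V) (g : ℕ → P)
    (σ : ℕ → ℕ) (hσ : Function.Injective σ) (m : ℕ) (hm : ∀ j < m, σ j < Module.finrank K V)
    (hg : ∀ j, f (g j) = e (σ j)) : m ≤ Module.finrank K P := by
  have h1 : LinearIndependent K fun j : Fin m => e (σ j) :=
    he.comp (fun j : Fin m => (⟨σ j, hm j j.2⟩ : Fin (Module.finrank K V)))
      fun i j hij => Fin.ext (hσ (Fin.mk.inj_iff.1 hij))
  have h2 : LinearIndependent K fun j : Fin m => g j := by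
    refine LinearIndependent.of_comp f ?_
    convert h1 using 1
    ext j
    exact hg j
  simpa using h2.fintype_card_le_finrank

/-- The vectors obtained from `x` by applying alternately `p` and `r`. -/
def alternating (p r : V →ₗ[K] V) (x : V) : ℕ → V
  | 0 => x
  | k + 1 => if Even k then p (alternating p r x k) else r (alternating p r x k)

theorem alternating_succ_of_even (p r : V →ₗ[K] V) (x : V) {k : ℕ} (hk : Even k) :
    alternating p r x (k + 1) = p (alternating p r x k) := by
  rw [alternating, if_pos hk]

theorem alternating_succ_of_odd (p r : V →ₗ[K] V) (x : V) {k : ℕ} (hk : ¬ Even k) :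
    alternating p r x (k + 1) = r (alternating p r x k) := by
  rw [alternating, if_neg hk]

variable {a : V →ₗ[K] P} {a' : P →ₗ[K] V} {b : V →ₗ[K] R} {b' : R →ₗ[K] V} {w : R} {β : R → K}

theorem comp_alternating_odd (ha : ∀ x, a (a' x) = 0) {k : ℕ} (hk : ¬ Even k) :
    a (alternating (a' ∘ₗ a) (b' ∘ₗ b) (b' w) k) = 0 := by
  rcases k with _ | k
  · exact absurd Even.zero hk
  · rw [alternating_succ_of_even _ _ _ (by simpa [Nat.even_add_one] using hk)]
    exact ha _

theorem comp_alternating_even (hb : ∀ x, b (b' x) = -(β x • w)) {k : ℕ} (hk : Even k) :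
    ∃ s : K, b (alternating (a' ∘ₗ a) (b' ∘ₗ b) (b' w) k) = s • w := by
  rcases k with _ | k
  · exact ⟨-β w, by rw [alternating, hb, neg_smul]⟩
  · rw [alternating_succ_of_odd _ _ _ (by simpa [Nat.even_add_one] using hk)]
    exact ⟨_, (hb _).trans (neg_smul _ _).symm⟩

/-- For odd k the vector lies in the image of a', so the first loop kills it. For even k it lies in
the image of b' and the second loop returns a multiple of e_0. Hence the sum of both loops generates
the sequence up to multiples of e_0. -/
theorem alternating_succ (ha : ∀ x, a (a' x) = 0) (hb : ∀ x, b (b' x) = -(β x • w)) (k : ℕ) :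
    ∃ s : K, alternating (a' ∘ₗ a) (b' ∘ₗ b) (b' w) (k + 1) =
      (a' ∘ₗ a + b' ∘ₗ b) (alternating (a' ∘ₗ a) (b' ∘ₗ b) (b' w) k) +
        s • alternating (a' ∘ₗ a) (b' ∘ₗ b) (b' w) 0 := by
  by_cases hk : Even k
  · obtain ⟨s, hs⟩ := comp_alternating_even (a := a) (a' := a') hb hk
    refine ⟨-s, ?_⟩
    rw [alternating_succ_of_even _ _ _ hk, LinearMap.add_apply, LinearMap.comp_apply b', hs,
      map_smul, alternating, add_assoc, neg_smul, add_neg_cancel, add_zero]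
  · refine ⟨0, ?_⟩
    rw [alternating_succ_of_odd _ _ _ hk, LinearMap.add_apply, LinearMap.comp_apply a',
      comp_alternating_odd ha hk, map_zero, zero_add, zero_smul, add_zero]

theorem map_span_alternating_le_left (ha : ∀ x, a (a' x) = 0) :
    ((Submodule.span K (Set.range (alternating (a' ∘ₗ a) (b' ∘ₗ b) (b' w)))).map a).map a' ≤
      Submodule.span K (Set.range (alternating (a' ∘ₗ a) (b' ∘ₗ b) (b' w))) := by
  rw [← Submodule.map_comp, Submodule.map_span, Submodule.span_le]
  rintro _ ⟨_, ⟨k, rfl⟩, rfl⟩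
  by_cases hk : Even k
  · rw [← alternating_succ_of_even _ _ _ hk]
    exact Submodule.subset_span ⟨_, rfl⟩
  · rw [LinearMap.comp_apply, comp_alternating_odd ha hk, map_zero]
    exact Submodule.zero_mem _

theorem map_span_alternating_le_right (hb : ∀ x, b (b' x) = -(β x • w)) :
    ((Submodule.span K (Set.range (alternating (a' ∘ₗ a) (b' ∘ₗ b) (b' w)))).map b ⊔
        Submodule.span K {w}).map b' ≤
      Submodule.span K (Set.range (alternating (a' ∘ₗ a) (b' ∘ₗ b) (b' w))) := by
  have h0 : b' w ∈ Submodule.span K (Set.range (alternating (a' ∘ₗ a) (b' ∘ₗ b) (b' w))) :=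
    Submodule.subset_span ⟨0, rfl⟩
  rw [Submodule.map_sup, sup_le_iff]
  constructor
  · rw [← Submodule.map_comp, Submodule.map_span, Submodule.span_le]
    rintro _ ⟨_, ⟨k, rfl⟩, rfl⟩
    by_cases hk : Even k
    · obtain ⟨s, hs⟩ := comp_alternating_even (a := a) (a' := a') hb hk
      rw [LinearMap.comp_apply, hs, map_smul]
      exact Submodule.smul_mem _ _ h0
    · rw [← alternating_succ_of_odd _ _ _ hk]
      exact Submodule.subset_span ⟨_, rfl⟩
  · rw [Submodule.map_span, Set.image_singleton, Submodule.span_singleton_le_iff_mem]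
    exact h0

/-- The first d = dim V vectors e_k are a basis. Since a kills the odd ones, P is spanned by the a
e_{2j} with 2j < d, and a' sends these to e_{2j+1}. Since b maps the even ones to multiples of w, R
is spanned by w and the b e_{2j+1}, which b' sends to e_0 and e_{2j+2}. Spanning gives the upper
bounds, independence of the images the lower ones. -/
theorem finrank_alternating [FiniteDimensional K V] [FiniteDimensional K P]
    [FiniteDimensional K R] (ha : ∀ x, a (a' x) = 0) (hb : ∀ x, b (b' x) = -(β x • w))
    (htop : Submodule.span K (Set.range (alternating (a' ∘ₗ a) (b' ∘ₗ b) (b' w))) = ⊤)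
    (hP : (⊤ : Submodule K V).map a = ⊤)
    (hR : (⊤ : Submodule K V).map b ⊔ Submodule.span K {w} = ⊤) :
    Module.finrank K V / 2 ≤ Module.finrank K P ∧
      Module.finrank K P ≤ (Module.finrank K V + 1) / 2 ∧
      (Module.finrank K V + 1) / 2 ≤ Module.finrank K R ∧
      Module.finrank K R ≤ Module.finrank K V / 2 + 1 := by
  set d := Module.finrank K V with hd
  set e := alternating (a' ∘ₗ a) (b' ∘ₗ b) (b' w) with he
  have hli := linearIndependent_finrank (alternating_succ ha hb) htop
  have hsp := span_image_Iio_finrank (alternating_succ ha hb) htop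
  have he1 : ∀ j, e (2 * j + 1) = a' (a (e (2 * j))) := fun j =>
    alternating_succ_of_even _ _ _ (even_two_mul j)
  have he2 : ∀ j, e (2 * j + 2) = b' (b (e (2 * j + 1))) := fun j =>
    alternating_succ_of_odd _ _ _ (Nat.not_even_iff_odd.2 ⟨j, rfl⟩)
  let f : ℕ → R := fun j => if j = 0 then w else b (e (2 * j - 1))
  refine ⟨?_, ?_, ?_, ?_⟩
  · refine le_finrank_of_comp hli a' (fun j => a (e (2 * j))) (fun j => 2 * j + 1)
      (fun i j h => by simpa using h) _ (fun j hj => ?_) fun j => (he1 j).symm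
    change 2 * j + 1 < d
    omega
  · refine finrank_le_of_span (K := K) (fun j => a (e (2 * j))) _ ?_
    rw [eq_top_iff, ← hP, ← hsp, Submodule.map_span, Submodule.span_le]
    rintro _ ⟨_, ⟨k, hk, rfl⟩, rfl⟩
    by_cases hk' : Even k
    · obtain ⟨j, rfl⟩ := even_iff_exists_two_mul.1 hk'
      have hk2 : 2 * j < d := hk
      exact Submodule.subset_span ⟨j, show j < (d + 1) / 2 by omega, rfl⟩
    · rw [he, comp_alternating_odd ha hk']
      exact Submodule.zero_mem _
  · refine le_finrank_of_comp hli b' f (fun j => 2 * j)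
      (fun i j h => by simpa using h) _ (fun j hj => ?_) fun j => ?_
    · change 2 * j < d
      omega
    · rcases j with _ | j
      · rfl
      · exact (he2 j).symm
  · refine finrank_le_of_span (K := K) f _ ?_
    have hw : w ∈ Submodule.span K (f '' Set.Iio (d / 2 + 1)) :=
      Submodule.subset_span ⟨0, Nat.succ_pos _, rfl⟩
    rw [eq_top_iff, ← hR, sup_le_iff, Submodule.span_singleton_le_iff_mem]
    refine ⟨?_, hw⟩
    rw [← hsp, Submodule.map_span, Submodule.span_le]
    rintro _ ⟨_, ⟨k, hk, rfl⟩, rfl⟩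
    by_cases hk' : Even k
    · obtain ⟨s, hs⟩ := comp_alternating_even (a := a) (a' := a') hb hk'
      rw [SetLike.mem_coe, hs]
      exact Submodule.smul_mem _ _ hw
    · obtain ⟨j, rfl⟩ := Nat.not_even_iff_odd.1 hk'
      have hk2 : 2 * j + 1 < d := hk
      exact Submodule.subset_span ⟨j + 1, show j + 1 < d / 2 + 1 by omega, rfl⟩

end Alternating

section Chain

/-- Transport along a chain of maps. -/
theorem exists_chain {W : ℕ → Type*} [∀ i, Nonempty (W i)] (f : ∀ i, W (i + 1) → W i) (M : ℕ)
    (w : W M) : ∃ g : ∀ i, W i, g M = w ∧ ∀ i < M, g i = f i (g (i + 1)) := by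
  induction M with
  | zero =>
    exact ⟨Function.update (fun i => Classical.arbitrary (W i)) 0 w, Function.update_self _ _ _,
      fun i hi => absurd hi (Nat.not_lt_zero i)⟩
  | succ M ih =>
    obtain ⟨g, hg, hg'⟩ := ih (f M w)
    refine ⟨Function.update g (M + 1) w, Function.update_self _ _ _, fun i hi => ?_⟩
    rw [Function.update_of_ne hi.ne]
    rcases Nat.lt_succ_iff_lt_or_eq.1 hi with h | rfl
    · rw [Function.update_of_ne (by omega), hg' i h]
    · rw [Function.update_self, hg]

theorem exists_framing_vector {m d : ℕ} (hm : m = 1) (A : (Fin m → ℂ) →ₗ[ℂ] (Fin d → ℂ)) :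
    ∃ (w : Fin d → ℂ) (i : Fin m), ∀ y, A y = y i • w := by
  subst hm
  refine ⟨A fun _ => 1, 0, fun y => ?_⟩
  rw [← map_smul]
  congr 1
  ext i
  rw [Subsingleton.elim i 0]
  simp

theorem comp_framing_eq_zero {m d d' : ℕ} (hm : m = 0) (A : (Fin m → ℂ) →ₗ[ℂ] (Fin d → ℂ))
    (B : (Fin d' → ℂ) →ₗ[ℂ] (Fin m → ℂ)) : A ∘ₗ B = 0 := by
  subst hm
  ext1 i
  ext1
  rw [LinearMap.comp_apply, LinearMap.comp_apply, Subsingleton.elim (B _) 0, map_zero]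
  rfl

end Chain

end

/-! ### The moment map equations and stability for the type D quiver. -/

section

section Stable

variable {M : ℕ} {v : ℕ → ℕ}

theorem deltaFraming_self (n : ℕ) : deltaFraming n n = 1 := if_pos rfl

theorem deltaFraming_of_ne {n i : ℕ} (h : i ≠ n) : deltaFraming n i = 0 := if_neg h

theorem filter_incoming_one (hM : 1 ≤ M) :
    {j ∈ Icc 1 (M + 2) | (j, 1) ∈ arrows (M + 2)} = ∅ := by
  ext j
  simp only [mem_filter, mem_Icc, mem_arrows, notMem_empty, iff_false]
  omega

theorem filter_incoming_mid {i : ℕ} (h1 : 1 ≤ i) (hi : i ≤ M) :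
    {j ∈ Icc 1 (M + 2) | (j, i + 1) ∈ arrows (M + 2)} = {i} := by
  ext j
  simp only [mem_filter, mem_Icc, mem_arrows, mem_singleton]
  omega

theorem filter_incoming_last (hM : 1 ≤ M) :
    {j ∈ Icc 1 (M + 2) | (j, M + 2) ∈ arrows (M + 2)} = {M} := by
  ext j
  simp only [mem_filter, mem_Icc, mem_arrows, mem_singleton, and_true]
  omega

theorem filter_outgoing_mid {i : ℕ} (h1 : 1 ≤ i) (hi : i < M) :
    {j ∈ Icc 1 (M + 2) | (i, j) ∈ arrows (M + 2)} = {i + 1} := by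
  ext j
  simp only [mem_filter, mem_Icc, mem_arrows, mem_singleton]
  omega

theorem filter_outgoing_branch (hM : 1 ≤ M) :
    {j ∈ Icc 1 (M + 2) | (M, j) ∈ arrows (M + 2)} = {M + 1, M + 2} := by
  ext j
  simp only [mem_filter, mem_Icc, mem_arrows, mem_insert, mem_singleton, true_and]
  omega

theorem filter_outgoing_last {i : ℕ} (hi : M < i) :
    {j ∈ Icc 1 (M + 2) | (i, j) ∈ arrows (M + 2)} = ∅ := by
  ext j
  simp only [mem_filter, mem_Icc, mem_arrows, notMem_empty, iff_false]
  omega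

/-- The sum of `X Y` over the arrows ending at `i`. -/
def FramedRep.incoming (R : FramedRep v (deltaFraming (M + 2))) (i : ℕ) :
    (Fin (v i) → ℂ) →ₗ[ℂ] (Fin (v i) → ℂ) :=
  ∑ j ∈ Icc 1 (M + 2) with (j, i) ∈ arrows (M + 2), R.X j i ∘ₗ R.Y j i

variable {R : FramedRep v (deltaFraming (M + 2))}

theorem FramedRep.MomentZero.incoming_eq (hR : R.MomentZero (M + 2)) {i : ℕ} (h1 : 1 ≤ i)
    (hi : i ≤ M + 1) : R.incoming i =
      ∑ j ∈ Icc 1 (M + 2) with (i, j) ∈ arrows (M + 2), R.Y i j ∘ₗ R.X i j := by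
  have h := hR i (mem_Icc.2 ⟨h1, by omega⟩)
  rw [comp_framing_eq_zero (deltaFraming_of_ne (by omega)), add_zero, sub_eq_zero] at h
  exact h

theorem FramedRep.MomentZero.incoming_mid (hR : R.MomentZero (M + 2)) {i : ℕ} (h1 : 1 ≤ i)
    (hi : i < M) : R.incoming i = R.Y i (i + 1) ∘ₗ R.X i (i + 1) := by
  rw [hR.incoming_eq h1 (by omega), filter_outgoing_mid h1 hi, sum_singleton]

theorem FramedRep.MomentZero.incoming_branch (hR : R.MomentZero (M + 2)) (hM : 1 ≤ M) :
    R.incoming M = R.Y M (M + 1) ∘ₗ R.X M (M + 1) + R.Y M (M + 2) ∘ₗ R.X M (M + 2) := by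
  rw [hR.incoming_eq hM (by omega), filter_outgoing_branch hM, sum_pair (by omega)]

theorem FramedRep.incoming_one (hM : 1 ≤ M) : R.incoming 1 = 0 := by
  rw [FramedRep.incoming, filter_incoming_one hM, sum_empty]

theorem FramedRep.incoming_succ {i : ℕ} (h1 : 1 ≤ i) (hi : i ≤ M) :
    R.incoming (i + 1) = R.X i (i + 1) ∘ₗ R.Y i (i + 1) := by
  rw [FramedRep.incoming, filter_incoming_mid h1 hi, sum_singleton]

theorem FramedRep.incoming_last (hM : 1 ≤ M) :
    R.incoming (M + 2) = R.X M (M + 2) ∘ₗ R.Y M (M + 2) := by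
  rw [FramedRep.incoming, filter_incoming_last hM, sum_singleton]

theorem FramedRep.MomentZero.comp_penult (hR : R.MomentZero (M + 2)) (hM : 1 ≤ M)
    (x : Fin (v (M + 1)) → ℂ) : R.X M (M + 1) (R.Y M (M + 1) x) = 0 := by
  have h := hR.incoming_eq (i := M + 1) (by omega) le_rfl
  rw [R.incoming_succ hM le_rfl, filter_outgoing_last (Nat.lt_succ_self M), sum_empty] at h
  exact LinearMap.congr_fun h x

theorem FramedRep.MomentZero.comp_last (hR : R.MomentZero (M + 2)) (hM : 1 ≤ M)
    (x : Fin (v (M + 2)) → ℂ) : R.X M (M + 2) (R.Y M (M + 2) x) =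
      -(R.A (M + 2) (R.B (M + 2) x)) := by
  have h := hR (M + 2) (mem_Icc.2 ⟨by omega, le_rfl⟩)
  rw [filter_outgoing_last (i := M + 2) (by omega), sum_empty, sub_zero] at h
  change R.incoming (M + 2) + _ = 0 at h
  rw [R.incoming_last hM] at h
  exact eq_neg_of_add_eq_zero_left (LinearMap.congr_fun h x)

/-- A family of subspaces `U i ⊆ V i` (`i ≤ n - 2`) with `U i = Y (U (i + 1))` that is stable under
the loops at the branch vertex is everything. -/
theorem FramedRep.Stable.eq_top_of_chain (hS : R.Stable (M + 2)) (hR : R.MomentZero (M + 2))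
    (hM : 1 ≤ M) {w : Fin (v (M + 2)) → ℂ}
    (hw : LinearMap.range (R.A (M + 2)) ≤ Submodule.span ℂ {w})
    (U : ∀ i, Submodule ℂ (Fin (v i) → ℂ))
    (hU : ∀ i < M, U i = (U (i + 1)).map (R.Y i (i + 1)))
    (h1 : ((U M).map (R.X M (M + 1))).map (R.Y M (M + 1)) ≤ U M)
    (h2 : ((U M).map (R.X M (M + 2)) ⊔ Submodule.span ℂ {w}).map (R.Y M (M + 2)) ≤ U M) :
    (∀ i, 1 ≤ i → i ≤ M → U i = ⊤) ∧ (U M).map (R.X M (M + 1)) = ⊤ ∧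
      (U M).map (R.X M (M + 2)) ⊔ Submodule.span ℂ {w} = ⊤ := by
  -- Descending induction along the tail. At the branch vertex the moment map turns the incoming
  -- loop into the sum of the two end loops; further down, the incoming loop is YX, and YX applied
  -- to Y(U_{i+1}) equals Y applied to the loop image of U_{i+1}.
  have hstab : ∀ k i, i + k = M → 1 ≤ i → (U i).map (R.incoming i) ≤ U i := by
    intro k
    induction k with
    | zero =>
      intro i hi _
      obtain rfl : i = M := hi
      rw [hR.incoming_branch hM]
      refine (Submodule.map_add_le _ _ _).trans (sup_le ?_ ?_)
      · rw [Submodule.map_comp]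
        exact h1
      · rw [Submodule.map_comp]
        exact (Submodule.map_mono le_sup_left).trans h2
    | succ k ih =>
      intro i hi hi1
      have h := ih (i + 1) (by omega) (by omega)
      rw [R.incoming_succ hi1 (by omega)] at h
      rw [hR.incoming_mid hi1 (by omega), Submodule.map_comp, hU i (by omega)]
      refine Submodule.map_mono ?_
      rw [← Submodule.map_comp]
      exact h
  -- At the two end vertices the collection is completed by the images of `U M`, with the framing
  -- vector adjoined at the framed end.
  let S : ∀ i, Submodule ℂ (Fin (v i) → ℂ) :=
    Function.update (Function.update U (M + 1) ((U M).map (R.X M (M + 1)))) (M + 2)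
      ((U M).map (R.X M (M + 2)) ⊔ Submodule.span ℂ {w})
  have e0 : ∀ i ≤ M, S i = U i := fun i hi => by
    simp only [S]
    rw [Function.update_of_ne (by omega), Function.update_of_ne (by omega)]
  have e1 : S (M + 1) = (U M).map (R.X M (M + 1)) := by
    simp only [S]
    rw [Function.update_of_ne (by omega), Function.update_self]
  have e2 : S (M + 2) = (U M).map (R.X M (M + 2)) ⊔ Submodule.span ℂ {w} :=
    Function.update_self _ _ _
  have htop := hS S ?_ ?_
  · refine ⟨fun i hi hi' => ?_, ?_, ?_⟩
    · rw [← e0 i hi']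
      exact htop i (mem_Icc.2 ⟨hi, by omega⟩)
    · rw [← e1]
      exact htop _ (mem_Icc.2 ⟨by omega, by omega⟩)
    · rw [← e2]
      exact htop _ (mem_Icc.2 ⟨by omega, by omega⟩)
  · intro i hi
    by_cases hi' : i = M + 2
    · subst hi'
      rw [e2]
      exact hw.trans le_sup_right
    · rintro _ ⟨y, rfl⟩
      have : IsEmpty (Fin (deltaFraming (M + 2) i)) := by
        rw [deltaFraming_of_ne hi']
        infer_instance
      rw [Subsingleton.elim y 0, map_zero]
      exact Submodule.zero_mem _
  · intro i j hij
    rw [mem_arrows] at hij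
    rcases hij with ⟨rfl, rfl⟩ | ⟨hi1, hi, rfl⟩
    · rw [e0 i le_rfl, e2]
      exact ⟨le_sup_left, h2⟩
    · rcases hi.eq_or_lt with rfl | hlt
      · rw [e0 i le_rfl, e1]
        exact ⟨le_rfl, h1⟩
      · rw [e0 i hi, e0 (i + 1) hlt]
        constructor
        · have h := hstab (M - (i + 1)) (i + 1) (by omega) (by omega)
          rw [R.incoming_succ hi1 hi, Submodule.map_comp, ← hU i hlt] at h
          exact h
        · rw [← hU i hlt]

/-- The moment map makes the loop XY vanish at vertex n - 1 and maps into the line of the framing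
vector w at vertex n, so the span of the alternating vectors is preserved by both loops at the
branch vertex. Pushed down the tail by Y it is an invariant collection, hence everything by
stability, and `finrank_alternating` gives the dimensions at the ends. -/
theorem admissible_of_nonempty (hM : 1 ≤ M)
    (hv : QuiverVarietyNonempty (M + 2) v (deltaFraming (M + 2))) : Admissible (M + 2) v := by
  obtain ⟨R, hR, hS⟩ := hv
  obtain ⟨w, i₀, hA⟩ := exists_framing_vector (deltaFraming_self _) (R.A (M + 2))
  set a := R.X M (M + 1)
  set a' := R.Y M (M + 1)
  set b := R.X M (M + 2)
  set b' := R.Y M (M + 2)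
  have ha : ∀ x, a (a' x) = 0 := hR.comp_penult hM
  have hb : ∀ x, b (b' x) = -((R.B (M + 2) x i₀) • w) := fun x => by
    rw [← hA]
    exact hR.comp_last hM x
  set e := alternating (a' ∘ₗ a) (b' ∘ₗ b) (b' w) with he
  obtain ⟨U, hUM, hU⟩ := exists_chain
    (W := fun i => Submodule ℂ (Fin (v i) → ℂ)) (fun i S => S.map (R.Y i (i + 1))) M
    (Submodule.span ℂ (Set.range e))
  have hw : LinearMap.range (R.A (M + 2)) ≤ Submodule.span ℂ {w} := by
    rintro _ ⟨y, rfl⟩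
    rw [hA]
    exact Submodule.smul_mem _ _ (Submodule.mem_span_singleton_self w)
  obtain ⟨h1, h2, h3⟩ := hS.eq_top_of_chain hR hM hw U hU
    (by rw [hUM]; exact map_span_alternating_le_left ha)
    (by rw [hUM]; exact map_span_alternating_le_right hb)
  have htop : Submodule.span ℂ (Set.range e) = ⊤ := hUM ▸ h1 M hM le_rfl
  rw [h1 M hM le_rfl] at h2 h3
  obtain ⟨f1, f2, f3, f4⟩ := finrank_alternating ha hb htop h2 h3
  simp only [Module.finrank_fin_fun] at f1 f2 f3 f4
  -- One vector together with the image of the incoming loop spans V_i: e_0 at the branch vertex,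
  -- carried down the tail by Y. The loop at i + 1 factors through V_i, which bounds v (i + 1) by v
  -- i + 1; at vertex 1 the loop is zero.
  have hgen : ∀ k i, i + k = M → 1 ≤ i → ∃ g, Submodule.span ℂ {g} ⊔
      LinearMap.range (R.incoming i) = ⊤ := by
    intro k
    induction k with
    | zero =>
      intro i hi _
      obtain rfl : i = M := hi
      refine ⟨e 0, ?_⟩
      rw [eq_top_iff, ← htop, Submodule.span_le]
      rintro _ ⟨k, rfl⟩
      have h0 : e 0 ∈ Submodule.span ℂ {e 0} ⊔ LinearMap.range (R.incoming i) :=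
        Submodule.mem_sup_left (Submodule.mem_span_singleton_self _)
      rcases k with _ | k
      · exact h0
      · obtain ⟨s, hs⟩ := alternating_succ ha hb k
        rw [SetLike.mem_coe, he, hs, ← hR.incoming_branch hM]
        exact Submodule.add_mem _ (Submodule.mem_sup_right ⟨_, rfl⟩) (Submodule.smul_mem _ _ h0)
    | succ k ih =>
      intro i hi hi1
      obtain ⟨g, hg⟩ := ih (i + 1) (by omega) (by omega)
      refine ⟨R.Y i (i + 1) g, ?_⟩
      rw [eq_top_iff, ← h1 i hi1 (by omega), hU i (by omega), h1 (i + 1) (by omega) (by omega),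
        ← hg, R.incoming_succ hi1 (by omega), hR.incoming_mid hi1 (by omega), Submodule.map_sup,
        Submodule.map_span, Set.image_singleton]
      refine sup_le_sup le_rfl ?_
      rintro _ ⟨_, ⟨x, rfl⟩, rfl⟩
      exact ⟨R.Y i (i + 1) x, rfl⟩
  have hone : v 1 ≤ 1 := by
    obtain ⟨g, hg⟩ := hgen (M - 1) 1 (by omega) le_rfl
    rw [R.incoming_one hM, LinearMap.range_zero, sup_bot_eq] at hg
    have : Module.finrank ℂ (Submodule.span ℂ {g}) ≤ 1 := by
      simpa using finrank_span_le_card (R := ℂ) ({g} : Set (Fin (v 1) → ℂ))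
    rw [hg, finrank_top, Module.finrank_fin_fun] at this
    exact this
  have hle : ∀ i, 1 ≤ i → i < M → v i ≤ v (i + 1) := by
    intro i hi1 hi
    have h : (⊤ : Submodule ℂ (Fin (v i) → ℂ)) = Submodule.map (R.Y i (i + 1)) ⊤ := by
      rw [← h1 i hi1 hi.le, ← h1 (i + 1) (by omega) hi, hU i hi]
    have := Submodule.finrank_map_le (R.Y i (i + 1)) ⊤
    rw [← h, finrank_top, finrank_top, Module.finrank_fin_fun, Module.finrank_fin_fun] at this
    exact this
  have hge : ∀ i, 1 ≤ i → i < M → v (i + 1) ≤ v i + 1 := by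
    intro i hi1 hi
    obtain ⟨g, hg⟩ := hgen (M - (i + 1)) (i + 1) (by omega) (by omega)
    have e1 := Submodule.finrank_add_le_finrank_add_finrank (Submodule.span ℂ {g})
      (LinearMap.range (R.incoming (i + 1)))
    rw [hg, finrank_top, Module.finrank_fin_fun, R.incoming_succ hi1 hi.le] at e1
    have e2 : Module.finrank ℂ (Submodule.span ℂ {g}) ≤ 1 := by
      simpa using finrank_span_le_card (R := ℂ) ({g} : Set (Fin (v (i + 1)) → ℂ))
    have e3 := Submodule.finrank_mono (LinearMap.range_comp_le_range (R.Y i (i + 1))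
      (R.X i (i + 1)))
    have e4 := LinearMap.finrank_range_le (R.X i (i + 1))
    rw [Module.finrank_fin_fun] at e4
    omega
  constructor
  · intro i hi
    rcases Nat.lt_succ_iff_lt_or_eq.1 (Nat.lt_of_succ_lt_succ hi) with hi | rfl
    · rw [len_mid v hi]
      rcases i with _ | i
      · rw [len_zero]
        exact Nat.le_one_iff_eq_zero_or_eq_one.1 hone
      · rw [len_mid v (by omega)]
        have := hle (i + 1) (by omega) hi
        have := hge (i + 1) (by omega) hi
        omega
    · obtain ⟨m, rfl⟩ : ∃ m, i = m + 1 := ⟨i - 1, by omega⟩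
      rw [len_last, len_mid v (by omega)]
      omega
  · change v (M + 2) = (len (M + 2) v (M + 1) + 1) / 2
    rw [len_last]
    omega

end Stable

end

section

/-! ### Interlacing tuples and reverse plane partitions -/

/-- The element of the poset holding the entry `p` (counted from the smallest one) of the `i`-th
partition; the two last colors are merged. -/
def cell (M i p : ℕ) : ℕ × ℕ :=
  if i = M + 1 then (if Even p then (M + 2, p / 2 + 1) else (M + 1, (p + 1) / 2)) else (i, p + 1)

theorem cell_of_le {M i : ℕ} (hi : i ≤ M) (p : ℕ) : cell M i p = (i, p + 1) :=
  if_neg (by omega)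

theorem cell_even (M j : ℕ) : cell M (M + 1) (2 * j) = (M + 2, j + 1) := by
  rw [cell, if_pos rfl, if_pos (even_two_mul j), Nat.mul_div_cancel_left j two_pos]

theorem cell_odd (M j : ℕ) : cell M (M + 1) (2 * j + 1) = (M + 1, j + 1) := by
  rw [cell, if_pos rfl, if_neg (Nat.not_even_iff_odd.2 ⟨j, rfl⟩), Prod.mk.injEq]
  exact ⟨rfl, by omega⟩

/-- The entry of the `i`-th partition at position `p`, counted from the bottom. -/
def bottomRow (n : ℕ) (v : ℕ → ℕ) (lam : ℕ → YoungDiagram) (i p : ℕ) : ℕ :=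
  (lam i).rowLen (len n v i - 1 - p)

open Classical in
/-- The reverse plane partition of a tuple of partitions. -/
def toRPP (M : ℕ) (v : ℕ → ℕ) (lam : ℕ → YoungDiagram) (i j : ℕ) : ℕ :=
  if InPoset (M + 2) v (i, j) then
    if i = M + 2 then bottomRow (M + 2) v lam (M + 1) (2 * (j - 1))
    else if i = M + 1 then bottomRow (M + 2) v lam (M + 1) (2 * (j - 1) + 1)
    else bottomRow (M + 2) v lam i (j - 1)
  else 0

theorem toRPP_of_not {M : ℕ} {v : ℕ → ℕ} {lam : ℕ → YoungDiagram} {i j : ℕ}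
    (h : ¬ InPoset (M + 2) v (i, j)) : toRPP M v lam i j = 0 := if_neg h

theorem len_of_le {M i : ℕ} (v : ℕ → ℕ) (h1 : 1 ≤ i) (hi : i ≤ M) : len (M + 2) v i = v i := by
  obtain ⟨i, rfl⟩ : ∃ k, i = k + 1 := ⟨i - 1, by omega⟩
  exact len_mid v (by omega)

section Bijection

variable {M : ℕ} {v : ℕ → ℕ}

theorem Admissible.last_eq (hv : Admissible (M + 2) v) :
    v (M + 2) = (len (M + 2) v (M + 1) + 1) / 2 := hv.last

theorem Admissible.penult_eq (hv : Admissible (M + 2) v) :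
    v (M + 1) = len (M + 2) v (M + 1) / 2 := by
  have h := hv.last_eq
  have h' := len_last M v
  omega

theorem Admissible.inPoset_cell (hv : Admissible (M + 2) v) {i p : ℕ} (h1 : 1 ≤ i)
    (hi : i ≤ M + 1) (hp : p < len (M + 2) v i) : InPoset (M + 2) v (cell M i p) := by
  rcases hi.lt_or_eq with hi | rfl
  · rw [cell_of_le (by omega)]
    rw [len_of_le v h1 (by omega)] at hp
    exact ⟨mem_Icc.2 ⟨h1, by change i ≤ M + 2; omega⟩,
      mem_Icc.2 ⟨Nat.succ_pos p, hp⟩⟩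
  · have e1 := hv.last_eq
    have e2 := hv.penult_eq
    obtain ⟨j, rfl | rfl⟩ := p.even_or_odd'
    · rw [cell_even]
      exact ⟨mem_Icc.2 ⟨Nat.succ_pos _, le_rfl⟩,
        mem_Icc.2 ⟨Nat.succ_pos j, by change j + 1 ≤ v (M + 2); omega⟩⟩
    · rw [cell_odd]
      exact ⟨mem_Icc.2 ⟨Nat.succ_pos _, Nat.le_succ _⟩,
        mem_Icc.2 ⟨Nat.succ_pos j, by change j + 1 ≤ v (M + 1); omega⟩⟩

theorem Admissible.exists_cell (hv : Admissible (M + 2) v) {a : ℕ × ℕ}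
    (h : InPoset (M + 2) v a) :
    ∃ i p, 1 ≤ i ∧ i ≤ M + 1 ∧ p < len (M + 2) v i ∧ a = cell M i p := by
  obtain ⟨i, j⟩ := a
  obtain ⟨h3, h4⟩ := h
  obtain ⟨h1, h1'⟩ : 1 ≤ i ∧ i ≤ M + 2 := mem_Icc.1 h3
  obtain ⟨h2, h2'⟩ : 1 ≤ j ∧ j ≤ v i := mem_Icc.1 h4
  obtain ⟨j, rfl⟩ : ∃ k, j = k + 1 := ⟨j - 1, by omega⟩
  have e1 := hv.last_eq
  have e2 := hv.penult_eq
  by_cases hi : i ≤ M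
  · exact ⟨i, j, h1, by omega, by rw [len_of_le v h1 hi]; omega, (cell_of_le hi j).symm⟩
  by_cases hi' : i = M + 1
  · subst hi'
    exact ⟨M + 1, 2 * j + 1, by omega, le_rfl, by omega, (cell_odd M j).symm⟩
  · obtain rfl : i = M + 2 := by omega
    exact ⟨M + 1, 2 * j, by omega, le_rfl, by omega, (cell_even M j).symm⟩

theorem Admissible.toRPP_cell (hv : Admissible (M + 2) v) (lam : ℕ → YoungDiagram) {i p : ℕ}
    (h1 : 1 ≤ i) (hi : i ≤ M + 1) (hp : p < len (M + 2) v i) :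
    toRPP M v lam (cell M i p).1 (cell M i p).2 = bottomRow (M + 2) v lam i p := by
  rw [toRPP, if_pos (hv.inPoset_cell h1 hi hp)]
  rcases hi.lt_or_eq with hi | rfl
  · rw [cell_of_le (by omega), if_neg (by change i ≠ M + 2; omega),
      if_neg (by change i ≠ M + 1; omega)]
    rfl
  · obtain ⟨j, rfl | rfl⟩ := p.even_or_odd'
    · rw [cell_even, if_pos rfl]
      rfl
    · rw [cell_odd, if_neg (by change M + 1 ≠ M + 2; omega), if_pos rfl]
      rfl

theorem spinLE_cell_down {i : ℕ} (h1 : 1 ≤ i) (hi : i ≤ M) (p : ℕ) :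
    SpinLE (M + 2) (cell M (i + 1) p) (cell M i p) := by
  rw [cell_of_le hi]
  rcases hi.lt_or_eq with hi | rfl
  · rw [cell_of_le hi]
    exact .down i (p + 1) (mem_Icc.2 ⟨h1, by omega⟩)
  · obtain ⟨j, rfl | rfl⟩ := p.even_or_odd'
    · rw [cell_even]
      exact .oddDown (j + 1)
    · rw [cell_odd]
      exact .evenDown (j + 1)

theorem spinLE_cell_up {i : ℕ} (h1 : 1 ≤ i) (hi : i ≤ M) (p : ℕ) :
    SpinLE (M + 2) (cell M i p) (cell M (i + 1) (p + 1)) := by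
  rw [cell_of_le hi]
  rcases hi.lt_or_eq with hi | rfl
  · rw [cell_of_le hi]
    exact .up i (p + 1) (mem_Icc.2 ⟨h1, by omega⟩)
  · obtain ⟨j, rfl | rfl⟩ := p.even_or_odd'
    · rw [cell_odd]
      exact .evenUp (j + 1)
    · rw [show 2 * j + 1 + 1 = 2 * (j + 1) by ring, cell_even]
      exact .oddUp (j + 2)

/-- When the last two colors are merged and positions are counted from the bottom, the six families
of generating relations reduce to two: position p of row i lies above position p and below position
p + 1 of row i + 1. -/
theorem exists_cell_of_spinLE {a b : ℕ × ℕ} (h : SpinLE (M + 2) a b)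
    (ha : InPoset (M + 2) v a) (hb : InPoset (M + 2) v b) :
    ∃ i p, 1 ≤ i ∧ i ≤ M ∧ p < v i ∧
      (a = cell M (i + 1) p ∧ b = cell M i p ∨ a = cell M i p ∧ b = cell M (i + 1) (p + 1)) := by
  have hM : ∀ {j : ℕ}, InPoset (M + 2) v (M, j) → 1 ≤ M ∧ 1 ≤ j ∧ j ≤ v M := fun h =>
    ⟨(mem_Icc.1 h.1).1, (mem_Icc.1 h.2).1, (mem_Icc.1 h.2).2⟩
  cases h with
  | down i j h =>
    obtain ⟨h1, h2⟩ : 1 ≤ i ∧ i ≤ M + 2 - 3 := mem_Icc.1 h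
    obtain ⟨h3, h4⟩ : 1 ≤ j ∧ j ≤ v i := mem_Icc.1 hb.2
    obtain ⟨j, rfl⟩ : ∃ k, j = k + 1 := ⟨j - 1, by omega⟩
    exact ⟨i, j, h1, by omega, h4,
      Or.inl ⟨(cell_of_le (by omega) _).symm, (cell_of_le (by omega) _).symm⟩⟩
  | up i j h =>
    obtain ⟨h1, h2⟩ : 1 ≤ i ∧ i ≤ M + 2 - 3 := mem_Icc.1 h
    obtain ⟨h3, h4⟩ : 1 ≤ j ∧ j ≤ v i := mem_Icc.1 ha.2
    obtain ⟨j, rfl⟩ : ∃ k, j = k + 1 := ⟨j - 1, by omega⟩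
    exact ⟨i, j, h1, by omega, h4,
      Or.inr ⟨(cell_of_le (by omega) _).symm, (cell_of_le (by omega) _).symm⟩⟩
  | evenDown j =>
    obtain ⟨h1, h2, h3⟩ := hM hb
    obtain ⟨j, rfl⟩ : ∃ k, j = k + 1 := ⟨j - 1, by omega⟩
    exact ⟨M, 2 * j + 1, h1, le_rfl, by omega,
      Or.inl ⟨(cell_odd M j).symm, (cell_of_le le_rfl _).symm⟩⟩
  | evenUp j =>
    obtain ⟨h1, h2, h3⟩ := hM ha
    obtain ⟨j, rfl⟩ : ∃ k, j = k + 1 := ⟨j - 1, by omega⟩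
    exact ⟨M, 2 * j, h1, le_rfl, by omega,
      Or.inr ⟨(cell_of_le le_rfl _).symm, (cell_odd M j).symm⟩⟩
  | oddDown j =>
    obtain ⟨h1, h2, h3⟩ := hM hb
    obtain ⟨j, rfl⟩ : ∃ k, j = k + 1 := ⟨j - 1, by omega⟩
    exact ⟨M, 2 * j, h1, le_rfl, by omega,
      Or.inl ⟨(cell_even M j).symm, (cell_of_le le_rfl _).symm⟩⟩
  | oddUp j =>
    obtain ⟨h1, h2, h3⟩ := hM ha
    -- The case j = 1 would need the element with second index 0, which is not in the poset.
    obtain ⟨j, rfl⟩ : ∃ k, j = k + 2 := ⟨j - 2, by omega⟩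
    exact ⟨M, 2 * j + 1, h1, le_rfl, by omega,
      Or.inr ⟨(cell_of_le le_rfl _).symm, (cell_even M (j + 1)).symm⟩⟩

theorem Admissible.len_mono (hv : Admissible (M + 2) v) {i : ℕ} (hi : i ≤ M) :
    len (M + 2) v i ≤ len (M + 2) v (i + 1) ∧ len (M + 2) v (i + 1) ≤ len (M + 2) v i + 1 := by
  have := hv.step i (by omega)
  omega

/-- The inequalities between the bottom-aligned entries of consecutive rows. -/
def Nested (M : ℕ) (v : ℕ → ℕ) (b : ℕ → ℕ → ℕ) : Prop :=
  ∀ i ≤ M, ∀ p < len (M + 2) v i, b (i + 1) p ≤ b i p ∧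
    (p + 1 < len (M + 2) v (i + 1) → b i p ≤ b (i + 1) (p + 1))

/-- Counting from the bottom absorbs the sign τ: if the length stays the same the interlacing points
one way, if it grows by one the alignment shifts and the opposite interlacing yields the same
inequalities. -/
theorem Admissible.nested_of_interlacing (hv : Admissible (M + 2) v) {lam : ℕ → YoungDiagram}
    (hlam : lam ∈ interlacingTuples (M + 2) v) : Nested M v (bottomRow (M + 2) v lam) := by
  intro i hi p hp
  obtain ⟨h1, h2, -⟩ := hlam.2.2 (i + 1) (mem_Icc.2 ⟨by omega, by omega⟩)
  rw [Nat.add_sub_cancel] at h1 h2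
  simp only [bottomRow]
  rcases hv.step i (by omega) with h | h
  · have hI := h2 (sgn_succ_of_eq h)
    rw [h]
    refine ⟨(hI _).1, fun hp' => ?_⟩
    have h3 := (hI (len (M + 2) v i - 1 - (p + 1))).2
    rwa [show len (M + 2) v i - 1 - (p + 1) + 1 = len (M + 2) v i - 1 - p by omega] at h3
  · have hI := h1 (sgn_succ_of_succ h)
    rw [h]
    have h3 := hI (len (M + 2) v i - 1 - p)
    rw [show len (M + 2) v i - 1 - p + 1 = len (M + 2) v i + 1 - 1 - p by omega] at h3
    refine ⟨h3.2, fun hp' => ?_⟩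
    rw [show len (M + 2) v i + 1 - 1 - (p + 1) = len (M + 2) v i - 1 - p by omega]
    exact h3.1

/-- Monotonicity within a row is not part of `Nested`; it comes from passing through the next row,
or through the previous one when the row is the last. -/
theorem Nested.le_succ (hv : Admissible (M + 2) v) {b : ℕ → ℕ → ℕ} (hb : Nested M v b)
    {i p : ℕ} (hi : i ≤ M + 1) (hp : p + 1 < len (M + 2) v i) : b i p ≤ b i (p + 1) := by
  rcases hi.lt_or_eq with hi | rfl
  · have h1 := hv.len_mono (Nat.le_of_lt_succ hi)
    exact ((hb i (by omega) p (by omega)).2 (by omega)).trans (hb i (by omega) (p + 1) hp).1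
  · have h1 := hv.len_mono (le_refl M)
    exact (hb M le_rfl p (by omega)).1.trans ((hb M le_rfl p (by omega)).2 hp)

theorem Nested.monotone (hv : Admissible (M + 2) v) {b : ℕ → ℕ → ℕ} (hb : Nested M v b)
    {i p s : ℕ} (hi : i ≤ M + 1) (hps : p ≤ s) (hs : s < len (M + 2) v i) : b i p ≤ b i s := by
  induction s, hps using Nat.le_induction with
  | base => exact le_rfl
  | succ s hps ih => exact (ih (by omega)).trans (hb.le_succ hv hi hs)

theorem Nested.exists_diagram (hv : Admissible (M + 2) v) {b : ℕ → ℕ → ℕ} (hb : Nested M v b)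
    (i : ℕ) : ∃ μ : YoungDiagram, μ.rowLen = fun k =>
      if i ≤ M + 1 ∧ k < len (M + 2) v i then b i (len (M + 2) v i - 1 - k) else 0 := by
  refine ⟨_, rowLen_ofRows _ ?_ (len (M + 2) v i) (if_neg (by omega))⟩
  intro k k' hk
  dsimp only
  split_ifs with h1 h2 h2
  · exact hb.monotone hv h1.1 (by omega) (by omega)
  · omega
  · exact Nat.zero_le _
  · exact le_rfl

theorem Nested.exists_tuple (hv : Admissible (M + 2) v) {b : ℕ → ℕ → ℕ} (hb : Nested M v b) :
    ∃ lam ∈ interlacingTuples (M + 2) v, ∀ i ≤ M + 1, ∀ p < len (M + 2) v i,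
      bottomRow (M + 2) v lam i p = b i p := by
  choose lam hlam using hb.exists_diagram hv
  have hrow : ∀ i ≤ M + 1, ∀ k, (lam i).rowLen k =
      if k < len (M + 2) v i then b i (len (M + 2) v i - 1 - k) else 0 := fun i hi k => by
    simp only [hlam, hi, true_and]
  refine ⟨lam, ⟨?_, fun i hi => ?_, fun i hi => ?_⟩, fun i hi p hp => ?_⟩
  · refine rowLen_injective (funext fun k => ?_)
    rw [hrow 0 (by omega), rowLen_bot, len_zero, if_neg (by omega)]
  · refine rowLen_injective (funext fun k => ?_)
    rw [hlam, rowLen_bot]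
    exact if_neg (by omega)
  · obtain ⟨i, rfl⟩ : ∃ k, i = k + 1 := ⟨i - 1, by have := (mem_Icc.1 hi).1; omega⟩
    have hi : i + 1 ≤ M + 2 - 1 := (mem_Icc.1 hi).2
    rw [Nat.add_sub_cancel]
    refine ⟨fun hs k => ?_, fun hs k => ?_, ?_⟩
    · have h := (hv.step i (by omega)).resolve_left fun h => by
        rw [sgn_succ_of_eq h] at hs
        exact absurd hs (by decide)
      rw [hrow i (by omega), hrow (i + 1) (by omega), hrow (i + 1) (by omega), h]
      constructor
      · split_ifs with h1 h2
        · have := (hb i (by omega) (len (M + 2) v i - 1 - k) (by omega)).2 (by omega)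
          rwa [show len (M + 2) v i - 1 - k + 1 = len (M + 2) v i + 1 - 1 - k by omega] at this
        · omega
        · exact Nat.zero_le _
        · exact le_rfl
      · split_ifs with h1 h2
        · have := (hb i (by omega) (len (M + 2) v i - 1 - k) (by omega)).1
          rwa [show len (M + 2) v i + 1 - 1 - (k + 1) = len (M + 2) v i - 1 - k by omega]
        · omega
        · exact Nat.zero_le _
        · exact le_rfl
    · have h := (hv.step i (by omega)).resolve_right fun h => by
        rw [sgn_succ_of_succ h] at hs
        exact absurd hs (by decide)
      rw [hrow i (by omega), hrow (i + 1) (by omega), hrow i (by omega), h]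
      constructor
      · split_ifs with h1
        · exact (hb i (by omega) (len (M + 2) v i - 1 - k) (by omega)).1
        · exact le_rfl
      · split_ifs with h1 h2
        · have := (hb i (by omega) (len (M + 2) v i - 1 - (k + 1)) (by omega)).2 (by omega)
          rwa [show len (M + 2) v i - 1 - (k + 1) + 1 = len (M + 2) v i - 1 - k by omega] at this
        · omega
        · exact Nat.zero_le _
        · exact le_rfl
    · rw [← rowLen_eq_zero_iff, hrow (i + 1) (by omega), if_neg (lt_irrefl _)]
  · rw [bottomRow, hrow i hi, if_pos (by omega)]
    congr 1
    omega

theorem Admissible.isRPP_toRPP (hv : Admissible (M + 2) v) {lam : ℕ → YoungDiagram}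
    (hlam : lam ∈ interlacingTuples (M + 2) v) : IsRPP (M + 2) v (toRPP M v lam) := by
  refine ⟨fun i j h => toRPP_of_not h, fun a b ha hb hab => ?_⟩
  obtain ⟨i, p, h1, hi, hp, ⟨rfl, rfl⟩ | ⟨rfl, rfl⟩⟩ := exists_cell_of_spinLE hab ha hb
  · rw [← len_of_le v h1 hi] at hp
    have hm := hv.len_mono hi
    rw [hv.toRPP_cell lam h1 (by omega) hp, hv.toRPP_cell lam (by omega) (by omega) (by omega)]
    exact (hv.nested_of_interlacing hlam i hi p hp).1
  · rw [← len_of_le v h1 hi] at hp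
    have hp' : p + 1 < len (M + 2) v (i + 1) := by
      rcases hi.lt_or_eq with hi' | rfl
      · rw [cell_of_le (by omega)] at hb
        rw [len_of_le v (by omega) (by omega)]
        exact (mem_Icc.1 hb.2).2
      · have e1 := hv.last_eq
        have e2 := hv.penult_eq
        obtain ⟨j, hj | hj⟩ := (p + 1).even_or_odd'
        · rw [hj, cell_even] at hb
          have : j + 1 ≤ v (i + 2) := (mem_Icc.1 hb.2).2
          omega
        · rw [hj, cell_odd] at hb
          have : j + 1 ≤ v (i + 1) := (mem_Icc.1 hb.2).2
          omega
    rw [hv.toRPP_cell lam h1 (by omega) hp, hv.toRPP_cell lam (by omega) (by omega) hp']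
    exact (hv.nested_of_interlacing hlam i hi p hp).2 hp'

theorem Admissible.nested_of_isRPP (hv : Admissible (M + 2) v) {π : ℕ → ℕ → ℕ}
    (hπ : IsRPP (M + 2) v π) : Nested M v fun i p => π (cell M i p).1 (cell M i p).2 := by
  intro i hi p hp
  have h1 : 1 ≤ i := by
    by_contra h
    obtain rfl : i = 0 := by omega
    rw [len_zero] at hp
    omega
  have hm := hv.len_mono hi
  have hc := hv.inPoset_cell h1 (by omega) hp
  exact ⟨hπ.2 _ _ (hv.inPoset_cell (by omega) (by omega) (by omega)) hc (spinLE_cell_down h1 hi p),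
    fun hp' => hπ.2 _ _ hc (hv.inPoset_cell (by omega) (by omega) hp') (spinLE_cell_up h1 hi p)⟩

/-- All entries of a tuple up to its prescribed lengths are recorded in the cells, which gives
injectivity. Conversely the order relations among cells are the nesting inequalities, from which
`Nested.exists_tuple` rebuilds the partitions. -/
theorem Admissible.bijOn_toRPP (hv : Admissible (M + 2) v) :
    Set.BijOn (toRPP M v) (interlacingTuples (M + 2) v) {π | IsRPP (M + 2) v π} := by
  refine ⟨fun lam hlam => hv.isRPP_toRPP hlam, fun lam hlam lam' hlam' h => ?_, fun π hπ => ?_⟩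
  · funext i
    rcases Nat.lt_or_ge i (M + 2) with hi | hi
    · refine rowLen_injective (funext fun k => ?_)
      rcases Nat.lt_or_ge k (len (M + 2) v i) with hk | hk
      · have h1 : 1 ≤ i := by
          by_contra h
          obtain rfl : i = 0 := by omega
          rw [len_zero] at hk
          omega
        have h2 := congrFun (congrFun h (cell M i (len (M + 2) v i - 1 - k)).1)
          (cell M i (len (M + 2) v i - 1 - k)).2
        rw [hv.toRPP_cell lam h1 (by omega) (by omega), hv.toRPP_cell lam' h1 (by omega) (by omega),
          bottomRow, bottomRow,
          show len (M + 2) v i - 1 - (len (M + 2) v i - 1 - k) = k by omega] at h2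
        exact h2
      · rw [rowLen_eq_zero_of_le (rowLen_len_eq_zero hlam (by omega)) hk,
          rowLen_eq_zero_of_le (rowLen_len_eq_zero hlam' (by omega)) hk]
    · rw [hlam.2.1 i hi, hlam'.2.1 i hi]
  · obtain ⟨lam, hlam, h⟩ := (hv.nested_of_isRPP hπ).exists_tuple hv
    refine ⟨lam, hlam, ?_⟩
    funext i j
    by_cases hij : InPoset (M + 2) v (i, j)
    · obtain ⟨i', p, h1, hi, hp, he⟩ := hv.exists_cell hij
      have h2 := hv.toRPP_cell lam h1 hi hp
      rw [h i' hi p hp, ← he] at h2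
      exact h2
    · rw [toRPP_of_not hij]
      exact (hπ.1 i j hij).symm

end Bijection

end

section

/-! ### The vertex function as a sum over tuples -/

theorem prod_range_parity {N : Type*} [CommMonoid N] (l : ℕ) (f : ℕ → N) : ∏ p ∈ range l, f p =
    (∏ j ∈ range (l / 2), f (2 * j + 1)) * ∏ j ∈ range ((l + 1) / 2), f (2 * j) := by
  induction l with
  | zero => simp
  | succ l ih =>
    rw [prod_range_succ, ih]
    obtain ⟨a, rfl | rfl⟩ := l.even_or_odd'
    · rw [show 2 * a / 2 = a by omega, show (2 * a + 1) / 2 = a by omega,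
        show (2 * a + 1 + 1) / 2 = a + 1 by omega, prod_range_succ _ a, mul_assoc]
    · rw [show (2 * a + 1) / 2 = a by omega, show (2 * a + 1 + 1) / 2 = a + 1 by omega,
        show (2 * a + 1 + 1 + 1) / 2 = a + 1 by omega,
        prod_range_succ (fun j => f (2 * j + 1)), mul_right_comm]

theorem sum_range_parity {N : Type*} [AddCommMonoid N] (l : ℕ) (f : ℕ → N) :
    ∑ p ∈ range l, f p =
      (∑ j ∈ range (l / 2), f (2 * j + 1)) + ∑ j ∈ range ((l + 1) / 2), f (2 * j) :=
  prod_range_parity (N := Multiplicative N) l f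

/-- The products over the positions of a tuple of bottom-aligned rows. -/
def cellTerm (q t : K) (M : ℕ) (v : ℕ → ℕ) (b : ℕ → ℕ → ℕ) : K :=
  (∏ p ∈ range (len (M + 2) v (M + 1)),
    if Even p then pochRatio q t p (b (M + 1) p) else 1) *
  (∏ i ∈ Icc 1 M, ∏ p ∈ range (len (M + 2) v i), ∏ s ∈ range (len (M + 2) v (i + 1)),
    pochRatio q t ((s : ℤ) - p - 1) ((b (i + 1) s : ℤ) - b i p)) *
  ∏ i ∈ Icc 1 (M + 1), ∏ p ∈ range (len (M + 2) v i), ∏ s ∈ range (len (M + 2) v i),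
    if i = M + 1 → p % 2 = s % 2 then
      (pochRatio q t ((s : ℤ) - p) ((b i s : ℤ) - b i p))⁻¹ else 1

theorem cellTerm_congr {M : ℕ} {v : ℕ → ℕ} {b b' : ℕ → ℕ → ℕ}
    (h : ∀ i, 1 ≤ i → i ≤ M + 1 → ∀ p < len (M + 2) v i, b i p = b' i p) :
    cellTerm q t M v b = cellTerm q t M v b' := by
  refine congrArg₂ (· * ·) (congrArg₂ (· * ·) ?_ ?_) ?_
  · refine prod_congr rfl fun p hp => ?_
    rw [h (M + 1) (by omega) le_rfl p (mem_range.1 hp)]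
  · refine prod_congr rfl fun i hi => prod_congr rfl fun p hp => prod_congr rfl fun s hs => ?_
    have hi := mem_Icc.1 hi
    rw [h i hi.1 (by omega) p (mem_range.1 hp), h (i + 1) (by omega) (by omega) s (mem_range.1 hs)]
  · refine prod_congr rfl fun i hi => prod_congr rfl fun p hp => prod_congr rfl fun s hs => ?_
    have hi := mem_Icc.1 hi
    rw [h i hi.1 hi.2 p (mem_range.1 hp), h i hi.1 hi.2 s (mem_range.1 hs)]

theorem alphaFactor_eq_bottomRow (q t : K) (M : ℕ) (v : ℕ → ℕ) (lam : ℕ → YoungDiagram) :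
    alphaFactor q t (M + 2) v lam = ∏ p ∈ range (len (M + 2) v (M + 1)),
      if Even p then pochRatio q t p (bottomRow (M + 2) v lam (M + 1) p) else 1 := by
  rw [alphaFactor, prod_filter, prod_Icc_one, show M + 2 - 1 = M + 1 from rfl, ← prod_range_reflect]
  refine prod_congr rfl fun p hp => ?_
  have hp := mem_range.1 hp
  rw [show len (M + 2) v (M + 1) - (len (M + 2) v (M + 1) - 1 - p + 1) = p by omega, pochRatio, part,
    Nat.add_sub_cancel, bottomRow, ← Nat.cast_succ, zpow_natCast, zpow_natCast]

theorem betaFactor_eq_bottomRow (q t : K) (n : ℕ) (v : ℕ → ℕ) (lam : ℕ → YoungDiagram) (i : ℕ) :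
    betaFactor q t n v lam i = ∏ p ∈ range (len n v i), ∏ s ∈ range (len n v (i + 1)),
      pochRatio q t ((s : ℤ) - p - 1)
        ((bottomRow n v lam (i + 1) s : ℤ) - bottomRow n v lam i p) := by
  rw [betaFactor_eq, ← prod_range_reflect]
  refine prod_congr rfl fun p hp => ?_
  rw [← prod_range_reflect]
  refine prod_congr rfl fun s hs => ?_
  have hp := mem_range.1 hp
  have hs := mem_range.1 hs
  rw [bottomRow, bottomRow]
  congr 1
  omega

theorem gammaFactor_eq_bottomRow (q t : K) (n : ℕ) (v : ℕ → ℕ) (lam : ℕ → YoungDiagram) (i : ℕ) :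
    gammaFactor q t n v lam i = ∏ p ∈ range (len n v i), ∏ s ∈ range (len n v i),
      if i = n - 1 → p % 2 = s % 2 then (pochRatio q t ((s : ℤ) - p)
        ((bottomRow n v lam i s : ℤ) - bottomRow n v lam i p))⁻¹ else 1 := by
  rw [gammaFactor_eq, ← prod_range_reflect]
  refine prod_congr rfl fun p hp => ?_
  rw [← prod_range_reflect]
  refine prod_congr rfl fun s hs => ?_
  have hp := mem_range.1 hp
  have hs := mem_range.1 hs
  refine ite_congr (propext (imp_congr_right fun _ => by omega)) (fun _ => ?_) fun _ => rfl
  rw [bottomRow, bottomRow]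
  congr 2
  omega

theorem factors_eq_cellTerm (q t : K) (M : ℕ) (v : ℕ → ℕ) (lam : ℕ → YoungDiagram) :
    alphaFactor q t (M + 2) v lam * (∏ i ∈ Icc 1 M, betaFactor q t (M + 2) v lam i) *
      ∏ i ∈ Icc 1 (M + 1), gammaFactor q t (M + 2) v lam i =
    cellTerm q t M v (bottomRow (M + 2) v lam) := by
  rw [cellTerm, alphaFactor_eq_bottomRow]
  simp only [betaFactor_eq_bottomRow, gammaFactor_eq_bottomRow]
  rfl

theorem qPoch_div_eq (ht : t ≠ 0) (c d : ℤ) :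
    qPoch q (t * t ^ c) d / qPoch q (q * t ^ c) d = pochRatio q t c d := by
  rw [pochRatio, add_comm, zpow_one_add₀ ht]

theorem qPoch_div_eq_inv (ht : t ≠ 0) (c d : ℤ) :
    qPoch q (q * t ^ c) d / qPoch q (t * t ^ c) d = (pochRatio q t c d)⁻¹ := by
  rw [← qPoch_div_eq ht, inv_div]

theorem wtExp_of_le {M i : ℕ} (hi : i ≤ M) (j : ℕ) :
    wtExp (M + 2) i (j + 1) = (M : ℤ) - i + j + 1 := by
  rw [wtExp, if_neg (by omega), if_neg (by omega)]
  push_cast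
  ring

theorem wtExp_penult (M j : ℕ) : wtExp (M + 2) (M + 1) (j + 1) = 2 * j + 1 := by
  rw [wtExp, if_neg (by omega), if_pos (by omega)]
  push_cast
  ring

theorem wtExp_last (M j : ℕ) : wtExp (M + 2) (M + 2) (j + 1) = 2 * j := by
  rw [wtExp, if_pos rfl]
  push_cast
  ring

theorem prod_arrows {N : Type*} [CommMonoid N] (M : ℕ) (f : ℕ × ℕ → N) :
    ∏ e ∈ arrows (M + 2), f e = f (M, M + 2) * ∏ i ∈ Icc 1 M, f (i, i + 1) := by
  rw [arrows, prod_insert, prod_image]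
  · rfl
  · intro i _ j _ h
    exact (Prod.mk.inj h).1
  · simp only [mem_image, Prod.mk.injEq, not_exists, not_and]
    omega

/-- At position p the weight is t to the power p in the merged last row and to the power M - i + p +
1 in row i ≤ M. All exponents therefore become s - p - 1 between rows and s - p within a row, and
keeping the colors n - 1 and n apart is the parity restriction. -/
theorem rppTerm_eq_cellTerm (ht : t ≠ 0) {M : ℕ} (hM : 1 ≤ M) {v : ℕ → ℕ}
    (hv : Admissible (M + 2) v) (π : ℕ → ℕ → ℕ) : rppTerm q t (M + 2) v π =
      cellTerm q t M v fun i p => π (cell M i p).1 (cell M i p).2 := by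
  have e1 := hv.last_eq
  have e2 := hv.penult_eq
  have hodd : ∀ j, ¬ Even (2 * j + 1) := fun j => Nat.not_even_iff_odd.2 ⟨j, rfl⟩
  simp only [rppTerm, cellTerm, qPoch_div_eq ht, qPoch_div_eq_inv ht, prod_Icc_one (v _)]
  refine congrArg₂ (· * ·) (congrArg₂ (· * ·) ?_ ?_) ?_
  · rw [prod_range_parity (len (M + 2) v (M + 1)), prod_eq_one fun j _ => if_neg (hodd j), one_mul, ← e1]
    refine prod_congr rfl fun j _ => ?_
    rw [if_pos (even_two_mul j), wtExp_last, cell_even]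
    push_cast
    rfl
  · obtain ⟨m, rfl⟩ : ∃ m, M = m + 1 := ⟨M - 1, by omega⟩
    rw [prod_arrows, prod_Icc_succ_top (by omega), prod_Icc_succ_top (by omega), mul_left_comm]
    refine congrArg₂ (· * ·) ?_ ?_
    · refine prod_congr rfl fun i hi => ?_
      have hi := mem_Icc.1 hi
      rw [len_of_le v hi.1 (by omega), len_of_le v (by omega) (by omega)]
      refine prod_congr rfl fun p _ => prod_congr rfl fun s _ => ?_
      rw [cell_of_le (by omega), cell_of_le (by omega), wtExp_of_le (by omega),
        wtExp_of_le (by omega)]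
      congr 1
      push_cast
      ring
    · rw [← prod_mul_distrib, len_of_le v (by omega) le_rfl]
      refine prod_congr rfl fun p _ => ?_
      rw [prod_range_parity (len (m + 1 + 2) v (m + 1 + 1)), ← e1, ← e2, mul_comm]
      refine congrArg₂ (· * ·) ?_ ?_
      · refine prod_congr rfl fun s _ => ?_
        rw [cell_odd, cell_of_le le_rfl, wtExp_of_le le_rfl, wtExp_penult]
        congr 1
        push_cast
        ring
      · refine prod_congr rfl fun s _ => ?_
        rw [cell_even, cell_of_le le_rfl, wtExp_of_le le_rfl, wtExp_last]
        congr 1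
        push_cast
        ring
  · rw [prod_Icc_succ_top (by omega), prod_Icc_succ_top (by omega),
      prod_Icc_succ_top (show 1 ≤ M + 1 by omega), mul_assoc]
    refine congrArg₂ (· * ·) ?_ ?_
    · refine prod_congr rfl fun i hi => ?_
      have hi := mem_Icc.1 hi
      rw [len_of_le v hi.1 (by omega)]
      refine prod_congr rfl fun p _ => prod_congr rfl fun s _ => ?_
      rw [if_pos (fun h => by omega), cell_of_le (by omega), cell_of_le (by omega),
        wtExp_of_le (by omega), wtExp_of_le (by omega)]
      congr 2
      ring
    · rw [prod_range_parity (len (M + 2) v (M + 1)), ← e1, ← e2]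
      refine congrArg₂ (· * ·) ?_ ?_
      · refine prod_congr rfl fun p _ => ?_
        rw [prod_range_parity (len (M + 2) v (M + 1)), ← e1, ← e2,
          prod_eq_one (s := range (v (M + 2))) fun s _ => if_neg (by omega), mul_one]
        refine prod_congr rfl fun s _ => ?_
        rw [if_pos (by omega), cell_odd, cell_odd, wtExp_penult, wtExp_penult]
        congr 2
      · refine prod_congr rfl fun p _ => ?_
        rw [prod_range_parity (len (M + 2) v (M + 1)), ← e1, ← e2,
          prod_eq_one (s := range (v (M + 1))) fun s _ => if_neg (by omega), one_mul]
        refine prod_congr rfl fun s _ => ?_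
        rw [if_pos (by omega), cell_even, cell_even, wtExp_last, wtExp_last]
        congr 2

theorem rppTerm_toRPP (ht : t ≠ 0) {M : ℕ} (hM : 1 ≤ M) {v : ℕ → ℕ}
    (hv : Admissible (M + 2) v) (lam : ℕ → YoungDiagram) :
    rppTerm q t (M + 2) v (toRPP M v lam) =
      alphaFactor q t (M + 2) v lam * (∏ i ∈ Icc 1 M, betaFactor q t (M + 2) v lam i) *
        ∏ i ∈ Icc 1 (M + 1), gammaFactor q t (M + 2) v lam i := by
  rw [factors_eq_cellTerm, rppTerm_eq_cellTerm ht hM hv]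
  exact cellTerm_congr fun i h1 hi p hp => hv.toRPP_cell lam h1 hi hp

theorem sum_toRPP {M : ℕ} {v : ℕ → ℕ} (hv : Admissible (M + 2) v) {lam : ℕ → YoungDiagram}
    (hlam : lam ∈ interlacingTuples (M + 2) v) (i : ℕ) :
    ∑ j ∈ Icc 1 (v i), toRPP M v lam i j = tupleDegree (M + 2) v lam i := by
  have e1 := hv.last_eq
  have e2 := hv.penult_eq
  rw [sum_Icc_one]
  by_cases hi : 1 ≤ i ∧ i ≤ M + 2
  · by_cases h1 : i ≤ M
    · have hl := len_of_le v hi.1 h1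
      obtain ⟨i, rfl⟩ : ∃ k, i = k + 1 := ⟨i - 1, by omega⟩
      symm
      rw [tupleDegree_mid v lam (by omega), ← hl,
        card_eq_sum_rowLen _ (rowLen_len_eq_zero hlam (by omega)), ← sum_range_reflect]
      refine sum_congr rfl fun p hp => ?_
      have h := hv.toRPP_cell lam hi.1 (by omega) (mem_range.1 hp)
      rw [cell_of_le h1] at h
      exact h.symm
    · by_cases h2 : i = M + 1
      · subst h2
        symm
        rw [tupleDegree_penult, ← sum_range_reflect, sum_range_parity (len (M + 2) v (M + 1)), ← e1, ← e2,
          sum_eq_zero (s := range (v (M + 2))) fun s hs => if_pos ?_, add_zero]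
        · refine sum_congr rfl fun p hp => ?_
          have hp := mem_range.1 hp
          have h := hv.toRPP_cell lam hi.1 le_rfl (show 2 * p + 1 < len (M + 2) v (M + 1) by omega)
          rw [cell_odd] at h
          rw [if_neg]
          · exact h.symm
          · rw [Nat.even_iff]
            omega
        · have hs := mem_range.1 hs
          rw [Nat.even_iff]
          omega
      · obtain rfl : i = M + 2 := by omega
        symm
        rw [tupleDegree_last, ← sum_range_reflect, sum_range_parity (len (M + 2) v (M + 1)), ← e1, ← e2,
          sum_eq_zero (s := range (v (M + 1))) fun s hs => if_neg ?_, zero_add]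
        · refine sum_congr rfl fun p hp => ?_
          have hp := mem_range.1 hp
          have h := hv.toRPP_cell lam (Nat.succ_pos M) le_rfl
            (show 2 * p < len (M + 2) v (M + 1) by omega)
          rw [cell_even] at h
          rw [if_pos]
          · exact h.symm
          · rw [Nat.even_iff]
            omega
        · have hs := mem_range.1 hs
          rw [Nat.even_iff]
          omega
  · rw [tupleDegree, if_neg (by omega), if_neg (by omega),
      if_neg (by rw [mem_Icc]; omega)]
    exact sum_eq_zero fun j _ => toRPP_of_not fun h => hi (mem_Icc.1 h.1)

/-- The degree `D` part of the vertex function as a sum over tuples of partitions. -/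
theorem coeff_vertexFunction (ht : t ≠ 0) {M : ℕ} (hM : 1 ≤ M) {v : ℕ → ℕ}
    (hv : Admissible (M + 2) v) (D : ℕ →₀ ℕ) :
    MvPowerSeries.coeff D (vertexFunction q t (M + 2) v) =
      ∑ᶠ (lam : ℕ → YoungDiagram) (_ : lam ∈ interlacingTuples (M + 2) v ∧
        ∀ i, tupleDegree (M + 2) v lam i = D i),
        (q / t) ^ nExp (M + 2) v D *
          (alphaFactor q t (M + 2) v lam * (∏ i ∈ Icc 1 M, betaFactor q t (M + 2) v lam i) *
            ∏ i ∈ Icc 1 (M + 1), gammaFactor q t (M + 2) v lam i) := by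
  have hbij := hv.bijOn_toRPP
  symm
  refine finsum_mem_eq_of_bijOn
    (s := {lam | lam ∈ interlacingTuples (M + 2) v ∧ ∀ i, tupleDegree (M + 2) v lam i = D i})
    (t := {π | IsRPP (M + 2) v π ∧ ∀ i, D i = ∑ j ∈ Icc 1 (v i), π i j})
    (toRPP M v) ⟨?_, ?_, ?_⟩ ?_
  · rintro lam ⟨hlam, hD⟩
    exact ⟨hbij.mapsTo hlam, fun i => by rw [sum_toRPP hv hlam, hD]⟩
  · exact hbij.injOn.mono fun lam h => h.1
  · rintro π ⟨hπ, hD⟩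
    obtain ⟨lam, hlam, rfl⟩ := hbij.surjOn hπ
    exact ⟨lam, ⟨hlam, fun i => by rw [hD i, sum_toRPP hv hlam]⟩, rfl⟩
  · rintro lam -
    rw [rppTerm_toRPP ht hM hv]

theorem finsum_weight_eq [CharZero K] (h : MulIndep q t) (hinj : Function.Injective (eig q t))
    {L : Type*} [Field L] [Algebra K L] {M : ℕ} (hM : 1 ≤ M) {v : ℕ → ℕ}
    (hv : Admissible (M + 2) v) {x z : ℕ → L} (hx : ∀ i ∈ Icc 1 (M + 2), x i ≠ 0)
    (hz : ∀ i ∈ Icc 1 (M + 1), algebraMap K L ((q / t) ^ aExp (M + 2) v i) * z i =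
      x i ^ sgn (M + 2) v i * x (i + 1) ^ (-sgn (M + 2) v (i + 1)))
    (hzn : algebraMap K L ((q / t) ^ aExp (M + 2) v (M + 2)) * z (M + 2) =
      x (M + 1) ^ sgn (M + 2) v (M + 1) * x (M + 2) ^ sgn (M + 2) v (M + 2)) (D : ℕ →₀ ℕ) :
    ∑ᶠ (lam : ℕ → YoungDiagram) (_ : lam ∈ interlacingTuples (M + 2) v ∧
      ∀ i, tupleDegree (M + 2) v lam i = D i), weight q t (M + 2) v x lam =
    algebraMap K L (MvPowerSeries.coeff D (vertexFunction q t (M + 2) v)) *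
      ∏ i ∈ Icc 1 (M + 2), z i ^ D i := by
  have hz0 : ∀ i ∈ Icc 1 (M + 2), z i ≠ 0 := by
    intro i hi h0
    have hi' := mem_Icc.1 hi
    rcases hi'.2.lt_or_eq with hlt | rfl
    · have := hz i (mem_Icc.2 ⟨hi'.1, by omega⟩)
      rw [h0, mul_zero] at this
      exact mul_ne_zero (zpow_ne_zero _ (hx i hi))
        (zpow_ne_zero _ (hx (i + 1) (mem_Icc.2 ⟨by omega, hlt⟩))) this.symm
    · rw [h0, mul_zero] at hzn
      exact mul_ne_zero (zpow_ne_zero _ (hx (M + 1) (mem_Icc.2 ⟨by omega, by omega⟩)))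
        (zpow_ne_zero _ (hx (M + 2) hi)) hzn.symm
  have hZ : ∏ i ∈ Icc 1 (M + 2), z i ^ D i ≠ 0 :=
    prod_ne_zero_iff.2 fun i hi => pow_ne_zero _ (hz0 i hi)
  -- Nonzero `x i` make every `z i` nonzero, so this additive map is injective; an injective
  -- additive map commutes with `finsum` without any check of finiteness.
  let φ : K →+ L := (AddMonoidHom.mulRight (∏ i ∈ Icc 1 (M + 2), z i ^ D i)).comp
    (algebraMap K L).toAddMonoidHom
  have hφ : Function.Injective φ := fun a b hab =>
    (algebraMap K L).injective (mul_right_cancel₀ hZ hab)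
  change _ = φ _
  rw [coeff_vertexFunction h.t_ne hM hv, AddMonoidHom.map_finsum_of_injective φ hφ]
  refine finsum_congr fun lam => ?_
  rw [AddMonoidHom.map_finsum_Prop]
  refine finsum_congr fun hlam => ?_
  have hD : tupleDegree (M + 2) v lam = D := funext hlam.2
  rw [weight_eq h hinj hM hv hx hz hzn hlam.1, zMonomial, hD]
  change _ = algebraMap K L _ * _
  rw [map_mul (algebraMap K L) ((q / t) ^ nExp (M + 2) v D), ← mul_assoc,
    mul_comm (algebraMap K L ((q / t) ^ nExp (M + 2) v D))]

end

end

end SpinVertex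

theorem lemma7p4 {K : Type*} [Field K] [CharZero K] (q ħ : K)
    (hqħ : AlgebraicIndependent ℚ ![q, ħ])
    {L : Type*} [Field L] [Algebra K L]
    (n : ℕ) (hn : 3 ≤ n) (v : ℕ → ℕ)
    (hv : SpinVertex.QuiverVarietyNonempty n v (SpinVertex.deltaFraming n))
    (x z : ℕ → L) (hx : ∀ i ∈ Finset.Icc 1 n, x i ≠ 0)
    (hz : ∀ i ∈ Finset.Icc 1 (n - 1),
      algebraMap K L ((q / ħ) ^ SpinVertex.aExp n v i) * z i =
        x i ^ SpinVertex.sgn n v i * x (i + 1) ^ (-SpinVertex.sgn n v (i + 1)))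
    (hzn : algebraMap K L ((q / ħ) ^ SpinVertex.aExp n v n) * z n =
      x (n - 1) ^ SpinVertex.sgn n v (n - 1) * x n ^ SpinVertex.sgn n v n) :
    (∀ lam ∈ SpinVertex.interlacingTuples n v,
      SpinVertex.weight q ħ n v x lam =
        algebraMap K L (SpinVertex.alphaFactor q ħ n v lam *
          (∏ i ∈ Finset.Icc 1 (n - 2), SpinVertex.betaFactor q ħ n v lam i) *
          (∏ i ∈ Finset.Icc 1 (n - 1), SpinVertex.gammaFactor q ħ n v lam i)) *
        SpinVertex.zMonomial q ħ n v z lam) ∧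
    (∀ D : ℕ →₀ ℕ,
      ∑ᶠ (lam : ℕ → YoungDiagram)
        (_ : lam ∈ SpinVertex.interlacingTuples n v ∧
          ∀ i, SpinVertex.tupleDegree n v lam i = D i),
        SpinVertex.weight q ħ n v x lam =
      algebraMap K L (MvPowerSeries.coeff D (SpinVertex.vertexFunction q ħ n v)) *
        ∏ i ∈ Finset.Icc 1 n, z i ^ D i) := by
  obtain ⟨M, rfl⟩ : ∃ M, n = M + 2 := ⟨n - 2, by omega⟩
  have hM : 1 ≤ M := by omega
  have h := SpinVertex.mulIndep_of_algebraicIndependent hqħ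
  have hinj := SpinVertex.eig_injective hqħ
  have hadm := SpinVertex.admissible_of_nonempty hM hv
  exact ⟨fun lam hlam => SpinVertex.weight_eq h hinj hM hadm hx hz hzn hlam,
    SpinVertex.finsum_weight_eq h hinj hM hadm hx hz hzn⟩
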